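/- Let $0<\alpha<1$, $\mu>0$ and $0\le\beta<\frac{\alpha}{\alpha+1}$, with $\mu\le 1$ if $\beta=0$. Let $(\tau_z)_{z\in\mathbb Z}$ be i.i.d. strictly positive random variables with $\lim_{x\to\infty}x^{\alpha}P\{\tau_z>x\}=1$. For $N\ge1$ with $\mu\le N^\beta$ let $X$ be, given $(\tau_z)$, the continuous-time Markov chain on $\mathbb Z$ started in $0$ with transition rates $$q_{i,i+1}=\frac{p^{(N)}}{\tau_i},\qquad q_{i,i-1}=\frac{1-p^{(N)}}{\tau_i},\qquad p^{(N)}=\frac12\Big(1+\frac{\mu}{N^\beta}\Big),$$ and let $X^{(N)}_t=X_{Nt}$. Write $\mathbb P$ for the law averaged over the environment $(\tau_z)$. Then for every $t>0$ there is a nonnegative nondegenerate random variable $\xi_t$ such that, in law under $\mathbb P$ as $N\to\infty$, $$\frac{\tau_{X^{(N)}_t}}{N^{1-\beta}}\Longrightarrow \xi_t .$$ The law of $\xi_t$ is given by $$P\{\xi_t>v\}=\sum_{j=1}^\infty P\Big\{\sum_{i=1}^{j-1}(U_i+S_i)+U_j<\frac tv\le\sum_{i=1}^{j}(U_i+S_i)\Big\},\qquad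 v>0,$$ where $U_1,S_1,U_2,S_2,\dots$ are independent; each $S_i$ is distributed as the product of a Pareto variable with index $\alpha$ (that is, $P\{\,\cdot>x\}=x^{-\alpha}$ for $x\ge1$) and an independent exponential variable with mean $1/\mu$; and each $U_i\ge0$ has the law with Laplace transform $$E\big[e^{-\lambda U_i}\big]=\Big(\frac{\alpha\pi}{\sin\alpha\pi}\Big(\frac\lambda\mu\Big)^{\alpha}+\alpha\int_1^\infty\frac{dz}{z^{\alpha+1}(1+z\lambda/\mu)}\Big)^{-1},\qquad\lambda\ge0.$$ Moreover $c(t)=E[\exp\{-1/\xi_t\}]$ (with $\exp\{-1/0\}=0$) lies in $(0,1)$, and $$\lim_{N\to\infty}\mathbb P\big\{X^{(N)}_t=X^{(N)}_{t+s}\ \text{for all}\ 0\le s\le N^{-\beta}\big\}=c(t).$$ -/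

import Mathlib

open MeasureTheory ProbabilityTheory Filter Topology

noncomputable section

namespace TrapModel

/-- A trap environment with index `α` on the probability space `(Ω, P)`: an i.i.d. family of
strictly positive random variables `τ z`, `z ∈ ℤ`, with `x ^ α * P(τ z > x) → 1` as `x → ∞`. -/
structure IsTrapEnvironment {Ω : Type*} [MeasurableSpace Ω] (P : Measure Ω) (α : ℝ)
    (τ : ℤ → Ω → ℝ) : Prop where
  measurable : ∀ z, Measurable (τ z)
  indep : iIndepFun τ P
  identDistrib : ∀ z, IdentDistrib (τ z) (τ 0) P P
  pos : ∀ z, ∀ᵐ ω ∂P, 0 < τ z ω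
  tail : Tendsto (fun x : ℝ => x ^ α * P.real {ω | x < τ 0 ω}) atTop (𝓝 1)

/-- Position after `n` jumps of the walk on `ℤ` that starts in `0` and has increments `ε k`. -/
def walk (ε : ℕ → ℤ) (n : ℕ) : ℤ := ∑ k ∈ Finset.range n, ε k

/-- The time of the `n`-th jump, when the `k`-th holding time is `τ_{S_k} η_k`, where `S` is the
embedded walk with increments `ε`. -/
def jumpTime (τ : ℤ → ℝ) (ε : ℕ → ℤ) (η : ℕ → ℝ) (n : ℕ) : ℝ :=
  ∑ k ∈ Finset.range n, τ (walk ε k) * η k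

/-- `X = (X_t : t ≥ 0)` is, on `(Ω, P)`, a trap model with drift started in `0`: given the
environment `τ`, it is the continuous-time Markov chain on `ℤ` with transition rates
`q_{i,i+1} = p / τ_i` and `q_{i,i-1} = (1 - p) / τ_i`.  This is the description of the chain by its
jump chain and its holding times: the jump chain has independent increments `ε k`, equal to `1` with
probability `p` and to `-1` with probability `1 - p`; the holding time of the `k`-th visited site
`z` is exponential with mean `τ z`, i.e. `τ z` times a standard exponential variable `η k`; and `τ`,
`ε`, `η` are independent. The measure `P` is the law averaged over the environment. -/
def IsTrapModel {Ω : Type*} [MeasurableSpace Ω] (P : Measure Ω) (τ : ℤ → Ω → ℝ) (p : ℝ)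
    (X : ℝ → Ω → ℤ) : Prop :=
  ∃ (ε : ℕ → Ω → ℤ) (η : ℕ → Ω → ℝ),
    (∀ n, Measurable (ε n)) ∧ (∀ n, Measurable (η n)) ∧
    iIndepFun ε P ∧
    (∀ n, P {ω | ε n ω = 1} = ENNReal.ofReal p ∧ P {ω | ε n ω = -1} = ENNReal.ofReal (1 - p)) ∧
    iIndepFun η P ∧
    (∀ n, HasLaw (η n) (expMeasure 1) P) ∧
    IndepFun (fun ω n => ε n ω) (fun ω n => η n ω) P ∧
    IndepFun (fun ω z => τ z ω) (fun ω => ((fun n => ε n ω), (fun n => η n ω))) P ∧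
    ∀ᵐ ω ∂P, ∀ t : ℝ, 0 ≤ t → ∀ n : ℕ,
      jumpTime (fun z => τ z ω) (fun k => ε k ω) (fun k => η k ω) n ≤ t →
      t < jumpTime (fun z => τ z ω) (fun k => ε k ω) (fun k => η k ω) (n + 1) →
      X t ω = walk (fun k => ε k ω) n

/-- The law of a trap-holding time `S`: the product of a Pareto variable with index `α`
(`P(> x) = x ^ (-α)` for `x ≥ 1`) and an independent exponential variable with mean `1 / μ`. -/
def holdingLaw (α μ : ℝ) : Measure ℝ :=
  ((paretoMeasure 1 α).prod (expMeasure μ)).map (fun x => x.1 * x.2)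

/-- `νU` is the law of a travel time `U`: the law on `[0, ∞)` with Laplace transform
`E[exp (-θ U)] = (απ / sin (απ) * (θ / μ) ^ α + α ∫_1^∞ dz / (z ^ (α + 1) (1 + z θ / μ)))⁻¹`. -/
structure IsTravelLaw (α μ : ℝ) (νU : Measure ℝ) : Prop where
  isProbabilityMeasure : IsProbabilityMeasure νU
  nonneg : νU (Set.Iio 0) = 0
  laplace : ∀ θ : ℝ, 0 ≤ θ →
    ∫ x, Real.exp (-θ * x) ∂νU
      = (α * Real.pi / Real.sin (α * Real.pi) * (θ / μ) ^ α
          + α * ∫ z in Set.Ioi (1 : ℝ), 1 / (z ^ (α + 1) * (1 + z * (θ / μ))))⁻¹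

/-- For independent `U_1, S_1, U_2, S_2, …`, where the `U_i` have law `νU` and the `S_i` have law
`νS`, the series
`∑_{j ≥ 1} P(∑_{i < j} (U_i + S_i) + U_j < r ≤ ∑_{i ≤ j} (U_i + S_i))`
(here the indices start from `0`). -/
def renewalProb (νU νS : Measure ℝ) (r : ℝ) : ENNReal :=
  ∑' j : ℕ, Measure.infinitePi (fun _ : ℕ => νU.prod νS)
    {w : ℕ → ℝ × ℝ |
      (∑ i ∈ Finset.range j, ((w i).1 + (w i).2)) + (w j).1 < r ∧
      r ≤ ∑ i ∈ Finset.range (j + 1), ((w i).1 + (w i).2)}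

end TrapModel

end

/-! Write `d = p - q` for the drift, and stop the process at an independent exponential time of rate
`l`. For the jump chain this is killing: a visit of `y` is survived with probability `1 / (1 + l
τ_y)`, and `l ∫ e^{-lu} P(X_u = y) du` is the probability to be killed in `y`. From `y` the walk
leaves for ever with probability `d` at each visit, so this probability is at most P(reach `y`)
times `τ_y / (τ_y + x)`, where `x = d / l`. If all killing outside `[0, y)` is ignored, then
reaching `y` depends on the traps in `[0, y)` only and is independent of `τ_y`. Hence the averaged
probability to be killed in a trap with depth in `D` is at most `A · E[τ / (τ + x); τ ∈ D]`, with
`A` the mean number of sites reached (`lintegral_exp_mul_meanOcc_le`).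

With `b = E[τ / (τ + x)]`, a Bonferroni inequality for the killing inside a block of `m` sites, `1/d
≪ m ≪ 1/b`, gives `A b ≤ 1 + o(1)` as soon as `b / d → 0` (`hit_weightOn_le`, `mul_meanReach_le`).
So there are upper bounds for `D` and for its complement whose sum tends to one, while the two
probabilities add up to one because the process does not explode. Both bounds are therefore
asymptotically sharp (`laplace_meanOcc_mem`). On the scales of the theorem `d = μ N^{-β}`, `l = k /
N`, `x = μ N^{1-β} / k`, and `b` is of order `x^{-α}`; `b / d → 0` is the condition `β < α / (α +
1)`.

The regularly varying tail gives `x^α E[τ / (τ + x); τ > c x] → I(c) = ∫_c^∞ α y^{-α} / (1 + y) dy`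
(`IsTailLaw.tendsto_lintegral`). Hence `k ∫ e^{-kt} P(τ_{X_{Nt}} > v N^{1-β}) dt → I(kv/μ) / I(0)`
(`IsScaling.tendsto_laplace`). This quotient equals `E[e^{-kvR}]` for `R = G / (μ B)` with
independent Gamma and Beta variables (`lintegral_exp_ratioLaw`), so that the limit of the tails must
be `P(R < t / v)`, that is, `ξ_t = t / R`.

Laplace transforms control time averages only. For fixed `t` a Tauberian argument is used
(`tendsto_of_laplace`): the probability to be in a deep trap cannot drop quickly. Indeed, by an
excessive-measure bound in a fixed environment (`one_le_occ_add`), a process in a deep trap is found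
there again a short time later with probability near one, up to the weights of the traps nearby and
the chance to escape to the right.

The renewal series has the Laplace transform `Û (1 - Ŝ) / (k (1 - Û Ŝ))`, and the formula for `Û` is
what makes this equal to `I(k/μ) / (k I(0))`; so the series is the distribution function of `R`
(`renewalProb_holdingLaw`). That the formula for `Û` belongs to a law follows by approximating it
with geometric sums of Pareto variables truncated from above (`exists_isTravelLaw`).

Finally, by lack of memory the probability not to jump during a time `N^{1-β}` is the mean of `exp
(-N^{1-β} / τ_X)` (`IsJumpModel.measure_forall_eq`), a bounded continuous function of the rescaled
depth, and weak convergence applies. -/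

noncomputable section

namespace TrapModel

open scoped ENNReal

/-! ### The biased walk and its harmonic functions. -/

/-- Jump probabilities `p` to the right and `q` to the left of a walk with drift to the right. -/
structure IsDriftPair (p q : ℝ) : Prop where
  q_nonneg : 0 ≤ q
  add_eq : p + q = 1
  lt : q < p

namespace IsDriftPair

variable {p q : ℝ} (h : IsDriftPair p q)

include h

lemma p_pos : 0 < p := h.q_nonneg.trans_lt h.lt

lemma p_le_one : p ≤ 1 := by linarith [h.q_nonneg, h.add_eq]

lemma drift_pos : 0 < p - q := by linarith [h.lt]

lemma ratio_nonneg : 0 ≤ q / p := div_nonneg h.q_nonneg h.p_pos.le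

lemma ratio_lt_one : q / p < 1 := (div_lt_one h.p_pos).2 h.lt

lemma p_mul_ratio : p * (q / p) = q := mul_div_cancel₀ _ h.p_pos.ne'

lemma drift_le_one_sub_ratio : p - q ≤ 1 - q / p := by
  have h1 := h.p_mul_ratio
  have h2 := h.ratio_lt_one
  nlinarith [h.p_le_one]

lemma step_ratio_pow (k : ℕ) :
    p * (q / p) ^ (k + 2) + q * (q / p) ^ k = (q / p) ^ (k + 1) := by
  have h1 := h.p_mul_ratio
  have h2 := h.add_eq
  calc p * (q / p) ^ (k + 2) + q * (q / p) ^ k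
      = (q / p) ^ (k + 1) * (p * (q / p)) + q * (q / p) ^ k := by ring
    _ = (q / p) ^ (k + 1) * q + p * (q / p) * (q / p) ^ k := by rw [h1]
    _ = (q / p) ^ (k + 1) * (p + q) := by ring
    _ = _ := by rw [h2, mul_one]

end IsDriftPair

/-- One step of the transition operator of the walk. -/
def stepAvg (p q : ℝ) (v : ℤ → ℝ) (x : ℤ) : ℝ := p * v (x + 1) + q * v (x - 1)

/-- The function `x ↦ (q / p) ^ (x - y)⁺`, harmonic off `y`. -/
def ratioPow (p q : ℝ) (y x : ℤ) : ℝ := (q / p) ^ (x - y).toNat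

lemma ratioPow_of_le {p q : ℝ} {y x : ℤ} (h : x ≤ y) : ratioPow p q y x = 1 := by
  simp [ratioPow, Int.toNat_of_nonpos (sub_nonpos.2 h)]

/-- The function is the probability to hit `y` from `x`. Its defect at `y` is the probability never
to return to `y`: a step to the right, then no return, with probability `p (1 - q / p) = p - q`. -/
lemma stepAvg_ratioPow {p q : ℝ} (h : IsDriftPair p q) (y x : ℤ) :
    stepAvg p q (ratioPow p q y) x = ratioPow p q y x - if x = y then p - q else 0 := by
  rcases lt_trichotomy x y with hxy | rfl | hxy
  · rw [stepAvg, ratioPow_of_le, ratioPow_of_le, ratioPow_of_le, if_neg hxy.ne]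
    · linarith [h.add_eq]
    all_goals omega
  · rw [stepAvg, ratioPow_of_le (show x - 1 ≤ x by omega), ratioPow_of_le le_rfl]
    have h1 := h.p_mul_ratio
    simp only [ratioPow, add_sub_cancel_left, if_true, Int.toNat_one, pow_one]
    linarith [h.add_eq]
  · obtain ⟨k, rfl⟩ : ∃ k : ℕ, x = y + (k + 1 : ℕ) := ⟨(x - y - 1).toNat, by omega⟩
    have e1 : (y + (k + 1 : ℕ) + 1 - y).toNat = k + 2 := by omega
    have e2 : (y + (k + 1 : ℕ) - 1 - y).toNat = k := by omega
    have e3 : (y + (k + 1 : ℕ) - y).toNat = k + 1 := by omega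
    rw [if_neg hxy.ne', stepAvg, ratioPow, ratioPow, ratioPow, e1, e2, e3, h.step_ratio_pow, sub_zero]

lemma ratioPow_nonneg {p q : ℝ} (h : IsDriftPair p q) (y x : ℤ) : 0 ≤ ratioPow p q y x :=
  pow_nonneg h.ratio_nonneg _

lemma ratioPow_le_one {p q : ℝ} (h : IsDriftPair p q) (y x : ℤ) : ratioPow p q y x ≤ 1 :=
  pow_le_one₀ h.ratio_nonneg h.ratio_lt_one.le

lemma ratioPow_anti {p q : ℝ} (h : IsDriftPair p q) (y : ℤ) : Antitone (ratioPow p q y) := by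
  intro a b hab
  exact pow_le_pow_of_le_one h.ratio_nonneg h.ratio_lt_one.le (by omega)

lemma ratioPow_lt_one {p q : ℝ} (h : IsDriftPair p q) {y x : ℤ} (hyx : y < x) :
    ratioPow p q y x < 1 :=
  pow_lt_one₀ h.ratio_nonneg h.ratio_lt_one (by omega)

/-! ### Hitting probabilities of the walk with killing. -/

/-- For the walk from `x` that survives each visit of a site `y` with probability `w y`, the
probability to reach `z` alive within `n` steps. -/
def hit (p q : ℝ) (w : ℤ → ℝ) (z : ℤ) : ℕ → ℤ → ℝ
  | 0, x => if x = z then 1 else 0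
  | n + 1, x => if x = z then 1 else w x * stepAvg p q (hit p q w z n) x

section hit

variable {p q : ℝ} {w : ℤ → ℝ} {z : ℤ}

lemma stepAvg_mono {u v : ℤ → ℝ} (hp : 0 ≤ p) (hq : 0 ≤ q) {x : ℤ}
    (h1 : u (x + 1) ≤ v (x + 1)) (h2 : u (x - 1) ≤ v (x - 1)) :
    stepAvg p q u x ≤ stepAvg p q v x := by
  unfold stepAvg; gcongr

lemma hit_self (n : ℕ) : hit p q w z n z = 1 := by cases n <;> simp [hit]

lemma hit_succ_of_ne {n : ℕ} {x : ℤ} (hx : x ≠ z) :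
    hit p q w z (n + 1) x = w x * stepAvg p q (hit p q w z n) x := by
  simp [hit, hx]

lemma hit_nonneg (h : IsDriftPair p q) (hw : ∀ x, 0 ≤ w x) (n : ℕ) (x : ℤ) :
    0 ≤ hit p q w z n x := by
  induction n generalizing x with
  | zero => simp only [hit]; split_ifs <;> simp
  | succ n ih =>
    simp only [hit]; split_ifs
    · simp
    · exact mul_nonneg (hw x) (add_nonneg (mul_nonneg h.p_pos.le (ih _))
        (mul_nonneg h.q_nonneg (ih _)))

/-- A minimum principle, by induction on the horizon. The set `S` is closed under the steps taken
before `z` is reached, so a function need only be a supersolution where the walk can go; in the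
Bonferroni bound this is a half line. -/
lemma hit_le_of_supersolution (h : IsDriftPair p q) (hw : ∀ x, 0 ≤ w x) {S : ℤ → Prop} {U : ℤ → ℝ}
    (hS : ∀ x, S x → x ≠ z → S (x + 1) ∧ S (x - 1)) (hU0 : ∀ x, S x → 0 ≤ U x) (hUz : 1 ≤ U z)
    (hU : ∀ x, S x → x ≠ z → w x * stepAvg p q U x ≤ U x) (n : ℕ) (x : ℤ) (hx : S x) :
    hit p q w z n x ≤ U x := by
  induction n generalizing x with
  | zero =>
    simp only [hit]; split_ifs with hxz
    · rwa [hxz]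
    · exact hU0 x hx
  | succ n ih =>
    simp only [hit]; split_ifs with hxz
    · rwa [hxz]
    · exact (mul_le_mul_of_nonneg_left (stepAvg_mono h.p_pos.le h.q_nonneg (ih _ (hS x hx hxz).1)
        (ih _ (hS x hx hxz).2)) (hw x)).trans (hU x hx hxz)

lemma stepAvg_const (h : IsDriftPair p q) (c : ℝ) (x : ℤ) : stepAvg p q (fun _ => c) x = c := by
  rw [stepAvg, ← add_mul, h.add_eq, one_mul]

lemma hit_le_one (h : IsDriftPair p q) (hw : ∀ x, 0 ≤ w x) (hw1 : ∀ x, w x ≤ 1) (n : ℕ) (x : ℤ) :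
    hit p q w z n x ≤ 1 :=
  hit_le_of_supersolution h hw (S := fun _ => True) (U := fun _ => 1) (by simp) (by simp) le_rfl
    (fun x _ _ => by rw [stepAvg_const h]; simpa using hw1 x) n x trivial

lemma hit_le_ratioPow (h : IsDriftPair p q) (hw : ∀ x, 0 ≤ w x) (hw1 : ∀ x, w x ≤ 1)
    (n : ℕ) (x : ℤ) : hit p q w z n x ≤ ratioPow p q z x := by
  refine hit_le_of_supersolution h hw (S := fun _ => True) (by simp)
    (fun x _ => ratioPow_nonneg h z x) (ratioPow_of_le le_rfl).ge (fun x _ hx => ?_) n x trivial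
  rw [stepAvg_ratioPow h, if_neg hx, sub_zero]
  exact mul_le_of_le_one_left (ratioPow_nonneg h z x) (hw1 x)

lemma hit_mono_weight (h : IsDriftPair p q) {w' : ℤ → ℝ} (hw : ∀ x, 0 ≤ w x)
    (hww : ∀ x, w x ≤ w' x) (n : ℕ) (x : ℤ) : hit p q w z n x ≤ hit p q w' z n x := by
  induction n generalizing x with
  | zero => simp [hit]
  | succ n ih =>
    simp only [hit]; split_ifs
    · rfl
    · refine mul_le_mul (hww x) (stepAvg_mono h.p_pos.le h.q_nonneg (ih _) (ih _)) ?_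
        ((hw x).trans (hww x))
      exact add_nonneg (mul_nonneg h.p_pos.le (hit_nonneg h hw _ _))
        (mul_nonneg h.q_nonneg (hit_nonneg h hw _ _))

lemma hit_le_succ (h : IsDriftPair p q) (hw : ∀ x, 0 ≤ w x) (n : ℕ) (x : ℤ) :
    hit p q w z n x ≤ hit p q w z (n + 1) x := by
  induction n generalizing x with
  | zero =>
    rw [hit]; split_ifs with hx
    · rw [hx, hit_self]
    · exact hit_nonneg h hw _ _
  | succ n ih =>
    rw [hit, hit]; split_ifs
    · rfl
    · exact mul_le_mul_of_nonneg_left (stepAvg_mono h.p_pos.le h.q_nonneg (ih _) (ih _)) (hw x)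

lemma hit_mono (h : IsDriftPair p q) (hw : ∀ x, 0 ≤ w x) (x : ℤ) :
    Monotone fun n => hit p q w z n x :=
  monotone_nat_of_le_succ fun n => hit_le_succ h hw n x

/-- Steps are of size one: a walk from the left of `z` sees no weight at or beyond `z` before it
hits `z`. -/
lemma hit_congr {w' : ℤ → ℝ} (hww : ∀ x, x < z → w x = w' x) (n : ℕ) {x : ℤ} (hx : x ≤ z) :
    hit p q w z n x = hit p q w' z n x := by
  induction n generalizing x with
  | zero => simp [hit]
  | succ n ih =>
    simp only [hit]; split_ifs with hxz
    · rfl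
    · have hlt : x < z := lt_of_le_of_ne hx hxz
      rw [hww x hlt, stepAvg, stepAvg, ih (by omega), ih (by omega)]

/-- The strong Markov property at the first visit of `y`, which every path from `x` to `z` must
make. It is an inequality because the horizon is not shortened after that visit. -/
lemma hit_le_mul (h : IsDriftPair p q) (hw : ∀ x, 0 ≤ w x) {y : ℤ} (hyz : y < z) {n : ℕ}
    {x : ℤ} (hx : x ≤ y) : hit p q w z n x ≤ hit p q w y n x * hit p q w z n y := by
  -- The horizon of the last factor stays at `n` while the other one decreases; otherwise the
  -- induction would not close.
  suffices H : ∀ k ≤ n, ∀ x ≤ y, hit p q w z k x ≤ hit p q w y k x * hit p q w z n y from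
    H n le_rfl x hx
  intro k
  induction k with
  | zero =>
    intro hk x hx
    have hxz : x ≠ z := by omega
    rw [hit, if_neg hxz]
    exact mul_nonneg (hit_nonneg h hw _ _) (hit_nonneg h hw _ _)
  | succ k ih =>
    intro hk x hx
    by_cases hxy : x = y
    · subst hxy
      rw [hit_self, one_mul]
      exact hit_mono h hw x hk
    · rw [hit_succ_of_ne (by omega), hit_succ_of_ne hxy, mul_assoc]
      refine mul_le_mul_of_nonneg_left ?_ (hw x)
      have h1 := ih (by omega) (x + 1) (by omega)
      have h2 := ih (by omega) (x - 1) (by omega)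
      rw [stepAvg, stepAvg, add_mul, mul_assoc, mul_assoc]
      exact add_le_add (mul_le_mul_of_nonneg_left h1 h.p_pos.le)
        (mul_le_mul_of_nonneg_left h2 h.q_nonneg)

lemma hit_le_hit_of_lt (h : IsDriftPair p q) (hw : ∀ x, 0 ≤ w x) (hw1 : ∀ x, w x ≤ 1) {y : ℤ}
    (hyz : y < z) {n : ℕ} {x : ℤ} (hx : x ≤ y) : hit p q w z n x ≤ hit p q w y n x :=
  (hit_le_mul h hw hyz hx).trans
    (mul_le_of_le_one_right (hit_nonneg h hw _ _) (hit_le_one h hw hw1 _ _))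

end hit

/-! ### Green's function, survival, and the time spent below a level. -/

/-- The expected number of visits of `z` before time `n` of the walk from `x` that survives each
visit of a site `y` with probability `w y`. -/
def green (p q : ℝ) (w : ℤ → ℝ) (z : ℤ) : ℕ → ℤ → ℝ
  | 0, _ => 0
  | n + 1, x => (if x = z then 1 else 0) + w x * stepAvg p q (green p q w z n) x

/-- The probability to survive `n` steps. -/
def survive (p q : ℝ) (w : ℤ → ℝ) : ℕ → ℤ → ℝ
  | 0, _ => 1
  | n + 1, x => w x * stepAvg p q (survive p q w n) x

section green

variable {p q : ℝ} {w : ℤ → ℝ} {z : ℤ}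

lemma green_nonneg (h : IsDriftPair p q) (hw : ∀ x, 0 ≤ w x) (n : ℕ) (x : ℤ) :
    0 ≤ green p q w z n x := by
  induction n generalizing x with
  | zero => simp [green]
  | succ n ih =>
    refine add_nonneg (by split_ifs <;> simp) (mul_nonneg (hw x) ?_)
    exact add_nonneg (mul_nonneg h.p_pos.le (ih _)) (mul_nonneg h.q_nonneg (ih _))

lemma green_le_succ (h : IsDriftPair p q) (hw : ∀ x, 0 ≤ w x) (n : ℕ) (x : ℤ) :
    green p q w z n x ≤ green p q w z (n + 1) x := by
  induction n generalizing x with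
  | zero => exact green_nonneg h hw _ _
  | succ n ih =>
    rw [green, green]
    gcongr
    · exact hw x
    · exact stepAvg_mono h.p_pos.le h.q_nonneg (ih _) (ih _)

/-- Without killing the walk returns to `z` with probability `q + p (q / p) = 2 q`, so with survival
probability `w z` the number of visits is dominated by a geometric one. In the proof `A = (1 - 2 q w
z)⁻¹` solves `1 + 2 q (w z) A = A`, which makes `A` times the free hitting probability a
supersolution. -/
lemma green_self_le (h : IsDriftPair p q) (hw : ∀ x, 0 ≤ w x) (hw1 : ∀ x, w x ≤ 1) (n : ℕ) :
    green p q w z n z ≤ (1 - 2 * q * w z)⁻¹ := by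
  have hq := h.q_nonneg
  have hq2 : 2 * q < 1 := by linarith [h.add_eq, h.lt]
  have hpos : 0 < 1 - 2 * q * w z := by nlinarith [hw1 z, hw z]
  suffices H : ∀ x, green p q w z n x ≤ (1 - 2 * q * w z)⁻¹ * ratioPow p q z x by
    simpa [ratioPow_of_le le_rfl] using H z
  induction n with
  | zero => intro x; exact mul_nonneg (inv_nonneg.2 hpos.le) (ratioPow_nonneg h _ _)
  | succ n ih =>
    intro x
    set A := (1 - 2 * q * w z)⁻¹ with hA
    have hA0 : 0 ≤ A := inv_nonneg.2 hpos.le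
    have e : stepAvg p q (green p q w z n) x ≤ A * stepAvg p q (ratioPow p q z) x := by
      calc _ ≤ stepAvg p q (fun x => A * ratioPow p q z x) x :=
            stepAvg_mono h.p_pos.le hq (ih _) (ih _)
        _ = _ := by simp only [stepAvg]; ring
    rw [stepAvg_ratioPow h] at e
    rw [green]
    split_ifs with hx
    · subst hx
      rw [if_pos rfl, ratioPow_of_le le_rfl] at e
      rw [ratioPow_of_le le_rfl, mul_one]
      have : w x * stepAvg p q (green p q w x n) x ≤ w x * (A * (1 - (p - q))) :=
        mul_le_mul_of_nonneg_left e (hw x)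
      have hA1 : A * (1 - 2 * q * w x) = 1 := inv_mul_cancel₀ hpos.ne'
      have h2 : 1 - (p - q) = 2 * q := by linarith [h.add_eq]
      rw [h2] at this
      nlinarith
    · rw [if_neg hx, sub_zero] at e
      rw [zero_add]
      exact (mul_le_mul_of_nonneg_left e (hw x)).trans
        (mul_le_of_le_one_left (mul_nonneg hA0 (ratioPow_nonneg h _ _)) (hw1 x))

lemma green_mono (h : IsDriftPair p q) (hw : ∀ x, 0 ≤ w x) (x : ℤ) :
    Monotone fun n => green p q w z n x :=
  monotone_nat_of_le_succ fun n => green_le_succ h hw n x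

/-- The strong Markov property at the first visit of `z`, again with a fixed horizon in the last
factor. -/
lemma green_le_hit_mul (h : IsDriftPair p q) (hw : ∀ x, 0 ≤ w x) (n : ℕ) (x : ℤ) :
    green p q w z n x ≤ hit p q w z n x * green p q w z n z := by
  suffices H : ∀ k ≤ n, ∀ x, green p q w z k x ≤ hit p q w z k x * green p q w z n z from
    H n le_rfl x
  intro k
  induction k with
  | zero =>
    intro _ x
    exact mul_nonneg (hit_nonneg h hw _ _) (green_nonneg h hw _ _)
  | succ k ih =>
    intro hk x
    by_cases hxz : x = z
    · subst hxz
      rw [hit_self, one_mul]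
      exact green_mono h hw x hk
    · rw [hit_succ_of_ne hxz, green, if_neg hxz, zero_add, mul_assoc]
      refine mul_le_mul_of_nonneg_left ?_ (hw x)
      have h1 := ih (by omega) (x + 1)
      have h2 := ih (by omega) (x - 1)
      rw [stepAvg, stepAvg, add_mul, mul_assoc, mul_assoc]
      exact add_le_add (mul_le_mul_of_nonneg_left h1 h.p_pos.le)
        (mul_le_mul_of_nonneg_left h2 h.q_nonneg)

lemma survive_nonneg (h : IsDriftPair p q) (hw : ∀ x, 0 ≤ w x) (n : ℕ) (x : ℤ) :
    0 ≤ survive p q w n x := by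
  induction n generalizing x with
  | zero => simp [survive]
  | succ n ih =>
    exact mul_nonneg (hw x) (add_nonneg (mul_nonneg h.p_pos.le (ih _))
      (mul_nonneg h.q_nonneg (ih _)))

lemma survive_le_one (h : IsDriftPair p q) (hw : ∀ x, 0 ≤ w x) (hw1 : ∀ x, w x ≤ 1) (n : ℕ)
    (x : ℤ) : survive p q w n x ≤ 1 := by
  induction n generalizing x with
  | zero => simp [survive]
  | succ n ih =>
    rw [survive]
    calc _ ≤ w x * stepAvg p q (fun _ => 1) x :=
          mul_le_mul_of_nonneg_left (stepAvg_mono h.p_pos.le h.q_nonneg (ih _) (ih _)) (hw x)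
      _ ≤ 1 := by rw [stepAvg_const h]; simpa using hw1 x

/-- The probability that the walk from `x` stays below `z` for `n` steps. -/
def stay (p q : ℝ) (z : ℤ) : ℕ → ℤ → ℝ
  | 0, x => if x < z then 1 else 0
  | n + 1, x => if x < z then stepAvg p q (stay p q z n) x else 0

lemma stay_nonneg (h : IsDriftPair p q) (n : ℕ) (x : ℤ) : 0 ≤ stay p q z n x := by
  induction n generalizing x with
  | zero => simp only [stay]; split_ifs <;> simp
  | succ n ih =>
    simp only [stay]; split_ifs
    · exact add_nonneg (mul_nonneg h.p_pos.le (ih _)) (mul_nonneg h.q_nonneg (ih _))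
    · exact le_rfl

lemma stay_le_one (h : IsDriftPair p q) (n : ℕ) (x : ℤ) : stay p q z n x ≤ 1 := by
  induction n generalizing x with
  | zero => simp only [stay]; split_ifs <;> simp
  | succ n ih =>
    simp only [stay]; split_ifs
    · exact (stepAvg_mono (v := fun _ => 1) h.p_pos.le h.q_nonneg (ih _) (ih _)).trans
        (stepAvg_const h 1 x).le
    · exact zero_le_one

lemma stay_succ_le (h : IsDriftPair p q) (n : ℕ) (x : ℤ) :
    stay p q z (n + 1) x ≤ stay p q z n x := by
  induction n generalizing x with
  | zero =>
    by_cases hx : x < z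
    · rw [show stay p q z 0 x = 1 by simp [stay, hx]]; exact stay_le_one h _ _
    · simp [stay, hx]
  | succ n ih =>
    rw [stay, stay]; split_ifs
    · exact stepAvg_mono h.p_pos.le h.q_nonneg (ih _) (ih _)
    · rfl

/-- Wald's identity as an inequality: the distance to `z` shrinks by `p - q` per step on average, so
the mean number of steps below `z` is at most `(z - x) / (p - q)`. -/
lemma sum_stay_le (h : IsDriftPair p q) (n : ℕ) {x : ℤ} (hx : x ≤ z) :
    ∑ k ∈ Finset.range n, stay p q z k x ≤ (z - x) / (p - q) := by
  induction n generalizing x with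
  | zero =>
    have : (x : ℝ) ≤ z := by exact_mod_cast hx
    simpa using div_nonneg (by linarith) h.drift_pos.le
  | succ n ih =>
    rcases hx.eq_or_lt with rfl | hlt
    · rw [Finset.sum_eq_zero]
      · simp
      · intro k _; cases k <;> simp [stay]
    · rw [Finset.sum_range_succ']
      have e : ∑ k ∈ Finset.range n, stay p q z (k + 1) x
          = p * ∑ k ∈ Finset.range n, stay p q z k (x + 1)
            + q * ∑ k ∈ Finset.range n, stay p q z k (x - 1) := by
        rw [Finset.mul_sum, Finset.mul_sum, ← Finset.sum_add_distrib]
        exact Finset.sum_congr rfl fun k _ => by simp [stay, hlt, stepAvg]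
      have h1 := mul_le_mul_of_nonneg_left (ih (x := x + 1) (by omega)) h.p_pos.le
      have h2 := mul_le_mul_of_nonneg_left (ih (x := x - 1) (by omega)) h.q_nonneg
      have h3 : stay p q z 0 x = 1 := by simp [stay, hlt]
      have hd := h.drift_pos
      rw [e, h3]
      calc _ ≤ p * ((z - (x + 1 : ℤ)) / (p - q)) + q * ((z - (x - 1 : ℤ)) / (p - q)) + 1 := by
            linarith
        _ = (p + q) * ((z - x) / (p - q)) := by push_cast; field_simp; ring
        _ = _ := by rw [h.add_eq, one_mul]

lemma stay_le_div (h : IsDriftPair p q) (n : ℕ) {x : ℤ} (hx : x ≤ z) :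
    n * stay p q z n x ≤ (z - x) / (p - q) := by
  refine le_trans ?_ (sum_stay_le h n hx)
  rw [← nsmul_eq_mul, ← Finset.card_range n, ← Finset.sum_const, Finset.card_range]
  exact Finset.sum_le_sum fun k hk =>
    antitone_nat_of_succ_le (f := fun n => stay p q z n x) (fun n => stay_succ_le h n x)
      (Finset.mem_range.1 hk).le

lemma tendsto_stay (h : IsDriftPair p q) {x : ℤ} (hx : x ≤ z) :
    Tendsto (fun n => stay p q z n x) atTop (𝓝 0) := by
  have : Tendsto (fun n : ℕ => (z - x) / (p - q) / (n : ℝ)) atTop (𝓝 0) :=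
    tendsto_const_div_atTop_nhds_zero_nat _
  refine squeeze_zero' (Eventually.of_forall fun n => stay_nonneg h n x) ?_ this
  filter_upwards [eventually_gt_atTop 0] with n hn
  have hn' : (0 : ℝ) < n := by exact_mod_cast hn
  rw [le_div_iff₀ hn', mul_comm]
  exact stay_le_div h n hx

/-- A walk that is alive after `n` steps has either reached `z` alive or stayed below `z` all the
time. The second alternative is negligible whatever the weights are. -/
lemma survive_le_hit_add_stay (h : IsDriftPair p q) (hw : ∀ x, 0 ≤ w x) (hw1 : ∀ x, w x ≤ 1)
    (n : ℕ) {x : ℤ} (hx : x ≤ z) :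
    survive p q w n x ≤ hit p q w z n x + stay p q z n x := by
  induction n generalizing x with
  | zero =>
    rcases hx.eq_or_lt with rfl | hlt
    · simp [survive, hit, stay]
    · simp [survive, hit, stay, hlt, hlt.ne]
  | succ n ih =>
    rcases hx.eq_or_lt with rfl | hlt
    · rw [hit_self]
      linarith [survive_le_one h hw hw1 (n + 1) x, stay_nonneg (z := x) h (n + 1) x]
    · rw [survive, hit_succ_of_ne hlt.ne, stay, if_pos hlt]
      have h1 := ih (x := x + 1) (by omega)
      have h2 := ih (x := x - 1) (by omega)
      have h3 : stepAvg p q (survive p q w n) x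
          ≤ stepAvg p q (hit p q w z n) x + stepAvg p q (stay p q z n) x := by
        simp only [stepAvg]
        nlinarith [h.p_pos, h.q_nonneg]
      have h4 : 0 ≤ stepAvg p q (stay p q z n) x :=
        add_nonneg (mul_nonneg h.p_pos.le (stay_nonneg h _ _))
          (mul_nonneg h.q_nonneg (stay_nonneg h _ _))
      calc _ ≤ w x * (stepAvg p q (hit p q w z n) x + stepAvg p q (stay p q z n) x) :=
            mul_le_mul_of_nonneg_left h3 (hw x)
        _ ≤ _ := by rw [mul_add]; linarith [mul_le_of_le_one_left h4 (hw1 x)]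

end green

/-! ### A Bonferroni inequality for the killing in a block. -/

/-- The probability that a walk that leaves a site for ever with probability `c` at each visit is
killed there, if it survives each visit with probability `w`. -/
def killProb (c w : ℝ) : ℝ := (1 - w) / (1 - w + w * c)

section block

variable {p q : ℝ} {w : ℤ → ℝ}

lemma killProb_nonneg {c w : ℝ} (hc : 0 ≤ c) (h0 : 0 ≤ w) (h1 : w ≤ 1) : 0 ≤ killProb c w :=
  div_nonneg (by linarith) (by nlinarith [mul_nonneg h0 hc])

lemma killProb_denom_pos {c w : ℝ} (hc : 0 < c) (h0 : 0 ≤ w) (h1 : w ≤ 1) :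
    0 < 1 - w + w * c := by
  rcases h0.eq_or_lt with rfl | h0
  · simp
  · nlinarith [mul_pos h0 hc]

lemma killProb_le_one {c w : ℝ} (hc : 0 < c) (h0 : 0 ≤ w) (h1 : w ≤ 1) : killProb c w ≤ 1 := by
  rw [killProb, div_le_one (killProb_denom_pos hc h0 h1)]
  nlinarith [mul_nonneg h0 hc.le]

lemma killProb_anti {c c' w : ℝ} (hc : 0 < c) (hcc : c ≤ c') (h0 : 0 ≤ w) (h1 : w ≤ 1) :
    killProb c' w ≤ killProb c w :=
  div_le_div_of_nonneg_left (by linarith) (killProb_denom_pos hc h0 h1)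
    (by nlinarith [mul_le_mul_of_nonneg_left hcc h0])

/-- Used with `θ = 1 - (q / p) ^ (z - y)`: the escape probability `c / θ` of `y` towards `z` depends
on the position in the block, and is traded for the constant `c` at the cost of a factor `θ`. -/
lemma mul_killProb_le {c θ w : ℝ} (hc : 0 < c) (hθ : 0 < θ) (hθ1 : θ ≤ 1) (h0 : 0 ≤ w)
    (h1 : w ≤ 1) : θ * killProb c w ≤ killProb (c / θ) w := by
  have h2 := killProb_denom_pos hc h0 h1
  have h3 := killProb_denom_pos (div_pos hc hθ) h0 h1
  rw [killProb, killProb, ← mul_div_assoc, div_le_div_iff₀ h2 h3]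
  have : θ * (1 - w) * (1 - w + w * (c / θ)) = (1 - w) * (θ * (1 - w) + w * c) := by
    field_simp
  rw [this]
  refine mul_le_mul_of_nonneg_left ?_ (by linarith)
  nlinarith

/-- The survival weights `w` on `Y`, and `1` elsewhere. -/
def weightOn (Y : Finset ℤ) (w : ℤ → ℝ) (x : ℤ) : ℝ := if x ∈ Y then w x else 1

lemma weightOn_nonneg (Y : Finset ℤ) (hw : ∀ x, 0 ≤ w x) (x : ℤ) : 0 ≤ weightOn Y w x := by
  unfold weightOn; split_ifs
  exacts [hw x, zero_le_one]

lemma weightOn_le_one (Y : Finset ℤ) (hw : ∀ x, w x ≤ 1) (x : ℤ) : weightOn Y w x ≤ 1 := by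
  unfold weightOn; split_ifs
  exacts [hw x, le_rfl]

/-- A Bonferroni inequality for the event to be killed at one of the sites of `Y` before the
walk reaches `z`. -/
theorem hit_weightOn_le (h : IsDriftPair p q) (hw : ∀ x, 0 ≤ w x) (hw1 : ∀ x, w x ≤ 1)
    {Y : Finset ℤ} {z x : ℤ} (hYz : ∀ y ∈ Y, y < z) (hxY : ∀ y ∈ Y, x ≤ y) (hxz : x ≤ z) (n : ℕ) :
    hit p q (weightOn Y w) z n x
      ≤ 1 - ∑ y ∈ Y, killProb ((p - q) / (1 - ratioPow p q y z)) (w y)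
        + ∑ y ∈ Y, ∑ y' ∈ Y.erase y, killProb (p - q) (w y) * killProb (p - q) (w y') := by
  set d := p - q with hd
  have hd0 : 0 < d := h.drift_pos
  -- Suppose that only `y` kills. Then `B y` is the probability to be killed from a start in `y`; `c
  -- y` is that to be killed before `z` is reached, since `d / (1 - E y)` is the probability to go
  -- from `y` to `z` without a return to `y`; and `φ y x` is the same for a start in `x`. The factor
  -- `g y` discounts for the other sites that may have killed before.
  set B : ℤ → ℝ := fun y => killProb d (w y) with hB
  set E : ℤ → ℝ := fun y => ratioPow p q y z with hE
  set c : ℤ → ℝ := fun y => killProb (d / (1 - E y)) (w y) with hc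
  set φ : ℤ → ℤ → ℝ := fun y x => c y * (ratioPow p q y x - E y) / (1 - E y) with hφ
  set g : ℤ → ℝ := fun y => 1 - ∑ y' ∈ Y.erase y, B y' with hg
  have hB0 : ∀ y, 0 ≤ B y := fun y => killProb_nonneg hd0.le (hw y) (hw1 y)
  have hB1 : ∀ y, B y ≤ 1 := fun y => killProb_le_one hd0 (hw y) (hw1 y)
  have hE1 : ∀ y ∈ Y, 0 < 1 - E y := fun y hy => sub_pos.2 (ratioPow_lt_one h (hYz y hy))
  have hE0 : ∀ y, 0 ≤ E y := fun y => ratioPow_nonneg h y z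
  have hdE : ∀ y ∈ Y, d ≤ d / (1 - E y) := fun y hy => by
    rw [le_div_iff₀ (hE1 y hy)]; nlinarith [hE0 y]
  have hc0 : ∀ y ∈ Y, 0 ≤ c y := fun y hy =>
    killProb_nonneg (hd0.le.trans (hdE y hy)) (hw y) (hw1 y)
  have hcB : ∀ y ∈ Y, c y ≤ B y := fun y hy => killProb_anti hd0 (hdE y hy) (hw y) (hw1 y)
  have hφ0 : ∀ y ∈ Y, ∀ x ≤ z, 0 ≤ φ y x := fun y hy x hx =>
    div_nonneg (mul_nonneg (hc0 y hy) (sub_nonneg.2 (ratioPow_anti h y hx))) (hE1 y hy).le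
  have hφB : ∀ y ∈ Y, ∀ x, φ y x ≤ B y := fun y hy x => by
    refine le_trans ?_ (hcB y hy)
    rw [hφ, div_le_iff₀ (hE1 y hy)]
    exact mul_le_mul_of_nonneg_left (by linarith [ratioPow_le_one h y x]) (hc0 y hy)
  have hg1 : ∀ y, g y ≤ 1 := fun y => by
    have := Finset.sum_nonneg fun y' (_ : y' ∈ Y.erase y) => hB0 y'
    simp only [hg]; linarith
  have hφg : ∀ y ∈ Y, ∀ x ≤ z, φ y x * g y ≤ B y := fun y hy x hx =>
    (mul_le_of_le_one_right (hφ0 y hy x hx) (hg1 y)).trans (hφB y hy x)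
  set s := ∑ y ∈ Y, B y with hs
  have hgs : ∀ y ∈ Y, g y = 1 - s + B y := fun y hy => by
    rw [hs, ← Finset.add_sum_erase _ _ hy]; simp only [hg]; ring
  have hstep : ∀ y ∈ Y, ∀ x, stepAvg p q (φ y) x
      = φ y x - if x = y then c y * (d / (1 - E y)) else 0 := by
    intro y hy x
    have h1 := stepAvg_ratioPow h y x
    have h2 := stepAvg_const h (E y) x
    have h3 : stepAvg p q (φ y) x
        = c y / (1 - E y) * (stepAvg p q (ratioPow p q y) x - stepAvg p q (fun _ => E y) x) := by
      simp only [stepAvg, hφ]; ring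
    rw [h3, h1, h2]
    split_ifs <;> simp only [hφ] <;> ring
  -- The candidate for a supersolution. It is harmonic off `Y`, as each `φ y` is harmonic off `y`.
  set V : ℤ → ℝ := fun x => 1 - ∑ y ∈ Y, φ y x * g y with hV
  have hVstep : ∀ x, stepAvg p q V x
      = V x + ∑ y ∈ Y, (if x = y then c y * (d / (1 - E y)) else 0) * g y := by
    intro x
    have h3 : stepAvg p q V x = (p + q) - ∑ y ∈ Y, stepAvg p q (φ y) x * g y := by
      simp only [stepAvg, hV, mul_sub, Finset.mul_sum, add_mul, Finset.sum_add_distrib]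
      simp only [mul_assoc]
      ring
    rw [h3, h.add_eq, Finset.sum_congr rfl fun y hy => by rw [hstep y hy x, sub_mul],
      Finset.sum_sub_distrib]
    simp only [hV]; ring
  have hmain : hit p q (weightOn Y w) z n x ≤ V x := by
    refine hit_le_of_supersolution h (weightOn_nonneg Y hw) (S := fun x => x ≤ z)
      (fun x hx hxz => by constructor <;> omega) ?_ ?_ ?_ n x hxz
    · intro x hx
      -- Nonnegativity of `V` is not obvious when the sum `s` of the killing probabilities is large.
      -- Since `g y = 1 - s + B y ≤ min 1 (2 - s)`, the sum in `V` is at most `s · max 0 (min 1 (2 -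
      -- s)) ≤ 1`, because `s (2 - s) ≤ 1`.
      have h1 : ∀ y ∈ Y, φ y x * g y ≤ B y * max 0 (min 1 (2 - s)) := by
        intro y hy
        have hBs : B y ≤ s := Finset.single_le_sum (f := B) (fun y _ => hB0 y) hy
        calc φ y x * g y ≤ φ y x * max 0 (min 1 (2 - s)) := by
              refine mul_le_mul_of_nonneg_left ?_ (hφ0 y hy x hx)
              rw [hgs y hy]
              exact le_max_of_le_right (le_min (by linarith) (by linarith [hB1 y]))
          _ ≤ _ := mul_le_mul_of_nonneg_right (hφB y hy x) (le_max_left _ _)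
      have h2 : ∑ y ∈ Y, φ y x * g y ≤ s * max 0 (min 1 (2 - s)) :=
        (Finset.sum_le_sum h1).trans_eq (Finset.sum_mul ..).symm
      have hs0 : 0 ≤ s := Finset.sum_nonneg fun y _ => hB0 y
      have h3 : s * max 0 (min 1 (2 - s)) ≤ 1 := by
        rcases le_total s 1 with h | h
        · rw [min_eq_left (by linarith), max_eq_right zero_le_one]; linarith
        · rw [min_eq_right (by linarith)]
          rcases le_total 2 s with h' | h'
          · rw [max_eq_left (by linarith)]; simp
          · rw [max_eq_right (by linarith)]; nlinarith [sq_nonneg (s - 1)]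
      simp only [hV]; linarith
    · simp [hV, hφ, hE]
    · intro x hx hxz
      rw [hVstep]
      by_cases hxY : x ∈ Y
      · rw [weightOn, if_pos hxY, Finset.sum_eq_single_of_mem x hxY
          (fun y _ hyx => by rw [if_neg hyx.symm, zero_mul]), if_pos rfl]
        have hden : 0 < 1 - w x + w x * (d / (1 - E x)) :=
          killProb_denom_pos (hd0.trans_le (hdE x hxY)) (hw x) (hw1 x)
        have hcx : c x * (1 - w x + w x * (d / (1 - E x))) = 1 - w x := by
          simp only [hc, killProb]; exact div_mul_cancel₀ _ hden.ne'
        have hφx : φ x x = c x := by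
          simp only [hφ]
          rw [ratioPow_of_le le_rfl, mul_div_assoc, div_self (hE1 x hxY).ne', mul_one]
        have hVx : V x = 1 - (c x * g x + ∑ y ∈ Y.erase x, φ y x * g y) := by
          simp only [hV]; rw [← Finset.add_sum_erase _ _ hxY, hφx]
        have hle : ∑ y ∈ Y.erase x, φ y x * g y ≤ 1 - g x := by
          have : 1 - g x = ∑ y ∈ Y.erase x, B y := by simp [hg]
          rw [this]
          exact Finset.sum_le_sum fun y hy => hφg y (Finset.mem_of_mem_erase hy) x hx
        -- The definition of `c x` balances the killing at `x` against the defect of `φ x`. What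
        -- remains to be shown is `(1 - c x) g x ≤ V x`, which holds because the other terms of `V
        -- x` sum to at most `1 - g x`.
        have h5 : w x * (c x * (d / (1 - E x)) * g x) = (1 - w x) * ((1 - c x) * g x) := by
          linear_combination (g x) * hcx
        rw [mul_add, h5]
        have h6 : (1 - c x) * g x ≤ V x := by rw [hVx]; linarith
        have h7 := mul_le_mul_of_nonneg_left h6 (sub_nonneg.2 (hw1 x))
        linarith
      · rw [weightOn, if_neg hxY, one_mul, Finset.sum_eq_zero, add_zero]
        intro y hy
        rw [if_neg (by rintro rfl; exact hxY hy), zero_mul]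
  refine hmain.trans ?_
  have hφx : ∀ y ∈ Y, φ y x = c y := fun y hy => by
    simp only [hφ]
    rw [ratioPow_of_le (hxY y hy), mul_div_assoc, div_self (hE1 y hy).ne', mul_one]
  have : V x = 1 - ∑ y ∈ Y, c y + ∑ y ∈ Y, ∑ y' ∈ Y.erase y, c y * B y' := by
    simp only [hV]
    rw [Finset.sum_congr rfl fun y hy => by rw [hφx y hy]]
    simp only [hg, mul_sub, mul_one, Finset.sum_sub_distrib, Finset.mul_sum]
    ring
  rw [this]
  gcongr with y hy y' hy'
  · exact hB0 y'
  · exact hcB y hy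

end block

/-! ### Exponential holding times and convolutions. -/

/-- The survival function of an exponential variable with mean `a`, on `[0, ∞)`. -/
def surv (a r : ℝ) : ℝ≥0∞ := if 0 ≤ r then ENNReal.ofReal (Real.exp (-r / a)) else 0

/-- The indicator function of `[0, ∞)`. -/
def heaviside (u : ℝ) : ℝ≥0∞ := if 0 ≤ u then 1 else 0

/-- The convolution of two functions on `ℝ`. -/
def convol (f g : ℝ → ℝ≥0∞) (u : ℝ) : ℝ≥0∞ := ∫⁻ r, f r * g (u - r)

section convol

variable {f g k : ℝ → ℝ≥0∞}

lemma measurable_surv_uncurry : Measurable fun x : ℝ × ℝ => surv x.1 x.2 :=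
  Measurable.ite (measurableSet_le measurable_const measurable_snd) (by fun_prop) measurable_const

@[fun_prop]
lemma measurable_surv (a : ℝ) : Measurable (surv a) :=
  measurable_surv_uncurry.comp (measurable_const.prodMk measurable_id)

@[fun_prop]
lemma measurable_heaviside : Measurable heaviside :=
  Measurable.ite measurableSet_Ici measurable_const measurable_const

lemma measurable_convol (hf : Measurable f) (hg : Measurable g) : Measurable (convol f g) := by
  unfold convol
  exact Measurable.lintegral_prod_right' (f := fun x : ℝ × ℝ => f x.2 * g (x.1 - x.2))
    (by fun_prop)

lemma convol_comm (f g : ℝ → ℝ≥0∞) (u : ℝ) : convol f g u = convol g f u := by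
  unfold convol
  rw [← lintegral_sub_left_eq_self (fun r => g r * f (u - r)) u]
  exact lintegral_congr fun r => by rw [sub_sub_cancel, mul_comm]

lemma convol_convol_comm (hf : Measurable f) (hg : Measurable g) (hk : Measurable k) (u : ℝ) :
    convol f (convol g k) u = convol g (convol f k) u := by
  have e : ∀ f g : ℝ → ℝ≥0∞, Measurable g → convol f (convol g k) u
      = ∫⁻ r, ∫⁻ s, f r * g s * k (u - r - s) := fun f g hg => by
    unfold convol
    refine lintegral_congr fun r => ?_
    rw [← lintegral_const_mul _ (by fun_prop)]
    simp only [mul_assoc]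
  rw [e f g hg, e g f hf, lintegral_lintegral_swap]
  · refine lintegral_congr fun r => lintegral_congr fun s => ?_
    rw [mul_comm (f s), sub_right_comm]
  · exact Measurable.aemeasurable (by fun_prop)

lemma convol_add_right (hf : Measurable f) (hg : Measurable g) (u : ℝ) :
    convol f (fun u => g u + k u) u = convol f g u + convol f k u := by
  unfold convol
  simp only [mul_add]
  exact lintegral_add_left (by fun_prop) _

lemma convol_const_mul_right (hf : Measurable f) (hg : Measurable g) (c : ℝ≥0∞) (u : ℝ) :
    convol f (fun u => c * g u) u = c * convol f g u := by
  unfold convol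
  rw [← lintegral_const_mul _ (by fun_prop)]
  simp only [mul_left_comm]

lemma convol_mono_right (h : ∀ u, g u ≤ k u) (u : ℝ) : convol f g u ≤ convol f k u :=
  lintegral_mono fun _ => mul_le_mul_right (h _) _

lemma lintegral_surv {a : ℝ} (ha : 0 < a) : ∫⁻ r, surv a r = ENNReal.ofReal a := by
  have e : surv a = (Set.Ici 0).indicator fun r => ENNReal.ofReal (Real.exp (-(1 / a) * r)) := by
    ext r
    simp only [surv, Set.indicator, Set.mem_Ici]
    congr 3; ring
  rw [e, lintegral_indicator measurableSet_Ici, setLIntegral_congr Ioi_ae_eq_Ici.symm,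
    ← ofReal_integral_eq_lintegral_ofReal]
  · rw [integral_exp_mul_Ioi (by simpa using ha)]
    simp
  · exact exp_neg_integrableOn_Ioi 0 (by positivity)
  · exact ae_of_all _ fun _ => (Real.exp_pos _).le

lemma surv_mul_exp {a l : ℝ} (ha : 0 < a) (hl : 0 ≤ l) (r : ℝ) :
    ENNReal.ofReal (Real.exp (-l * r)) * surv a r = surv (a / (1 + l * a)) r := by
  have : 0 < 1 + l * a := by positivity
  unfold surv
  split_ifs
  · rw [← ENNReal.ofReal_mul (Real.exp_pos _).le, ← Real.exp_add]
    congr 2; field_simp; ring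
  · simp

lemma lintegral_exp_mul_surv {a l : ℝ} (ha : 0 < a) (hl : 0 ≤ l) :
    ∫⁻ r, ENNReal.ofReal (Real.exp (-l * r)) * surv a r = ENNReal.ofReal (a / (1 + l * a)) := by
  simp only [surv_mul_exp ha hl]
  exact lintegral_surv (by positivity)

lemma surv_add {a u r : ℝ} (hu : 0 ≤ u) (hr : 0 ≤ r) : surv a (u + r) = surv a u * surv a r := by
  rw [surv, surv, surv, if_pos hu, if_pos hr, if_pos (add_nonneg hu hr),
    ← ENNReal.ofReal_mul (Real.exp_pos _).le, ← Real.exp_add]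
  congr 2; ring

/-- The density of the holding time is `surv a / a`, so this says that the clock has rung before
time `u` or has not. It is the form in which mass is conserved in one step. -/
lemma surv_add_convol {a : ℝ} (ha : 0 < a) (u : ℝ) :
    surv a u + ENNReal.ofReal (1 / a) * convol (surv a) heaviside u = heaviside u := by
  rcases lt_or_ge u 0 with hu | hu
  · have h1 : convol (surv a) heaviside u = 0 := by
      unfold convol
      rw [← lintegral_zero]
      refine lintegral_congr fun r => ?_
      unfold surv heaviside
      split_ifs with h1 h2
      · linarith
      all_goals simp
    rw [h1]; simp [surv, heaviside, hu.not_ge]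
  -- The integral is split at `u`; the part beyond `u` is `surv a u` times the whole integral, by
  -- lack of memory.
  · have hsplit : ∫⁻ r, surv a r = convol (surv a) heaviside u + surv a u * ∫⁻ r, surv a r := by
      unfold convol
      rw [← lintegral_const_mul _ (by fun_prop),
        ← lintegral_sub_right_eq_self (fun r => surv a u * surv a r) u,
        ← lintegral_add_left (by fun_prop)]
      refine lintegral_congr_ae ?_
      have hne : ∀ᵐ r : ℝ, r ≠ u := by simp [ae_iff]
      filter_upwards [hne] with r hr
      rcases lt_or_gt_of_ne hr with h | h
      · have h1 : heaviside (u - r) = 1 := by simp [heaviside, h.le]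
        have h2 : surv a (r - u) = 0 := by simp [surv, h]
        simp [h1, h2]
      · have h1 : heaviside (u - r) = 0 := by simp [heaviside, h]
        rw [h1, ← surv_add hu (by linarith)]; simp
    rw [lintegral_surv ha] at hsplit
    have h1 : ENNReal.ofReal (1 / a) * ENNReal.ofReal a = 1 := by
      rw [← ENNReal.ofReal_mul (by positivity)]; field_simp; simp
    have h2 := congrArg (fun x => ENNReal.ofReal (1 / a) * x) hsplit
    simp only [mul_add, mul_left_comm _ (surv a u), h1, mul_one] at h2
    rw [add_comm, ← h2]; simp [heaviside, hu]

lemma convol_heaviside_heaviside (u : ℝ) :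
    convol heaviside heaviside u = ENNReal.ofReal u := by
  unfold convol
  have : (fun r => heaviside r * heaviside (u - r)) = (Set.Icc 0 u).indicator 1 := by
    ext r
    simp only [heaviside, Set.indicator, Set.mem_Icc, sub_nonneg]
    split_ifs <;> simp_all
  rw [this, lintegral_indicator_one measurableSet_Icc, Real.volume_Icc, sub_zero]

lemma lintegral_exp_mul_convol (l : ℝ) (hf : Measurable f) (hg : Measurable g) :
    ∫⁻ u, ENNReal.ofReal (Real.exp (-l * u)) * convol f g u
      = (∫⁻ u, ENNReal.ofReal (Real.exp (-l * u)) * f u)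
        * ∫⁻ u, ENNReal.ofReal (Real.exp (-l * u)) * g u := by
  unfold convol
  have e1 : ∀ u, ENNReal.ofReal (Real.exp (-l * u)) * ∫⁻ r, f r * g (u - r)
      = ∫⁻ r, (ENNReal.ofReal (Real.exp (-l * r)) * f r)
        * (ENNReal.ofReal (Real.exp (-l * (u - r))) * g (u - r)) := fun u => by
    rw [← lintegral_const_mul _ (by fun_prop)]
    refine lintegral_congr fun r => ?_
    have : ENNReal.ofReal (Real.exp (-l * u))
        = ENNReal.ofReal (Real.exp (-l * r)) * ENNReal.ofReal (Real.exp (-l * (u - r))) := by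
      rw [← ENNReal.ofReal_mul (Real.exp_pos _).le, ← Real.exp_add]; congr 2; ring
    rw [this]; ring
  simp only [e1]
  rw [lintegral_lintegral_swap (Measurable.aemeasurable (by fun_prop)),
    ← lintegral_mul_const _ (by fun_prop)]
  refine lintegral_congr fun r => ?_
  rw [lintegral_const_mul _ (by fun_prop),
    lintegral_sub_right_eq_self (fun u => ENNReal.ofReal (Real.exp (-l * u)) * g u) r]

end convol

/-! ### Occupation probabilities of the process in a fixed environment. -/

section occupation

variable (p q : ℝ) (t : ℤ → ℝ) (A : Set ℤ)

/-- The transition operator of the pair (site, remaining time) for the walk that waits at each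
site `x` an exponential time with mean `t x` and is killed outside `A`. -/
def stepTime (ψ : ℤ → ℝ → ℝ≥0∞) (x : ℤ) (u : ℝ) : ℝ≥0∞ :=
  A.indicator 1 x * (ENNReal.ofReal (1 / t x) * convol (surv (t x))
    (fun u => ENNReal.ofReal p * ψ (x + 1) u + ENNReal.ofReal q * ψ (x - 1) u) u)

/-- The probability to wait in `y` for the time `u` when the current site is `x`. -/
def waitAt (y x : ℤ) (u : ℝ) : ℝ≥0∞ := if x = y then surv (t y) u else 0

/-- The probability that the process started in `x` is in `y` at time `u`, after less than `n`
jumps. -/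
def occ : ℕ → ℤ → ℤ → ℝ → ℝ≥0∞
  | 0, _ => fun _ _ => 0
  | n + 1, y => fun x u => waitAt t y x u + stepTime p q t A (occ n y) x u

variable {p q t A}

lemma measurable_stepTime {ψ : ℤ → ℝ → ℝ≥0∞} (hψ : ∀ x, Measurable (ψ x)) (x : ℤ) :
    Measurable (stepTime p q t A ψ x) := by
  have h1 := hψ (x + 1)
  have h2 := hψ (x - 1)
  exact ((measurable_convol (measurable_surv _) (by fun_prop)).const_mul _).const_mul _

lemma measurable_waitAt (y x : ℤ) : Measurable (waitAt t y x) := by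
  unfold waitAt; split_ifs <;> fun_prop

lemma measurable_occ (n : ℕ) (y x : ℤ) : Measurable (occ p q t A n y x) := by
  induction n generalizing x with
  | zero => exact measurable_const
  | succ n ih => exact (measurable_waitAt y x).add (measurable_stepTime ih x)

lemma stepTime_add {ψ χ : ℤ → ℝ → ℝ≥0∞} (hψ : ∀ x, Measurable (ψ x)) (hχ : ∀ x, Measurable (χ x))
    (x : ℤ) (u : ℝ) : stepTime p q t A (fun x u => ψ x u + χ x u) x u
      = stepTime p q t A ψ x u + stepTime p q t A χ x u := by
  have h1 := hψ (x + 1)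
  have h2 := hψ (x - 1)
  have h3 := hχ (x + 1)
  have h4 := hχ (x - 1)
  simp only [stepTime]
  rw [← mul_add, ← mul_add, ← convol_add_right (by fun_prop) (by fun_prop)]
  congr 2
  refine congrArg (fun f => convol (surv (t x)) f u) (funext fun u => ?_)
  ring

lemma stepTime_const_mul {ψ : ℤ → ℝ → ℝ≥0∞} (hψ : ∀ x, Measurable (ψ x)) (c : ℝ≥0∞)
    (x : ℤ) (u : ℝ) :
    stepTime p q t A (fun x u => c * ψ x u) x u = c * stepTime p q t A ψ x u := by
  have h1 := hψ (x + 1)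
  have h2 := hψ (x - 1)
  simp only [stepTime]
  rw [mul_left_comm c, mul_left_comm c, ← convol_const_mul_right (by fun_prop) (by fun_prop) c]
  congr 2
  refine congrArg (fun f => convol (surv (t x)) f u) (funext fun u => ?_)
  ring

lemma stepTime_mono {ψ χ : ℤ → ℝ → ℝ≥0∞} (h : ∀ x u, ψ x u ≤ χ x u) (x : ℤ) (u : ℝ) :
    stepTime p q t A ψ x u ≤ stepTime p q t A χ x u := by
  unfold stepTime
  gcongr
  exact convol_mono_right (fun u => by gcongr <;> apply h) u

lemma stepTime_convol {ψ : ℤ → ℝ → ℝ≥0∞} (hψ : ∀ x, Measurable (ψ x)) {g : ℝ → ℝ≥0∞}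
    (hg : Measurable g) (x : ℤ) (u : ℝ) :
    stepTime p q t A (fun x u => convol g (ψ x) u) x u
      = convol g (stepTime p q t A ψ x) u := by
  have h1 := hψ (x + 1)
  have h2 := hψ (x - 1)
  have h3 : Measurable fun u => ENNReal.ofReal p * ψ (x + 1) u + ENNReal.ofReal q * ψ (x - 1) u := by
    fun_prop
  have h4 := measurable_convol (measurable_surv (t x)) h3
  unfold stepTime
  rw [convol_const_mul_right hg (h4.const_mul _), convol_const_mul_right hg h4,
    convol_convol_comm hg (measurable_surv _) h3]
  congr 2
  refine congrArg (fun f => convol (surv (t x)) f u) (funext fun u => ?_)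
  rw [convol_add_right hg (by fun_prop), convol_const_mul_right hg h1,
    convol_const_mul_right hg h2]

lemma occ_le_succ (n : ℕ) (y x : ℤ) (u : ℝ) :
    occ p q t A n y x u ≤ occ p q t A (n + 1) y x u := by
  induction n generalizing x u with
  | zero => exact zero_le
  | succ n ih => exact add_le_add_right (stepTime_mono ih x u) _

lemma occ_mono (y x : ℤ) (u : ℝ) : Monotone fun n => occ p q t A n y x u :=
  monotone_nat_of_le_succ fun n => occ_le_succ n y x u

lemma occ_mono_set {A' : Set ℤ} (hA : A ⊆ A') (n : ℕ) (y x : ℤ) (u : ℝ) :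
    occ p q t A n y x u ≤ occ p q t A' n y x u := by
  induction n generalizing x u with
  | zero => exact le_rfl
  | succ n ih =>
    refine add_le_add_right ?_ _
    refine (stepTime_mono ih x u).trans ?_
    unfold stepTime
    gcongr

lemma waitAt_self (y : ℤ) : waitAt t y y = surv (t y) := by ext; simp [waitAt]

lemma waitAt_of_ne {y x : ℤ} (h : x ≠ y) : waitAt t y x = fun _ => 0 := by ext; simp [waitAt, h]

/-- The decomposition of the occupation probabilities at the last jump. -/
lemma occ_succ_eq_last (n : ℕ) (y x : ℤ) (u : ℝ) :
    occ p q t A (n + 1) y x u = waitAt t y x u + convol (surv (t y)) (fun u =>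
      A.indicator 1 (y - 1) * ENNReal.ofReal (1 / t (y - 1)) * ENNReal.ofReal p
          * occ p q t A n (y - 1) x u
        + A.indicator 1 (y + 1) * ENNReal.ofReal (1 / t (y + 1)) * ENNReal.ofReal q
          * occ p q t A n (y + 1) x u) u := by
  set a := A.indicator 1 (y - 1) * ENNReal.ofReal (1 / t (y - 1)) * ENNReal.ofReal p with ha
  set b := A.indicator 1 (y + 1) * ENNReal.ofReal (1 / t (y + 1)) * ENNReal.ofReal q with hb
  have hm := fun n y x => measurable_occ (p := p) (q := q) (t := t) (A := A) n y x
  have hw := fun y x => measurable_waitAt (t := t) y x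
  -- Base of the exchange of first and last jump: a single jump ends in `y` only if it starts in `y
  -- - 1` or `y + 1`, and `a`, `b` are the rates of these two jumps.
  have hwait : ∀ x u, stepTime p q t A (waitAt t y) x u = convol (surv (t y))
      (fun u => a * waitAt t (y - 1) x u + b * waitAt t (y + 1) x u) u := by
    intro x u
    by_cases h1 : x = y - 1
    · subst h1
      have e1 : y - 1 - 1 ≠ y := by omega
      have e2 : y - 1 ≠ y + 1 := by omega
      unfold stepTime
      simp only [sub_add_cancel, waitAt_self, waitAt_of_ne e1, waitAt_of_ne e2, mul_zero, add_zero]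
      rw [convol_const_mul_right (by fun_prop) (by fun_prop),
        convol_const_mul_right (by fun_prop) (by fun_prop), convol_comm (surv (t y))]
      ring
    · by_cases h2 : x = y + 1
      · subst h2
        have e1 : y + 1 + 1 ≠ y := by omega
        have e2 : y + 1 ≠ y - 1 := by omega
        unfold stepTime
        simp only [add_sub_cancel_right, waitAt_self, waitAt_of_ne e1, waitAt_of_ne e2, mul_zero,
          zero_add]
        rw [convol_const_mul_right (by fun_prop) (by fun_prop),
          convol_const_mul_right (by fun_prop) (by fun_prop), convol_comm (surv (t y))]
        ring
      · have e1 : x + 1 ≠ y := by omega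
        have e2 : x - 1 ≠ y := by omega
        unfold stepTime
        simp only [waitAt_of_ne e1, waitAt_of_ne e2, waitAt_of_ne h1, waitAt_of_ne h2, mul_zero,
          add_zero]
        simp [convol]
  induction n generalizing x u with
  | zero =>
    simp [occ, stepTime, convol]
  | succ n ih =>
    have e1 : occ p q t A (n + 1 + 1) y x u
        = waitAt t y x u + stepTime p q t A (occ p q t A (n + 1) y) x u := rfl
    have e2 : occ p q t A (n + 1) y = fun x u => waitAt t y x u + convol (surv (t y)) (fun u =>
      a * occ p q t A n (y - 1) x u + b * occ p q t A n (y + 1) x u) u := by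
      funext x u; exact ih x u
    have hm1 : ∀ x, Measurable fun u =>
        a * occ p q t A n (y - 1) x u + b * occ p q t A n (y + 1) x u := fun x => by
      have := hm n (y - 1) x
      have := hm n (y + 1) x
      fun_prop
    rw [e1, e2, stepTime_add (hw y) (fun x => measurable_convol (measurable_surv _) (hm1 x)),
      hwait, stepTime_convol hm1 (measurable_surv _), ← convol_add_right (measurable_surv _)]
    · congr 2
      ext u
      rw [stepTime_add (fun x => (hm _ _ _).const_mul _) (fun x => (hm _ _ _).const_mul _),
        stepTime_const_mul (hm _ _), stepTime_const_mul (hm _ _)]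
      simp only [occ]
      ring
    · exact ((hw _ _).const_mul _).add ((hw _ _).const_mul _)

/-- Occupation probabilities are bounded by multiples of the excessive measure `t y * U y`. -/
theorem occ_le_of_excessive (h : IsDriftPair p q) (ht : ∀ x, 0 < t x) {U : ℤ → ℝ} {z : ℤ}
    (hU0 : ∀ y, 0 ≤ U y) (hUz : 1 ≤ U z) (hU : ∀ y ∈ A, p * U (y - 1) + q * U (y + 1) ≤ U y)
    (n : ℕ) (y : ℤ) (hy : y ∈ A) (s : ℝ) :
    occ p q t A n y z s ≤ ENNReal.ofReal (t y / t z * U y) * heaviside s := by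
  induction n generalizing y s with
  | zero => exact zero_le
  | succ n ih =>
    rw [occ_succ_eq_last]
    have hterm : ∀ (y' : ℤ) (r : ℝ), 0 ≤ r → ∀ u, A.indicator 1 y' * ENNReal.ofReal (1 / t y')
        * ENNReal.ofReal r * occ p q t A n y' z u
        ≤ ENNReal.ofReal (r * U y' / t z) * heaviside u := by
      intro y' r hr u
      by_cases hy' : y' ∈ A
      · rw [Set.indicator_of_mem hy', Pi.one_apply, one_mul,
          ← ENNReal.ofReal_mul (one_div_pos.2 (ht y')).le]
        refine (mul_le_mul_right (ih y' hy' u) _).trans_eq ?_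
        have h1 := ht y'
        have h2 := ht z
        rw [← mul_assoc, ← ENNReal.ofReal_mul (by positivity)]
        congr 2; field_simp
      · simp [hy']
    have h1 : convol (surv (t y)) (fun u =>
        A.indicator 1 (y - 1) * ENNReal.ofReal (1 / t (y - 1)) * ENNReal.ofReal p
          * occ p q t A n (y - 1) z u
        + A.indicator 1 (y + 1) * ENNReal.ofReal (1 / t (y + 1)) * ENNReal.ofReal q
          * occ p q t A n (y + 1) z u) s
        ≤ ENNReal.ofReal (U y / t z) * convol (surv (t y)) heaviside s := by
      rw [← convol_const_mul_right (by fun_prop) (by fun_prop)]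
      refine convol_mono_right (fun u => ?_) s
      refine (add_le_add (hterm _ p h.p_pos.le u) (hterm _ q h.q_nonneg u)).trans ?_
      have hz := ht z
      have := hU0 (y - 1)
      have := hU0 (y + 1)
      have := h.p_pos
      have := h.q_nonneg
      rw [← add_mul, ← ENNReal.ofReal_add (by positivity) (by positivity), ← add_div]
      gcongr
      exact hU y hy
    have h2 : waitAt t y z s ≤ ENNReal.ofReal (t y / t z * U y) * surv (t y) s := by
      unfold waitAt
      split_ifs with hzy
      · subst hzy
        rw [div_self (ht z).ne', one_mul]
        refine le_mul_of_one_le_left zero_le ?_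
        rw [← ENNReal.ofReal_one]; exact ENNReal.ofReal_le_ofReal hUz
      · exact zero_le
    refine (add_le_add h2 h1).trans_eq ?_
    rw [← surv_add_convol (ht y) s, mul_add, ← mul_assoc, ← ENNReal.ofReal_mul
      (mul_nonneg (div_pos (ht y) (ht z)).le (hU0 y))]
    congr 3
    have := ht y
    have := ht z
    field_simp

/-- The case of the constant excessive function: since `p + q = 1`, the depths form an invariant
measure. -/
lemma occ_self_le (h : IsDriftPair p q) (ht : ∀ x, 0 < t x) (n : ℕ) (z : ℤ) (hz : z ∈ A) (s : ℝ) :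
    occ p q t A n z z s ≤ heaviside s := by
  simpa [div_self (ht z).ne'] using occ_le_of_excessive h ht (A := A) (U := fun _ => 1) (z := z)
    (fun _ => zero_le_one) le_rfl (fun y _ => by rw [mul_one, mul_one, h.add_eq]) n z hz s

lemma occ_of_neg (h : IsDriftPair p q) (ht : ∀ x, 0 < t x) (n : ℕ) (y x : ℤ) {s : ℝ}
    (hs : s < 0) : occ p q t A n y x s = 0 := by
  have h1 := occ_mono_set (p := p) (q := q) (t := t) (Set.subset_univ A) n y x s
  have h2 := occ_le_of_excessive h ht (A := Set.univ) (U := fun _ => 1) (z := x)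
    (fun _ => zero_le_one) le_rfl (fun y _ => by rw [mul_one, mul_one, h.add_eq]) n y trivial s
  have h3 : heaviside s = 0 := by simp [heaviside, hs]
  rw [h3, mul_zero] at h2
  exact le_antisymm (h1.trans h2) zero_le

end occupation

/-! ### Chernoff bounds, conservation of mass, and a lower bound for staying in a trap. -/

section mass

variable {p q : ℝ} {t : ℤ → ℝ} {A : Set ℤ}

/-- A Chernoff bound, one step at a time. Against `e^{lu}` a holding time with mean `t x` acts as
the factor `1 / (1 + l t x)`: this is how holding times become killing of the jump chain. -/
lemma stepTime_le (h : IsDriftPair p q) (ht : ∀ x, 0 < t x) {l : ℝ} (hl : 0 ≤ l)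
    {ψ : ℤ → ℝ → ℝ≥0∞} {v : ℤ → ℝ} (hv : ∀ x, 0 ≤ v x)
    (hψ : ∀ x u, ψ x u ≤ ENNReal.ofReal (Real.exp (l * u) * v x)) (x : ℤ) (u : ℝ) :
    stepTime p q t A ψ x u ≤ A.indicator 1 x *
      ENNReal.ofReal (Real.exp (l * u) * (1 / (1 + l * t x) * stepAvg p q v x)) := by
  unfold stepTime
  gcongr
  have hstep : 0 ≤ stepAvg p q v x :=
    add_nonneg (mul_nonneg h.p_pos.le (hv _)) (mul_nonneg h.q_nonneg (hv _))
  have htx := ht x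
  have hpos : 0 < 1 + l * t x := by positivity
  have h1 : ∀ u, ENNReal.ofReal p * ψ (x + 1) u + ENNReal.ofReal q * ψ (x - 1) u
      ≤ ENNReal.ofReal (stepAvg p q v x) * ENNReal.ofReal (Real.exp (l * u)) := by
    intro u
    refine (add_le_add (mul_le_mul_right (hψ _ u) _) (mul_le_mul_right (hψ _ u) _)).trans_eq ?_
    have e0 := (Real.exp_pos (l * u)).le
    rw [← ENNReal.ofReal_mul h.p_pos.le, ← ENNReal.ofReal_mul h.q_nonneg,
      ← ENNReal.ofReal_add (mul_nonneg h.p_pos.le (mul_nonneg e0 (hv _)))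
        (mul_nonneg h.q_nonneg (mul_nonneg e0 (hv _))), ← ENNReal.ofReal_mul hstep]
    congr 1; simp only [stepAvg]; ring
  have h2 : convol (surv (t x)) (fun u => ENNReal.ofReal (Real.exp (l * u))) u
      = ENNReal.ofReal (Real.exp (l * u)) * ENNReal.ofReal (t x / (1 + l * t x)) := by
    rw [← lintegral_exp_mul_surv htx hl, ← lintegral_const_mul _ (by fun_prop)]
    unfold convol
    refine lintegral_congr fun r => ?_
    rw [← mul_assoc, ← ENNReal.ofReal_mul (Real.exp_pos _).le, ← Real.exp_add, mul_comm]
    congr 3; ring_nf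
  calc _ ≤ ENNReal.ofReal (1 / t x) * (ENNReal.ofReal (stepAvg p q v x)
        * (ENNReal.ofReal (Real.exp (l * u)) * ENNReal.ofReal (t x / (1 + l * t x)))) := by
        refine mul_le_mul_right ((convol_mono_right h1 u).trans_eq ?_) _
        rw [convol_const_mul_right (by fun_prop) (by fun_prop), h2]
    _ = _ := by
        rw [← ENNReal.ofReal_mul (Real.exp_pos _).le, ← ENNReal.ofReal_mul hstep,
          ← ENNReal.ofReal_mul (by positivity)]
        congr 1; field_simp

/-- To be in `z` at time `s`, the process must reach `z` by time `s`; the Chernoff factor turns this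
into reaching `z` before being killed at rate `l`. At `z` itself the induction stops with the
invariant-measure bound, so later returns are not counted. -/
lemma occ_le_hit (h : IsDriftPair p q) (ht : ∀ x, 0 < t x) {l : ℝ} (hl : 0 ≤ l) (n : ℕ)
    (z x : ℤ) (s : ℝ) : occ p q t A n z x s
      ≤ ENNReal.ofReal (Real.exp (l * s) * hit p q (fun x => 1 / (1 + l * t x)) z n x) := by
  have hw : ∀ x, 0 ≤ (fun x => 1 / (1 + l * t x)) x := fun x => by
    have := ht x
    have : 0 < 1 + l * t x := by positivity
    positivity
  refine (occ_mono_set (Set.subset_univ A) n z x s).trans ?_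
  induction n generalizing x s with
  | zero => exact zero_le
  | succ n ih =>
    by_cases hx : x = z
    · subst hx
      rw [hit_self, mul_one]
      refine (occ_self_le h ht (n + 1) x (Set.mem_univ x) s).trans ?_
      unfold heaviside
      split_ifs with hs
      · rw [← ENNReal.ofReal_one]
        exact ENNReal.ofReal_le_ofReal (Real.one_le_exp (by positivity))
      · exact zero_le
    · rw [hit_succ_of_ne hx]
      have e : occ p q t Set.univ (n + 1) z x s = stepTime p q t Set.univ
          (occ p q t Set.univ n z) x s := by
        simp [occ, waitAt, hx]
      rw [e]
      refine (stepTime_le h ht hl (hit_nonneg h hw n) ih x s).trans_eq ?_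
      simp

/-- The probability that the process makes `n` jumps before time `u` without leaving `A`. -/
def remain (p q : ℝ) (t : ℤ → ℝ) (A : Set ℤ) : ℕ → ℤ → ℝ → ℝ≥0∞
  | 0 => fun x u => A.indicator 1 x * heaviside u
  | n + 1 => stepTime p q t A (remain p q t A n)

/-- The intensity of jumps from `x` out of `A`, relative to all jumps. -/
def exitRate (p q : ℝ) (A : Set ℤ) (x : ℤ) : ℝ≥0∞ :=
  ENNReal.ofReal p * Aᶜ.indicator 1 (x + 1) + ENNReal.ofReal q * Aᶜ.indicator 1 (x - 1)

/-- The probability to leave `A` by a jump from `y` among the first `n` jumps, before time `u`. -/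
def exitFrom (p q : ℝ) (t : ℤ → ℝ) (A : Set ℤ) (n : ℕ) (y x : ℤ) (u : ℝ) : ℝ≥0∞ :=
  ENNReal.ofReal (1 / t y) * exitRate p q A y * convol heaviside (occ p q t A n y x) u

lemma measurable_remain (n : ℕ) (x : ℤ) : Measurable (remain p q t A n x) := by
  induction n generalizing x with
  | zero => exact measurable_heaviside.const_mul _
  | succ n ih => exact measurable_stepTime ih x

lemma stepTime_tsum {ψ : ℤ → ℤ → ℝ → ℝ≥0∞} (hψ : ∀ y x, Measurable (ψ y x)) (x : ℤ) (u : ℝ) :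
    stepTime p q t A (fun x u => ∑' y, ψ y x u) x u = ∑' y, stepTime p q t A (ψ y) x u := by
  have h1 := fun y => hψ y (x + 1)
  have h2 := fun y => hψ y (x - 1)
  simp only [stepTime]
  rw [ENNReal.tsum_mul_left, ENNReal.tsum_mul_left]
  congr 2
  unfold convol
  rw [← lintegral_tsum (fun y => Measurable.aemeasurable (by fun_prop))]
  refine lintegral_congr fun r => ?_
  rw [ENNReal.tsum_mul_left, ENNReal.tsum_add, ENNReal.tsum_mul_left, ENNReal.tsum_mul_left]

lemma measurable_exitFrom (n : ℕ) (y x : ℤ) : Measurable (exitFrom p q t A n y x) :=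
  (measurable_convol measurable_heaviside (measurable_occ n y x)).const_mul _

lemma exitFrom_succ (n : ℕ) (y x : ℤ) (u : ℝ) : exitFrom p q t A (n + 1) y x u
    = ENNReal.ofReal (1 / t y) * exitRate p q A y * convol heaviside (waitAt t y x) u
      + stepTime p q t A (exitFrom p q t A n y) x u := by
  have h := fun x => measurable_occ (p := p) (q := q) (t := t) (A := A) n y x
  have e : exitFrom p q t A n y = fun x u => ENNReal.ofReal (1 / t y) * exitRate p q A y *
      convol heaviside (occ p q t A n y x) u := rfl
  rw [e, stepTime_const_mul (fun x => measurable_convol measurable_heaviside (h x)),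
    stepTime_convol h measurable_heaviside, ← mul_add,
    ← convol_add_right measurable_heaviside (measurable_waitAt y x)]
  rfl

/-- Conservation of mass over one holding time: the process waits in `x`, jumps out of `A`, or jumps
to a neighbour in `A`. -/
lemma indicator_eq_add (h : IsDriftPair p q) (ht : ∀ x, 0 < t x) (x : ℤ) (u : ℝ) :
    A.indicator 1 x * heaviside u = (∑' y, A.indicator 1 y * (waitAt t y x u
        + ENNReal.ofReal (1 / t y) * exitRate p q A y * convol heaviside (waitAt t y x) u))
      + stepTime p q t A (fun x u => A.indicator 1 x * heaviside u) x u := by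
  rw [tsum_eq_single x]
  · rw [waitAt_self]
    unfold stepTime
    rw [← mul_add]
    congr 1
    rw [← surv_add_convol (ht x), add_assoc]
    congr 1
    rw [convol_comm heaviside, mul_assoc, ← mul_add]
    congr 1
    have e : ∀ u, ENNReal.ofReal p * (A.indicator 1 (x + 1) * heaviside u)
        + ENNReal.ofReal q * (A.indicator 1 (x - 1) * heaviside u)
        = (ENNReal.ofReal p * A.indicator 1 (x + 1) + ENNReal.ofReal q * A.indicator 1 (x - 1))
          * heaviside u := fun u => by ring
    simp only [e]
    rw [convol_const_mul_right (by fun_prop) (by fun_prop), ← add_mul]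
    have hA : ∀ y : ℤ, Aᶜ.indicator (1 : ℤ → ℝ≥0∞) y + A.indicator 1 y = 1 := fun y => by
      by_cases hy : y ∈ A <;> simp [hy]
    have : exitRate p q A x + (ENNReal.ofReal p * A.indicator 1 (x + 1)
        + ENNReal.ofReal q * A.indicator 1 (x - 1)) = 1 := by
      unfold exitRate
      rw [add_add_add_comm, ← mul_add, ← mul_add, hA, hA, mul_one, mul_one,
        ← ENNReal.ofReal_add h.p_pos.le h.q_nonneg, h.add_eq, ENNReal.ofReal_one]
    rw [this, one_mul]
  · intro y hy
    rw [waitAt_of_ne hy.symm]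
    simp [convol]

/-- Conservation of mass: at time `u` the process is in `A`, or has left `A`, or has made at least
`n` jumps. -/
theorem mass_balance (h : IsDriftPair p q) (ht : ∀ x, 0 < t x) (n : ℕ) (x : ℤ) (u : ℝ) :
    A.indicator 1 x * heaviside u
      = (∑' y, A.indicator 1 y * (occ p q t A n y x u + exitFrom p q t A n y x u))
        + remain p q t A n x u := by
  induction n generalizing x u with
  | zero => simp [occ, exitFrom, remain, convol]
  | succ n ih =>
    have hm : ∀ y x, Measurable fun u =>
        A.indicator 1 y * (occ p q t A n y x u + exitFrom p q t A n y x u) := fun y x =>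
      ((measurable_occ n y x).add (measurable_exitFrom n y x)).const_mul _
    rw [indicator_eq_add h ht x u]
    have e : (fun x u => A.indicator 1 x * heaviside u)
        = fun x u => (∑' y, A.indicator 1 y * (occ p q t A n y x u + exitFrom p q t A n y x u))
        + remain p q t A n x u := by funext x u; exact ih x u
    rw [e, stepTime_add (fun x => Measurable.tsum fun y => hm y x) (measurable_remain n),
      stepTime_tsum hm, ← add_assoc, ← ENNReal.tsum_add]
    congr 1
    refine tsum_congr fun y => ?_
    have e' := stepTime_const_mul (p := p) (q := q) (t := t) (A := A)
      (ψ := fun x u => occ p q t A n y x u + exitFrom p q t A n y x u)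
      (fun x => (measurable_occ n y x).add (measurable_exitFrom n y x)) (A.indicator 1 y) x u
    rw [e', ← mul_add, exitFrom_succ, stepTime_add (measurable_occ n y) (measurable_exitFrom n y)]
    simp only [occ]
    ring

lemma remain_Iic_le_stay (h : IsDriftPair p q) (ht : ∀ x, 0 < t x) (b : ℤ) (n : ℕ) (x : ℤ)
    (u : ℝ) : remain p q t (Set.Iic b) n x u ≤ ENNReal.ofReal (stay p q (b + 1) n x) := by
  induction n generalizing x u with
  | zero =>
    simp only [remain, stay, Set.indicator, Set.mem_Iic, Int.lt_add_one_iff, heaviside]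
    split_ifs <;> simp
  | succ n ih =>
    have h1 := stepTime_le (A := Set.Iic b) h ht le_rfl (stay_nonneg (z := b + 1) h n)
      (fun x u => by simpa using ih x u) x u
    refine h1.trans ?_
    simp only [stay, Set.indicator, Set.mem_Iic, Int.lt_add_one_iff]
    split_ifs <;> simp

lemma remain_univ_le_survive (h : IsDriftPair p q) (ht : ∀ x, 0 < t x) {l : ℝ} (hl : 0 ≤ l)
    (n : ℕ) (x : ℤ) (u : ℝ) : remain p q t Set.univ n x u
      ≤ ENNReal.ofReal (Real.exp (l * u) * survive p q (fun x => 1 / (1 + l * t x)) n x) := by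
  have hw : ∀ x, 0 ≤ (fun x => 1 / (1 + l * t x)) x := fun x => by
    have := ht x
    have : 0 < 1 + l * t x := by positivity
    positivity
  induction n generalizing x u with
  | zero =>
    simp only [remain, survive, heaviside]
    split_ifs
    · simpa using by positivity
    · simp
  | succ n ih =>
    refine (stepTime_le h ht hl (survive_nonneg h hw n) ih x u).trans_eq ?_
    simp [survive]

/-- The excessive function of the walk killed above `z + k`, seen from `z`. -/
lemma exists_excessive (h : IsDriftPair p q) (z : ℤ) (k : ℕ) : ∃ U : ℤ → ℝ, (∀ y, 0 ≤ U y) ∧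
    1 ≤ U z ∧ (∀ y ∈ Set.Iic (z + k), p * U (y - 1) + q * U (y + 1) ≤ U y) ∧
    (∀ y, U y ≤ (q / p) ^ (z - y).toNat) ∧
    U (z + k) ≤ (1 - q / p) / (1 - (q / p) ^ (k + 1)) := by
  set e : ℤ → ℤ → ℝ := fun b y => ratioPow p q (-b) (-y) with he
  have hstep : ∀ b y, p * e b (y - 1) + q * e b (y + 1) = e b y - if y = b then p - q else 0 := by
    intro b y
    have := stepAvg_ratioPow h (-b) (-y)
    simp only [neg_inj] at this
    rw [← this]
    simp only [he, stepAvg]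
    rw [show -(y - 1) = -y + 1 by ring, show -(y + 1) = -y - 1 by ring]
  have hD : 0 < 1 - (q / p) ^ (k + 1) :=
    sub_pos.2 (pow_lt_one₀ h.ratio_nonneg h.ratio_lt_one (by omega))
  have hp := h.p_pos.le
  have hq := h.q_nonneg
  set f : ℤ → ℝ := fun y => (1 - e (z + k + 1) y) / (1 - (q / p) ^ (k + 1)) with hf
  -- A minimum of two excessive functions. The first is the probability of hitting `z` for the
  -- reversed walk and decays to the left of `z`. The second vanishes at `z + k + 1`, is one at `z`,
  -- and makes the value at the exit site `z + k` small.
  refine ⟨fun y => min (e z y) (f y), fun y => ?_, ?_, fun y hy => ?_, fun y => ?_, ?_⟩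
  · refine le_min (ratioPow_nonneg h _ _) (div_nonneg (sub_nonneg.2 (ratioPow_le_one h _ _)) hD.le)
  · refine le_min (ratioPow_of_le le_rfl).ge ?_
    have : e (z + k + 1) z = (q / p) ^ (k + 1) := by
      simp only [he, ratioPow]; congr 1; omega
    rw [hf]; simp only [this]; rw [div_self hD.ne']
  · refine le_min ?_ ?_
    · calc _ ≤ p * e z (y - 1) + q * e z (y + 1) := by gcongr <;> exact min_le_left _ _
        _ ≤ _ := by
          rw [hstep]
          split_ifs
          · linarith [h.drift_pos]
          · simp
    · have hy' : y ≠ z + k + 1 := by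
        have : y ≤ z + k := hy
        omega
      calc _ ≤ p * f (y - 1) + q * f (y + 1) := by gcongr <;> exact min_le_right _ _
        _ = ((p + q) - (p * e (z + k + 1) (y - 1) + q * e (z + k + 1) (y + 1)))
            / (1 - (q / p) ^ (k + 1)) := by simp only [hf]; ring
        _ ≤ _ := by rw [hstep, if_neg hy', h.add_eq, sub_zero]
  · refine (min_le_left _ _).trans_eq ?_
    simp only [he, ratioPow]; congr 1; omega
  · refine (min_le_right _ _).trans_eq ?_
    simp only [hf, he, ratioPow]
    rw [show (-(z + k : ℤ) - -(z + k + 1)).toNat = 1 by omega, pow_one]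

/-- A lower bound for the probability to be found in the starting point `z` at time `s`. -/
theorem one_le_occ_add (h : IsDriftPair p q) (ht : ∀ x, 0 < t x) (z : ℤ) (k : ℕ) {s : ℝ}
    (hs : 0 ≤ s) : 1 ≤ (⨆ n, occ p q t Set.univ n z z s)
      + (∑' y, if y = z ∨ z + k < y then 0
          else ENNReal.ofReal ((q / p) ^ (z - y).toNat * (t y / t z)))
      + ENNReal.ofReal (s * (p - q) / (t z * (1 - (q / p) ^ (k + 1)))) := by
  obtain ⟨U, hU0, hUz, hU, hUle, hUk⟩ := exists_excessive h z k
  set A := Set.Iic (z + k : ℤ) with hA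
  have hzA : z ∈ A := by simp [hA]
  have hocc := fun n => occ_le_of_excessive h ht hU0 hUz hU n
  have hhs : heaviside s = 1 := by simp [heaviside, hs]
  have hbase : ∀ n, 1 ≤ ((⨆ n, occ p q t Set.univ n z z s)
      + (∑' y, if y = z ∨ z + k < y then 0
          else ENNReal.ofReal ((q / p) ^ (z - y).toNat * (t y / t z)))
      + ENNReal.ofReal (s * (p - q) / (t z * (1 - (q / p) ^ (k + 1)))))
      + ENNReal.ofReal (stay p q (z + k + 1) n z) := by
    intro n
    -- On the half line `A = (-∞, z + k]` the process is at time `s` in `z`, or elsewhere in `A`, or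
    -- has left `A`, or has made `n` jumps inside `A`. The last alternative vanishes as `n → ∞`; the
    -- second and third are controlled by the excessive function, and leaving is possible only by a
    -- right jump from `z + k`.
    have hmb := mass_balance (A := A) h ht n z s
    rw [Set.indicator_of_mem hzA, Pi.one_apply, one_mul, hhs] at hmb
    rw [hmb]
    refine add_le_add ?_ (remain_Iic_le_stay h ht (z + k) n z s)
    simp only [mul_add]
    rw [ENNReal.tsum_add]
    refine add_le_add ?_ ?_
    · rw [ENNReal.tsum_eq_add_tsum_ite z, Set.indicator_of_mem hzA, Pi.one_apply, one_mul]
      refine add_le_add ?_ (ENNReal.tsum_le_tsum fun y => ?_)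
      · exact (occ_mono_set (Set.subset_univ A) n z z s).trans
          (le_iSup (fun n => occ p q t Set.univ n z z s) n)
      · by_cases hyz : y = z
        · simp [hyz]
        by_cases hyA : y ∈ A
        · have hyk : ¬ z + k < y := not_lt.2 hyA
          rw [if_neg hyz, Set.indicator_of_mem hyA, if_neg (by simp [hyz, hyk]), Pi.one_apply,
            one_mul]
          refine (hocc n y hyA s).trans ?_
          rw [hhs, mul_one, mul_comm]
          exact ENNReal.ofReal_le_ofReal
            (mul_le_mul_of_nonneg_right (hUle y) (div_pos (ht y) (ht z)).le)
        · simp [hyA, hyz]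
    · rw [tsum_eq_single (z + k : ℤ)]
      · have hk : (z + k : ℤ) ∈ A := by simp [hA]
        have hex : exitRate p q A (z + k) = ENNReal.ofReal p := by
          simp [exitRate, hA]
        rw [Set.indicator_of_mem hk, Pi.one_apply, one_mul, exitFrom, hex]
        have h1 : convol heaviside (occ p q t A n (z + k) z) s
            ≤ ENNReal.ofReal (t (z + k) / t z * U (z + k)) * ENNReal.ofReal s := by
          rw [← convol_heaviside_heaviside s, ← convol_const_mul_right (by fun_prop) (by fun_prop)]
          exact convol_mono_right (hocc n _ hk) s
        refine (mul_le_mul_right h1 _).trans ?_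
        have e1 := ht (z + k)
        have e2 := ht z
        have e3 := hU0 (z + k)
        have e4 := h.p_pos.le
        rw [← ENNReal.ofReal_mul (by positivity), ← ENNReal.ofReal_mul (by positivity),
          ← ENNReal.ofReal_mul (by positivity)]
        refine ENNReal.ofReal_le_ofReal ?_
        calc _ = s * (p * U (z + k)) / t z := by field_simp
          _ ≤ s * (p * ((1 - q / p) / (1 - (q / p) ^ (k + 1)))) / t z := by gcongr
          _ = s * (p - p * (q / p)) / (t z * (1 - (q / p) ^ (k + 1))) := by
              rw [mul_comm (t z), ← div_div]; ring
          _ = _ := by rw [h.p_mul_ratio]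
      · intro y hy
        by_cases hyA : y ∈ A
        · have : y ≤ z + k := hyA
          have : y + 1 ∈ A := by simp only [hA, Set.mem_Iic]; omega
          have : y - 1 ∈ A := by simp only [hA, Set.mem_Iic]; omega
          simp_all [exitFrom, exitRate]
        · simp [hyA]
  have hlim : Tendsto (fun n => ((⨆ n, occ p q t Set.univ n z z s)
      + (∑' y, if y = z ∨ z + k < y then 0
          else ENNReal.ofReal ((q / p) ^ (z - y).toNat * (t y / t z)))
      + ENNReal.ofReal (s * (p - q) / (t z * (1 - (q / p) ^ (k + 1)))))
      + ENNReal.ofReal (stay p q (z + k + 1) n z)) atTop (𝓝 (((⨆ n, occ p q t Set.univ n z z s)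
      + (∑' y, if y = z ∨ z + k < y then 0
          else ENNReal.ofReal ((q / p) ^ (z - y).toNat * (t y / t z)))
      + ENNReal.ofReal (s * (p - q) / (t z * (1 - (q / p) ^ (k + 1))))) + 0)) := by
    refine tendsto_const_nhds.add ?_
    have := ENNReal.tendsto_ofReal (tendsto_stay (z := z + k + 1) h (x := z) (by omega))
    simpa using this
  rw [add_zero] at hlim
  exact ge_of_tendsto' hlim hbase

end mass

/-! ### Laplace transforms in time and Green's function. -/

section laplace

variable {p q : ℝ} {t : ℤ → ℝ}

lemma lintegral_exp_mul_stepTime {l : ℝ} (hl : 0 ≤ l) (ht : ∀ x, 0 < t x)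
    {ψ : ℤ → ℝ → ℝ≥0∞} (hψ : ∀ x, Measurable (ψ x)) (x : ℤ) :
    ∫⁻ u, ENNReal.ofReal (Real.exp (-l * u)) * stepTime p q t Set.univ ψ x u
      = ENNReal.ofReal (1 / (1 + l * t x))
        * (ENNReal.ofReal p * (∫⁻ u, ENNReal.ofReal (Real.exp (-l * u)) * ψ (x + 1) u)
          + ENNReal.ofReal q * ∫⁻ u, ENNReal.ofReal (Real.exp (-l * u)) * ψ (x - 1) u) := by
  have h1 := hψ (x + 1)
  have h2 := hψ (x - 1)
  have htx := ht x
  simp only [stepTime, Set.indicator_univ, Pi.one_apply, one_mul]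
  simp only [mul_left_comm _ (ENNReal.ofReal (1 / t x))]
  have h3 : Measurable (convol (surv (t x))
      (fun u => ENNReal.ofReal p * ψ (x + 1) u + ENNReal.ofReal q * ψ (x - 1) u)) :=
    measurable_convol (by fun_prop) (by fun_prop)
  rw [lintegral_const_mul _ (by fun_prop), lintegral_exp_mul_convol _ (by fun_prop) (by fun_prop), lintegral_exp_mul_surv (ht x) hl,
    ← mul_assoc, ← ENNReal.ofReal_mul (by positivity)]
  congr 1
  · congr 1; field_simp
  · simp only [mul_add]
    rw [lintegral_add_left (by fun_prop)]
    simp only [mul_left_comm (ENNReal.ofReal (Real.exp _))]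
    rw [lintegral_const_mul _ (by fun_prop), lintegral_const_mul _ (by fun_prop)]

lemma lintegral_exp_mul_occ (h : IsDriftPair p q) {l : ℝ} (hl : 0 ≤ l) (ht : ∀ x, 0 < t x)
    (n : ℕ) (z x : ℤ) :
    ∫⁻ u, ENNReal.ofReal (Real.exp (-l * u)) * occ p q t Set.univ n z x u
      = ENNReal.ofReal (green p q (fun x => 1 / (1 + l * t x)) z n x
          * (t z / (1 + l * t z))) := by
  have hpos : ∀ x, 0 < 1 + l * t x := fun x => by have := ht x; positivity
  have hw : ∀ x, 0 ≤ (fun x => 1 / (1 + l * t x)) x := fun x => (one_div_pos.2 (hpos x)).le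
  have hz : 0 ≤ t z / (1 + l * t z) := (div_pos (ht z) (hpos z)).le
  induction n generalizing x with
  | zero => simp [occ, green]
  | succ n ih =>
    simp only [occ, mul_add]
    have hg := fun x => green_nonneg (z := z) h hw n x
    have hwm := measurable_waitAt (t := t) z x
    rw [lintegral_add_left (by fun_prop), lintegral_exp_mul_stepTime hl ht (measurable_occ n z), ih, ih, green,
      ← ENNReal.ofReal_mul h.p_pos.le, ← ENNReal.ofReal_mul h.q_nonneg,
      ← ENNReal.ofReal_add (mul_nonneg h.p_pos.le (mul_nonneg (hg _) hz))
        (mul_nonneg h.q_nonneg (mul_nonneg (hg _) hz)), ← ENNReal.ofReal_mul (hw x), add_mul,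
      ENNReal.ofReal_add]
    · congr 1
      · by_cases hx : x = z
        · subst hx
          rw [waitAt_self, lintegral_exp_mul_surv (ht x) hl]; simp
        · simp [waitAt_of_ne hx, hx]
      · congr 1; simp only [stepAvg]; ring
    · split_ifs <;> simp [hz]
    · exact mul_nonneg (mul_nonneg (hw x) (add_nonneg (mul_nonneg h.p_pos.le (hg _))
        (mul_nonneg h.q_nonneg (hg _)))) hz

/-- Each visit of `z` ends in killing with probability `1 - w = l t / (1 + l t)`, and after the
first visit there are at most `(1 - 2 q w)⁻¹` visits on average. As `1 - 2 q w = 1 - w + w (p - q)`,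
the product is `killProb (p - q) w`. -/
lemma mul_lintegral_exp_mul_occ_le (h : IsDriftPair p q) {l : ℝ} (hl : 0 < l)
    (ht : ∀ x, 0 < t x) (n : ℕ) (z x : ℤ) :
    ENNReal.ofReal l * ∫⁻ u, ENNReal.ofReal (Real.exp (-l * u)) * occ p q t Set.univ n z x u
      ≤ ENNReal.ofReal (hit p q (fun x => 1 / (1 + l * t x)) z n x
          * killProb (p - q) (1 / (1 + l * t z))) := by
  have hpos : ∀ x, 0 < 1 + l * t x := fun x => by have := ht x; positivity
  have hw : ∀ x, 0 ≤ (fun x => 1 / (1 + l * t x)) x := fun x => (one_div_pos.2 (hpos x)).le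
  have hw1 : ∀ x, (fun x => 1 / (1 + l * t x)) x ≤ 1 := fun x => by
    have := ht x
    rw [div_le_one (hpos x)]
    nlinarith [mul_pos hl this]
  rw [lintegral_exp_mul_occ h hl.le ht, ← ENNReal.ofReal_mul hl.le]
  refine ENNReal.ofReal_le_ofReal ?_
  have h1 := green_le_hit_mul (z := z) h hw n x
  have h2 := green_self_le (z := z) h hw hw1 n
  have h3 := hit_nonneg (z := z) h hw n x
  have e1 : l * (t z / (1 + l * t z)) = 1 - 1 / (1 + l * t z) := by
    have := (hpos z).ne'; field_simp; ring
  have e2 : (1 - 2 * q * (1 / (1 + l * t z)))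
      = 1 - 1 / (1 + l * t z) + 1 / (1 + l * t z) * (p - q) := by
    linear_combination (-(1 / (1 + l * t z))) * h.add_eq
  have h4 : 0 ≤ 1 - 1 / (1 + l * t z) := sub_nonneg.2 (hw1 z)
  calc _ = green p q (fun x => 1 / (1 + l * t x)) z n x * (1 - 1 / (1 + l * t z)) := by
        rw [← e1]; ring
    _ ≤ hit p q (fun x => 1 / (1 + l * t x)) z n x * (1 - 2 * q * (1 / (1 + l * t z)))⁻¹
        * (1 - 1 / (1 + l * t z)) :=
        mul_le_mul_of_nonneg_right (h1.trans (mul_le_mul_of_nonneg_left h2 h3)) h4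
    _ = _ := by rw [killProb, e2]; ring

end laplace

/-! ### The Chapman–Kolmogorov inequality. -/

section semigroup

variable {p q : ℝ} {t : ℤ → ℝ}

lemma stepTime_univ (ψ : ℤ → ℝ → ℝ≥0∞) (x : ℤ) (u : ℝ) :
    stepTime p q t Set.univ ψ x u = ENNReal.ofReal (1 / t x) * convol (surv (t x))
      (fun u => ENNReal.ofReal p * ψ (x + 1) u + ENNReal.ofReal q * ψ (x - 1) u) u := by
  simp [stepTime]

/-- A Chapman–Kolmogorov inequality. -/
theorem occ_mul_occ_le (h : IsDriftPair p q) (ht : ∀ x, 0 < t x) (n k : ℕ) (y x : ℤ) (u : ℝ)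
    {s : ℝ} (hs : 0 ≤ s) : occ p q t Set.univ n y x u * occ p q t Set.univ k y y s
      ≤ occ p q t Set.univ (n + k) y x (u + s) := by
  set c := occ p q t Set.univ k y y s with hc
  induction n generalizing x u with
  | zero => simp [occ]
  | succ n ih =>
    have hm := fun n x => measurable_occ (p := p) (q := q) (t := t) (A := Set.univ) n y x
    set G : ℝ → ℝ≥0∞ := fun u => ENNReal.ofReal p * occ p q t Set.univ n y (x + 1) u
      + ENNReal.ofReal q * occ p q t Set.univ n y (x - 1) u with hG
    set F : ℝ → ℝ≥0∞ := fun u => ENNReal.ofReal p * occ p q t Set.univ (n + k) y (x + 1) u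
      + ENNReal.ofReal q * occ p q t Set.univ (n + k) y (x - 1) u with hF
    have hGm : Measurable G := ((hm _ _).const_mul _).add ((hm _ _).const_mul _)
    have hFm : Measurable F := ((hm _ _).const_mul _).add ((hm _ _).const_mul _)
    have hGF : ∀ u, G u * c ≤ F (u + s) := fun u => by
      simp only [hG, hF, add_mul, mul_assoc]
      gcongr <;> apply ih
    have hG0 : ∀ u < 0, G u = 0 := fun u hu => by
      simp [hG, occ_of_neg h ht _ _ _ hu]
    have e1 : occ p q t Set.univ (n + 1) y x u
        = waitAt t y x u + ENNReal.ofReal (1 / t x) * convol (surv (t x)) G u := by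
      simp only [occ, stepTime_univ, hG]
    have e2 : ∀ u, occ p q t Set.univ (n + 1 + k) y x u
        = waitAt t y x u + ENNReal.ofReal (1 / t x) * convol (surv (t x)) F u := fun u => by
      rw [Nat.add_right_comm]
      simp only [occ, stepTime_univ, hF]
    rcases lt_or_ge u 0 with hu | hu
    · rw [occ_of_neg h ht _ _ _ hu, zero_mul]; exact zero_le
    by_cases hx : x = y
    · subst hx
      -- The first jump time is compared with `u`. If it is smaller, the induction hypothesis
      -- applies after the jump; if it is larger, the holding time starts afresh at `u` by lack of
      -- memory.
      have key : convol (surv (t x)) G u * c + surv (t x) u * convol (surv (t x)) F s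
          ≤ convol (surv (t x)) F (u + s) := by
        unfold convol
        rw [← lintegral_mul_const _ (by fun_prop), ← lintegral_const_mul _ (by fun_prop),
          ← lintegral_sub_right_eq_self (fun r => surv (t x) u * (surv (t x) r * F (s - r))) u,
          ← lintegral_add_left (by fun_prop)]
        refine lintegral_mono_ae ?_
        have hne : ∀ᵐ r : ℝ, r ≠ u := by simp [ae_iff]
        filter_upwards [hne] with r hr
        rcases lt_or_gt_of_ne hr with hlt | hgt
        · have : surv (t x) (r - u) = 0 := by simp [surv, hlt]
          rw [this, zero_mul, mul_zero, add_zero, mul_assoc]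
          gcongr
          exact (hGF _).trans_eq (by congr 1; ring)
        · rw [hG0 _ (by linarith), mul_zero, zero_mul, zero_add, ← mul_assoc,
            ← surv_add hu (by linarith)]
          apply le_of_eq
          congr 2 <;> ring_nf
      have hck : c ≤ surv (t x) s + ENNReal.ofReal (1 / t x) * convol (surv (t x)) F s := by
        have := e2 s
        rw [waitAt_self] at this
        rw [← this]
        exact occ_mono x x s (by omega)
      rw [e1, e2, waitAt_self, surv_add hu hs]
      calc (surv (t x) u + ENNReal.ofReal (1 / t x) * convol (surv (t x)) G u) * c
          = surv (t x) u * c + ENNReal.ofReal (1 / t x) * (convol (surv (t x)) G u * c) := by ring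
        _ ≤ surv (t x) u * (surv (t x) s + ENNReal.ofReal (1 / t x) * convol (surv (t x)) F s)
            + ENNReal.ofReal (1 / t x) * (convol (surv (t x)) G u * c) := by gcongr
        _ = surv (t x) u * surv (t x) s + ENNReal.ofReal (1 / t x) * (convol (surv (t x)) G u * c
            + surv (t x) u * convol (surv (t x)) F s) := by ring
        _ ≤ _ := by gcongr
    · rw [e1, e2, waitAt_of_ne hx, zero_add, zero_add, mul_assoc]
      gcongr
      unfold convol
      rw [← lintegral_mul_const _ (by fun_prop)]
      refine lintegral_mono fun r => ?_
      simp only [mul_assoc]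
      gcongr
      exact (hGF _).trans_eq (by congr 1; ring)

end semigroup

/-! ### The random environment and the range of the killed walk. -/

section measurability

variable {Ω : Type*} [MeasurableSpace Ω] {p q : ℝ}

lemma measurable_hit {w : Ω → ℤ → ℝ} (hw : ∀ x, Measurable fun ω => w ω x) (z : ℤ) (n : ℕ)
    (x : ℤ) : Measurable fun ω => hit p q (w ω) z n x := by
  induction n generalizing x with
  | zero => exact measurable_const
  | succ n ih =>
    simp only [hit]
    split_ifs
    · exact measurable_const
    · exact (hw x).mul (((ih _).const_mul p).add ((ih _).const_mul q))

lemma measurable_occ_env {τ : ℤ → Ω → ℝ} (hτ : ∀ z, Measurable (τ z)) (A : Set ℤ) (n : ℕ)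
    (y x : ℤ) : Measurable fun a : Ω × ℝ => occ p q (fun z => τ z a.1) A n y x a.2 := by
  have hsurv : ∀ z, Measurable fun a : Ω × ℝ => surv (τ z a.1) a.2 := fun z =>
    measurable_surv_uncurry.comp (((hτ z).comp measurable_fst).prodMk measurable_snd)
  induction n generalizing x with
  | zero => exact measurable_const
  | succ n ih =>
    simp only [occ, stepTime, waitAt]
    refine Measurable.add ?_ (measurable_const.mul (Measurable.mul ?_ ?_))
    · split_ifs
      · exact hsurv y
      · exact measurable_const
    · have := hτ x
      fun_prop
    · unfold convol
      refine Measurable.lintegral_prod_right' (f := fun a : (Ω × ℝ) × ℝ =>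
        surv (τ x a.1.1) a.2 * (ENNReal.ofReal p * occ p q (fun z => τ z a.1.1) A n y (x + 1)
          (a.1.2 - a.2) + ENNReal.ofReal q * occ p q (fun z => τ z a.1.1) A n y (x - 1)
          (a.1.2 - a.2))) ?_
      have h1 : Measurable fun a : (Ω × ℝ) × ℝ => surv (τ x a.1.1) a.2 :=
        (hsurv x).comp ((measurable_fst.comp measurable_fst).prodMk measurable_snd)
      have h2 : Measurable fun a : (Ω × ℝ) × ℝ => (a.1.1, a.1.2 - a.2) := by fun_prop
      exact h1.mul ((((ih (x + 1)).comp h2).const_mul _).add (((ih (x - 1)).comp h2).const_mul _))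

end measurability

/-- The `σ`-algebra generated by the traps in `S`. -/
@[reducible]
def envSigma {Ω : Type*} (τ : ℤ → Ω → ℝ) (S : Set ℤ) : MeasurableSpace Ω :=
  ⨆ i ∈ S, MeasurableSpace.comap (τ i) inferInstance

/-- The survival weights of the walk that is killed at rate `l`. -/
def weight {Ω : Type*} (τ : ℤ → Ω → ℝ) (l : ℝ) (ω : Ω) (z : ℤ) : ℝ := 1 / (1 + l * τ z ω)

/-- The probability that the killed walk from `0` reaches `z`, if killing takes place in `[0, z)`
only. -/
def reach {Ω : Type*} (p q : ℝ) (τ : ℤ → Ω → ℝ) (l : ℝ) (z : ℤ) (ω : Ω) : ℝ≥0∞ :=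
  ⨆ n, ENNReal.ofReal (hit p q (weightOn (Finset.Ico 0 z) (weight τ l ω)) z n 0)

/-- The environment consists of i.i.d. strictly positive random variables. -/
structure IsPosIIDEnv {Ω : Type*} [MeasurableSpace Ω] (P : Measure Ω) (τ : ℤ → Ω → ℝ) : Prop where
  measurable : ∀ z, Measurable (τ z)
  indep : iIndepFun τ P
  identDistrib : ∀ z, IdentDistrib (τ z) (τ 0) P P
  pos : ∀ z ω, 0 < τ z ω

section env

variable {Ω : Type*} {mΩ : MeasurableSpace Ω} {P : Measure Ω} {τ : ℤ → Ω → ℝ} {p q l : ℝ}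

lemma measurable_envSigma {S : Set ℤ} {z : ℤ} (hz : z ∈ S) :
    Measurable[envSigma τ S] (τ z) := by
  rw [measurable_iff_comap_le]
  exact le_iSup₂_of_le z hz le_rfl

namespace IsPosIIDEnv

lemma envSigma_le (hτ : IsPosIIDEnv P τ) (S : Set ℤ) : envSigma τ S ≤ mΩ :=
  iSup₂_le fun z _ => (hτ.measurable z).comap_le

lemma lintegral_mul (hτ : IsPosIIDEnv P τ) {S T : Set ℤ} (hST : Disjoint S T) {f g : Ω → ℝ≥0∞}
    (hf : Measurable[envSigma τ S] f) (hg : Measurable[envSigma τ T] g) :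
    ∫⁻ ω, f ω * g ω ∂P = (∫⁻ ω, f ω ∂P) * ∫⁻ ω, g ω ∂P :=
  lintegral_mul_eq_lintegral_mul_lintegral_of_independent_measurableSpace
    (hτ.envSigma_le S) (hτ.envSigma_le T)
    (indep_iSup_of_disjoint (fun z => (hτ.measurable z).comap_le)
      ((iIndepFun_iff_iIndep ..).1 hτ.indep) hST) hf hg

lemma lintegral_comp (hτ : IsPosIIDEnv P τ) {f : ℝ → ℝ≥0∞} (hf : Measurable f) (z : ℤ) :
    ∫⁻ ω, f (τ z ω) ∂P = ∫⁻ ω, f (τ 0 ω) ∂P :=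
  ((hτ.identDistrib z).comp hf).lintegral_eq

lemma weight_pos (hτ : IsPosIIDEnv P τ) (hl : 0 ≤ l) (ω : Ω) (z : ℤ) : 0 < weight τ l ω z := by
  have := hτ.pos z ω
  unfold weight; positivity

lemma weight_le_one (hτ : IsPosIIDEnv P τ) (hl : 0 ≤ l) (ω : Ω) (z : ℤ) : weight τ l ω z ≤ 1 := by
  have := hτ.pos z ω
  unfold weight
  rw [div_le_one (by positivity)]
  nlinarith [mul_nonneg hl this.le]

end IsPosIIDEnv

lemma measurable_weightOn {S : Set ℤ} (Y : Finset ℤ) (hY : ∀ y ∈ Y, y ∈ S) (l : ℝ) (x : ℤ) :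
    Measurable[envSigma τ S] fun ω => weightOn Y (weight τ l ω) x := by
  by_cases hx : x ∈ Y
  · simp only [weightOn, hx, if_true, weight]
    have := measurable_envSigma (τ := τ) (hY x hx)
    fun_prop
  · simp only [weightOn, hx, if_false]
    exact measurable_const

lemma measurable_hit_weightOn {S : Set ℤ} (Y : Finset ℤ) (hY : ∀ y ∈ Y, y ∈ S) (l : ℝ) (z : ℤ)
    (n : ℕ) (x : ℤ) :
    Measurable[envSigma τ S] fun ω => hit p q (weightOn Y (weight τ l ω)) z n x :=
  @measurable_hit Ω (envSigma τ S) p q _ (measurable_weightOn Y hY l) z n x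

lemma measurable_reach {S : Set ℤ} (z : ℤ) (hS : ∀ y, 0 ≤ y → y < z → y ∈ S) :
    Measurable[envSigma τ S] (reach p q τ l z) := by
  unfold reach
  refine Measurable.iSup fun n => ENNReal.measurable_ofReal.comp ?_
  exact measurable_hit_weightOn _ (fun y hy => hS y (Finset.mem_Ico.1 hy).1 (Finset.mem_Ico.1 hy).2)
    l z n 0

variable [IsProbabilityMeasure P]

lemma measurable_killProb (c : ℝ) : Measurable (killProb c) := by
  unfold killProb; fun_prop

lemma integrable_killProb (hτ : IsPosIIDEnv P τ) (hl : 0 ≤ l) {c : ℝ} (hc : 0 < c) (z : ℤ) :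
    Integrable (fun ω => killProb c (weight τ l ω z)) P := by
  refine Integrable.of_bound (C := 1) ?_ (ae_of_all _ fun ω => ?_)
  · have := hτ.measurable z
    refine ((measurable_killProb c).comp (f := fun ω => weight τ l ω z) ?_).aestronglyMeasurable
    unfold weight; fun_prop
  · have h0 := hτ.weight_pos hl ω z
    have h1 := hτ.weight_le_one hl ω z
    rw [Real.norm_eq_abs, abs_of_nonneg (killProb_nonneg hc.le h0.le h1)]
    exact killProb_le_one hc h0.le h1

omit [IsProbabilityMeasure P] in
lemma integral_killProb_eq (hτ : IsPosIIDEnv P τ) (l c : ℝ) (z : ℤ) :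
    ∫ ω, killProb c (weight τ l ω z) ∂P = ∫ ω, killProb c (weight τ l ω 0) ∂P := by
  have : Measurable fun t : ℝ => killProb c (1 / (1 + l * t)) :=
    (measurable_killProb c).comp (by fun_prop)
  exact ((hτ.identDistrib z).comp this).integral_eq

lemma sum_ratioPow_le (h : IsDriftPair p q) (c : ℤ) (m : ℕ) :
    ∑ y ∈ Finset.Ico c (c + m), ratioPow p q y (c + m) ≤ 1 / (p - q) := by
  have e : ∑ y ∈ Finset.Ico c (c + m), ratioPow p q y (c + m)
      = ∑ k ∈ Finset.range m, (q / p) ^ (k + 1) := by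
    refine Finset.sum_nbij' (fun y => (c + m - 1 - y).toNat) (fun k => c + m - 1 - k) ?_ ?_ ?_ ?_ ?_
    · intro y hy; rw [Finset.mem_Ico] at hy; rw [Finset.mem_range]; omega
    · intro k hk; rw [Finset.mem_range] at hk; rw [Finset.mem_Ico]; omega
    · intro y hy; rw [Finset.mem_Ico] at hy; omega
    · intro k hk; rw [Finset.mem_range] at hk; omega
    · intro y hy; rw [Finset.mem_Ico] at hy; unfold ratioPow; congr 1; omega
  have h0 := h.ratio_nonneg
  have h1 := h.ratio_lt_one
  rw [e]
  calc ∑ k ∈ Finset.range m, (q / p) ^ (k + 1) ≤ ∑ k ∈ Finset.range m, (q / p) ^ k := by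
        refine Finset.sum_le_sum fun k _ => ?_
        exact pow_le_pow_of_le_one h0 h1.le (by omega)
    _ ≤ (1 - q / p)⁻¹ := by
        rw [← tsum_geometric_of_lt_one h0 h1]
        exact (summable_geometric_of_lt_one h0 h1).sum_le_tsum _ fun k _ => by positivity
    _ ≤ 1 / (p - q) := by
        rw [← one_div]
        exact one_div_le_one_div_of_le h.drift_pos h.drift_le_one_sub_ratio

/-- The mean probability to be killed before the walk has passed a block of `m` sites. -/
theorem integral_hit_block_le (h : IsDriftPair p q) (hτ : IsPosIIDEnv P τ) (hl : 0 ≤ l) (c : ℤ)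
    (m n : ℕ) {b : ℝ} (hb : b = ∫ ω, killProb (p - q) (weight τ l ω 0) ∂P) :
    ∫ ω, hit p q (weightOn (Finset.Ico c (c + m)) (weight τ l ω)) (c + m) n c ∂P
      ≤ 1 - b * (m - 1 / (p - q) - m ^ 2 * b) := by
  set Y := Finset.Ico c (c + m) with hY
  have hd := h.drift_pos
  have hw0 : ∀ ω z, 0 ≤ weight τ l ω z := fun ω z => (hτ.weight_pos hl ω z).le
  have hw1 : ∀ ω z, weight τ l ω z ≤ 1 := fun ω z => hτ.weight_le_one hl ω z
  have hB := fun z => integrable_killProb hτ hl hd z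
  have hBz := fun z => (integral_killProb_eq hτ l (p - q) z).trans hb.symm
  have hb0 : 0 ≤ b := by
    rw [hb]; exact integral_nonneg fun ω => killProb_nonneg hd.le (hw0 ω 0) (hw1 ω 0)
  have hind : ∀ y y', y ≠ y' → IndepFun (fun ω => killProb (p - q) (weight τ l ω y))
      (fun ω => killProb (p - q) (weight τ l ω y')) P := fun y y' hyy => by
    have hm : Measurable fun t : ℝ => killProb (p - q) (1 / (1 + l * t)) :=
      (measurable_killProb _).comp (by fun_prop)
    exact (hτ.indep.indepFun hyy).comp hm hm
  have hBB : ∀ y ∈ Y, ∀ y' ∈ Y.erase y, Integrable (fun ω =>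
      killProb (p - q) (weight τ l ω y) * killProb (p - q) (weight τ l ω y')) P :=
    fun y _ y' hy' => (hind y y' (Finset.ne_of_mem_erase hy').symm).integrable_mul (hB y) (hB y')
  set U : Ω → ℝ := fun ω => 1 - ∑ y ∈ Y, (1 - ratioPow p q y (c + m))
      * killProb (p - q) (weight τ l ω y)
    + ∑ y ∈ Y, ∑ y' ∈ Y.erase y,
      killProb (p - q) (weight τ l ω y) * killProb (p - q) (weight τ l ω y') with hU
  have hint1 : Integrable (fun ω => ∑ y ∈ Y, (1 - ratioPow p q y (c + m))
      * killProb (p - q) (weight τ l ω y)) P :=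
    integrable_finsetSum _ fun y _ => (hB y).const_mul _
  have hint2 : Integrable (fun ω => ∑ y ∈ Y, ∑ y' ∈ Y.erase y,
      killProb (p - q) (weight τ l ω y) * killProb (p - q) (weight τ l ω y')) P :=
    integrable_finsetSum _ fun y hy => integrable_finsetSum _ fun y' hy' => hBB y hy y' hy'
  have hint0 : Integrable (fun ω => 1 - ∑ y ∈ Y, (1 - ratioPow p q y (c + m))
      * killProb (p - q) (weight τ l ω y)) P := (integrable_const 1).sub hint1
  have hUi : Integrable U P := hint0.add hint2
  have hle : ∀ ω, hit p q (weightOn Y (weight τ l ω)) (c + m) n c ≤ U ω := by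
    intro ω
    refine (hit_weightOn_le h (hw0 ω) (hw1 ω) (fun y hy => (Finset.mem_Ico.1 hy).2)
      (fun y hy => (Finset.mem_Ico.1 hy).1) (by omega) n).trans ?_
    simp only [hU]
    gcongr with y hy
    have hlt : y < c + m := (Finset.mem_Ico.1 hy).2
    -- The position-dependent escape probability is replaced by `p - q`. The remaining killing
    -- probabilities are i.i.d. over the block, and the weights `1 - ratioPow` sum to at least `m -
    -- 1 / (p - q)`.
    exact mul_killProb_le hd (sub_pos.2 (ratioPow_lt_one h hlt))
      (by linarith [ratioPow_nonneg h y (c + m)]) (hw0 ω y) (hw1 ω y)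
  calc _ ≤ ∫ ω, U ω ∂P := by
        refine integral_mono_of_nonneg (ae_of_all _ fun ω => ?_) hUi (ae_of_all _ hle)
        exact hit_nonneg h (weightOn_nonneg Y (hw0 ω)) _ _
    _ = 1 - (∑ y ∈ Y, (1 - ratioPow p q y (c + m))) * b + ∑ y ∈ Y, ∑ _y' ∈ Y.erase y, b * b := by
        simp only [hU]
        rw [integral_add hint0 hint2, integral_sub (integrable_const 1)
          hint1, integral_finsetSum _ (fun y _ => (hB y).const_mul _),
          integral_finsetSum _ (fun y hy => integrable_finsetSum _ fun y' hy' => hBB y hy y' hy'),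
          Finset.sum_mul]
        congr 1
        · congr 1
          · simp
          · exact Finset.sum_congr rfl fun y _ => by rw [integral_const_mul, hBz]
        · refine Finset.sum_congr rfl fun y hy => ?_
          rw [integral_finsetSum _ (fun y' hy' => hBB y hy y' hy')]
          refine Finset.sum_congr rfl fun y' hy' => ?_
          have := (hind y y' (Finset.ne_of_mem_erase hy').symm).integral_fun_mul_eq_mul_integral
            (hB y).aestronglyMeasurable (hB y').aestronglyMeasurable
          rw [this, hBz, hBz]
    _ ≤ 1 - (m - 1 / (p - q)) * b + m ^ 2 * (b * b) := by
        have hcard : Y.card = m := by simp [hY]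
        have hs : (m : ℝ) - 1 / (p - q) ≤ ∑ y ∈ Y, (1 - ratioPow p q y (c + m)) := by
          rw [Finset.sum_sub_distrib, Finset.sum_const, hcard, nsmul_eq_mul, mul_one]
          linarith [sum_ratioPow_le h c m]
        have hs2 : ∑ y ∈ Y, ∑ _y' ∈ Y.erase y, b * b ≤ m ^ 2 * (b * b) := by
          calc _ ≤ ∑ y ∈ Y, ∑ _y' ∈ Y, b * b := by
                refine Finset.sum_le_sum fun y _ => ?_
                exact Finset.sum_le_sum_of_subset_of_nonneg (Finset.erase_subset _ _)
                  fun _ _ _ => mul_nonneg hb0 hb0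
            _ = m ^ 2 * (b * b) := by simp [hcard]; ring
        have := mul_le_mul_of_nonneg_right hs hb0
        linarith
    _ = _ := by ring

section reach

variable (h : IsDriftPair p q) (hτ : IsPosIIDEnv P τ) (hl : 0 ≤ l)
include h hτ hl

-- On its way to `z` the walk from `0` passes `y`, and until then only the weights below `y` matter.
-- The same bound allows a site to be replaced by the left end of its block.
omit [IsProbabilityMeasure P] in
lemma reach_anti {y z : ℤ} (hy : 0 ≤ y) (hyz : y ≤ z) (ω : Ω) :
    reach p q τ l z ω ≤ reach p q τ l y ω := by
  have hw0 : ∀ z, 0 ≤ weight τ l ω z := fun z => (hτ.weight_pos hl ω z).le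
  have hw1 : ∀ z, weight τ l ω z ≤ 1 := fun z => hτ.weight_le_one hl ω z
  rcases hyz.eq_or_lt with rfl | hlt
  · exact le_rfl
  refine iSup_mono fun n => ENNReal.ofReal_le_ofReal ?_
  refine (hit_le_hit_of_lt h (weightOn_nonneg _ hw0) (weightOn_le_one _ hw1) hlt hy).trans_eq ?_
  refine hit_congr (fun x hx => ?_) n hy
  simp only [weightOn, Finset.mem_Ico]
  congr 1
  simp only [eq_iff_iff]
  omega

omit [IsProbabilityMeasure P] in
lemma hit_le_reach (n : ℕ) (z : ℤ) (ω : Ω) :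
    ENNReal.ofReal (hit p q (weight τ l ω) z n 0) ≤ reach p q τ l z ω := by
  have hw0 : ∀ z, 0 ≤ weight τ l ω z := fun z => (hτ.weight_pos hl ω z).le
  refine le_trans (ENNReal.ofReal_le_ofReal ?_) (le_iSup (fun n => ENNReal.ofReal
    (hit p q (weightOn (Finset.Ico 0 z) (weight τ l ω)) z n 0)) n)
  refine hit_mono_weight h hw0 (fun x => ?_) n 0
  unfold weightOn
  split_ifs
  exacts [le_rfl, hτ.weight_le_one hl ω x]

omit [IsProbabilityMeasure P] in
lemma reach_neg_le (k : ℕ) (ω : Ω) :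
    reach p q τ l (-k : ℤ) ω ≤ ENNReal.ofReal ((q / p) ^ k) := by
  have hw0 : ∀ z, 0 ≤ weight τ l ω z := fun z => (hτ.weight_pos hl ω z).le
  have hw1 : ∀ z, weight τ l ω z ≤ 1 := fun z => hτ.weight_le_one hl ω z
  refine iSup_le fun n => ENNReal.ofReal_le_ofReal ?_
  refine (hit_le_ratioPow h (weightOn_nonneg _ hw0) (weightOn_le_one _ hw1) n 0).trans_eq ?_
  unfold ratioPow
  congr 1
  omega

/-- The passages of successive blocks of `m` sites are made independent: on entering a block, only
the killing inside this block is kept. The walk may fall back to earlier blocks, but these no longer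
kill, which only increases the probability. -/
lemma lintegral_reach_block_le {b : ℝ} (hb : b = ∫ ω, killProb (p - q) (weight τ l ω 0) ∂P)
    (m j : ℕ) : ∫⁻ ω, reach p q τ l (j * m : ℕ) ω ∂P
      ≤ ENNReal.ofReal (1 - b * (m - 1 / (p - q) - m ^ 2 * b)) ^ j := by
  have hw0 : ∀ ω z, 0 ≤ weight τ l ω z := fun ω z => (hτ.weight_pos hl ω z).le
  have hw1 : ∀ ω z, weight τ l ω z ≤ 1 := fun ω z => hτ.weight_le_one hl ω z
  set r := ENNReal.ofReal (1 - b * (m - 1 / (p - q) - m ^ 2 * b)) with hr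
  have hfin : ∀ n (j : ℕ), ∫⁻ ω, ENNReal.ofReal (hit p q (weightOn (Finset.Ico 0 ((j * m : ℕ) : ℤ))
      (weight τ l ω)) ((j * m : ℕ) : ℤ) n 0) ∂P ≤ r ^ j := by
    intro n j
    induction j with
    | zero =>
      refine (lintegral_mono (g := fun _ => 1) fun ω => ?_).trans (by simp)
      rw [← ENNReal.ofReal_one]
      exact ENNReal.ofReal_le_ofReal (hit_le_one h (weightOn_nonneg _ (hw0 ω))
        (weightOn_le_one _ (hw1 ω)) _ _)
    | succ j ih =>
      rcases Nat.eq_zero_or_pos m with rfl | hm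
      -- For `m = 0` the bracket in `r` is negative, so that `1 ≤ r` and the bound is trivial.
      · refine le_trans ?_ (pow_le_pow_left' (show (1 : ℝ≥0∞) ≤ r from ?_) (j + 1))
        · rw [one_pow]
          refine (lintegral_mono (g := fun _ => 1) fun ω => ?_).trans (by simp)
          rw [← ENNReal.ofReal_one]
          exact ENNReal.ofReal_le_ofReal (hit_le_one h (weightOn_nonneg _ (hw0 ω))
            (weightOn_le_one _ (hw1 ω)) _ _)
        · rw [hr, ← ENNReal.ofReal_one]
          refine ENNReal.ofReal_le_ofReal ?_
          have hb0 : 0 ≤ b := by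
            rw [hb]
            exact integral_nonneg fun ω => killProb_nonneg h.drift_pos.le (hw0 ω 0) (hw1 ω 0)
          have := div_nonneg zero_le_one h.drift_pos.le
          simp only [Nat.cast_zero]
          nlinarith [mul_nonneg hb0 this]
      set c : ℤ := ((j * m : ℕ) : ℤ) with hc
      have hc0 : 0 ≤ c := by positivity
      have hcm : (((j + 1) * m : ℕ) : ℤ) = c + m := by rw [hc]; push_cast; ring
      rw [hcm]
      have hstep : ∀ ω, ENNReal.ofReal (hit p q (weightOn (Finset.Ico 0 (c + m)) (weight τ l ω))
          (c + m) n 0) ≤ ENNReal.ofReal (hit p q (weightOn (Finset.Ico 0 c) (weight τ l ω)) c n 0)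
          * ENNReal.ofReal (hit p q (weightOn (Finset.Ico c (c + m)) (weight τ l ω)) (c + m) n c) := by
        intro ω
        rw [← ENNReal.ofReal_mul (hit_nonneg h (weightOn_nonneg _ (hw0 ω)) _ _)]
        refine ENNReal.ofReal_le_ofReal ?_
        refine (hit_le_mul (y := c) h (weightOn_nonneg _ (hw0 ω)) (by omega) hc0).trans ?_
        refine mul_le_mul (le_of_eq (hit_congr (fun x hx => ?_) n hc0)) ?_
          (hit_nonneg h (weightOn_nonneg _ (hw0 ω)) _ _)
          (hit_nonneg h (weightOn_nonneg _ (hw0 ω)) _ _)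
        · simp only [weightOn, Finset.mem_Ico]
          congr 1
          simp only [eq_iff_iff]
          omega
        · refine hit_mono_weight h (weightOn_nonneg _ (hw0 ω)) (fun x => ?_) n c
          simp only [weightOn, Finset.mem_Ico]
          split_ifs with h1 h2 h2
          · exact le_rfl
          · exact hw1 ω x
          · omega
          · exact le_rfl
      refine (lintegral_mono hstep).trans ?_
      have hdisj : Disjoint (Set.Iio c) (Set.Ici c) :=
        Set.disjoint_left.2 fun x (hx : x < c) (hx' : c ≤ x) => not_lt.2 hx' hx
      have e := hτ.lintegral_mul hdisj
        (f := fun ω => ENNReal.ofReal (hit p q (weightOn (Finset.Ico 0 c) (weight τ l ω)) c n 0))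
        (g := fun ω => ENNReal.ofReal
          (hit p q (weightOn (Finset.Ico c (c + m)) (weight τ l ω)) (c + m) n c))
        (ENNReal.measurable_ofReal.comp (measurable_hit_weightOn _
          (fun y hy => (Finset.mem_Ico.1 hy).2) l c n 0))
        (ENNReal.measurable_ofReal.comp (measurable_hit_weightOn _
          (fun y hy => (Finset.mem_Ico.1 hy).1) l (c + m) n c))
      rw [e, pow_succ]
      refine mul_le_mul' ih ?_
      rw [← ofReal_integral_eq_lintegral_ofReal]
      · exact ENNReal.ofReal_le_ofReal (integral_hit_block_le h hτ hl c m n hb)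
      · refine Integrable.of_bound (C := 1) ?_ (ae_of_all _ fun ω => ?_)
        · exact ((measurable_hit_weightOn (S := Set.univ) _ (fun _ _ => trivial) l _ n c).mono
            (hτ.envSigma_le _) le_rfl).aestronglyMeasurable
        · rw [Real.norm_eq_abs, abs_of_nonneg (hit_nonneg h (weightOn_nonneg _ (hw0 ω)) _ _)]
          exact hit_le_one h (weightOn_nonneg _ (hw0 ω)) (weightOn_le_one _ (hw1 ω)) _ _
      · exact ae_of_all _ fun ω => hit_nonneg h (weightOn_nonneg _ (hw0 ω)) _ _
  unfold reach
  rw [lintegral_iSup]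
  · exact iSup_le fun n => hfin n j
  · intro n
    exact (ENNReal.measurable_ofReal.comp (measurable_hit_weightOn (S := Set.univ) _
      (fun _ _ => trivial) l _ n 0)).mono (hτ.envSigma_le _) le_rfl
  · intro n k hnk ω
    exact ENNReal.ofReal_le_ofReal (hit_mono h (weightOn_nonneg _ (hw0 ω)) 0 hnk)

omit hτ hl [IsProbabilityMeasure P] in
lemma tsum_ratio_le : ∑' k : ℕ, ENNReal.ofReal ((q / p) ^ (k + 1)) ≤ ENNReal.ofReal (1 / (p - q)) := by
  have h0 := h.ratio_nonneg
  have h1 := h.ratio_lt_one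
  calc ∑' k : ℕ, ENNReal.ofReal ((q / p) ^ (k + 1)) ≤ ∑' k : ℕ, ENNReal.ofReal ((q / p) ^ k) :=
        ENNReal.tsum_le_tsum fun k => ENNReal.ofReal_le_ofReal
          (pow_le_pow_of_le_one h0 h1.le (by omega))
    _ = ENNReal.ofReal (∑' k : ℕ, (q / p) ^ k) :=
        (ENNReal.ofReal_tsum_of_nonneg (fun k => by positivity)
          (summable_geometric_of_lt_one h0 h1)).symm
    _ ≤ _ := by
        rw [tsum_geometric_of_lt_one h0 h1, ← one_div]
        exact ENNReal.ofReal_le_ofReal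
          (one_div_le_one_div_of_le h.drift_pos h.drift_le_one_sub_ratio)

/-- The mean number of sites that the killed walk reaches. -/
theorem tsum_lintegral_reach_le {b : ℝ} (hb : b = ∫ ω, killProb (p - q) (weight τ l ω 0) ∂P)
    {m : ℕ} (hm : 0 < m) {δ : ℝ} (hδ : δ = b * (m - 1 / (p - q) - m ^ 2 * b)) (hδ0 : 0 < δ)
    (hδ1 : δ ≤ 1) : ∑' z : ℤ, ∫⁻ ω, reach p q τ l z ω ∂P ≤ ENNReal.ofReal (1 / (p - q) + m / δ) := by
  have hneg : ∑' k : ℕ, ∫⁻ ω, reach p q τ l (-((k : ℤ) + 1)) ω ∂P ≤ ENNReal.ofReal (1 / (p - q)) := by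
    refine le_trans (ENNReal.tsum_le_tsum fun k => ?_) (tsum_ratio_le h)
    refine (lintegral_mono fun ω => ?_).trans_eq (by rw [lintegral_const, measure_univ, mul_one])
    exact_mod_cast reach_neg_le h hτ hl (k + 1) ω
  have hpos : ∑' k : ℕ, ∫⁻ ω, reach p q τ l (k : ℤ) ω ∂P ≤ ENNReal.ofReal (m / δ) := by
    have : NeZero m := ⟨hm.ne'⟩
    -- The sites are written as `j m + i` with `i < m`; each is compared with the start `j m` of its
    -- block, and the geometric series over `j` gives `m / δ`.
    rw [← (Nat.divModEquiv m).symm.tsum_eq, ENNReal.tsum_prod']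
    have hblock : ∀ (j : ℕ) (i : Fin m), ∫⁻ ω, reach p q τ l
        (((Nat.divModEquiv m).symm (j, i) : ℕ) : ℤ) ω ∂P ≤ ENNReal.ofReal (1 - δ) ^ j := by
      intro j i
      rw [hδ]
      refine le_trans (lintegral_mono fun ω => ?_) (lintegral_reach_block_le h hτ hl hb m j)
      refine reach_anti h hτ hl (by positivity) ?_ ω
      simp only [Nat.divModEquiv_symm_apply]
      push_cast
      nlinarith [i.2]
    calc _ ≤ ∑' j : ℕ, ∑' _i : Fin m, ENNReal.ofReal (1 - δ) ^ j :=
          ENNReal.tsum_le_tsum fun j => ENNReal.tsum_le_tsum fun i => hblock j i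
      _ = m * ∑' j : ℕ, ENNReal.ofReal (1 - δ) ^ j := by
          rw [← ENNReal.tsum_mul_left]
          simp [tsum_fintype]
      _ = m * (1 - ENNReal.ofReal (1 - δ))⁻¹ := by rw [ENNReal.tsum_geometric]
      _ = ENNReal.ofReal (m / δ) := by
          rw [← ENNReal.ofReal_one, ← ENNReal.ofReal_sub _ (by linarith), sub_sub_cancel,
            div_eq_mul_inv, ENNReal.ofReal_mul (by positivity), ENNReal.ofReal_natCast,
            ENNReal.ofReal_inv_of_pos hδ0]
  have hsplit : ∑' z : ℤ, ∫⁻ ω, reach p q τ l z ω ∂P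
      = ∑' k : ℕ, ∫⁻ ω, reach p q τ l (k : ℤ) ω ∂P
        + ∑' k : ℕ, ∫⁻ ω, reach p q τ l (-((k : ℤ) + 1)) ω ∂P :=
    tsum_of_nat_of_neg_add_one ENNReal.summable ENNReal.summable
  rw [hsplit, add_comm, ENNReal.ofReal_add (div_nonneg zero_le_one h.drift_pos.le) (by positivity)]
  exact add_le_add hneg hpos

end reach

end env

/-! ### Averaged occupation probabilities. -/

/-- The probability, in the environment `ω`, that the process started in `0` is in `y` at time
`s`. -/
def occAt {Ω : Type*} (p q : ℝ) (τ : ℤ → Ω → ℝ) (y : ℤ) (s : ℝ) (ω : Ω) : ℝ≥0∞ :=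
  ⨆ n, occ p q (fun z => τ z ω) Set.univ n y 0 s

/-- The averaged probability that the process is at time `s` in a trap whose depth is in `D`. -/
def meanOcc {Ω : Type*} [MeasurableSpace Ω] (P : Measure Ω) (p q : ℝ) (τ : ℤ → Ω → ℝ) (D : Set ℝ)
    (s : ℝ) : ℝ≥0∞ :=
  ∫⁻ ω, ∑' y, D.indicator 1 (τ y ω) * occAt p q τ y s ω ∂P

/-- The mean number of sites that the walk reaches before it is killed at rate `l`. -/
def meanReach {Ω : Type*} [MeasurableSpace Ω] (P : Measure Ω) (p q : ℝ) (τ : ℤ → Ω → ℝ)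
    (l : ℝ) : ℝ≥0∞ :=
  ∑' z, ∫⁻ ω, reach p q τ l z ω ∂P

/-- The mean of `1 ∧ a τ`. -/
def meanTrunc {Ω : Type*} [MeasurableSpace Ω] (P : Measure Ω) (τ : ℤ → Ω → ℝ) (a : ℝ) : ℝ≥0∞ :=
  ∫⁻ ω, min 1 (ENNReal.ofReal (a * τ 0 ω)) ∂P

section env

variable {Ω : Type*} [MeasurableSpace Ω] {P : Measure Ω} {τ : ℤ → Ω → ℝ} {p q l : ℝ}

lemma measurable_occAt_uncurry (hτ : IsPosIIDEnv P τ) (y : ℤ) :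
    Measurable fun a : Ω × ℝ => occAt p q τ y a.2 a.1 :=
  Measurable.iSup fun n => measurable_occ_env hτ.measurable Set.univ n y 0

lemma measurable_occAt (hτ : IsPosIIDEnv P τ) (y : ℤ) (s : ℝ) :
    Measurable (occAt p q τ y s) :=
  (measurable_occAt_uncurry hτ y).comp (f := fun ω => (ω, s)) (by fun_prop)

lemma measurable_reach' (hτ : IsPosIIDEnv P τ) (y : ℤ) : Measurable (reach p q τ l y) :=
  (measurable_reach (S := Set.univ) y fun _ _ _ => trivial).mono (hτ.envSigma_le _) le_rfl

lemma measurable_indicator_comp (hτ : IsPosIIDEnv P τ) {D : Set ℝ} (hD : MeasurableSet D) (y : ℤ) :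
    Measurable fun ω => D.indicator (1 : ℝ → ℝ≥0∞) (τ y ω) :=
  (measurable_one.indicator hD).comp (hτ.measurable y)

lemma measurable_indicator_mul_occAt (hτ : IsPosIIDEnv P τ) {D : Set ℝ} (hD : MeasurableSet D)
    (y : ℤ) (s : ℝ) :
    Measurable fun ω => D.indicator (1 : ℝ → ℝ≥0∞) (τ y ω) * occAt p q τ y s ω :=
  (measurable_indicator_comp hτ hD y).mul (measurable_occAt hτ y s)

variable (h : IsDriftPair p q) (hτ : IsPosIIDEnv P τ)
include h hτ

lemma occAt_le (hl : 0 ≤ l) (y : ℤ) (s : ℝ) (ω : Ω) :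
    occAt p q τ y s ω ≤ ENNReal.ofReal (Real.exp (l * s)) * reach p q τ l y ω := by
  refine iSup_le fun n => (occ_le_hit h (fun z => hτ.pos z ω) hl n y 0 s).trans ?_
  rw [ENNReal.ofReal_mul (Real.exp_pos _).le]
  gcongr
  exact hit_le_reach h hτ hl n y ω

lemma lintegral_exp_mul_occAt_le (hl : 0 < l) (y : ℤ) (ω : Ω) :
    ENNReal.ofReal l * ∫⁻ u, ENNReal.ofReal (Real.exp (-l * u)) * occAt p q τ y u ω
      ≤ reach p q τ l y ω * ENNReal.ofReal (killProb (p - q) (weight τ l ω y)) := by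
  have hw0 : ∀ z, 0 ≤ weight τ l ω z := fun z => (hτ.weight_pos hl.le ω z).le
  simp only [occAt, ENNReal.mul_iSup]
  rw [lintegral_iSup, ENNReal.mul_iSup]
  · refine iSup_le fun n => ?_
    refine (mul_lintegral_exp_mul_occ_le h hl (fun z => hτ.pos z ω) n y 0).trans ?_
    refine (ENNReal.ofReal_mul (hit_nonneg h hw0 n 0)).le.trans ?_
    exact mul_le_mul_left (hit_le_reach h hτ hl.le n y ω) _
  · intro n
    exact Measurable.mul (by fun_prop) (measurable_occ n y 0)
  · intro n k hnk u
    exact mul_le_mul_right (occ_mono y 0 u hnk) _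

/-- The decoupling on which everything rests: `reach` at `y` is a function of the traps to the left
of `y`, whereas the depth condition and the killing probability depend on `τ y` alone. The mean of
the product factorizes, and the second factor does not depend on `y`. -/
lemma lintegral_exp_mul_meanOcc_le [IsProbabilityMeasure P] (hl : 0 < l) {D : Set ℝ}
    (hD : MeasurableSet D) :
    ENNReal.ofReal l * ∫⁻ u, ENNReal.ofReal (Real.exp (-l * u)) * meanOcc P p q τ D u
      ≤ meanReach P p q τ l * ∫⁻ ω, D.indicator 1 (τ 0 ω)
        * ENNReal.ofReal (killProb (p - q) (weight τ l ω 0)) ∂P := by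
  have hm := fun y => measurable_occAt_uncurry (p := p) (q := q) hτ y
  have hi := fun y => measurable_indicator_comp hτ hD y
  have hm' : ∀ y, Measurable fun a : ℝ × Ω => occAt p q τ y a.1 a.2 := fun y =>
    (hm y).comp measurable_swap
  have hk : Measurable fun t : ℝ => D.indicator (1 : ℝ → ℝ≥0∞) t
      * ENNReal.ofReal (killProb (p - q) (1 / (1 + l * t))) := by
    refine (measurable_one.indicator hD).mul (ENNReal.measurable_ofReal.comp ?_)
    exact (measurable_killProb _).comp (by fun_prop)
  have e1 : ∀ u, ENNReal.ofReal (Real.exp (-l * u)) * meanOcc P p q τ D u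
      = ∑' y, ∫⁻ ω, ENNReal.ofReal (Real.exp (-l * u)) * (D.indicator 1 (τ y ω)
        * occAt p q τ y u ω) ∂P := by
    intro u
    unfold meanOcc
    rw [lintegral_tsum fun y => (measurable_indicator_mul_occAt hτ hD y u).aemeasurable,
      ← ENNReal.tsum_mul_left]
    refine tsum_congr fun y => ?_
    rw [lintegral_const_mul _ (measurable_indicator_mul_occAt hτ hD y u)]
  have hjoint : ∀ y, Measurable fun a : ℝ × Ω => ENNReal.ofReal (Real.exp (-l * a.1))
      * (D.indicator 1 (τ y a.2) * occAt p q τ y a.1 a.2) := fun y =>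
    Measurable.mul (by fun_prop) (((hi y).comp measurable_snd).mul (hm' y))
  simp only [e1]
  rw [lintegral_tsum fun y => ((hjoint y).lintegral_prod_right').aemeasurable,
    ← ENNReal.tsum_mul_left, meanReach, ← ENNReal.tsum_mul_right]
  refine ENNReal.tsum_le_tsum fun y => ?_
  rw [lintegral_lintegral_swap (hjoint y).aemeasurable]
  have hin : ∀ ω, Measurable fun u => ENNReal.ofReal (Real.exp (-l * u))
      * occAt p q τ y u ω := fun ω =>
    Measurable.mul (by fun_prop) ((hm' y).comp (f := fun u => (u, ω)) (by fun_prop))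
  have hin2 : Measurable fun ω => ∫⁻ u, ENNReal.ofReal (Real.exp (-l * u))
      * occAt p q τ y u ω :=
    Measurable.lintegral_prod_right' (f := fun a : Ω × ℝ => ENNReal.ofReal (Real.exp (-l * a.2))
      * occAt p q τ y a.2 a.1) (Measurable.mul (by fun_prop) (hm y))
  calc _ = ∫⁻ ω, D.indicator 1 (τ y ω) * (ENNReal.ofReal l * ∫⁻ u, ENNReal.ofReal (Real.exp (-l * u))
        * occAt p q τ y u ω) ∂P := by
        rw [← lintegral_const_mul _ ?_]
        · refine lintegral_congr fun ω => ?_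
          simp only [mul_left_comm _ (D.indicator 1 (τ y ω))]
          rw [lintegral_const_mul _ (hin ω), mul_left_comm]
        · exact Measurable.lintegral_prod_right' (f := fun a : Ω × ℝ =>
            ENNReal.ofReal (Real.exp (-l * a.2)) * (D.indicator 1 (τ y a.1)
              * occAt p q τ y a.2 a.1)) ((hjoint y).comp measurable_swap)
    _ ≤ ∫⁻ ω, reach p q τ l y ω * (D.indicator 1 (τ y ω)
        * ENNReal.ofReal (killProb (p - q) (weight τ l ω y))) ∂P := by
        refine lintegral_mono fun ω => ?_
        rw [mul_left_comm (reach p q τ l y ω)]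
        exact mul_le_mul_right (lintegral_exp_mul_occAt_le h hτ hl y ω) _
    _ = _ := by
        have hdisj : Disjoint (Set.Iio y) {y} := by simp
        have e := hτ.lintegral_mul hdisj (f := reach p q τ l y)
          (g := fun ω => D.indicator 1 (τ y ω)
            * ENNReal.ofReal (killProb (p - q) (weight τ l ω y)))
          (measurable_reach y fun _ _ hx => hx)
          (hk.comp (measurable_envSigma (Set.mem_singleton y)))
        rw [e]
        congr 1
        exact hτ.lintegral_comp hk y

omit hτ in
lemma tsum_occ_add_remain {t : ℤ → ℝ} (ht : ∀ x, 0 < t x) (n : ℕ) {s : ℝ} (hs : 0 ≤ s) :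
    ∑' y, occ p q t Set.univ n y 0 s + remain p q t Set.univ n 0 s = 1 := by
  have := mass_balance (A := Set.univ) h ht n 0 s
  have he : heaviside s = 1 := by simp [heaviside, hs]
  simpa [exitFrom, exitRate, he] using this.symm

lemma tsum_occAt_le_one {s : ℝ} (hs : 0 ≤ s) (ω : Ω) : ∑' y, occAt p q τ y s ω ≤ 1 := by
  rw [ENNReal.tsum_eq_iSup_sum]
  refine iSup_le fun F => ?_
  simp only [occAt]
  rw [ENNReal.finsetSum_iSup_of_monotone fun y => occ_mono y 0 s]
  refine iSup_le fun n => (ENNReal.sum_le_tsum F).trans ?_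
  rw [← tsum_occ_add_remain h (fun z => hτ.pos z ω) n hs]
  exact le_self_add

lemma meanOcc_le_one [IsProbabilityMeasure P] (D : Set ℝ) {s : ℝ} (hs : 0 ≤ s) :
    meanOcc P p q τ D s ≤ 1 := by
  unfold meanOcc
  refine (lintegral_mono (g := fun _ => 1) fun ω => ?_).trans (by simp)
  refine (ENNReal.tsum_le_tsum fun y => ?_).trans (tsum_occAt_le_one h hτ hs ω)
  refine (mul_le_mul_left (?_ : _ ≤ (1 : ℝ≥0∞)) _).trans_eq (one_mul _)
  exact Set.indicator_le_self' (fun _ _ => zero_le) _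

/-- The process does not explode. -/
theorem meanOcc_univ [IsProbabilityMeasure P] (hl : 0 ≤ l) (hA : meanReach P p q τ l ≠ ⊤)
    {s : ℝ} (hs : 0 ≤ s) : meanOcc P p q τ Set.univ s = 1 := by
  refine le_antisymm (meanOcc_le_one h hτ _ hs) ?_
  have hw0 : ∀ ω z, 0 ≤ weight τ l ω z := fun ω z => (hτ.weight_pos hl ω z).le
  have hw1 : ∀ ω z, weight τ l ω z ≤ 1 := fun ω z => hτ.weight_le_one hl ω z
  set c := ENNReal.ofReal (Real.exp (l * s)) with hc
  -- A killed walk alive after `n` steps has reached `M` or is still below `M`. First `n → ∞`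
  -- removes the second case; then `M → ∞` removes the first, because the terms of the finite sum
  -- `meanReach` tend to zero.
  have hstep : ∀ n M : ℕ, 1 ≤ meanOcc P p q τ Set.univ s
      + c * (∫⁻ ω, reach p q τ l (M : ℤ) ω ∂P + ENNReal.ofReal (stay p q M n 0)) := by
    intro n M
    calc (1 : ℝ≥0∞) = ∫⁻ _ω, 1 ∂P := by simp
      _ ≤ ∫⁻ ω, (∑' y, Set.univ.indicator 1 (τ y ω) * occAt p q τ y s ω
          + c * (reach p q τ l (M : ℤ) ω + ENNReal.ofReal (stay p q M n 0))) ∂P := by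
          refine lintegral_mono fun ω => ?_
          dsimp only
          rw [← tsum_occ_add_remain h (fun z => hτ.pos z ω) n hs]
          gcongr with y
          · simp only [Set.indicator_univ, Pi.one_apply, one_mul]
            exact le_iSup (fun n => occ p q (fun z => τ z ω) Set.univ n y 0 s) n
          · refine (remain_univ_le_survive h (fun z => hτ.pos z ω) hl n 0 s).trans ?_
            rw [ENNReal.ofReal_mul (Real.exp_pos _).le]
            gcongr
            refine (ENNReal.ofReal_le_ofReal (survive_le_hit_add_stay (z := M) h (hw0 ω) (hw1 ω) n
              (Int.natCast_nonneg M))).trans ?_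
            refine ENNReal.ofReal_add_le.trans ?_
            gcongr
            exact hit_le_reach h hτ hl n M ω
      _ = _ := by
          rw [lintegral_add_right _ (((measurable_reach' hτ _).add_const _).const_mul _),
            lintegral_const_mul _ ((measurable_reach' hτ _).add_const _),
            lintegral_add_left (measurable_reach' hτ _), meanOcc]
          simp
  have h1 : ∀ M : ℕ, 1 ≤ meanOcc P p q τ Set.univ s
      + c * ∫⁻ ω, reach p q τ l (M : ℤ) ω ∂P := by
    intro M
    have hst : Tendsto (fun n => ENNReal.ofReal (stay p q M n 0)) atTop (𝓝 0) := by
      simpa using ENNReal.tendsto_ofReal (tendsto_stay h (Int.natCast_nonneg M))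
    have hlim := (ENNReal.Tendsto.const_mul (hst.const_add (∫⁻ ω, reach p q τ l (M : ℤ) ω ∂P))
      (Or.inr ENNReal.ofReal_ne_top : _ ∨ c ≠ ⊤)).const_add (meanOcc P p q τ Set.univ s)
    rw [add_zero] at hlim
    exact ge_of_tendsto' hlim fun n => hstep n M
  have h2 : Tendsto (fun M : ℕ => ∫⁻ ω, reach p q τ l (M : ℤ) ω ∂P) atTop (𝓝 0) := by
    have := ENNReal.tendsto_cofinite_zero_of_tsum_ne_top hA
    have h3 := this.comp (Nat.cast_injective (R := ℤ)).tendsto_cofinite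
    rwa [Nat.cofinite_eq_atTop] at h3
  have hlim := (ENNReal.Tendsto.const_mul h2
    (Or.inr ENNReal.ofReal_ne_top : _ ∨ c ≠ ⊤)).const_add (meanOcc P p q τ Set.univ s)
  rw [mul_zero, add_zero] at hlim
  exact ge_of_tendsto' hlim h1

omit h in
lemma meanOcc_add_compl {D : Set ℝ} (hD : MeasurableSet D) (s : ℝ) :
    meanOcc P p q τ D s + meanOcc P p q τ Dᶜ s = meanOcc P p q τ Set.univ s := by
  unfold meanOcc
  rw [← lintegral_add_left (Measurable.tsum fun y => measurable_indicator_mul_occAt hτ hD y s)]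
  refine lintegral_congr fun ω => ?_
  rw [← ENNReal.tsum_add]
  refine tsum_congr fun y => ?_
  rw [← add_mul]
  congr 1
  by_cases hy : τ y ω ∈ D <;> simp [hy]

omit h in
lemma lintegral_indicator_mul_reach (D : Set ℝ) (hD : MeasurableSet D) (y : ℤ) :
    ∫⁻ ω, D.indicator 1 (τ y ω) * reach p q τ l y ω ∂P
      = P {ω | τ 0 ω ∈ D} * ∫⁻ ω, reach p q τ l y ω ∂P := by
  have hd1 : Disjoint ({y} : Set ℤ) (Set.Iio y) := by simp
  have hi : Measurable fun t : ℝ => D.indicator (1 : ℝ → ℝ≥0∞) t := measurable_one.indicator hD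
  have e1 := hτ.lintegral_mul hd1 (f := fun ω => D.indicator (1 : ℝ → ℝ≥0∞) (τ y ω))
    (g := reach p q τ l y) (hi.comp (measurable_envSigma (by simp)))
    (measurable_reach y fun _ _ hx => hx)
  rw [e1, hτ.lintegral_comp hi y]
  congr 1
  exact lintegral_indicator_one (hτ.measurable 0 hD)

omit h in
/-- The walk reaches `z` independently of the traps `y` and `y'` outside `[0, z)`. -/
lemma lintegral_indicator_mul_reach_mul (D : Set ℝ) (hD : MeasurableSet D) {y y' z : ℤ}
    (hyy : y ≠ y') (hy : y < 0 ∨ z ≤ y) (hy' : y' < 0 ∨ z ≤ y') (a : ℝ) :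
    ∫⁻ ω, D.indicator 1 (τ y ω) * reach p q τ l z ω * min 1 (ENNReal.ofReal (a * τ y' ω)) ∂P
      = P {ω | τ 0 ω ∈ D} * (∫⁻ ω, reach p q τ l z ω ∂P) * meanTrunc P τ a := by
  have hi : Measurable fun t : ℝ => D.indicator (1 : ℝ → ℝ≥0∞) t := measurable_one.indicator hD
  have hmin : Measurable fun t : ℝ => min 1 (ENNReal.ofReal (a * t)) := by fun_prop
  have hd1 : Disjoint ({y'}ᶜ : Set ℤ) {y'} := Set.disjoint_left.2 fun x hx hx' => hx hx'
  have hd2 : Disjoint ({y} : Set ℤ) (Set.Ico 0 z) := by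
    refine Set.disjoint_left.2 fun x (hx : x = y) hx' => ?_
    obtain ⟨h1, h2⟩ := Set.mem_Ico.1 hx'
    omega
  have e1 := hτ.lintegral_mul hd1
    (f := fun ω => D.indicator (1 : ℝ → ℝ≥0∞) (τ y ω) * reach p q τ l z ω)
    (g := fun ω => min 1 (ENNReal.ofReal (a * τ y' ω)))
    ((hi.comp (measurable_envSigma (by simpa using hyy))).mul
      (measurable_reach z fun x h0 h1 => by simp only [Set.mem_compl_iff, Set.mem_singleton_iff]; omega))
    (hmin.comp (measurable_envSigma (by simp)))
  have e2 := hτ.lintegral_mul hd2 (f := fun ω => D.indicator (1 : ℝ → ℝ≥0∞) (τ y ω))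
    (g := reach p q τ l z) (hi.comp (measurable_envSigma (by simp)))
    (measurable_reach z fun x h0 h1 => ⟨h0, h1⟩)
  rw [e1, e2, hτ.lintegral_comp hi y, hτ.lintegral_comp hmin y']
  congr 2
  exact lintegral_indicator_one (hτ.measurable 0 hD)

/-- The sum of the weights of the traps that can be reached from a given trap at short times. -/
def sideWeight (P : Measure Ω) (p q : ℝ) (τ : ℤ → Ω → ℝ) (ρ : ℝ) (M : ℕ) : ℝ≥0∞ :=
  ∑' j : ℤ, if j = 0 ∨ j < -M then 0 else meanTrunc P τ ((q / p) ^ j.toNat / ρ)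

/-- The process rarely leaves a deep trap for good during a short time. -/
theorem meanOcc_le_add (hl : 0 ≤ l) {D : Set ℝ} (hD : MeasurableSet D) {ρ : ℝ} (hρ : 0 < ρ)
    (hDρ : ∀ x ∈ D, ρ ≤ x) (M : ℕ) (s : ℝ) {r : ℝ} (hr : 0 ≤ r) :
    meanOcc P p q τ D s ≤ meanOcc P p q τ D (s + r)
      + ENNReal.ofReal (Real.exp (l * s)) * P {ω | τ 0 ω ∈ D} * (2 * meanReach P p q τ l
        * sideWeight P p q τ ρ M + meanReach P p q τ l
        * ENNReal.ofReal (r * (p - q) / (ρ * (1 - (q / p) ^ (M + 1))))) := by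
  set E := ENNReal.ofReal (Real.exp (l * s)) with hE
  set κ := ENNReal.ofReal (r * (p - q) / (ρ * (1 - (q / p) ^ (M + 1)))) with hκ
  have hϱ0 := h.ratio_nonneg
  have hϱ1 : (q / p) ^ (M + 1) < 1 := pow_lt_one₀ hϱ0 h.ratio_lt_one (by omega)
  set I : ℤ → Ω → ℝ≥0∞ := fun y ω => D.indicator 1 (τ y ω) with hI
  -- The weight of `y'` in the bound for staying in `y`, with `τ y` replaced by its lower bound `ρ`,
  -- so that it depends on `τ y'` only. It is cut off at one because for `α < 1` the depths have no
  -- mean.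
  set T : ℤ → ℤ → Ω → ℝ≥0∞ := fun y y' ω => if y' = y ∨ y + M < y' then 0 else
    min 1 (ENNReal.ofReal ((q / p) ^ (y - y').toNat / ρ * τ y' ω)) with hT
  have hpt : ∀ y ω, I y ω * occAt p q τ y s ω ≤ I y ω * occAt p q τ y (s + r) ω
      + (∑' y', E * (I y ω * reach p q τ l y ω * T y y' ω)
        + E * κ * (I y ω * reach p q τ l y ω)) := by
    intro y ω
    by_cases hy : τ y ω ∈ D
    swap
    · simp [hI, hy]
    have ht : ∀ x, 0 < τ x ω := fun x => hτ.pos x ω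
    have hρy := hDρ _ hy
    have hI1 : I y ω = 1 := by simp [hI, hy]
    simp only [hI1, one_mul]
    set v := ⨆ n, occ p q (fun z => τ z ω) Set.univ n y y r with hv
    have h1 : 1 ≤ v + (∑' y', T y y' ω + κ) := by
      have h0 := one_le_occ_add h ht y M hr
      rw [add_assoc] at h0
      -- If some weight reaches one, the inequality is trivial; if not, no weight has been cut off
      -- and the bound in the fixed environment applies.
      by_cases hbig : ∃ y', 1 ≤ T y y' ω
      · obtain ⟨y', hy'⟩ := hbig
        exact hy'.trans ((ENNReal.le_tsum y').trans (le_self_add.trans le_add_self))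
      push Not at hbig
      refine h0.trans ?_
      gcongr with y'
      · simp only [hT]
        split_ifs with hc
        · exact le_rfl
        · have hb := hbig y'
          simp only [hT, if_neg hc] at hb
          rw [min_lt_iff] at hb
          have hb' := hb.resolve_left (lt_irrefl _)
          rw [min_eq_right hb'.le]
          refine ENNReal.ofReal_le_ofReal ?_
          rw [div_mul_eq_mul_div, ← mul_div_assoc]
          have := ht y'
          gcongr
      · refine ENNReal.ofReal_le_ofReal ?_
        have h3 : 0 < 1 - (q / p) ^ (M + 1) := by linarith
        have h4 := h.drift_pos
        gcongr
    have h2 : occAt p q τ y s ω * v ≤ occAt p q τ y (s + r) ω := by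
      simp only [hv, occAt, ENNReal.iSup_mul, ENNReal.mul_iSup]
      refine iSup_le fun k => iSup_le fun n => (occ_mul_occ_le h ht n k y 0 s hr).trans ?_
      exact le_iSup (fun n => occ p q (fun z => τ z ω) Set.univ n y 0 (s + r)) (n + k)
    calc occAt p q τ y s ω = occAt p q τ y s ω * 1 := (mul_one _).symm
      _ ≤ occAt p q τ y s ω * (v + (∑' y', T y y' ω + κ)) := mul_le_mul_right h1 _
      _ ≤ occAt p q τ y (s + r) ω + E * reach p q τ l y ω * (∑' y', T y y' ω + κ) := by
          rw [mul_add]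
          gcongr
          exact occAt_le h hτ hl y s ω
      _ = _ := by
          rw [mul_add, ← ENNReal.tsum_mul_left]
          congr 2
          · exact tsum_congr fun y' => by rw [mul_assoc]
          · ring
  have hmI : ∀ y, Measurable (I y) := fun y => measurable_indicator_comp hτ hD y
  have hmR : ∀ y, Measurable (reach p q τ l y) := fun y => measurable_reach' hτ y
  have hmT : ∀ y y', Measurable (T y y') := fun y y' => by
    have := hτ.measurable y'
    simp only [hT]
    split_ifs
    · exact measurable_const
    · fun_prop
  have hmIR : ∀ y, Measurable fun ω => I y ω * reach p q τ l y ω := fun y => (hmI y).mul (hmR y)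
  have hmIRT : ∀ y y', Measurable fun ω => I y ω * reach p q τ l y ω * T y y' ω := fun y y' =>
    (hmIR y).mul (hmT y y')
  set W : ℤ → ℝ≥0∞ := fun j => if j = 0 ∨ j < -M then 0 else
    meanTrunc P τ ((q / p) ^ j.toNat / ρ) with hW
  set r1 : ℤ → ℝ≥0∞ := fun y => ∫⁻ ω, reach p q τ l y ω ∂P with hr1
  have hpair : ∀ y y', ∫⁻ ω, I y ω * reach p q τ l y ω * T y y' ω ∂P
      ≤ P {ω | τ 0 ω ∈ D} * (r1 y + r1 y') * W (y - y') := by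
    intro y y'
    by_cases hc : y' = y ∨ y + M < y'
    · simp [hT, hc]
    have hTe : ∀ ω, T y y' ω = min 1 (ENNReal.ofReal ((q / p) ^ (y - y').toNat / ρ * τ y' ω)) :=
      fun ω => by simp only [hT, if_neg hc]
    have hWe : W (y - y') = meanTrunc P τ ((q / p) ^ (y - y').toNat / ρ) := by
      simp only [hW]
      rw [if_neg]
      omega
    simp only [hTe, hWe]
    have hne : y ≠ y' := fun e => hc (Or.inl e.symm)
    -- Reaching `y` depends on `τ y'` exactly when `y'` lies in `[0, y)`. In this case reaching `y`
    -- is weakened to reaching `y'`, which restores independence; hence the sum `r1 y + r1 y'` and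
    -- the factor 2 in the result.
    by_cases hin : 0 ≤ y' ∧ y' < y
    · calc _ ≤ ∫⁻ ω, I y ω * reach p q τ l y' ω
            * min 1 (ENNReal.ofReal ((q / p) ^ (y - y').toNat / ρ * τ y' ω)) ∂P := by
            refine lintegral_mono fun ω => ?_
            dsimp only
            gcongr
            exact reach_anti h hτ hl hin.1 hin.2.le ω
        _ = _ := lintegral_indicator_mul_reach_mul hτ D hD hne (by omega) (by omega) _
        _ ≤ _ := by gcongr; exact le_add_self
    · rw [lintegral_indicator_mul_reach_mul hτ D hD hne (by omega) (by omega) _]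
      gcongr
      exact le_self_add
  calc meanOcc P p q τ D s ≤ ∫⁻ ω, ∑' y, (I y ω * occAt p q τ y (s + r) ω
      + (∑' y', E * (I y ω * reach p q τ l y ω * T y y' ω)
        + E * κ * (I y ω * reach p q τ l y ω))) ∂P :=
        lintegral_mono fun ω => ENNReal.tsum_le_tsum fun y => hpt y ω
    _ = meanOcc P p q τ D (s + r) + ∑' y, (E * ∑' y', ∫⁻ ω, I y ω * reach p q τ l y ω * T y y' ω ∂P
        + E * κ * ∫⁻ ω, I y ω * reach p q τ l y ω ∂P) := by
        simp only [ENNReal.tsum_add (f := fun y => I y _ * occAt p q τ y (s + r) _)]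
        rw [lintegral_add_left (Measurable.tsum fun y =>
          measurable_indicator_mul_occAt hτ hD y (s + r)), meanOcc]
        congr 1
        rw [lintegral_tsum]
        · refine tsum_congr fun y => ?_
          rw [lintegral_add_right _ ((hmIR y).const_mul _), lintegral_const_mul _ (hmIR y),
            lintegral_tsum fun y' => ((hmIRT y y').const_mul _).aemeasurable,
            ← ENNReal.tsum_mul_left]
          congr 1
          exact tsum_congr fun y' => by rw [lintegral_const_mul _ (hmIRT y y')]
        · intro y
          exact ((Measurable.tsum fun y' => (hmIRT y y').const_mul _).add
            ((hmIR y).const_mul _)).aemeasurable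
    _ ≤ meanOcc P p q τ D (s + r) + ∑' y, (E * ∑' y', P {ω | τ 0 ω ∈ D} * (r1 y + r1 y') * W (y - y')
        + E * κ * (P {ω | τ 0 ω ∈ D} * r1 y)) := by
        gcongr with y y'
        · exact hpair y y'
        · exact (lintegral_indicator_mul_reach hτ D hD y).le
    _ = _ := by
        have e1 : ∀ y, ∑' y', r1 y * W (y - y') = r1 y * ∑' j, W j := fun y => by
          rw [ENNReal.tsum_mul_left, ← (Equiv.subLeft y).tsum_eq W]
          rfl
        have e2 : ∑' y, ∑' y', r1 y' * W (y - y') = (∑' y, r1 y) * ∑' j, W j := by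
          rw [ENNReal.tsum_comm, ← ENNReal.tsum_mul_right]
          refine tsum_congr fun y' => ?_
          rw [ENNReal.tsum_mul_left, ← (Equiv.subRight y').tsum_eq W]
          rfl
        have e3 : ∑' y, ∑' y', P {ω | τ 0 ω ∈ D} * (r1 y + r1 y') * W (y - y')
            = P {ω | τ 0 ω ∈ D} * (2 * (∑' y, r1 y) * ∑' j, W j) := by
          simp only [mul_assoc, ENNReal.tsum_mul_left]
          congr 1
          simp only [add_mul, ENNReal.tsum_add]
          rw [e2]
          simp only [e1]
          rw [ENNReal.tsum_mul_right, two_mul]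
        rw [ENNReal.tsum_add, ENNReal.tsum_mul_left, ENNReal.tsum_mul_left, ENNReal.tsum_mul_left,
          e3]
        simp only [meanReach, sideWeight, ← hr1, ← hW]
        ring

end env

/-! ### Independence of the past and the next step. -/

section fourfold

variable {Ω α β γ δ : Type*} [MeasurableSpace Ω] [MeasurableSpace α] [MeasurableSpace β]
  [MeasurableSpace γ] [MeasurableSpace δ] {P : Measure Ω} [IsProbabilityMeasure P]

lemma lintegral_comp_prodMk {a : Ω → α} {b : Ω → β} (ha : Measurable a) (hb : Measurable b)
    (hab : IndepFun a b P) {F : α × β → ℝ≥0∞} (hF : Measurable F) :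
    ∫⁻ ω, F (a ω, b ω) ∂P = ∫⁻ ω, ∫⁻ ω', F (a ω, b ω') ∂P ∂P := by
  have e := (indepFun_iff_map_prod_eq_prod_map_map ha.aemeasurable hb.aemeasurable).1 hab
  have := Measure.isProbabilityMeasure_map (μ := P) hb.aemeasurable
  have h1 : ∫⁻ ω, F (a ω, b ω) ∂P = ∫⁻ x, F x ∂(P.map fun ω => (a ω, b ω)) :=
    (lintegral_map hF (ha.prodMk hb)).symm
  rw [h1, e, lintegral_prod _ hF.aemeasurable, lintegral_map hF.lintegral_prod_right' ha]
  refine lintegral_congr fun ω => ?_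
  exact lintegral_map (hF.comp measurable_prodMk_left) hb

/-- In the application `a` and `c` are the past jumps and the past holding variables, `b` and `d`
the next ones. Independence within each sequence and between the two sequences allows `b` and `d` to
be integrated out separately, given the joint past. -/
lemma lintegral_comp_fourfold {a : Ω → α} {b : Ω → β} {c : Ω → γ} {d : Ω → δ} (ha : Measurable a)
    (hb : Measurable b) (hc : Measurable c) (hd : Measurable d) (hab : IndepFun a b P)
    (hcd : IndepFun c d P) (h : IndepFun (fun ω => (a ω, b ω)) (fun ω => (c ω, d ω)) P)
    {F : (α × γ) × (β × δ) → ℝ≥0∞} (hF : Measurable F) :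
    ∫⁻ ω, F ((a ω, c ω), (b ω, d ω)) ∂P
      = ∫⁻ ω, ∫⁻ ω', ∫⁻ ω'', F ((a ω, c ω), (b ω', d ω'')) ∂P ∂P ∂P := by
  have hac : IndepFun a c P := h.comp measurable_fst measurable_fst
  have e1 := lintegral_comp_prodMk (ha.prodMk hb) (hc.prodMk hd) h
    (F := fun x => F ((x.1.1, x.2.1), (x.1.2, x.2.2))) (by fun_prop)
  have e2 := lintegral_comp_prodMk ha hb hab
    (F := fun x => ∫⁻ ω', F ((x.1, c ω'), (x.2, d ω')) ∂P)
    (Measurable.lintegral_prod_right' (f := fun y : (α × β) × Ω =>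
      F ((y.1.1, c y.2), (y.1.2, d y.2))) (by fun_prop))
  have e3 : ∀ x y, ∫⁻ ω, F ((x, c ω), (y, d ω)) ∂P
      = ∫⁻ ω, ∫⁻ ω', F ((x, c ω), (y, d ω')) ∂P ∂P := fun x y =>
    lintegral_comp_prodMk hc hd hcd (F := fun z => F ((x, z.1), (y, z.2))) (by fun_prop)
  have hm4 : Measurable fun z : ((Ω × Ω) × Ω) × Ω =>
      F ((a z.1.1.1, c z.1.1.2), (b z.1.2, d z.2)) := by fun_prop
  have hm3 := hm4.lintegral_prod_right' (ν := P)
  have hm2 := hm3.lintegral_prod_right' (ν := P)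
  have e4 := lintegral_comp_prodMk ha hc hac
    (F := fun x => ∫⁻ ω', ∫⁻ ω'', F ((x.1, x.2), (b ω', d ω'')) ∂P ∂P)
    (Measurable.lintegral_prod_right' (f := fun y : (α × γ) × Ω => ∫⁻ ω'',
      F ((y.1.1, y.1.2), (b y.2, d ω'')) ∂P) (Measurable.lintegral_prod_right'
        (f := fun y : ((α × γ) × Ω) × Ω => F ((y.1.1.1, y.1.1.2), (b y.1.2, d y.2)))
        (by fun_prop)))
  refine e1.trans ?_
  simp only
  rw [e2, e4]
  refine lintegral_congr fun ω => ?_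
  simp only [e3]
  rw [lintegral_lintegral_swap]
  refine Measurable.aemeasurable (Measurable.lintegral_prod_right'
    (f := fun y : (Ω × Ω) × Ω => F ((a ω, c y.1.2), (b y.1.1, d y.2))) (by fun_prop))

end fourfold

lemma lintegral_expMeasure {f : ℝ → ℝ≥0∞} (hf : Measurable f) :
    ∫⁻ x, f x ∂(expMeasure 1) = ∫⁻ x, surv 1 x * f x := by
  have hm : Measurable (gammaPDF 1 1) :=
    ENNReal.measurable_ofReal.comp (measurable_gammaPDFReal 1 1)
  rw [expMeasure, gammaMeasure, lintegral_withDensity_eq_lintegral_mul _ hm hf]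
  refine lintegral_congr fun x => ?_
  have := exponentialPDF_eq 1 x
  rw [exponentialPDF, exponentialPDFReal, ← gammaPDF] at this
  rw [Pi.mul_apply, this, surv]
  split_ifs <;> simp

lemma expMeasure_Ioi {x : ℝ} (hx : 0 ≤ x) : expMeasure 1 (Set.Ioi x) = surv 1 x := by
  have := isProbabilityMeasure_expMeasure one_pos
  have h1 := cdf_expMeasure_eq one_pos x
  rw [if_pos hx, cdf_eq_real] at h1
  have h2 : (expMeasure 1).real (Set.Ioi x) = Real.exp (-x) := by
    rw [← Set.compl_Iic, measureReal_compl measurableSet_Iic, h1]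
    simp
  rw [surv, if_pos hx, div_one, ← h2, ofReal_measureReal]

lemma expMeasure_Iic_zero : expMeasure 1 (Set.Iic 0) = 0 := by
  have := isProbabilityMeasure_expMeasure one_pos
  have h1 := cdf_expMeasure_eq one_pos 0
  rw [if_pos le_rfl, cdf_eq_real] at h1
  simpa [measureReal_eq_zero_iff] using h1

/-! ### From the jump chain and the holding times to occupation probabilities. -/

/-- The jump chain and the standardized holding times of a trap model. -/
structure IsJumpData {Ω : Type*} [MeasurableSpace Ω] (P : Measure Ω) (p q : ℝ) (ε : ℕ → Ω → ℤ)
    (η : ℕ → Ω → ℝ) : Prop where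
  measurable_jump : ∀ n, Measurable (ε n)
  measurable_hold : ∀ n, Measurable (η n)
  indep_jump : iIndepFun ε P
  jump_right : ∀ n, P {ω | ε n ω = 1} = ENNReal.ofReal p
  jump_left : ∀ n, P {ω | ε n ω = -1} = ENNReal.ofReal q
  indep_hold : iIndepFun η P
  law_hold : ∀ n, HasLaw (η n) (expMeasure 1) P
  indep : IndepFun (fun ω n => ε n ω) (fun ω n => η n ω) P

section jump

variable {Ω : Type*} [MeasurableSpace Ω] {P : Measure Ω} [IsProbabilityMeasure P] {p q : ℝ}
  {ε : ℕ → Ω → ℤ} {η : ℕ → Ω → ℝ} {t : ℤ → ℝ}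

lemma walk_succ (e : ℕ → ℤ) (n : ℕ) : walk e (n + 1) = walk e n + e n := Finset.sum_range_succ ..

lemma jumpTime_succ (t : ℤ → ℝ) (e : ℕ → ℤ) (i : ℕ → ℝ) (n : ℕ) :
    jumpTime t e i (n + 1) = jumpTime t e i n + t (walk e n) * i n := Finset.sum_range_succ ..

lemma walk_congr {e e' : ℕ → ℤ} {n : ℕ} (h : ∀ k < n, e k = e' k) : walk e n = walk e' n :=
  Finset.sum_congr rfl fun k hk => h k (Finset.mem_range.1 hk)

lemma jumpTime_congr (t : ℤ → ℝ) {e e' : ℕ → ℤ} {i i' : ℕ → ℝ} {n : ℕ} (h : ∀ k < n, e k = e' k)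
    (h' : ∀ k < n, i k = i' k) : jumpTime t e i n = jumpTime t e' i' n := by
  refine Finset.sum_congr rfl fun k hk => ?_
  have hk := Finset.mem_range.1 hk
  rw [walk_congr fun j hj => h j (hj.trans hk), h' k hk]

lemma measurable_walk (n : ℕ) : Measurable fun e : ℕ → ℤ => walk e n := by
  unfold walk
  fun_prop

lemma measurable_eval_int : Measurable fun a : (ℤ → ℝ) × ℤ => a.1 a.2 :=
  measurable_from_prod_countable_left fun z => measurable_pi_apply z

lemma measurable_jumpTime (n : ℕ) :
    Measurable fun a : (ℤ → ℝ) × (ℕ → ℤ) × (ℕ → ℝ) => jumpTime a.1 a.2.1 a.2.2 n := by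
  unfold jumpTime
  refine Finset.measurable_sum _ fun k _ => Measurable.mul ?_ (by fun_prop)
  exact measurable_eval_int.comp (f := fun a : (ℤ → ℝ) × (ℕ → ℤ) × (ℕ → ℝ) =>
    (a.1, walk a.2.1 k)) (measurable_fst.prodMk ((measurable_walk k).comp (by fun_prop)))

/-- The extension of a finite sequence by a constant. -/
def extendSeq {α : Type*} (c : α) (n : ℕ) (e : Finset.range n → α) (k : ℕ) : α :=
  if hk : k ∈ Finset.range n then e ⟨k, hk⟩ else c

lemma measurable_extendSeq {α : Type*} [MeasurableSpace α] (c : α) (n : ℕ) :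
    Measurable (extendSeq c n) := by
  refine measurable_pi_lambda _ fun k => ?_
  unfold extendSeq
  split_ifs
  · fun_prop
  · exact measurable_const

omit [IsProbabilityMeasure P] in
lemma IsJumpData.measurable_walk (hj : IsJumpData P p q ε η) (n : ℕ) :
    Measurable fun ω => walk (fun k => ε k ω) n :=
  (TrapModel.measurable_walk n).comp (measurable_pi_lambda _ hj.measurable_jump)

omit [IsProbabilityMeasure P] in
lemma IsJumpData.measurable_jumpTime (hj : IsJumpData P p q ε η) (t : ℤ → ℝ) (n : ℕ) :
    Measurable fun ω => jumpTime t (fun k => ε k ω) (fun k => η k ω) n :=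
  (TrapModel.measurable_jumpTime n).comp (f := fun ω => (t, (fun k => ε k ω), (fun k => η k ω)))
    (measurable_const.prodMk ((measurable_pi_lambda _ hj.measurable_jump).prodMk
      (measurable_pi_lambda _ hj.measurable_hold)))

omit [IsProbabilityMeasure P] in
lemma indepFun_past {α : Type*} [MeasurableSpace α] {f : ℕ → Ω → α} (hf : iIndepFun f P)
    (hm : ∀ n, Measurable (f n)) (n : ℕ) :
    IndepFun (fun ω (k : Finset.range n) => f k ω) (f n) P :=
  (hf.indepFun_finset (Finset.range n) {n} (by simp) hm).comp measurable_id
    (measurable_pi_apply (⟨n, by simp⟩ : ({n} : Finset ℕ)))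

/-- The next step is independent of the past. -/
lemma IsJumpData.lintegral_step (hj : IsJumpData P p q ε η) (t : ℤ → ℝ) (n : ℕ)
    {F : (ℤ × ℝ) × ℤ × ℝ → ℝ≥0∞} (hF : Measurable F) :
    ∫⁻ ω, F ((walk (fun k => ε k ω) n, jumpTime t (fun k => ε k ω) (fun k => η k ω) n),
        (ε n ω, η n ω)) ∂P
      = ∫⁻ ω, ∫⁻ ω', ∫⁻ ω'', F ((walk (fun k => ε k ω) n,
          jumpTime t (fun k => ε k ω) (fun k => η k ω) n), (ε n ω', η n ω'')) ∂P ∂P ∂P := by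
  -- Position and time of the `n`-th jump depend on the first `n` entries only; extending these by a
  -- constant presents them as functions of a finite past.
  have hG : Measurable fun x : ((Finset.range n → ℤ) × (Finset.range n → ℝ)) × (ℤ × ℝ) =>
      F ((walk (extendSeq 0 n x.1.1) n, jumpTime t (extendSeq 0 n x.1.1)
        (extendSeq 0 n x.1.2) n), x.2) := by
    have h1 := measurable_extendSeq (0 : ℤ) n
    have h2 := measurable_extendSeq (0 : ℝ) n
    refine hF.comp (Measurable.prodMk (Measurable.prodMk ?_ ?_) measurable_snd)
    · exact (TrapModel.measurable_walk n).comp (by fun_prop)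
    · exact (TrapModel.measurable_jumpTime n).comp (f := fun x : ((Finset.range n → ℤ)
        × (Finset.range n → ℝ)) × (ℤ × ℝ) => (t, extendSeq 0 n x.1.1, extendSeq 0 n x.1.2))
        (by fun_prop)
  have key := lintegral_comp_fourfold (P := P) (a := fun ω (k : Finset.range n) => ε k ω)
    (b := ε n) (c := fun ω (k : Finset.range n) => η k ω) (d := η n)
    (measurable_pi_lambda _ fun k => hj.measurable_jump k) (hj.measurable_jump n)
    (measurable_pi_lambda _ fun k => hj.measurable_hold k) (hj.measurable_hold n)
    (indepFun_past hj.indep_jump hj.measurable_jump n)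
    (indepFun_past hj.indep_hold hj.measurable_hold n)
    (hj.indep.comp (φ := fun e : ℕ → ℤ => ((fun k : Finset.range n => e k), e n))
      (ψ := fun e : ℕ → ℝ => ((fun k : Finset.range n => e k), e n)) (by fun_prop) (by fun_prop))
    hG
  have e1 : ∀ ω, walk (extendSeq 0 n fun k => ε k ω) n = walk (fun k => ε k ω) n := fun ω =>
    walk_congr fun k hk => by simp [extendSeq, hk]
  have e2 : ∀ ω, jumpTime t (extendSeq 0 n fun k => ε k ω) (extendSeq 0 n fun k => η k ω) n
      = jumpTime t (fun k => ε k ω) (fun k => η k ω) n := fun ω =>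
    jumpTime_congr t (fun k hk => by simp [extendSeq, hk]) (fun k hk => by simp [extendSeq, hk])
  simpa only [e1, e2] using key

lemma IsJumpData.ae_jump (h : IsDriftPair p q) (hj : IsJumpData P p q ε η) (n : ℕ) :
    ∀ᵐ ω ∂P, ε n ω = 1 ∨ ε n ω = -1 := by
  have hm1 : MeasurableSet {ω | ε n ω = 1} := hj.measurable_jump n (measurableSet_singleton 1)
  have hm2 : MeasurableSet {ω | ε n ω = -1} := hj.measurable_jump n (measurableSet_singleton _)
  have hd : Disjoint {ω | ε n ω = 1} {ω | ε n ω = -1} :=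
    Set.disjoint_left.2 fun ω (h1 : _ = _) (h2 : _ = _) => by rw [h1] at h2; omega
  have e : P ({ω | ε n ω = 1} ∪ {ω | ε n ω = -1}) = 1 := by
    rw [measure_union hd hm2, hj.jump_right, hj.jump_left,
      ← ENNReal.ofReal_add h.p_pos.le h.q_nonneg, h.add_eq, ENNReal.ofReal_one]
  exact (prob_compl_eq_zero_iff (hm1.union hm2)).2 e

lemma IsJumpData.lintegral_jump (h : IsDriftPair p q) (hj : IsJumpData P p q ε η) (n : ℕ)
    (f : ℤ → ℝ≥0∞) :
    ∫⁻ ω, f (ε n ω) ∂P = ENNReal.ofReal p * f 1 + ENNReal.ofReal q * f (-1) := by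
  have hm1 : MeasurableSet {ω | ε n ω = 1} := hj.measurable_jump n (measurableSet_singleton 1)
  have hm2 : MeasurableSet {ω | ε n ω = -1} := hj.measurable_jump n (measurableSet_singleton _)
  calc ∫⁻ ω, f (ε n ω) ∂P = ∫⁻ ω, ({ω | ε n ω = 1}.indicator (fun _ => f 1) ω
        + {ω | ε n ω = -1}.indicator (fun _ => f (-1)) ω) ∂P := by
        refine lintegral_congr_ae ?_
        filter_upwards [hj.ae_jump h n] with ω hω
        rcases hω with hω | hω <;> simp [Set.indicator, hω]
    _ = _ := by
        rw [lintegral_add_left (measurable_const.indicator hm1), lintegral_indicator_const hm1,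
          lintegral_indicator_const hm2, hj.jump_right, hj.jump_left, mul_comm, mul_comm (f (-1))]

omit [IsProbabilityMeasure P] in
lemma IsJumpData.lintegral_hold (hj : IsJumpData P p q ε η) (n : ℕ) {f : ℝ → ℝ≥0∞}
    (hf : Measurable f) : ∫⁻ ω, f (η n ω) ∂P = ∫⁻ x, surv 1 x * f x := by
  rw [← lintegral_expMeasure hf, ← (hj.law_hold n).map_eq, lintegral_map hf (hj.measurable_hold n)]

lemma lintegral_surv_one_mul {a : ℝ} (ha : 0 < a) {g : ℝ → ℝ≥0∞} (hg : Measurable g) (u : ℝ) :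
    ∫⁻ x, surv 1 x * g (u - a * x) = ENNReal.ofReal (1 / a) * convol (surv a) g u := by
  have h1 : ∀ x, surv 1 x = surv a (a * x) := fun x => by
    unfold surv
    have : 0 ≤ a * x ↔ 0 ≤ x := by rw [mul_nonneg_iff_of_pos_left ha]
    simp only [this]
    congr 3
    field_simp
  simp only [h1, convol]
  have hm : Measurable fun y => surv a y * g (u - y) :=
    (measurable_surv a).mul (hg.comp (by fun_prop))
  have := lintegral_map (μ := volume) hm (measurable_const_mul a)
  rw [← this, Real.map_volume_mul_left ha.ne', lintegral_smul_measure, abs_of_pos (inv_pos.2 ha),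
    one_div, smul_eq_mul]

lemma measurable_uncurry_int {ψ : ℤ → ℝ → ℝ≥0∞} (hψ : ∀ x, Measurable (ψ x)) :
    Measurable fun a : ℤ × ℝ => ψ a.1 a.2 :=
  measurable_from_prod_countable_right hψ

/-- The walk and its jump times are described by the iterates of the transition operator. -/
lemma IsJumpData.lintegral_path (h : IsDriftPair p q) (hj : IsJumpData P p q ε η)
    (ht : ∀ x, 0 < t x) (n : ℕ) {ψ : ℤ → ℝ → ℝ≥0∞} (hψ : ∀ x, Measurable (ψ x)) (u : ℝ) :
    ∫⁻ ω, ψ (walk (fun k => ε k ω) n) (u - jumpTime t (fun k => ε k ω) (fun k => η k ω) n) ∂P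
      = (stepTime p q t Set.univ)^[n] ψ 0 u := by
  induction n generalizing ψ with
  | zero => simp [walk, jumpTime]
  | succ n ih =>
    rw [Function.iterate_succ_apply, ← ih (measurable_stepTime hψ)]
    have hψ' := measurable_uncurry_int hψ
    have hF : Measurable fun x : (ℤ × ℝ) × ℤ × ℝ =>
        ψ (x.1.1 + x.2.1) (u - (x.1.2 + t x.1.1 * x.2.2)) := by
      have ht' : Measurable t := measurable_of_countable t
      exact hψ'.comp (f := fun x : (ℤ × ℝ) × ℤ × ℝ =>
        (x.1.1 + x.2.1, u - (x.1.2 + t x.1.1 * x.2.2))) (by fun_prop)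
    have key := hj.lintegral_step t n hF
    simp only [walk_succ, jumpTime_succ]
    refine key.trans (lintegral_congr fun ω => ?_)
    generalize walk (fun k => ε k ω) n = x
    generalize jumpTime t (fun k => ε k ω) (fun k => η k ω) n = T
    have h1 : ∀ e : ℤ, ∫⁻ ω'', ψ (x + e) (u - (T + t x * η n ω'')) ∂P
        = ENNReal.ofReal (1 / t x) * convol (surv (t x)) (ψ (x + e)) (u - T) := fun e => by
      rw [hj.lintegral_hold n (f := fun r => ψ (x + e) (u - (T + t x * r)))
        ((hψ _).comp (by fun_prop)), ← lintegral_surv_one_mul (ht x) (hψ (x + e))]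
      simp only [sub_sub]
    simp only [h1]
    rw [hj.lintegral_jump h n (fun e => ENNReal.ofReal (1 / t x)
      * convol (surv (t x)) (ψ (x + e)) (u - T)), stepTime_univ,
      convol_add_right (g := fun u => ENNReal.ofReal p * ψ (x + 1) u)
        (k := fun u => ENNReal.ofReal q * ψ (x - 1) u) (measurable_surv _)
        ((hψ _).const_mul _),
      convol_const_mul_right (measurable_surv _) (hψ _),
      convol_const_mul_right (measurable_surv _) (hψ _), ← sub_eq_add_neg]
    ring

omit [IsProbabilityMeasure P] in
lemma IsJumpData.ae_hold_pos (hj : IsJumpData P p q ε η) (n : ℕ) : ∀ᵐ ω ∂P, 0 < η n ω := by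
  have := (hj.law_hold n).map_eq
  have h0 := expMeasure_Iic_zero
  rw [← this, Measure.map_apply (hj.measurable_hold n) measurableSet_Iic] at h0
  rw [ae_iff]
  simp only [not_lt]
  exact h0

/-- The probability to be in `z` after `n` jumps at time `s`, and to stay there for a time `a`. -/
lemma IsJumpData.measure_stay (h : IsDriftPair p q) (hj : IsJumpData P p q ε η)
    (ht : ∀ x, 0 < t x) (n : ℕ) (z : ℤ) (s : ℝ) {a : ℝ} (ha : 0 ≤ a) :
    P {ω | walk (fun k => ε k ω) n = z
        ∧ jumpTime t (fun k => ε k ω) (fun k => η k ω) n ≤ s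
        ∧ s + a < jumpTime t (fun k => ε k ω) (fun k => η k ω) (n + 1)}
      = ENNReal.ofReal (Real.exp (-a / t z)) * (stepTime p q t Set.univ)^[n] (waitAt t z) 0 s := by
  rw [← hj.lintegral_path h ht n (measurable_waitAt z) s]
  have hm1 := hj.measurable_walk n
  have hm2 := hj.measurable_jumpTime t n
  have hm3 := hj.measurable_jumpTime t (n + 1)
  have hmeas : MeasurableSet {ω | walk (fun k => ε k ω) n = z
        ∧ jumpTime t (fun k => ε k ω) (fun k => η k ω) n ≤ s
        ∧ s + a < jumpTime t (fun k => ε k ω) (fun k => η k ω) (n + 1)} :=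
    (hm1 (measurableSet_singleton z)).inter
      ((measurableSet_le hm2 measurable_const).inter (measurableSet_lt measurable_const hm3))
  rw [← lintegral_indicator_one hmeas]
  set B : Set ((ℤ × ℝ) × ℤ × ℝ) := {x | x.1.1 = z ∧ x.1.2 ≤ s ∧ s + a < x.1.2 + t z * x.2.2}
    with hB
  have hBm : MeasurableSet B := by
    refine ((measurable_fst.comp measurable_fst) (measurableSet_singleton z)).inter
      ((measurableSet_le (f := fun x : (ℤ × ℝ) × ℤ × ℝ => x.1.2) (g := fun _ => s)
        (by fun_prop) (by fun_prop)).inter (measurableSet_lt (f := fun _ => s + a)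
          (g := fun x : (ℤ × ℝ) × ℤ × ℝ => x.1.2 + t z * x.2.2) (by fun_prop) (by fun_prop)))
  have key := hj.lintegral_step t n (F := B.indicator 1) (measurable_one.indicator hBm)
  have e : ∀ ω, {ω | walk (fun k => ε k ω) n = z
        ∧ jumpTime t (fun k => ε k ω) (fun k => η k ω) n ≤ s
        ∧ s + a < jumpTime t (fun k => ε k ω) (fun k => η k ω) (n + 1)}.indicator
        (1 : Ω → ℝ≥0∞) ω
      = B.indicator 1 ((walk (fun k => ε k ω) n,
        jumpTime t (fun k => ε k ω) (fun k => η k ω) n), (ε n ω, η n ω)) := fun ω => by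
    simp only [Set.indicator, hB, Set.mem_ofPred_eq, jumpTime_succ, Pi.one_apply]
    congr 1
    by_cases hz : walk (fun k => ε k ω) n = z <;> simp [hz]
  simp only [e]
  rw [key, ← lintegral_const_mul]
  swap
  · exact (measurable_uncurry_int (measurable_waitAt (t := t) z)).comp
      (f := fun ω => (walk (fun k => ε k ω) n,
        s - jumpTime t (fun k => ε k ω) (fun k => η k ω) n)) (by fun_prop)
  refine lintegral_congr fun ω => ?_
  generalize walk (fun k => ε k ω) n = x
  generalize jumpTime t (fun k => ε k ω) (fun k => η k ω) n = T
  have htz := ht z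
  by_cases hx : x = z ∧ T ≤ s
  swap
  · have h1 : ∀ y, B.indicator (1 : (ℤ × ℝ) × ℤ × ℝ → ℝ≥0∞) ((x, T), y) = 0 := fun y => by
      refine Set.indicator_of_notMem (fun hy => hx ⟨hy.1, hy.2.1⟩) _
    simp only [h1, lintegral_zero]
    by_cases hxz : x = z
    · have hT : ¬ 0 ≤ s - T := by
        intro hT
        exact hx ⟨hxz, by linarith⟩
      simp [waitAt, surv, hT]
    · simp [waitAt, hxz]
  · obtain ⟨rfl, hT⟩ := hx
    have h1 : ∀ ω' ω'', B.indicator (1 : (ℤ × ℝ) × ℤ × ℝ → ℝ≥0∞) ((x, T), (ε n ω', η n ω''))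
        = {ω'' | (s + a - T) / t x < η n ω''}.indicator 1 ω'' := fun ω' ω'' => by
      simp only [Set.indicator, hB, Set.mem_ofPred_eq, div_lt_iff₀ htz, Pi.one_apply]
      congr 1
      simp only [true_and, hT, eq_iff_iff]
      constructor <;> intro h <;> linarith
    have h2 : P {ω'' | (s + a - T) / t x < η n ω''} = surv 1 ((s + a - T) / t x) := by
      rw [← expMeasure_Ioi (div_nonneg (by linarith) htz.le), ← (hj.law_hold n).map_eq,
        Measure.map_apply (hj.measurable_hold n) measurableSet_Ioi]
      rfl
    simp only [h1]
    rw [lintegral_indicator_one (measurableSet_lt measurable_const (hj.measurable_hold n)), h2]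
    simp only [lintegral_const, measure_univ, mul_one, waitAt_self]
    rw [surv, surv, if_pos (div_nonneg (by linarith) htz.le), if_pos (by linarith),
      ← ENNReal.ofReal_mul (Real.exp_pos _).le, ← Real.exp_add]
    congr 2
    field_simp
    ring

omit [IsProbabilityMeasure P] in
lemma occ_succ_eq_add (n : ℕ) (y x : ℤ) (u : ℝ) : occ p q t Set.univ (n + 1) y x u
    = occ p q t Set.univ n y x u + (stepTime p q t Set.univ)^[n] (waitAt t y) x u := by
  induction n generalizing x u with
  | zero => simp [occ, stepTime, convol]
  | succ n ih =>
    have e : occ p q t Set.univ (n + 1) y = fun x u => occ p q t Set.univ n y x u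
        + (stepTime p q t Set.univ)^[n] (waitAt t y) x u := by
      ext x u; exact ih x u
    have hm : ∀ n x, Measurable ((stepTime p q t Set.univ)^[n] (waitAt t y) x) := by
      intro n
      induction n with
      | zero => exact measurable_waitAt y
      | succ n ih => rw [Function.iterate_succ']; exact measurable_stepTime ih
    rw [Function.iterate_succ_apply']
    change waitAt t y x u + stepTime p q t Set.univ (occ p q t Set.univ (n + 1) y) x u = _
    rw [e, stepTime_add (fun x => measurable_occ n y x) (hm n), ← add_assoc]
    exact congrArg (· + _) (ih x u)

lemma tsum_iterate_stepTime (y x : ℤ) (u : ℝ) :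
    ∑' n, (stepTime p q t Set.univ)^[n] (waitAt t y) x u = ⨆ n, occ p q t Set.univ n y x u := by
  rw [ENNReal.tsum_eq_iSup_nat]
  congr 1
  ext n
  induction n with
  | zero => simp [occ]
  | succ n ih => rw [Finset.sum_range_succ, ih, occ_succ_eq_add]

/-- The sum of `f (t S_n)` over those `n` for which the process with environment `t` has made
exactly `n` jumps up to time `s` and also up to time `s + a`. -/
def pathSum (f : ℝ → ℝ≥0∞) (s a : ℝ) (x : (ℤ → ℝ) × (ℕ → ℤ) × (ℕ → ℝ)) : ℝ≥0∞ :=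
  ∑' n, {x : (ℤ → ℝ) × (ℕ → ℤ) × (ℕ → ℝ) | jumpTime x.1 x.2.1 x.2.2 n ≤ s
    ∧ s + a < jumpTime x.1 x.2.1 x.2.2 (n + 1)}.indicator (fun x => f (x.1 (walk x.2.1 n))) x

lemma measurable_pathSum {f : ℝ → ℝ≥0∞} (hf : Measurable f) (s a : ℝ) :
    Measurable (pathSum f s a) := by
  refine Measurable.tsum fun n => Measurable.indicator ?_ ?_
  · refine hf.comp (measurable_eval_int.comp (f := fun x : (ℤ → ℝ) × (ℕ → ℤ) × (ℕ → ℝ) =>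
      (x.1, walk x.2.1 n)) (measurable_fst.prodMk ((measurable_walk n).comp (by fun_prop))))
  · exact (measurableSet_le (measurable_jumpTime n) measurable_const).inter
      (measurableSet_lt measurable_const (measurable_jumpTime (n + 1)))

/-- The events for different `n` and `z` are weighed by `measure_stay`. The requirement of no jump
during `a` factors out as `e^{-a / t z}` in each term, and the rest sums over `n` to the occupation
probability. -/
lemma IsJumpData.lintegral_pathSum_fixed (h : IsDriftPair p q) (hj : IsJumpData P p q ε η)
    (ht : ∀ x, 0 < t x) {f : ℝ → ℝ≥0∞} (s : ℝ) {a : ℝ} (ha : 0 ≤ a) :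
    ∫⁻ ω, pathSum f s a (t, (fun k => ε k ω), (fun k => η k ω)) ∂P
      = ∑' z, f (t z) * ENNReal.ofReal (Real.exp (-a / t z))
        * ⨆ n, occ p q t Set.univ n z 0 s := by
  have hmeas : ∀ n z, MeasurableSet {ω | walk (fun k => ε k ω) n = z
        ∧ jumpTime t (fun k => ε k ω) (fun k => η k ω) n ≤ s
        ∧ s + a < jumpTime t (fun k => ε k ω) (fun k => η k ω) (n + 1)} := fun n z =>
    ((hj.measurable_walk n) (measurableSet_singleton z)).inter
      ((measurableSet_le (hj.measurable_jumpTime t n) measurable_const).inter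
        (measurableSet_lt measurable_const (hj.measurable_jumpTime t (n + 1))))
  have e : ∀ ω, pathSum f s a (t, (fun k => ε k ω), (fun k => η k ω))
      = ∑' n, ∑' z, {ω | walk (fun k => ε k ω) n = z
        ∧ jumpTime t (fun k => ε k ω) (fun k => η k ω) n ≤ s
        ∧ s + a < jumpTime t (fun k => ε k ω) (fun k => η k ω) (n + 1)}.indicator
        (fun _ => f (t z)) ω := fun ω => by
    refine tsum_congr fun n => ?_
    rw [tsum_eq_single (walk (fun k => ε k ω) n)]
    · simp [Set.indicator]
    · intro z hz
      exact Set.indicator_of_notMem (fun hω => hz hω.1.symm) _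
  simp only [e]
  rw [lintegral_tsum fun n => (Measurable.tsum fun z =>
    measurable_const.indicator (hmeas n z)).aemeasurable]
  have e2 : ∀ n, ∫⁻ ω, ∑' z, {ω | walk (fun k => ε k ω) n = z
        ∧ jumpTime t (fun k => ε k ω) (fun k => η k ω) n ≤ s
        ∧ s + a < jumpTime t (fun k => ε k ω) (fun k => η k ω) (n + 1)}.indicator
        (fun _ => f (t z)) ω ∂P = ∑' z, f (t z) * ENNReal.ofReal (Real.exp (-a / t z))
        * (stepTime p q t Set.univ)^[n] (waitAt t z) 0 s := fun n => by
    rw [lintegral_tsum fun z => (measurable_const.indicator (hmeas n z)).aemeasurable]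
    refine tsum_congr fun z => ?_
    rw [lintegral_indicator_const (hmeas n z), hj.measure_stay h ht n z s ha, mul_assoc]
  simp only [e2]
  rw [ENNReal.tsum_comm]
  refine tsum_congr fun z => ?_
  rw [ENNReal.tsum_mul_left, tsum_iterate_stepTime]

lemma IsJumpData.lintegral_pathSum (h : IsDriftPair p q) (hj : IsJumpData P p q ε η)
    {τ : ℤ → Ω → ℝ} (hτ : IsPosIIDEnv P τ)
    (hind : IndepFun (fun ω z => τ z ω) (fun ω => ((fun n => ε n ω), (fun n => η n ω))) P)
    {f : ℝ → ℝ≥0∞} (hf : Measurable f) (s : ℝ) {a : ℝ} (ha : 0 ≤ a) :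
    ∫⁻ ω, pathSum f s a ((fun z => τ z ω), (fun k => ε k ω), (fun k => η k ω)) ∂P
      = ∫⁻ ω, ∑' z, f (τ z ω) * ENNReal.ofReal (Real.exp (-a / τ z ω)) * occAt p q τ z s ω ∂P := by
  have key := lintegral_comp_prodMk (measurable_pi_lambda _ hτ.measurable)
    ((measurable_pi_lambda _ hj.measurable_jump).prodMk (measurable_pi_lambda _ hj.measurable_hold))
    hind (measurable_pathSum hf s a)
  refine key.trans (lintegral_congr fun ω => ?_)
  exact hj.lintegral_pathSum_fixed h (fun z => hτ.pos z ω) s ha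

end jump

/-! ### The paths of the trap model. -/

section path

variable {t : ℤ → ℝ} {e : ℕ → ℤ} {i : ℕ → ℝ}

lemma strictMono_jumpTime (ht : ∀ z, 0 < t z) (hi : ∀ n, 0 < i n) :
    StrictMono (jumpTime t e i) :=
  strictMono_nat_of_lt_succ fun n => by
    rw [jumpTime_succ]
    have := mul_pos (ht (walk e n)) (hi n)
    linarith

lemma eq_of_jumpTime_le_lt (hT : StrictMono (jumpTime t e i)) {m n : ℕ} {s : ℝ}
    (hm : jumpTime t e i m ≤ s) (hm' : s < jumpTime t e i (m + 1))
    (hn : jumpTime t e i n ≤ s) (hn' : s < jumpTime t e i (n + 1)) : m = n := by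
  have h1 := hT.lt_iff_lt.1 (hm.trans_lt hn')
  have h2 := hT.lt_iff_lt.1 (hn.trans_lt hm')
  omega

lemma pathSum_eq (hT : StrictMono (jumpTime t e i)) (f : ℝ → ℝ≥0∞) {n : ℕ} {s a : ℝ} (ha : 0 ≤ a)
    (hn : jumpTime t e i n ≤ s) (hn' : s < jumpTime t e i (n + 1)) :
    pathSum f s a (t, e, i)
      = if s + a < jumpTime t e i (n + 1) then f (t (walk e n)) else 0 := by
  unfold pathSum
  rw [tsum_eq_single n]
  · simp [Set.indicator, hn]
  · intro m hm
    refine Set.indicator_of_notMem (fun h => hm ?_) _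
    exact eq_of_jumpTime_le_lt hT h.1 (by linarith [h.2]) hn hn'

lemma pathSum_eq_zero (f : ℝ → ℝ≥0∞) {s a : ℝ} (ha : 0 ≤ a)
    (h : ¬ ∃ n, jumpTime t e i n ≤ s ∧ s < jumpTime t e i (n + 1)) :
    pathSum f s a (t, e, i) = 0 := by
  refine ENNReal.tsum_eq_zero.2 fun m => Set.indicator_of_notMem (fun hm => h ⟨m, hm.1, ?_⟩) _
  linarith [hm.2]

/-- A path that follows the jump chain is constant on `[s, s + a]` if and only if it does not
jump. -/
lemma forall_eq_iff_lt_jumpTime (hT : StrictMono (jumpTime t e i)) (he : ∀ n, e n = 1 ∨ e n = -1)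
    {x : ℝ → ℤ} {s a : ℝ} (hs : 0 ≤ s)
    (hx : ∀ r, 0 ≤ r → ∀ n, jumpTime t e i n ≤ r → r < jumpTime t e i (n + 1) → x r = walk e n)
    {n : ℕ} (hn : jumpTime t e i n ≤ s) (hn' : s < jumpTime t e i (n + 1)) :
    (∀ r, 0 ≤ r → r ≤ a → x s = x (s + r)) ↔ s + a < jumpTime t e i (n + 1) := by
  constructor
  · intro h
    by_contra hlt
    push Not at hlt
    have h1 := h (jumpTime t e i (n + 1) - s) (by linarith) (by linarith)
    rw [add_sub_cancel, hx s hs n hn hn', hx _ (by linarith) (n + 1) le_rfl (hT (Nat.lt_succ_self _)),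
      walk_succ] at h1
    rcases he n with h2 | h2 <;> omega
  · intro h r hr hra
    rw [hx s hs n hn hn', hx (s + r) (by linarith) n (by linarith) (by linarith)]

end path

section process

variable {Ω : Type*} [MeasurableSpace Ω] {P : Measure Ω} [IsProbabilityMeasure P] {p q l : ℝ}
  {ε : ℕ → Ω → ℤ} {η : ℕ → Ω → ℝ} {τ : ℤ → Ω → ℝ} {X : ℝ → Ω → ℤ}

/-- A trap model together with its jump chain and holding times. -/
structure IsJumpModel (P : Measure Ω) (p q : ℝ) (τ : ℤ → Ω → ℝ) (ε : ℕ → Ω → ℤ) (η : ℕ → Ω → ℝ)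
    (X : ℝ → Ω → ℤ) : Prop where
  data : IsJumpData P p q ε η
  indep_env : IndepFun (fun ω z => τ z ω) (fun ω => ((fun n => ε n ω), (fun n => η n ω))) P
  path : ∀ᵐ ω ∂P, ∀ t : ℝ, 0 ≤ t → ∀ n : ℕ,
    jumpTime (fun z => τ z ω) (fun k => ε k ω) (fun k => η k ω) n ≤ t →
    t < jumpTime (fun z => τ z ω) (fun k => ε k ω) (fun k => η k ω) (n + 1) →
    X t ω = walk (fun k => ε k ω) n

variable (h : IsDriftPair p q) (hτ : IsPosIIDEnv P τ) (hX : IsJumpModel P p q τ ε η X)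
include h hτ hX

/-- With `f = 1` and `a = 0`, `pathSum` is almost surely the indicator of the event in question. Its
mean is the total mass of the occupation probabilities, which is one as no mass escapes to infinity.
-/
lemma IsJumpModel.ae_exists_index (hl : 0 ≤ l) (hA : meanReach P p q τ l ≠ ⊤) {s : ℝ}
    (hs : 0 ≤ s) :
    ∀ᵐ ω ∂P, ∃ n, jumpTime (fun z => τ z ω) (fun k => ε k ω) (fun k => η k ω) n ≤ s
      ∧ s < jumpTime (fun z => τ z ω) (fun k => ε k ω) (fun k => η k ω) (n + 1) := by
  have hm : ∀ n, Measurable fun ω => jumpTime (fun z => τ z ω) (fun k => ε k ω) (fun k => η k ω) n :=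
    fun n => (measurable_jumpTime n).comp
      (f := fun ω => ((fun z => τ z ω), (fun k => ε k ω), (fun k => η k ω)))
      ((measurable_pi_lambda _ hτ.measurable).prodMk
        ((measurable_pi_lambda _ hX.data.measurable_jump).prodMk
          (measurable_pi_lambda _ hX.data.measurable_hold)))
  set G : Set Ω := {ω | ∃ n, jumpTime (fun z => τ z ω) (fun k => ε k ω) (fun k => η k ω) n ≤ s
      ∧ s < jumpTime (fun z => τ z ω) (fun k => ε k ω) (fun k => η k ω) (n + 1)} with hG
  have hGm : MeasurableSet G := by
    have : G = ⋃ n, {ω | jumpTime (fun z => τ z ω) (fun k => ε k ω) (fun k => η k ω) n ≤ s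
      ∧ s < jumpTime (fun z => τ z ω) (fun k => ε k ω) (fun k => η k ω) (n + 1)} := by
      ext ω; simp [hG]
    rw [this]
    exact MeasurableSet.iUnion fun n => (measurableSet_le (hm n) measurable_const).inter
      (measurableSet_lt measurable_const (hm (n + 1)))
  have hone : ∫⁻ ω, pathSum (fun _ => 1) s 0 ((fun z => τ z ω), (fun k => ε k ω), (fun k => η k ω)) ∂P
      = 1 := by
    rw [hX.data.lintegral_pathSum h hτ hX.indep_env measurable_const s le_rfl]
    refine Eq.trans ?_ (meanOcc_univ h hτ hl hA hs)
    simp [meanOcc]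
  have hle : 1 ≤ P G := by
    rw [← hone, ← lintegral_indicator_one hGm]
    refine lintegral_mono_ae ?_
    filter_upwards [ae_all_iff.2 hX.data.ae_hold_pos] with ω hω
    by_cases hωG : ω ∈ G
    · obtain ⟨n, hn, hn'⟩ := id hωG
      rw [pathSum_eq (strictMono_jumpTime (fun z => hτ.pos z ω) hω) _ le_rfl hn hn']
      simp [hωG, hn']
    · rw [pathSum_eq_zero _ le_rfl hωG]
      exact zero_le
  exact (prob_compl_eq_zero_iff hGm).2 (le_antisymm prob_le_one hle)

/-- The law of the depth of the trap in which the process is. -/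
theorem IsJumpModel.lintegral_trap (hl : 0 ≤ l) (hA : meanReach P p q τ l ≠ ⊤) {s : ℝ}
    (hs : 0 ≤ s) {f : ℝ → ℝ≥0∞} (hf : Measurable f) :
    ∫⁻ ω, f (τ (X s ω) ω) ∂P = ∫⁻ ω, ∑' z, f (τ z ω) * occAt p q τ z s ω ∂P := by
  have e := hX.data.lintegral_pathSum h hτ hX.indep_env hf s le_rfl
  simp only [neg_zero, zero_div, Real.exp_zero, ENNReal.ofReal_one, mul_one] at e
  rw [← e]
  refine lintegral_congr_ae ?_
  filter_upwards [ae_all_iff.2 hX.data.ae_hold_pos, hX.ae_exists_index h hτ hl hA hs, hX.path]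
    with ω hω ⟨n, hn, hn'⟩ hpath
  rw [pathSum_eq (strictMono_jumpTime (fun z => hτ.pos z ω) hω) _ le_rfl hn hn', add_zero,
    if_pos hn', hpath s hs n hn hn']

lemma IsJumpModel.measure_trap_mem (hl : 0 ≤ l) (hA : meanReach P p q τ l ≠ ⊤) {s : ℝ}
    (hs : 0 ≤ s) {D : Set ℝ} (hD : MeasurableSet D) (hXm : Measurable (X s)) :
    P {ω | τ (X s ω) ω ∈ D} = meanOcc P p q τ D s := by
  have hm : Measurable fun ω => τ (X s ω) ω :=
    measurable_eval_int.comp (f := fun ω => ((fun z => τ z ω), X s ω))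
      ((measurable_pi_lambda _ hτ.measurable).prodMk hXm)
  rw [meanOcc, ← hX.lintegral_trap h hτ hl hA hs (measurable_one.indicator hD)]
  exact (lintegral_indicator_one (hm hD)).symm

/-- The probability that the process does not move during a time interval. -/
theorem IsJumpModel.measure_forall_eq (hl : 0 ≤ l) (hA : meanReach P p q τ l ≠ ⊤) {s a : ℝ}
    (hs : 0 ≤ s) (ha : 0 ≤ a) :
    P {ω | ∀ r, 0 ≤ r → r ≤ a → X s ω = X (s + r) ω}
      = ∫⁻ ω, ENNReal.ofReal (Real.exp (-a / τ (X s ω) ω)) ∂P := by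
  rw [hX.lintegral_trap h hτ hl hA hs (f := fun x => ENNReal.ofReal (Real.exp (-a / x)))
    (by fun_prop)]
  have e := hX.data.lintegral_pathSum h hτ hX.indep_env (measurable_const (a := (1 : ℝ≥0∞))) s ha
  simp only [one_mul] at e
  rw [← e]
  set g := fun ω => pathSum (fun _ => 1) s a ((fun z => τ z ω), (fun k => ε k ω), (fun k => η k ω))
    with hg
  have hgm : Measurable g := (measurable_pathSum measurable_const s a).comp
    ((measurable_pi_lambda _ hτ.measurable).prodMk
        ((measurable_pi_lambda _ hX.data.measurable_jump).prodMk
          (measurable_pi_lambda _ hX.data.measurable_hold)))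
  -- The event is an intersection over uncountably many `r` and is not known to be measurable; it
  -- agrees almost surely with the measurable set `{g = 1}`, and `g` takes only the values 0 and 1.
  have hset : {ω | ∀ r, 0 ≤ r → r ≤ a → X s ω = X (s + r) ω} =ᵐ[P] {ω | g ω = 1}
      ∧ g =ᵐ[P] {ω | g ω = 1}.indicator 1 := by
    have hae : ∀ᵐ ω ∂P, ((∀ r, 0 ≤ r → r ≤ a → X s ω = X (s + r) ω) ↔ g ω = 1)
        ∧ (g ω = 1 ∨ g ω = 0) := by
      filter_upwards [ae_all_iff.2 hX.data.ae_hold_pos, ae_all_iff.2 (hX.data.ae_jump h),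
        hX.ae_exists_index h hτ hl hA hs, hX.path] with ω hω hε ⟨n, hn, hn'⟩ hpath
      have hT := strictMono_jumpTime (e := fun k => ε k ω) (fun z => hτ.pos z ω) hω
      have h1 := forall_eq_iff_lt_jumpTime (a := a) (x := fun r => X r ω) hT hε hs hpath hn hn'
      have h2 : g ω = _ := pathSum_eq hT (fun _ => 1) ha hn hn'
      rw [h1, h2]
      split_ifs with hc <;> simp [hc]
    constructor
    · filter_upwards [hae] with ω hω
      exact propext hω.1
    · filter_upwards [hae] with ω hω
      rcases hω.2 with h1 | h1 <;> simp [Set.indicator, h1]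
  rw [measure_congr hset.1, lintegral_congr_ae hset.2]
  exact (lintegral_indicator_one (hgm (measurableSet_singleton 1))).symm

end process

/-! ### Truncated means under a regularly varying tail. -/

/-- A law on `(0, ∞)` whose tail is regularly varying with `x ^ α * ρ (x, ∞) → 1`. -/
structure IsTailLaw (α : ℝ) (ρ : Measure ℝ) : Prop where
  isProbabilityMeasure : IsProbabilityMeasure ρ
  pos : ∀ᵐ y ∂ρ, 0 < y
  tail : Tendsto (fun x : ℝ => x ^ α * ρ.real (Set.Ioi x)) atTop (𝓝 1)

/-- The inverse function of `y ↦ 1{y > u} y / (1 + y)`. -/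
def cutoff (u w : ℝ) : ℝ := max u (w / (1 - w))

/-- The integral `∫_u^∞ α y ^ (-α) / (1 + y) dy`, in layers. -/
def tailIntegral (α u : ℝ) : ℝ≥0∞ := ∫⁻ w in Set.Ioo (0 : ℝ) 1, ENNReal.ofReal (cutoff u w ^ (-α))

section tail

variable {α u : ℝ} {ρ : Measure ℝ}

lemma measurable_cutoff (u : ℝ) : Measurable (cutoff u) := by
  unfold cutoff; fun_prop

lemma measurable_cutoff_rpow (α u : ℝ) :
    Measurable fun w => ENNReal.ofReal (cutoff u w ^ (-α)) :=
  ENNReal.measurable_ofReal.comp ((measurable_cutoff u).pow_const _)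

lemma cutoff_pos (u : ℝ) {w : ℝ} (h0 : 0 < w) (h1 : w < 1) : 0 < cutoff u w :=
  lt_max_of_lt_right (div_pos h0 (by linarith))

lemma cutoff_rpow_le (hα : 0 < α) (u : ℝ) {w : ℝ} (h0 : 0 < w) (h1 : w < 1) :
    cutoff u w ^ (-α) ≤ w ^ (-α) := by
  refine Real.rpow_le_rpow_of_nonpos h0 (le_max_of_le_right ?_) (by linarith)
  rw [le_div_iff₀ (by linarith)]
  nlinarith

lemma tailIntegral_lt_top (hα : 0 < α) (hα1 : α < 1) (u : ℝ) : tailIntegral α u < ⊤ := by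
  have hint : IntegrableOn (fun w : ℝ => w ^ (-α)) (Set.Ioo 0 1) :=
    (intervalIntegral.integrableOn_Ioo_rpow_iff one_pos).2 (by linarith)
  refine lt_of_le_of_lt (setLIntegral_mono' measurableSet_Ioo fun w hw =>
    ENNReal.ofReal_le_ofReal (cutoff_rpow_le hα u hw.1 hw.2)) ?_
  exact hint.setLIntegral_lt_top

lemma tailIntegral_pos (u : ℝ) : 0 < tailIntegral α u := by
  rw [tailIntegral, setLIntegral_pos_iff (measurable_cutoff_rpow α u)]
  have : (Function.support fun w => ENNReal.ofReal (cutoff u w ^ (-α))) ∩ Set.Ioo 0 1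
      = Set.Ioo (0 : ℝ) 1 := by
    refine Set.inter_eq_right.2 fun w hw => ?_
    simpa using Real.rpow_pos_of_pos (cutoff_pos u hw.1 hw.2) (-α)
  rw [this]
  simp

lemma tailIntegral_anti (hα : 0 < α) {u' : ℝ} (h : u ≤ u') :
    tailIntegral α u' ≤ tailIntegral α u := by
  refine setLIntegral_mono' measurableSet_Ioo fun w hw => ENNReal.ofReal_le_ofReal ?_
  exact Real.rpow_le_rpow_of_nonpos (cutoff_pos u hw.1 hw.2) (max_le_max_right _ h) (by linarith)

/-- The layer-cake formula: `1{y > u x} y / (y + x)` is the length of the set of `w` in `(0, 1)`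
with `x · cutoff u w < y`. It expresses the mean through tails, so no density is needed. -/
lemma lintegral_layer [IsProbabilityMeasure ρ] (hpos : ∀ᵐ y ∂ρ, 0 < y) (u : ℝ) {x : ℝ}
    (hx : 0 < x) :
    ∫⁻ y, (Set.Ioi (u * x)).indicator 1 y * ENNReal.ofReal (y / (y + x)) ∂ρ
      = ∫⁻ w in Set.Ioo (0 : ℝ) 1, ρ (Set.Ioi (x * cutoff u w)) := by
  have hmc := measurable_cutoff u
  have hms : MeasurableSet {a : ℝ × ℝ | x * cutoff u a.1 < a.2} :=
    measurableSet_lt (by fun_prop) measurable_snd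
  have e1 : ∀ w, ρ (Set.Ioi (x * cutoff u w))
      = ∫⁻ y, {a : ℝ × ℝ | x * cutoff u a.1 < a.2}.indicator 1 (w, y) ∂ρ := fun w => by
    rw [← lintegral_indicator_one measurableSet_Ioi]
    rfl
  simp only [e1]
  rw [lintegral_lintegral_swap]
  swap
  · exact (measurable_one.indicator hms).aemeasurable
  refine lintegral_congr_ae ?_
  filter_upwards [hpos] with y hy
  have hle : y / (y + x) ≤ 1 := by rw [div_le_one (by linarith)]; linarith
  by_cases huy : u * x < y
  · have e2 : ∀ w ∈ Set.Ioo (0 : ℝ) 1, {a : ℝ × ℝ | x * cutoff u a.1 < a.2}.indicator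
        (1 : ℝ × ℝ → ℝ≥0∞) (w, y) = (Set.Ioo 0 (y / (y + x))).indicator 1 w := by
      intro w hw
      have hiff : x * cutoff u w < y ↔ w < y / (y + x) := by
        rw [← lt_div_iff₀' hx, cutoff, max_lt_iff, lt_div_iff₀ hx, and_iff_right huy,
          div_lt_div_iff₀ (by linarith [hw.2]) hx, lt_div_iff₀ (by linarith)]
        constructor <;> intro h <;> linarith
      simp only [Set.indicator, Set.mem_ofPred_eq, hiff, Set.mem_Ioo, hw.1, true_and, Pi.one_apply]
    rw [setLIntegral_congr_fun measurableSet_Ioo e2, ← lintegral_indicator measurableSet_Ioo,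
      Set.indicator_indicator, Set.inter_eq_right.2 (Set.Ioo_subset_Ioo_right hle),
      lintegral_indicator_one measurableSet_Ioo, Real.volume_Ioo, sub_zero]
    simp [huy]
  · have e2 : ∀ w ∈ Set.Ioo (0 : ℝ) 1, {a : ℝ × ℝ | x * cutoff u a.1 < a.2}.indicator
        (1 : ℝ × ℝ → ℝ≥0∞) (w, y) = 0 := by
      intro w hw
      refine Set.indicator_of_notMem (fun h => huy ?_) _
      have h' : x * cutoff u w < y := h
      refine lt_of_le_of_lt ?_ h'
      rw [mul_comm]
      exact mul_le_mul_of_nonneg_left (le_max_left _ _) hx.le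
    rw [setLIntegral_congr_fun measurableSet_Ioo e2]
    simp [huy]

namespace IsTailLaw

variable (hα : 0 < α) (hρ : IsTailLaw α ρ)
include hα hρ

/-- Beyond some `x₀` the tail hypothesis gives the constant 2; below `x₀` the probability is at most
one, and `x ^ α` is bounded. -/
lemma exists_tail_le : ∃ C : ℝ, 0 < C ∧ ∀ x, 0 < x → ρ.real (Set.Ioi x) ≤ C * x ^ (-α) := by
  have := hρ.isProbabilityMeasure
  obtain ⟨x₀, hx₀⟩ := eventually_atTop.1 (hρ.tail.eventually_le_const (show (1 : ℝ) < 2 by norm_num))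
  refine ⟨max 2 ((max x₀ 1) ^ α), by positivity, fun x hx => ?_⟩
  rw [Real.rpow_neg hx.le, ← div_eq_mul_inv, le_div_iff₀ (Real.rpow_pos_of_pos hx α), mul_comm]
  rcases le_total x₀ x with h | h
  · exact (hx₀ x h).trans (le_max_left _ _)
  · refine le_trans ?_ (le_max_right _ _)
    calc x ^ α * ρ.real (Set.Ioi x) ≤ x ^ α * 1 := by
          gcongr; exact measureReal_le_one
      _ ≤ (max x₀ 1) ^ α := by
          rw [mul_one]
          exact Real.rpow_le_rpow hx.le (h.trans (le_max_left _ _)) hα.le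

lemma exists_lintegral_le (hα1 : α < 1) : ∃ C : ℝ, 0 < C ∧ ∀ x, 0 < x →
    ∫⁻ y, ENNReal.ofReal (y / (y + x)) ∂ρ ≤ ENNReal.ofReal (C * x ^ (-α)) := by
  have := hρ.isProbabilityMeasure
  obtain ⟨C, hC, h⟩ := hρ.exists_tail_le hα
  have hI := tailIntegral_lt_top hα hα1 0
  refine ⟨C * (tailIntegral α 0).toReal,
    mul_pos hC (ENNReal.toReal_pos (tailIntegral_pos 0).ne' hI.ne), fun x hx => ?_⟩
  calc ∫⁻ y, ENNReal.ofReal (y / (y + x)) ∂ρ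
      = ∫⁻ y, (Set.Ioi (0 * x)).indicator 1 y * ENNReal.ofReal (y / (y + x)) ∂ρ := by
        refine lintegral_congr_ae ?_
        filter_upwards [hρ.pos] with y hy
        simp [hy]
    _ = ∫⁻ w in Set.Ioo (0 : ℝ) 1, ρ (Set.Ioi (x * cutoff 0 w)) := lintegral_layer hρ.pos 0 hx
    _ ≤ ∫⁻ w in Set.Ioo (0 : ℝ) 1, ENNReal.ofReal (C * x ^ (-α))
        * ENNReal.ofReal (cutoff 0 w ^ (-α)) := by
        refine setLIntegral_mono' measurableSet_Ioo fun w hw => ?_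
        have hk := cutoff_pos 0 hw.1 hw.2
        rw [← ENNReal.ofReal_mul (by positivity), mul_assoc, ← Real.mul_rpow hx.le hk.le,
          ← ofReal_measureReal]
        exact ENNReal.ofReal_le_ofReal (h _ (mul_pos hx hk))
    _ = ENNReal.ofReal (C * x ^ (-α)) * tailIntegral α 0 := by
        rw [lintegral_const_mul _ (measurable_cutoff_rpow α 0), tailIntegral]
    _ = _ := by
        rw [← ENNReal.ofReal_toReal hI.ne, ← ENNReal.ofReal_mul (by positivity),
          ENNReal.toReal_ofReal ENNReal.toReal_nonneg]
        congr 1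
        ring

/-- The asymptotics of truncated means of a law with a regularly varying tail. -/
theorem tendsto_lintegral (hα1 : α < 1) (u : ℝ) :
    Tendsto (fun x : ℝ => ENNReal.ofReal (x ^ α)
      * ∫⁻ y, (Set.Ioi (u * x)).indicator 1 y * ENNReal.ofReal (y / (y + x)) ∂ρ) atTop
      (𝓝 (tailIntegral α u)) := by
  have := hρ.isProbabilityMeasure
  obtain ⟨C, hC, h⟩ := hρ.exists_tail_le hα
  have hmc := measurable_cutoff u
  have hmm : ∀ x : ℝ, Measurable fun w => ρ (Set.Ioi (x * cutoff u w)) := fun x => by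
    have hanti : Antitone fun c : ℝ => ρ (Set.Ioi c) := fun a b hab =>
      measure_mono (Set.Ioi_subset_Ioi hab)
    exact hanti.measurable.comp (by fun_prop)
  have hlim : Tendsto (fun x : ℝ => ∫⁻ w in Set.Ioo (0 : ℝ) 1, ENNReal.ofReal (x ^ α)
      * ρ (Set.Ioi (x * cutoff u w))) atTop (𝓝 (tailIntegral α u)) := by
    -- For fixed `w` the tail hypothesis is applied along `x · cutoff u w → ∞`. The dominating
    -- function is integrable at `w = 0` because `α < 1`.
    refine tendsto_lintegral_filter_of_dominated_convergence
      (fun w => ENNReal.ofReal C * ENNReal.ofReal (cutoff u w ^ (-α))) ?_ ?_ ?_ ?_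
    · exact Eventually.of_forall fun x => (hmm x).const_mul _
    · filter_upwards [eventually_gt_atTop 0] with x hx
      refine (ae_restrict_iff' measurableSet_Ioo).2 (ae_of_all _ fun w hw => ?_)
      have hk := cutoff_pos u hw.1 hw.2
      rw [← ofReal_measureReal, ← ENNReal.ofReal_mul (by positivity),
        ← ENNReal.ofReal_mul hC.le]
      refine ENNReal.ofReal_le_ofReal ?_
      calc x ^ α * ρ.real (Set.Ioi (x * cutoff u w))
          ≤ x ^ α * (C * (x * cutoff u w) ^ (-α)) := by
            gcongr; exact h _ (mul_pos hx hk)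
        _ = C * cutoff u w ^ (-α) := by
            rw [Real.mul_rpow hx.le hk.le, Real.rpow_neg hx.le]
            field_simp
    · rw [lintegral_const_mul _ (measurable_cutoff_rpow α u)]
      exact (ENNReal.mul_lt_top ENNReal.ofReal_lt_top (tailIntegral_lt_top hα hα1 u)).ne
    · refine (ae_restrict_iff' measurableSet_Ioo).2 (ae_of_all _ fun w hw => ?_)
      have hk := cutoff_pos u hw.1 hw.2
      have h1 : Tendsto (fun x : ℝ => cutoff u w ^ (-α) * ((x * cutoff u w) ^ α
          * ρ.real (Set.Ioi (x * cutoff u w)))) atTop (𝓝 (cutoff u w ^ (-α) * 1)) :=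
        (hρ.tail.comp (tendsto_id.atTop_mul_const hk)).const_mul _
      rw [mul_one] at h1
      refine (ENNReal.tendsto_ofReal h1).congr' ?_
      filter_upwards [eventually_gt_atTop 0] with x hx
      rw [← ofReal_measureReal, ← ENNReal.ofReal_mul (by positivity)]
      congr 1
      rw [Real.mul_rpow hx.le hk.le, Real.rpow_neg hk.le]
      have := Real.rpow_pos_of_pos hk α
      field_simp
  refine hlim.congr' ?_
  filter_upwards [eventually_gt_atTop 0] with x hx
  rw [lintegral_layer hρ.pos u hx, lintegral_const_mul _ (hmm x)]

end IsTailLaw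

end tail

/-! ### The Pareto law. -/

section pareto

variable {α u : ℝ}

lemma lintegral_pareto (α : ℝ) {f : ℝ → ℝ≥0∞} (hf : Measurable f) :
    ∫⁻ z, f z ∂(paretoMeasure 1 α)
      = ∫⁻ z in Set.Ioi 1, ENNReal.ofReal (α * z ^ (-(α + 1))) * f z := by
  have hm : Measurable (paretoPDF 1 α) :=
    ENNReal.measurable_ofReal.comp (measurable_paretoPDFReal 1 α)
  rw [paretoMeasure, lintegral_withDensity_eq_lintegral_mul _ hm hf,
    ← setLIntegral_congr Ioi_ae_eq_Ici.symm, ← lintegral_indicator measurableSet_Ici]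
  refine lintegral_congr fun z => ?_
  simp only [Pi.mul_apply, Set.indicator, Set.mem_Ici]
  split_ifs with h
  · rw [paretoPDF_of_le h, Real.one_rpow, mul_one]
  · rw [paretoPDF_of_lt (not_le.1 h), zero_mul]

lemma pareto_Ioi (hα : 0 < α) {x : ℝ} (hx : 1 ≤ x) :
    paretoMeasure 1 α (Set.Ioi x) = ENNReal.ofReal (x ^ (-α)) := by
  rw [← lintegral_indicator_one measurableSet_Ioi,
    lintegral_pareto α (measurable_one.indicator measurableSet_Ioi)]
  have e : ∀ z, ENNReal.ofReal (α * z ^ (-(α + 1))) * (Set.Ioi x).indicator 1 z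
      = (Set.Ioi x).indicator (fun z => ENNReal.ofReal (α * z ^ (-(α + 1)))) z := fun z => by
    simp only [Set.indicator, Pi.one_apply]
    split_ifs <;> simp
  simp only [e]
  have hx0 : 0 < x := by linarith
  rw [setLIntegral_indicator measurableSet_Ioi,
    Set.inter_eq_left.2 (Set.Ioi_subset_Ioi hx),
    ← ofReal_integral_eq_lintegral_ofReal]
  · rw [integral_const_mul, integral_Ioi_rpow_of_lt (by linarith) hx0]
    congr 1
    have : -(α + 1) + 1 = -α := by ring
    rw [this]
    field_simp
  · exact (integrableOn_Ioi_rpow_of_lt (by linarith) hx0).const_mul _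
  · refine (ae_restrict_iff' measurableSet_Ioi).2 (ae_of_all _ fun z (hz : x < z) => ?_)
    have : 0 < z := by linarith
    positivity

lemma pareto_ae_one_lt (hα : 0 < α) : ∀ᵐ z ∂(paretoMeasure 1 α), 1 < z := by
  have := isProbabilityMeasure_paretoMeasure one_pos hα
  refine (prob_compl_eq_zero_iff measurableSet_Ioi).2 ?_
  rw [pareto_Ioi hα le_rfl]
  simp

lemma isTailLaw_pareto (hα : 0 < α) : IsTailLaw α (paretoMeasure 1 α) where
  isProbabilityMeasure := isProbabilityMeasure_paretoMeasure one_pos hα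
  pos := (pareto_ae_one_lt hα).mono fun z hz => by linarith
  tail := by
    refine tendsto_const_nhds.congr' ?_
    filter_upwards [eventually_ge_atTop 1] with x hx
    have hx0 : 0 < x := by linarith
    rw [measureReal_def, pareto_Ioi hα hx, ENNReal.toReal_ofReal (by positivity),
      ← Real.rpow_add hx0]
    simp

lemma pareto_Ioi_eq_min (hα : 0 < α) {x : ℝ} (hx : 0 < x) :
    paretoMeasure 1 α (Set.Ioi x) = ENNReal.ofReal (min 1 (x ^ (-α))) := by
  have := isProbabilityMeasure_paretoMeasure one_pos hα
  rcases le_total 1 x with h | h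
  · rw [pareto_Ioi hα h, min_eq_right (Real.rpow_le_one_of_one_le_of_nonpos h (by linarith))]
  · rw [min_eq_left (Real.one_le_rpow_of_pos_of_le_one_of_nonpos hx h (by linarith))]
    refine le_antisymm (by simpa using prob_le_one) ?_
    refine le_trans ?_ (measure_mono (Set.Ioi_subset_Ioi h))
    rw [pareto_Ioi hα le_rfl]
    simp

/-- For an exact Pareto tail `min 1 (x ^ (-α))` the asymptotic formula for the mean at `x = 1 / u`
is an identity: the minimum with one becomes the lower cutoff at `u` after multiplication by `u ^
α`. -/
lemma lintegral_pareto_eq_tailIntegral (hα : 0 < α) (hu : 0 < u) :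
    ∫⁻ z, ENNReal.ofReal (z * u / (1 + z * u)) ∂(paretoMeasure 1 α)
      = ENNReal.ofReal (u ^ α) * tailIntegral α u := by
  have hT := isTailLaw_pareto hα
  have := hT.isProbabilityMeasure
  calc ∫⁻ z, ENNReal.ofReal (z * u / (1 + z * u)) ∂(paretoMeasure 1 α)
      = ∫⁻ z, (Set.Ioi (0 * u⁻¹)).indicator 1 z * ENNReal.ofReal (z / (z + u⁻¹))
          ∂(paretoMeasure 1 α) := by
        refine lintegral_congr_ae ?_
        filter_upwards [hT.pos] with z hz
        simp only [zero_mul, Set.indicator, Set.mem_Ioi, hz, if_true, Pi.one_apply, one_mul]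
        congr 1
        field_simp
        ring
    _ = ∫⁻ w in Set.Ioo (0 : ℝ) 1, paretoMeasure 1 α (Set.Ioi (u⁻¹ * cutoff 0 w)) :=
        lintegral_layer hT.pos 0 (inv_pos.2 hu)
    _ = ∫⁻ w in Set.Ioo (0 : ℝ) 1, ENNReal.ofReal (u ^ α) * ENNReal.ofReal (cutoff u w ^ (-α)) := by
        refine setLIntegral_congr_fun measurableSet_Ioo fun w hw => ?_
        have hk := cutoff_pos 0 hw.1 hw.2
        have hk' : cutoff 0 w = w / (1 - w) := max_eq_right
          (div_nonneg hw.1.le (by linarith [hw.2]))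
        rw [pareto_Ioi_eq_min hα (mul_pos (inv_pos.2 hu) hk),
          ← ENNReal.ofReal_mul (by positivity)]
        congr 1
        rw [show cutoff u w = max u (cutoff 0 w) by rw [hk']; rfl,
          Real.mul_rpow (inv_pos.2 hu).le hk.le, Real.inv_rpow hu.le, Real.rpow_neg hu.le, inv_inv]
        have hua := Real.rpow_pos_of_pos hu α
        rcases le_total u (cutoff 0 w) with h | h
        · have h1 := Real.rpow_le_rpow_of_nonpos hu h (show -α ≤ 0 by linarith)
          rw [max_eq_right h, min_eq_right]
          calc u ^ α * cutoff 0 w ^ (-α) ≤ u ^ α * u ^ (-α) := by gcongr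
            _ = 1 := by rw [Real.rpow_neg hu.le, mul_inv_cancel₀ hua.ne']
        · have h1 := Real.rpow_le_rpow_of_nonpos hk h (show -α ≤ 0 by linarith)
          have h2 : u ^ α * u ^ (-α) = 1 := by rw [Real.rpow_neg hu.le, mul_inv_cancel₀ hua.ne']
          rw [max_eq_left h, h2, min_eq_left]
          calc (1 : ℝ) = u ^ α * u ^ (-α) := h2.symm
            _ ≤ _ := by gcongr
    _ = _ := by
        rw [lintegral_const_mul _ (measurable_cutoff_rpow α u), tailIntegral]

lemma integral_pareto_eq (hα : 0 < α) (hu : 0 ≤ u) :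
    ∫ z, 1 / (1 + z * u) ∂(paretoMeasure 1 α)
      = α * ∫ z in Set.Ioi (1 : ℝ), 1 / (z ^ (α + 1) * (1 + z * u)) := by
  have hT := isTailLaw_pareto hα
  rw [integral_eq_lintegral_of_nonneg_ae, lintegral_pareto α (by fun_prop), ← integral_const_mul,
    integral_eq_lintegral_of_nonneg_ae]
  · congr 1
    refine setLIntegral_congr_fun measurableSet_Ioi fun z (hz : 1 < z) => ?_
    have hz0 : 0 < z := by linarith
    rw [← ENNReal.ofReal_mul (by positivity), Real.rpow_neg hz0.le]
    congr 1
    field_simp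
  · refine (ae_restrict_iff' measurableSet_Ioi).2 (ae_of_all _ fun z (hz : 1 < z) => ?_)
    have hz0 : 0 < z := by linarith
    simp only [Pi.zero_apply]
    positivity
  · exact Measurable.aestronglyMeasurable (by fun_prop)
  · filter_upwards [hT.pos] with z hz
    simp only [Pi.zero_apply]
    positivity
  · exact Measurable.aestronglyMeasurable (by fun_prop)

end pareto

/-! ### The tail integral as a Beta-type integral. -/

section betaIntegrals

variable {α u : ℝ}

lemma integrableOn_one_sub_rpow_mul (hα : 0 < α) (hα1 : α < 1) (hu : 0 ≤ u) :
    IntegrableOn (fun b : ℝ => (1 - b) ^ (α - 1) * (b + u) ^ (-α)) (Set.Ioo 0 1) := by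
  have hB := beta_pos (α := 1 - α) (β := α) (by linarith) hα
  have h1 : Integrable (fun b => betaPDFReal (1 - α) α b) := by
    refine ⟨(measurable_betaPDFReal _ _).aestronglyMeasurable, ?_⟩
    rw [hasFiniteIntegral_iff_ofReal]
    · have := lintegral_betaPDF_eq_one (α := 1 - α) (β := α) (by linarith) hα
      unfold betaPDF at this
      rw [this]
      exact ENNReal.one_lt_top
    · refine ae_of_all _ fun b => ?_
      simp only [betaPDFReal, Pi.zero_apply]
      split_ifs with hb
      · have : 0 ≤ 1 - b := by linarith [hb.2]
        have := hb.1.le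
        positivity
      · exact le_rfl
  refine (h1.integrableOn.const_mul (beta (1 - α) α)).mono'
    (Measurable.aestronglyMeasurable (by fun_prop)) ?_
  refine (ae_restrict_iff' measurableSet_Ioo).2 (ae_of_all _ fun b hb => ?_)
  have h1b : 0 < 1 - b := by linarith [hb.2]
  have hbu : 0 < b + u := by linarith [hb.1]
  rw [Real.norm_of_nonneg (by positivity), betaPDFReal, if_pos ⟨hb.1, hb.2⟩]
  have e : 1 - α - 1 = -α := by ring
  rw [e]
  have h2 : (b + u) ^ (-α) ≤ b ^ (-α) :=
    Real.rpow_le_rpow_of_nonpos hb.1 (by linarith) (by linarith)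
  calc (1 - b) ^ (α - 1) * (b + u) ^ (-α) ≤ (1 - b) ^ (α - 1) * b ^ (-α) := by gcongr
    _ = _ := by field_simp

lemma integrableOn_one_sub_rpow_mul' (hα : 0 < α) (hα1 : α < 1) (hu : 0 ≤ u) :
    IntegrableOn (fun b : ℝ => (1 - b) ^ α * (b + u) ^ (-α)) (Set.Ioo 0 1) := by
  refine (integrableOn_one_sub_rpow_mul hα hα1 hu).mono'
    (Measurable.aestronglyMeasurable (by fun_prop)) ?_
  refine (ae_restrict_iff' measurableSet_Ioo).2 (ae_of_all _ fun b hb => ?_)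
  have h1b : 0 < 1 - b := by linarith [hb.2]
  have hbu : 0 < b + u := by linarith [hb.1]
  rw [Real.norm_of_nonneg (by positivity)]
  exact mul_le_mul_of_nonneg_right (Real.rpow_le_rpow_of_exponent_ge h1b (by linarith [hb.1])
    (by linarith)) (by positivity)

lemma intervalIntegrable_of_integrableOn_Ioo {f : ℝ → ℝ} (hf : IntegrableOn f (Set.Ioo 0 1)) :
    IntervalIntegrable f volume 0 1 :=
  (intervalIntegrable_iff_integrableOn_Ioo_of_le zero_le_one).2 hf

/-- The fundamental theorem of calculus for `(1 - b)^α (b + u)^(1 - α)`, with `b + u = (1 + u) - (1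
- b)` inserted into the derivative of the first factor. -/
lemma integral_one_sub_rpow_by_parts (hα : 0 < α) (hα1 : α < 1) (hu : 0 ≤ u) :
    α * (1 + u) * ∫ b in (0 : ℝ)..1, (1 - b) ^ (α - 1) * (b + u) ^ (-α)
      = u ^ (1 - α) + ∫ b in (0 : ℝ)..1, (1 - b) ^ α * (b + u) ^ (-α) := by
  have hX := intervalIntegrable_of_integrableOn_Ioo (integrableOn_one_sub_rpow_mul hα hα1 hu)
  have hY := intervalIntegrable_of_integrableOn_Ioo (integrableOn_one_sub_rpow_mul' hα hα1 hu)
  have key := intervalIntegral.integral_eq_sub_of_hasDerivAt_of_le (a := 0) (b := 1) zero_le_one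
    (f := fun b : ℝ => (1 - b) ^ α * (b + u) ^ (1 - α))
    (f' := fun b => (1 - b) ^ α * (b + u) ^ (-α)
      - α * (1 + u) * ((1 - b) ^ (α - 1) * (b + u) ^ (-α))) ?_ ?_ ?_
  · rw [intervalIntegral.integral_sub hY (hX.const_mul _), intervalIntegral.integral_const_mul]
      at key
    simp only [sub_self, Real.zero_rpow hα.ne', sub_zero, Real.one_rpow, zero_add, one_mul,
      zero_mul, zero_sub] at key
    linarith
  · refine ContinuousOn.mul ?_ ?_
    · exact ContinuousOn.rpow_const (by fun_prop) fun b _ => Or.inr hα.le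
    · exact ContinuousOn.rpow_const (by fun_prop) fun b _ => Or.inr (by linarith)
  · intro b hb
    have h1b : 0 < 1 - b := by linarith [hb.2]
    have hbu : 0 < b + u := by linarith [hb.1]
    have d1 : HasDerivAt (fun b : ℝ => (1 - b) ^ α) (-1 * α * (1 - b) ^ (α - 1)) b :=
      ((hasDerivAt_id b).const_sub 1).rpow_const (Or.inl h1b.ne')
    have d2 : HasDerivAt (fun b : ℝ => (b + u) ^ (1 - α)) (1 * (1 - α) * (b + u) ^ (1 - α - 1)) b :=
      ((hasDerivAt_id b).add_const u).rpow_const (Or.inl hbu.ne')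
    refine (d1.mul d2).congr_deriv ?_
    have e1 : (1 - b) ^ α = (1 - b) * (1 - b) ^ (α - 1) := by
      rw [← Real.rpow_one_add' h1b.le (by linarith)]; ring_nf
    have e2 : (b + u) ^ (1 - α) = (b + u) * (b + u) ^ (-α) := by
      rw [← Real.rpow_one_add' hbu.le (by linarith)]; ring_nf
    have e3 : (1 : ℝ) - α - 1 = -α := by ring
    rw [e3, e2, e1]
    ring
  · exact hY.sub (hX.const_mul _)

/-- On `[0, u / (1 + u)]` the cutoff is the constant `u`; beyond, the substitution `w = (b + u) / (1
+ u)` gives `w / (1 - w) = (b + u) / (1 - b)`. Integration by parts merges the two pieces. -/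
lemma tailIntegral_eq (hα : 0 < α) (hα1 : α < 1) (hu : 0 ≤ u) :
    tailIntegral α u
      = ENNReal.ofReal (α * ∫ b in (0 : ℝ)..1, (1 - b) ^ (α - 1) * (b + u) ^ (-α)) := by
  have hu1 : 0 < 1 + u := by linarith
  set w₀ := u / (1 + u) with hw₀
  have hw0 : 0 ≤ w₀ := by positivity
  have hw1 : w₀ < 1 := by rw [hw₀, div_lt_one hu1]; linarith
  have hcut : ∀ w ∈ Set.Ioo (0 : ℝ) 1, 0 ≤ cutoff u w ^ (-α) := fun w hw =>
    (Real.rpow_pos_of_pos (cutoff_pos u hw.1 hw.2) _).le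
  have hint : IntegrableOn (fun w => cutoff u w ^ (-α)) (Set.Ioo 0 1) := by
    refine ⟨((measurable_cutoff u).pow_const _).aestronglyMeasurable, ?_⟩
    rw [hasFiniteIntegral_iff_ofReal]
    · exact tailIntegral_lt_top hα hα1 u
    · exact (ae_restrict_iff' measurableSet_Ioo).2 (ae_of_all _ hcut)
  have hII := intervalIntegrable_of_integrableOn_Ioo hint
  have hsub : ∀ {a b : ℝ}, 0 ≤ a → a ≤ b → b ≤ 1 →
      IntervalIntegrable (fun w => cutoff u w ^ (-α)) volume a b := fun {a b} h0 hab h1 =>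
    hII.mono_set (by rw [Set.uIcc_of_le hab, Set.uIcc_of_le zero_le_one]; exact Set.Icc_subset_Icc h0 h1)
  rw [tailIntegral, ← ofReal_integral_eq_lintegral_ofReal hint
    ((ae_restrict_iff' measurableSet_Ioo).2 (ae_of_all _ hcut)), ← integral_Ioc_eq_integral_Ioo,
    ← intervalIntegral.integral_of_le zero_le_one]
  congr 1
  rw [← intervalIntegral.integral_add_adjacent_intervals (hsub le_rfl hw0 hw1.le)
    (hsub hw0 hw1.le le_rfl)]
  have h1 : ∫ w in (0 : ℝ)..w₀, cutoff u w ^ (-α) = u ^ (1 - α) / (1 + u) := by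
    have e : ∫ w in (0 : ℝ)..w₀, cutoff u w ^ (-α) = ∫ _w in (0 : ℝ)..w₀, u ^ (-α) := by
      refine intervalIntegral.integral_congr fun w hw => ?_
      rw [Set.uIcc_of_le hw0] at hw
      have hle : w / (1 - w) ≤ u := by
        have h3 := hw.2
        rw [hw₀, le_div_iff₀ hu1] at h3
        rw [div_le_iff₀ (by linarith [hw.2])]
        linarith
      simp only [cutoff, max_eq_left hle]
    rw [e, intervalIntegral.integral_const, sub_zero, smul_eq_mul, hw₀]
    rcases hu.eq_or_lt with rfl | hu'
    · simp [Real.zero_rpow (show 1 - α ≠ 0 by linarith)]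
    · rw [Real.rpow_sub hu', Real.rpow_one, Real.rpow_neg hu]
      field_simp
  have h2 : ∫ w in w₀..1, cutoff u w ^ (-α)
      = (1 + u)⁻¹ * ∫ b in (0 : ℝ)..1, (1 - b) ^ α * (b + u) ^ (-α) := by
    have hc : (1 + u)⁻¹ ≠ 0 := (inv_pos.2 hu1).ne'
    have hs := intervalIntegral.integral_comp_mul_add (a := 0) (b := 1)
      (fun w => cutoff u w ^ (-α)) hc w₀
    have e1 : (1 + u)⁻¹ * 1 + w₀ = 1 := by rw [hw₀]; field_simp
    rw [mul_zero, zero_add, e1, inv_inv, smul_eq_mul] at hs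
    rw [eq_inv_mul_iff_mul_eq₀ hu1.ne', ← hs]
    rw [intervalIntegral.integral_of_le zero_le_one, intervalIntegral.integral_of_le zero_le_one,
      integral_Ioc_eq_integral_Ioo, integral_Ioc_eq_integral_Ioo]
    refine setIntegral_congr_fun measurableSet_Ioo fun b hb => ?_
    have h1b : 0 < 1 - b := by linarith [hb.2]
    have hbu : 0 < b + u := by linarith [hb.1]
    have e2 : (1 + u)⁻¹ * b + w₀ = (b + u) / (1 + u) := by rw [hw₀]; field_simp
    have e3 : (b + u) / (1 + u) / (1 - (b + u) / (1 + u)) = (b + u) / (1 - b) := by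
      have : 1 - (b + u) / (1 + u) = (1 - b) / (1 + u) := by field_simp; ring
      rw [this]
      field_simp
    have hle : u ≤ (b + u) / (1 - b) := by
      rw [le_div_iff₀ h1b]
      nlinarith [hb.1]
    simp only [cutoff, e2, e3, max_eq_right hle]
    rw [Real.div_rpow hbu.le h1b.le, Real.rpow_neg h1b.le, div_inv_eq_mul, mul_comm]
  rw [h1, h2]
  have h3 := integral_one_sub_rpow_by_parts hα hα1 hu
  field_simp
  linarith

end betaIntegrals

/-! ### The limit law as a ratio of Gamma and Beta variables. -/

/-- The law of `G / (μ B)`, where `G` is a Gamma variable with index `α` and `B` is an independent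
Beta variable with indices `1 - α` and `α`. -/
def ratioLaw (α μ : ℝ) : Measure ℝ :=
  ((gammaMeasure α 1).prod (betaMeasure (1 - α) α)).map fun x => x.1 / (μ * x.2)

section ratioLaw

variable {α μ : ℝ}

lemma gamma_ae_pos (α : ℝ) : ∀ᵐ g ∂(gammaMeasure α 1), 0 < g := by
  have hm : Measurable (gammaPDF α 1) :=
    ENNReal.measurable_ofReal.comp (measurable_gammaPDFReal α 1)
  rw [gammaMeasure, ae_withDensity_iff hm]
  have h0 : ∀ᵐ g : ℝ, g ≠ 0 := by simp [ae_iff]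
  filter_upwards [h0] with g hg hpdf
  by_contra hneg
  exact hpdf (gammaPDF_of_neg (lt_of_le_of_ne (not_lt.1 hneg) hg))

lemma beta_ae_mem : ∀ᵐ b ∂(betaMeasure (1 - α) α), b ∈ Set.Ioo (0 : ℝ) 1 := by
  have hm : Measurable (betaPDF (1 - α) α) :=
    ENNReal.measurable_ofReal.comp (measurable_betaPDFReal _ _)
  rw [betaMeasure, ae_withDensity_iff hm]
  refine ae_of_all _ fun b hpdf => ?_
  by_contra hb
  refine hpdf ?_
  rw [Set.mem_Ioo, not_and_or, not_lt, not_lt] at hb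
  exact hb.elim betaPDF_eq_zero_of_nonpos betaPDF_eq_zero_of_one_le

lemma lintegral_exp_gamma (ha : 0 < α) {c : ℝ} (hc : 0 ≤ c) :
    ∫⁻ g, ENNReal.ofReal (Real.exp (-c * g)) ∂(gammaMeasure α 1)
      = ENNReal.ofReal ((1 + c) ^ (-α)) := by
  have hm : Measurable (gammaPDF α 1) :=
    ENNReal.measurable_ofReal.comp (measurable_gammaPDFReal α 1)
  have hc1 : 0 < 1 + c := by linarith
  rw [gammaMeasure, lintegral_withDensity_eq_lintegral_mul _ hm (by fun_prop)]
  have e : ∀ g, (gammaPDF α 1 * fun g => ENNReal.ofReal (Real.exp (-c * g))) g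
      = ENNReal.ofReal ((1 + c) ^ (-α)) * gammaPDF α (1 + c) g := fun g => by
    rw [Pi.mul_apply, gammaPDF_eq, gammaPDF_eq, ← ENNReal.ofReal_mul' (Real.exp_pos _).le,
      ← ENNReal.ofReal_mul (by positivity)]
    congr 1
    split_ifs with hg
    · have e1 : Real.exp (-((1 + c) * g)) = Real.exp (-(1 * g)) * Real.exp (-c * g) := by
        rw [← Real.exp_add]; ring_nf
      rw [e1, Real.one_rpow, Real.rpow_neg hc1.le]
      have := Real.rpow_pos_of_pos hc1 α
      field_simp
    · simp
  simp only [e]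
  have hm2 : Measurable (gammaPDF α (1 + c)) :=
    ENNReal.measurable_ofReal.comp (measurable_gammaPDFReal α (1 + c))
  rw [lintegral_const_mul _ hm2, lintegral_gammaPDF_eq_one ha hc1, mul_one]

/-- The factor `b ^ α` in `(1 + u / b)^(-α) = b ^ α (b + u)^(-α)` cancels against the Beta density
and leaves the integral of `tailIntegral_eq`. On the left stands the Gamma Laplace transform at `u /
b`, to be averaged over the Beta variable. -/
lemma lintegral_beta_rpow (hα : 0 < α) (hα1 : α < 1) {u : ℝ} (hu : 0 ≤ u) :
    ∫⁻ b, ENNReal.ofReal ((1 + u / b) ^ (-α)) ∂(betaMeasure (1 - α) α)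
      = ENNReal.ofReal ((α * beta (1 - α) α)⁻¹) * tailIntegral α u := by
  have hB := beta_pos (α := 1 - α) (β := α) (by linarith) hα
  have hm : Measurable (betaPDF (1 - α) α) :=
    ENNReal.measurable_ofReal.comp (measurable_betaPDFReal _ _)
  have hX := integrableOn_one_sub_rpow_mul hα hα1 hu
  rw [betaMeasure, lintegral_withDensity_eq_lintegral_mul _ hm (by fun_prop), tailIntegral_eq hα
    hα1 hu, ← ENNReal.ofReal_mul (by positivity), intervalIntegral.integral_of_le zero_le_one,
    integral_Ioc_eq_integral_Ioo]
  have e : ∀ b, (betaPDF (1 - α) α * fun b => ENNReal.ofReal ((1 + u / b) ^ (-α))) b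
      = (Set.Ioo (0 : ℝ) 1).indicator (fun b => ENNReal.ofReal ((beta (1 - α) α)⁻¹
        * ((1 - b) ^ (α - 1) * (b + u) ^ (-α)))) b := fun b => by
    rw [Pi.mul_apply]
    simp only [Set.indicator]
    split_ifs with hb
    · have h1b : 0 < 1 - b := by linarith [hb.2]
      have hb0 := hb.1
      have hbu : 0 < b + u := by linarith [hb.1]
      rw [betaPDF_of_pos_lt_one hb.1 hb.2, ← ENNReal.ofReal_mul (by positivity)]
      congr 1
      have e1 : 1 + u / b = (b + u) / b := by field_simp
      have e2 : 1 - α - 1 = -α := by ring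
      have := Real.rpow_pos_of_pos hb0 (-α)
      rw [e1, e2, Real.div_rpow hbu.le hb0.le]
      field_simp
    · rw [Set.mem_Ioo, not_and_or, not_lt, not_lt] at hb
      rw [hb.elim betaPDF_eq_zero_of_nonpos betaPDF_eq_zero_of_one_le, zero_mul]
  simp only [e]
  rw [lintegral_indicator measurableSet_Ioo, ← ofReal_integral_eq_lintegral_ofReal
    (hX.const_mul _), integral_const_mul]
  · congr 1
    field_simp
  · refine (ae_restrict_iff' measurableSet_Ioo).2 (ae_of_all _ fun b hb => ?_)
    have h1b : 0 < 1 - b := by linarith [hb.2]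
    have hbu : 0 < b + u := by linarith [hb.1]
    simp only [Pi.zero_apply]
    positivity

lemma isProbabilityMeasure_ratioLaw (hα : 0 < α) (hα1 : α < 1) :
    IsProbabilityMeasure (ratioLaw α μ) := by
  have := isProbabilityMeasure_gammaMeasure hα one_pos
  have := isProbabilityMeasureBeta (α := 1 - α) (β := α) (by linarith) hα
  exact Measure.isProbabilityMeasure_map (by fun_prop)

lemma ratioLaw_ae_pos (hα : 0 < α) (hα1 : α < 1) (hμ : 0 < μ) :
    ∀ᵐ r ∂(ratioLaw α μ), 0 < r := by
  have := isProbabilityMeasure_gammaMeasure hα one_pos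
  have := isProbabilityMeasureBeta (α := 1 - α) (β := α) (by linarith) hα
  refine (ae_map_iff (by fun_prop) measurableSet_Ioi).2 ?_
  filter_upwards [Measure.quasiMeasurePreserving_fst.ae (gamma_ae_pos α),
    Measure.quasiMeasurePreserving_snd.ae beta_ae_mem] with x h1 h2
  exact div_pos h1 (mul_pos hμ h2.1)

/-- The previous formula at `u = 0`, where the left-hand side is the total mass one: the normalizing
constant needs no separate integral. -/
lemma tailIntegral_zero (hα : 0 < α) (hα1 : α < 1) :
    tailIntegral α 0 = ENNReal.ofReal (α * beta (1 - α) α) := by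
  have hB := beta_pos (α := 1 - α) (β := α) (by linarith) hα
  have := isProbabilityMeasureBeta (α := 1 - α) (β := α) (by linarith) hα
  have h := lintegral_beta_rpow hα hα1 le_rfl
  simp only [zero_div, add_zero, Real.one_rpow, ENNReal.ofReal_one, lintegral_const, measure_univ,
    mul_one] at h
  have h2 := congrArg (ENNReal.ofReal (α * beta (1 - α) α) * ·) h
  simp only [mul_one] at h2
  rw [h2, ← mul_assoc, ← ENNReal.ofReal_mul (by positivity), mul_inv_cancel₀ (by positivity),
    ENNReal.ofReal_one, one_mul]

lemma beta_one_sub (α : ℝ) : beta (1 - α) α = Real.pi / Real.sin (α * Real.pi) := by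
  rw [beta, sub_add_cancel, Real.Gamma_one, div_one, mul_comm, Real.Gamma_mul_Gamma_one_sub,
    mul_comm]

/-- The Laplace transform of `ratioLaw`. -/
theorem lintegral_exp_ratioLaw (hα : 0 < α) (hα1 : α < 1) (hμ : 0 < μ) {l : ℝ} (hl : 0 ≤ l) :
    ∫⁻ r, ENNReal.ofReal (Real.exp (-l * r)) ∂(ratioLaw α μ)
      = tailIntegral α (l / μ) / tailIntegral α 0 := by
  have hB := beta_pos (α := 1 - α) (β := α) (by linarith) hα
  have := isProbabilityMeasure_gammaMeasure hα one_pos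
  have := isProbabilityMeasureBeta (α := 1 - α) (β := α) (by linarith) hα
  rw [ratioLaw, lintegral_map (by fun_prop) (by fun_prop), lintegral_prod_symm' _ (by fun_prop)]
  have e : ∀ᵐ b ∂(betaMeasure (1 - α) α),
      ∫⁻ g, ENNReal.ofReal (Real.exp (-l * (g / (μ * b)))) ∂(gammaMeasure α 1)
        = ENNReal.ofReal ((1 + l / μ / b) ^ (-α)) := by
    filter_upwards [beta_ae_mem] with b hb
    have hb0 := hb.1
    rw [← lintegral_exp_gamma hα (c := l / μ / b) (by positivity)]
    refine lintegral_congr fun g => ?_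
    congr 2
    field_simp
  rw [lintegral_congr_ae e, lintegral_beta_rpow hα hα1 (by positivity), tailIntegral_zero hα hα1,
    ENNReal.ofReal_inv_of_pos (by positivity), mul_comm, ENNReal.div_eq_inv_mul, mul_comm]

lemma ratioLaw_singleton (hα : 0 < α) (hα1 : α < 1) (hμ : 0 < μ) (r : ℝ) :
    ratioLaw α μ {r} = 0 := by
  have := isProbabilityMeasure_gammaMeasure hα one_pos
  have := isProbabilityMeasureBeta (α := 1 - α) (β := α) (by linarith) hα
  have hm : MeasurableSet ((fun x : ℝ × ℝ => x.1 / (μ * x.2)) ⁻¹' {r}) :=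
    (show Measurable fun x : ℝ × ℝ => x.1 / (μ * x.2) by fun_prop) (measurableSet_singleton r)
  rw [ratioLaw, Measure.map_apply (by fun_prop) (measurableSet_singleton r),
    Measure.prod_apply_symm hm]
  refine (lintegral_congr_ae ?_).trans lintegral_zero
  filter_upwards [beta_ae_mem] with b hb
  refine measure_mono_null (t := {r * (μ * b)}) (fun g hg => ?_) ?_
  · have hg' : g / (μ * b) = r := hg
    have hb0 := hb.1
    rw [Set.mem_singleton_iff, ← hg', div_mul_cancel₀ _ (by positivity)]
  · rw [gammaMeasure]
    exact withDensity_absolutelyContinuous _ _ (by simp)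

end ratioLaw

/-! ### Tauberian theorem and uniqueness for Laplace transforms. -/

section tauber

lemma integrableOn_exp_neg : IntegrableOn (fun t : ℝ => Real.exp (-t)) (Set.Ioi 0) :=
  integrableOn_exp_neg_Ioi 0

lemma abs_exp_neg_le {t : ℝ} (ht : 0 < t) : Real.exp (-t) ∈ Set.Icc (0 : ℝ) 1 :=
  ⟨(Real.exp_pos _).le, Real.exp_le_one_iff.2 (by linarith)⟩

lemma integrableOn_comp_exp_mul {ψ : ℝ → ℝ} (hψ : Continuous ψ) {f : ℝ → ℝ} (hf : Measurable f)
    (hf1 : ∀ t, 0 < t → |f t| ≤ 1) :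
    IntegrableOn (fun t => ψ (Real.exp (-t)) * Real.exp (-t) * f t) (Set.Ioi 0) := by
  obtain ⟨C, hC⟩ := isCompact_Icc.exists_bound_of_continuousOn (s := Set.Icc (0 : ℝ) 1)
    hψ.continuousOn
  refine (integrableOn_exp_neg.const_mul C).mono' ?_ ?_
  · have := hψ.measurable
    exact Measurable.aestronglyMeasurable (by fun_prop)
  · refine (ae_restrict_iff' measurableSet_Ioi).2 (ae_of_all _ fun t (ht : 0 < t) => ?_)
    rw [norm_mul, norm_mul, Real.norm_eq_abs (f t), Real.norm_of_nonneg (Real.exp_pos _).le]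
    have h1 := hC _ (abs_exp_neg_le ht)
    have h2 := hf1 t ht
    have h3 := (norm_nonneg _).trans h1
    calc _ ≤ C * Real.exp (-t) * 1 := by gcongr
      _ = _ := mul_one _

/-- In the variable `exp (-t)` Laplace transforms at positive integers are moments. One factor `exp
(-t)` is kept apart as an integrable weight. -/
lemma integral_polynomial_exp_mul (p : Polynomial ℝ) {f : ℝ → ℝ} (hf : Measurable f)
    (hf1 : ∀ t, 0 < t → |f t| ≤ 1) :
    ∫ t in Set.Ioi (0 : ℝ), p.eval (Real.exp (-t)) * Real.exp (-t) * f t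
      = ∑ k ∈ p.support, p.coeff k
        * ∫ t in Set.Ioi (0 : ℝ), Real.exp (-((k : ℝ) + 1) * t) * f t := by
  have e : ∀ (k : ℕ) t, Real.exp (-((k : ℝ) + 1) * t) = Real.exp (-t) ^ k * Real.exp (-t) := by
    intro k t
    rw [← Real.exp_nat_mul, ← Real.exp_add]
    ring_nf
  simp only [e, ← integral_const_mul]
  rw [← integral_finsetSum _ fun k _ => (integrableOn_comp_exp_mul (ψ := fun u => u ^ k)
    (by fun_prop) hf hf1).const_mul _]
  refine integral_congr_ae (ae_of_all _ fun t => ?_)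
  simp only [Polynomial.eval_eq_sum, Polynomial.sum, Finset.sum_mul]
  exact Finset.sum_congr rfl fun k _ => by ring

/-- If the Laplace transforms converge at the positive integers, then so do the integrals of
continuous functions of `exp (-t)`. -/
theorem tendsto_integral_comp_exp {ι : Type*} {L : Filter ι} {F : ι → ℝ → ℝ} {G : ℝ → ℝ}
    (hF : ∀ n, Measurable (F n)) (hF1 : ∀ n t, 0 < t → |F n t| ≤ 1) (hG : Measurable G)
    (hG1 : ∀ t, 0 < t → |G t| ≤ 1)
    (hlap : ∀ k : ℕ, Tendsto (fun n => ∫ t in Set.Ioi (0 : ℝ), Real.exp (-((k : ℝ) + 1) * t) * F n t)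
      L (𝓝 (∫ t in Set.Ioi (0 : ℝ), Real.exp (-((k : ℝ) + 1) * t) * G t)))
    {ψ : ℝ → ℝ} (hψ : Continuous ψ) :
    Tendsto (fun n => ∫ t in Set.Ioi (0 : ℝ), ψ (Real.exp (-t)) * Real.exp (-t) * F n t) L
      (𝓝 (∫ t in Set.Ioi (0 : ℝ), ψ (Real.exp (-t)) * Real.exp (-t) * G t)) := by
  have happrox : ∀ ε > 0, ∃ p : Polynomial ℝ, ∀ f : ℝ → ℝ, Measurable f →
      (∀ t, 0 < t → |f t| ≤ 1) →
      |(∫ t in Set.Ioi (0 : ℝ), ψ (Real.exp (-t)) * Real.exp (-t) * f t)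
        - ∫ t in Set.Ioi (0 : ℝ), p.eval (Real.exp (-t)) * Real.exp (-t) * f t| ≤ ε := by
    intro ε hε
    -- Weierstrass approximation on `[0, 1]`; the error is uniform over all functions bounded by
    -- one, since the weight `exp (-t)` has integral one.
    obtain ⟨p, hp⟩ := exists_polynomial_near_of_continuousOn 0 1 ψ hψ.continuousOn ε hε
    refine ⟨p, fun f hf hf1 => ?_⟩
    rw [← integral_sub (integrableOn_comp_exp_mul hψ hf hf1)
      (integrableOn_comp_exp_mul p.continuous hf hf1)]
    calc _ ≤ ∫ t in Set.Ioi (0 : ℝ), ε * Real.exp (-t) := by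
          rw [← Real.norm_eq_abs]
          refine norm_integral_le_of_norm_le (integrableOn_exp_neg.const_mul ε) ?_
          refine (ae_restrict_iff' measurableSet_Ioi).2 (ae_of_all _ fun t (ht : 0 < t) => ?_)
          rw [← sub_mul, ← sub_mul, norm_mul, norm_mul, Real.norm_eq_abs, Real.norm_eq_abs,
            Real.norm_eq_abs, abs_of_pos (Real.exp_pos _), abs_sub_comm]
          calc _ ≤ ε * Real.exp (-t) * 1 := by
                gcongr
                · exact (hp _ (abs_exp_neg_le ht)).le
                · exact hf1 t ht
            _ = _ := mul_one _
      _ = ε := by rw [integral_const_mul, integral_exp_neg_Ioi_zero, mul_one]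
  rw [Metric.tendsto_nhds]
  intro ε hε
  obtain ⟨p, hp⟩ := happrox (ε / 4) (by positivity)
  have hpoly : Tendsto (fun n => ∫ t in Set.Ioi (0 : ℝ),
      p.eval (Real.exp (-t)) * Real.exp (-t) * F n t) L
      (𝓝 (∫ t in Set.Ioi (0 : ℝ), p.eval (Real.exp (-t)) * Real.exp (-t) * G t)) := by
    rw [integral_polynomial_exp_mul p hG hG1]
    refine (tendsto_finsetSum _ fun k _ => (hlap k).const_mul _).congr fun n => ?_
    rw [integral_polynomial_exp_mul p (hF n) (hF1 n)]
  filter_upwards [Metric.tendsto_nhds.1 hpoly (ε / 4) (by positivity)] with n hn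
  have h1 := hp (F n) (hF n) (hF1 n)
  have h2 := hp G hG hG1
  rw [Real.dist_eq] at hn ⊢
  rw [abs_le] at h1 h2
  rw [abs_lt] at hn ⊢
  constructor <;> linarith

/-- A continuous bump with given support, in the variable `exp (-t)`. -/
lemma exists_bump {a b : ℝ} (ha : 0 < a) (hab : a < b) : ∃ ψ : ℝ → ℝ, Continuous ψ ∧
    (∀ u, 0 ≤ ψ u) ∧ (∀ t, ψ (Real.exp (-t)) ≠ 0 → t ∈ Set.Icc a b) ∧
    ∫ t in Set.Ioi (0 : ℝ), ψ (Real.exp (-t)) * Real.exp (-t) = 1 := by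
  set ψ₀ : ℝ → ℝ := fun u => max 0 ((u - Real.exp (-b)) * (Real.exp (-a) - u)) with hψ₀
  have hc : Continuous ψ₀ := by fun_prop
  have h0 : ∀ u, 0 ≤ ψ₀ u := fun u => le_max_left _ _
  have hint : IntegrableOn (fun t => ψ₀ (Real.exp (-t)) * Real.exp (-t)) (Set.Ioi 0) := by
    simpa using integrableOn_comp_exp_mul hc (f := fun _ => 1) measurable_const (by simp)
  have hsupp : ∀ t, ψ₀ (Real.exp (-t)) ≠ 0 → t ∈ Set.Icc a b := by
    intro t ht
    have hpos : 0 < (Real.exp (-t) - Real.exp (-b)) * (Real.exp (-a) - Real.exp (-t)) := by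
      by_contra hle
      exact ht (max_eq_left (not_lt.1 hle))
    have hba : Real.exp (-b) < Real.exp (-a) := Real.exp_lt_exp.2 (by linarith)
    rcases pos_and_pos_or_neg_and_neg_of_mul_pos hpos with ⟨h1, h2⟩ | ⟨h1, h2⟩
    · have h3 := Real.exp_lt_exp.1 (sub_pos.1 h1)
      have h4 := Real.exp_lt_exp.1 (sub_pos.1 h2)
      constructor <;> linarith
    · linarith
  have hpos : 0 < ∫ t in Set.Ioi (0 : ℝ), ψ₀ (Real.exp (-t)) * Real.exp (-t) := by
    rw [setIntegral_pos_iff_support_of_nonneg_ae (ae_of_all _ fun t =>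
      mul_nonneg (h0 _) (Real.exp_pos _).le) hint]
    refine lt_of_lt_of_le ?_ (measure_mono (s := Set.Ioo a b) fun t ht => ⟨?_, ?_⟩)
    · simp [hab]
    · have h1 : Real.exp (-b) < Real.exp (-t) := Real.exp_lt_exp.2 (by linarith [ht.2])
      have h2 : Real.exp (-t) < Real.exp (-a) := Real.exp_lt_exp.2 (by linarith [ht.1])
      have h3 : 0 < ψ₀ (Real.exp (-t)) :=
        lt_max_of_lt_right (mul_pos (sub_pos.2 h1) (sub_pos.2 h2))
      exact (mul_pos h3 (Real.exp_pos _)).ne'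
    · exact ha.trans ht.1
  set c := ∫ t in Set.Ioi (0 : ℝ), ψ₀ (Real.exp (-t)) * Real.exp (-t) with hcdef
  refine ⟨fun u => c⁻¹ * ψ₀ u, by fun_prop, fun u => by have := h0 u; positivity,
    fun t ht => hsupp t (right_ne_zero_of_mul ht), ?_⟩
  simp only [mul_assoc]
  rw [integral_const_mul]
  exact inv_mul_cancel₀ hpos.ne'

lemma integral_bump_le {ψ : ℝ → ℝ} (hψ : Continuous ψ) (h0 : ∀ u, 0 ≤ ψ u) {s : Set ℝ}
    (hs : ∀ t, ψ (Real.exp (-t)) ≠ 0 → t ∈ s)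
    (h1 : ∫ t in Set.Ioi (0 : ℝ), ψ (Real.exp (-t)) * Real.exp (-t) = 1) {f g : ℝ → ℝ}
    (hf : Measurable f) (hf1 : ∀ t, 0 < t → |f t| ≤ 1) (hg : Measurable g)
    (hg1 : ∀ t, 0 < t → |g t| ≤ 1) (c : ℝ)
    (hfg : ∀ t ∈ s, f t ≤ g t + c) :
    ∫ t in Set.Ioi (0 : ℝ), ψ (Real.exp (-t)) * Real.exp (-t) * f t
      ≤ (∫ t in Set.Ioi (0 : ℝ), ψ (Real.exp (-t)) * Real.exp (-t) * g t) + c := by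
  have hi : IntegrableOn (fun t => ψ (Real.exp (-t)) * Real.exp (-t)) (Set.Ioi 0) := by
    simpa using integrableOn_comp_exp_mul hψ (f := fun _ => 1) measurable_const (by simp)
  have hig := integrableOn_comp_exp_mul hψ hg hg1
  have e : (∫ t in Set.Ioi (0 : ℝ), ψ (Real.exp (-t)) * Real.exp (-t) * g t) + c
      = ∫ t in Set.Ioi (0 : ℝ), (ψ (Real.exp (-t)) * Real.exp (-t) * g t
        + ψ (Real.exp (-t)) * Real.exp (-t) * c) := by
    rw [integral_add hig (hi.mul_const c), integral_mul_const, h1, one_mul]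
  rw [e]
  refine integral_mono (integrableOn_comp_exp_mul hψ hf hf1) (hig.add (hi.mul_const c)) fun t => ?_
  dsimp only
  by_cases ht : ψ (Real.exp (-t)) = 0
  · simp [ht]
  · rw [← mul_add]
    exact mul_le_mul_of_nonneg_left (hfg t (hs t ht)) (mul_nonneg (h0 _) (Real.exp_pos _).le)

lemma integral_bump_const {ψ : ℝ → ℝ}
    (h1 : ∫ t in Set.Ioi (0 : ℝ), ψ (Real.exp (-t)) * Real.exp (-t) = 1) (c : ℝ) :
    ∫ t in Set.Ioi (0 : ℝ), ψ (Real.exp (-t)) * Real.exp (-t) * c = c := by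
  rw [integral_mul_const, h1, one_mul]

/-- A Tauberian theorem: Laplace transforms of functions that do not drop quickly. -/
theorem tendsto_of_laplace {ι : Type*} {L : Filter ι} {F : ι → ℝ → ℝ} {G : ℝ → ℝ}
    (hF : ∀ n, Measurable (F n)) (hF1 : ∀ n t, 0 < t → |F n t| ≤ 1) (hG : Measurable G)
    (hG1 : ∀ t, 0 < t → |G t| ≤ 1)
    (hlap : ∀ k : ℕ, Tendsto (fun n => ∫ t in Set.Ioi (0 : ℝ), Real.exp (-((k : ℝ) + 1) * t) * F n t)
      L (𝓝 (∫ t in Set.Ioi (0 : ℝ), Real.exp (-((k : ℝ) + 1) * t) * G t)))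
    {t : ℝ} (ht : 0 < t) (hGt : ContinuousAt G t)
    (hdrop : ∀ ε > 0, ∃ r > 0, ∀ᶠ n in L, ∀ s s', 0 ≤ s → s ≤ t → s ≤ s' → s' ≤ s + r →
      F n s ≤ F n s' + ε) :
    Tendsto (fun n => F n t) L (𝓝 (G t)) := by
  rw [Metric.tendsto_nhds]
  intro ε hε
  obtain ⟨r, hr, hdrop⟩ := hdrop (ε / 4) (by positivity)
  obtain ⟨r', hr', hcont⟩ := Metric.continuousAt_iff.1 hGt (ε / 4) (by positivity)
  set δ := min r (min (r' / 2) (t / 2)) with hδ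
  have hδ0 : 0 < δ := by positivity
  have hδr : δ ≤ r := min_le_left _ _
  have hδr' : δ ≤ r' / 2 := (min_le_right _ _).trans (min_le_left _ _)
  have hδt : δ ≤ t / 2 := (min_le_right _ _).trans (min_le_right _ _)
  have hclose : ∀ s, |s - t| ≤ δ → |G s - G t| ≤ ε / 4 := fun s hs =>
    (hcont (by rw [Real.dist_eq]; linarith)).le
  -- `F n` does not drop by more than `ε / 4` within `r`. So `F n t` lies below its average just
  -- after `t` and above its average just before `t`, up to this error, and both averages converge
  -- to values near `G t`.
  obtain ⟨ψ, hψ, hψ0, hψs, hψ1⟩ := exists_bump ht (lt_add_of_pos_right t hδ0)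
  obtain ⟨χ, hχ, hχ0, hχs, hχ1⟩ := exists_bump (a := t - δ) (b := t) (by linarith) (by linarith)
  have hlimψ := tendsto_integral_comp_exp hF hF1 hG hG1 hlap hψ
  have hlimχ := tendsto_integral_comp_exp hF hF1 hG hG1 hlap hχ
  have hub : ∫ s in Set.Ioi (0 : ℝ), ψ (Real.exp (-s)) * Real.exp (-s) * G s ≤ G t + ε / 4 := by
    refine (integral_bump_le hψ hψ0 hψs hψ1 hG hG1 (g := fun _ => G t) measurable_const
      (fun _ _ => hG1 t ht) (ε / 4) fun s hs => ?_).trans_eq (by rw [integral_bump_const hψ1])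
    have := hclose s (by rw [abs_le]; constructor <;> linarith [hs.1, hs.2])
    linarith [(abs_le.1 this).2]
  have hlb : G t ≤ (∫ s in Set.Ioi (0 : ℝ), χ (Real.exp (-s)) * Real.exp (-s) * G s) + ε / 4 := by
    refine (integral_bump_const hχ1 (G t)).symm.trans_le (integral_bump_le hχ hχ0 hχs hχ1
      (f := fun _ => G t) measurable_const (fun _ _ => hG1 t ht) hG hG1 (ε / 4) fun s hs => ?_)
    have := hclose s (by rw [abs_le]; constructor <;> linarith [hs.1, hs.2])
    linarith [(abs_le.1 this).1]
  filter_upwards [hdrop, Metric.tendsto_nhds.1 hlimψ (ε / 4) (by positivity),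
    Metric.tendsto_nhds.1 hlimχ (ε / 4) (by positivity)] with n hn hnψ hnχ
  have h1 : F n t ≤ (∫ s in Set.Ioi (0 : ℝ), ψ (Real.exp (-s)) * Real.exp (-s) * F n s)
      + ε / 4 := by
    refine (integral_bump_const hψ1 (F n t)).symm.trans_le (integral_bump_le hψ hψ0 hψs hψ1
      (f := fun _ => F n t) measurable_const (fun _ _ => hF1 n t ht) (hF n) (hF1 n) (ε / 4)
      fun s hs => ?_)
    exact hn t s ht.le le_rfl hs.1 (by linarith [hs.2])
  have h2 : ∫ s in Set.Ioi (0 : ℝ), χ (Real.exp (-s)) * Real.exp (-s) * F n s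
      ≤ F n t + ε / 4 := by
    refine (integral_bump_le hχ hχ0 hχs hχ1 (hF n) (hF1 n) (g := fun _ => F n t) measurable_const
      (fun _ _ => hF1 n t ht) (ε / 4) fun s hs => ?_).trans_eq (by rw [integral_bump_const hχ1])
    exact hn s t (by linarith [hs.1]) hs.2 hs.2 (by linarith [hs.1])
  rw [Real.dist_eq, abs_lt] at hnψ hnχ ⊢
  constructor <;> linarith

/-- Uniqueness of Laplace transforms, for one-sided continuous functions. -/
theorem eq_of_laplace {f G : ℝ → ℝ} (hf : Measurable f) (hf1 : ∀ t, 0 < t → |f t| ≤ 1)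
    (hG : Measurable G) (hG1 : ∀ t, 0 < t → |G t| ≤ 1)
    (hlap : ∀ k : ℕ, ∫ t in Set.Ioi (0 : ℝ), Real.exp (-((k : ℝ) + 1) * t) * f t
      = ∫ t in Set.Ioi (0 : ℝ), Real.exp (-((k : ℝ) + 1) * t) * G t)
    {t : ℝ} (ht : 0 < t) (hft : ContinuousWithinAt f (Set.Iic t) t) (hGt : ContinuousAt G t) :
    f t = G t := by
  refine eq_of_abs_sub_le_all fun ε hε => ?_
  obtain ⟨r, hr, hcf⟩ := Metric.continuousWithinAt_iff.1 hft (ε / 2) (by positivity)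
  obtain ⟨r', hr', hcG⟩ := Metric.continuousAt_iff.1 hGt (ε / 2) (by positivity)
  set δ := min (r / 2) (min (r' / 2) (t / 2)) with hδ
  have hδ0 : 0 < δ := by positivity
  have hδr : δ ≤ r / 2 := min_le_left _ _
  have hδr' : δ ≤ r' / 2 := (min_le_right _ _).trans (min_le_left _ _)
  have hδt : δ ≤ t / 2 := (min_le_right _ _).trans (min_le_right _ _)
  obtain ⟨χ, hχ, hχ0, hχs, hχ1⟩ := exists_bump (a := t - δ) (b := t) (by linarith) (by linarith)
  -- The convergence theorem along a trivial filter is an equality of the integrals.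
  have hlim := tendsto_integral_comp_exp (L := (pure () : Filter Unit)) (F := fun _ => f)
    (fun _ => hf) (fun _ => hf1) hG hG1 (fun k => by rw [hlap k]; exact tendsto_const_nhds) hχ
  have heq := tendsto_nhds_unique tendsto_const_nhds hlim
  have key : ∀ g : ℝ → ℝ, Measurable g → (∀ t, 0 < t → |g t| ≤ 1) →
      (∀ s ∈ Set.Icc (t - δ) t, |g s - g t| ≤ ε / 2) →
      |(∫ s in Set.Ioi (0 : ℝ), χ (Real.exp (-s)) * Real.exp (-s) * g s) - g t| ≤ ε / 2 := by
    intro g hg hg1 hgt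
    rw [abs_le]
    constructor
    · have := (integral_bump_const hχ1 (g t)).symm.trans_le (integral_bump_le hχ hχ0 hχs hχ1
        (f := fun _ => g t) measurable_const (fun _ _ => hg1 t ht) hg hg1 (ε / 2) fun s hs => by
          linarith [(abs_le.1 (hgt s hs)).1])
      linarith
    · have := (integral_bump_le hχ hχ0 hχs hχ1 hg hg1 (g := fun _ => g t) measurable_const
        (fun _ _ => hg1 t ht) (ε / 2) fun s hs => by
          linarith [(abs_le.1 (hgt s hs)).2]).trans_eq (by rw [integral_bump_const hχ1])
      linarith
  have h1 := key f hf hf1 fun s hs => (hcf hs.2 (by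
    rw [Real.dist_eq, abs_lt]; constructor <;> linarith [hs.1, hs.2])).le
  have h2 := key G hG hG1 fun s hs => (hcG (by
    rw [Real.dist_eq, abs_lt]; constructor <;> linarith [hs.1, hs.2])).le
  rw [heq] at h1
  rw [abs_le] at h1 h2 ⊢
  constructor <;> linarith

end tauber

/-! ### Laplace transforms of laws on `[0, ∞]` as power means. -/

/-- `φ θ = E[u ^ θ]`, `θ > 0`, for some random variable `u` with values in `[0, 1]`; so that `φ` is
the Laplace transform of `- log u`, a law on `[0, ∞]`. -/
def IsPowerMean (φ : ℝ → ℝ) : Prop :=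
  ∃ ν : ProbabilityMeasure unitInterval, ∀ θ, 0 < θ → ∫ u, (u : ℝ) ^ θ ∂(ν : Measure unitInterval)
    = φ θ

namespace IsPowerMean

/-- The function `u ↦ u ^ θ` on the unit interval. -/
def powMap (θ : ℝ) (hθ : 0 < θ) : C(unitInterval, ℝ) :=
  ⟨fun u => (u : ℝ) ^ θ, Continuous.rpow_const continuous_subtype_val fun _ => Or.inr hθ.le⟩

variable {φ χ : ℝ → ℝ}

lemma rpow_mem (u : unitInterval) {θ : ℝ} (hθ : 0 < θ) : (u : ℝ) ^ θ ∈ Set.Icc (0 : ℝ) 1 :=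
  ⟨Real.rpow_nonneg u.2.1 _, Real.rpow_le_one u.2.1 u.2.2 hθ.le⟩

lemma aestronglyMeasurable_rpow (ν : Measure unitInterval) {θ : ℝ} (hθ : 0 < θ) :
    AEStronglyMeasurable (fun u : unitInterval => (u : ℝ) ^ θ) ν :=
  (powMap θ hθ).continuous.aestronglyMeasurable

lemma integrable_rpow (ν : Measure unitInterval) [IsProbabilityMeasure ν] {θ : ℝ} (hθ : 0 < θ) :
    Integrable (fun u : unitInterval => (u : ℝ) ^ θ) ν :=
  (powMap θ hθ).continuous.integrable_of_hasCompactSupport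
    (HasCompactSupport.of_compactSpace _)

lemma nonneg (h : IsPowerMean φ) {θ : ℝ} (hθ : 0 < θ) : 0 ≤ φ θ := by
  obtain ⟨ν, hν⟩ := h
  rw [← hν θ hθ]
  exact integral_nonneg fun u => (rpow_mem u hθ).1

lemma le_one (h : IsPowerMean φ) {θ : ℝ} (hθ : 0 < θ) : φ θ ≤ 1 := by
  obtain ⟨ν, hν⟩ := h
  rw [← hν θ hθ]
  calc _ ≤ ∫ _u : unitInterval, (1 : ℝ) ∂(ν : Measure unitInterval) :=
        integral_mono (integrable_rpow _ hθ) (integrable_const 1) fun u => (rpow_mem u hθ).2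
    _ = 1 := by simp

lemma congr (h : IsPowerMean φ) (hφ : ∀ θ, 0 < θ → φ θ = χ θ) : IsPowerMean χ := by
  obtain ⟨ν, hν⟩ := h
  exact ⟨ν, fun θ hθ => (hν θ hθ).trans (hφ θ hθ)⟩

lemma one : IsPowerMean fun _ => 1 :=
  ⟨⟨Measure.dirac 1, inferInstance⟩, fun θ hθ => by simp⟩

lemma mul (h : IsPowerMean φ) (h' : IsPowerMean χ) : IsPowerMean fun θ => φ θ * χ θ := by
  obtain ⟨ν, hν⟩ := h
  obtain ⟨ν', hν'⟩ := h'
  have hm : Measurable fun x : unitInterval × unitInterval => x.1 * x.2 := by fun_prop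
  refine ⟨⟨((ν : Measure unitInterval).prod (ν' : Measure unitInterval)).map fun x => x.1 * x.2,
    Measure.isProbabilityMeasure_map hm.aemeasurable⟩, fun θ hθ => ?_⟩
  beta_reduce
  rw [← hν θ hθ, ← hν' θ hθ, ← integral_prod_mul, ProbabilityMeasure.coe_mk,
    integral_map hm.aemeasurable (aestronglyMeasurable_rpow _ hθ)]
  refine integral_congr_ae (ae_of_all _ fun x => ?_)
  exact Real.mul_rpow x.1.2.1 x.2.2.1

lemma convexComb (h : IsPowerMean φ) (h' : IsPowerMean χ) {a : ℝ} (ha : 0 ≤ a) (ha1 : a ≤ 1) :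
    IsPowerMean fun θ => (1 - a) * φ θ + a * χ θ := by
  obtain ⟨ν, hν⟩ := h
  obtain ⟨ν', hν'⟩ := h'
  have hp : IsProbabilityMeasure (ENNReal.ofReal (1 - a) • (ν : Measure unitInterval)
      + ENNReal.ofReal a • (ν' : Measure unitInterval)) := by
    constructor
    simp only [Measure.add_apply, Measure.smul_apply, measure_univ, smul_eq_mul, mul_one]
    rw [← ENNReal.ofReal_add (by linarith) ha, sub_add_cancel, ENNReal.ofReal_one]
  refine ⟨⟨_, hp⟩, fun θ hθ => ?_⟩
  rw [ProbabilityMeasure.coe_mk, integral_add_measure, integral_smul_measure,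
    integral_smul_measure, hν θ hθ, hν' θ hθ, ENNReal.toReal_ofReal (by linarith),
    ENNReal.toReal_ofReal ha, smul_eq_mul, smul_eq_mul]
  · exact (integrable_rpow _ hθ).smul_measure ENNReal.ofReal_ne_top
  · exact (integrable_rpow _ hθ).smul_measure ENNReal.ofReal_ne_top

/-- Probability measures on the unit interval form a compact space, and `u ↦ u ^ θ` is continuous
for `θ > 0`, so any cluster point represents the limit. No tightness is needed, as mass may go to `u
= 0`, that is, to infinity for `- log u`. -/
lemma of_tendsto {f : ℕ → ℝ → ℝ} (hf : ∀ n, IsPowerMean (f n))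
    (hlim : ∀ θ, 0 < θ → Tendsto (fun n => f n θ) atTop (𝓝 (φ θ))) : IsPowerMean φ := by
  choose ν hν using hf
  obtain ⟨ν₀, hν₀⟩ := exists_clusterPt_of_compactSpace (map ν atTop)
  refine ⟨ν₀, fun θ hθ => ?_⟩
  have hc : Continuous fun ν : ProbabilityMeasure unitInterval =>
      ∫ u, (u : ℝ) ^ θ ∂(ν : Measure unitInterval) :=
    ProbabilityMeasure.continuous_integral_continuousMap (powMap θ hθ)
  have h1 : MapClusterPt (∫ u, (u : ℝ) ^ θ ∂(ν₀ : Measure unitInterval)) atTop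
      fun n => f n θ := by
    have := hν₀.map hc.continuousAt tendsto_map
    rw [map_map] at this
    have e : (fun ν : ProbabilityMeasure unitInterval =>
      ∫ u, (u : ℝ) ^ θ ∂(ν : Measure unitInterval)) ∘ ν = fun n => f n θ := by
      ext n; exact hν n θ hθ
    rwa [e] at this
  have h2 : ClusterPt (∫ u, (u : ℝ) ^ θ ∂(ν₀ : Measure unitInterval)) (𝓝 (φ θ)) :=
    ClusterPt.mono h1 (hlim θ hθ)
  exact eq_of_nhds_neBot h2

/-- The transform of a sum of a geometric number of independent terms. It is the limit of the
iterates of `g ↦ (1 - a) + a φ g`, which truncate the number of terms and stay in the class. -/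
lemma geometric (h : IsPowerMean φ) {a : ℝ} (ha : 0 ≤ a) (ha1 : a < 1) :
    IsPowerMean fun θ => (1 - a) / (1 - a * φ θ) := by
  set f : ℕ → ℝ → ℝ := fun n => Nat.rec (fun _ => 1)
    (fun _ g θ => (1 - a) * 1 + a * (φ θ * g θ)) n with hf
  have hf' : ∀ n, IsPowerMean (f n) := by
    intro n
    induction n with
    | zero => exact one
    | succ n ih => exact one.convexComb (h.mul ih) ha ha1.le
  refine of_tendsto hf' fun θ hθ => ?_
  have h0 := h.nonneg hθ
  have h1 := h.le_one hθ
  have haφ : 0 ≤ a * φ θ := mul_nonneg ha h0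
  have haφ1 : a * φ θ < 1 := by nlinarith
  set c := (1 - a) / (1 - a * φ θ) with hc
  have hcc : c * (1 - a * φ θ) = 1 - a := div_mul_cancel₀ _ (by linarith)
  have e : ∀ n, f n θ = c + (a * φ θ) ^ n * (1 - c) := by
    intro n
    induction n with
    | zero => simp [hf]
    | succ n ih =>
      have : f (n + 1) θ = (1 - a) * 1 + a * (φ θ * f n θ) := rfl
      rw [this, ih, pow_succ, ← hcc]
      ring
  simp only [e]
  have := (((tendsto_pow_atTop_nhds_zero_of_lt_one haφ haφ1).mul_const (1 - c)).const_add c)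
  simpa using this

/-- Mixtures of exponential laws. -/
lemma mixture {κ : Measure ℝ} [IsProbabilityMeasure κ] (hκ : ∀ᵐ z ∂κ, 0 ≤ z) :
    IsPowerMean fun θ => ∫ z, 1 / (1 + z * θ) ∂κ := by
  have := isProbabilityMeasure_expMeasure one_pos
  set g : ℝ × ℝ → unitInterval := fun x => ⟨Real.exp (-(max x.1 0 * max x.2 0)),
    (Real.exp_pos _).le, Real.exp_le_one_iff.2 (neg_nonpos.2 (by positivity))⟩ with hg
  have hm : Measurable g := Measurable.subtype_mk (by fun_prop)
  refine ⟨⟨(κ.prod (expMeasure 1)).map g, Measure.isProbabilityMeasure_map hm.aemeasurable⟩,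
    fun θ hθ => ?_⟩
  rw [ProbabilityMeasure.coe_mk, integral_map hm.aemeasurable (aestronglyMeasurable_rpow _ hθ)]
  have hint : Integrable (fun x => ((g x : unitInterval) : ℝ) ^ θ) (κ.prod (expMeasure 1)) := by
    refine Integrable.of_bound (C := 1) ?_ (ae_of_all _ fun x => ?_)
    · exact ((powMap θ hθ).continuous.measurable.comp hm).aestronglyMeasurable
    · rw [Real.norm_of_nonneg (rpow_mem _ hθ).1]
      exact (rpow_mem _ hθ).2
  rw [integral_prod _ hint]
  refine integral_congr_ae ?_
  filter_upwards [hκ] with z hz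
  have hpos : ∀ᵐ x ∂(expMeasure 1), 0 < x := by
    have := expMeasure_Iic_zero
    rw [ae_iff]
    simp only [not_lt]
    exact this
  have e1 : ∫ y, ((g (z, y) : unitInterval) : ℝ) ^ θ ∂(expMeasure 1)
      = ∫ y, Real.exp (-(z * θ) * y) ∂(expMeasure 1) := by
    refine integral_congr_ae ?_
    filter_upwards [hpos] with y hy
    simp only [hg, max_eq_left hz, max_eq_left hy.le]
    rw [← Real.exp_mul]
    ring_nf
  have e2 := lintegral_exp_gamma (α := 1) one_pos (mul_nonneg hz hθ.le)
  rw [e1, integral_eq_lintegral_of_nonneg_ae (ae_of_all _ fun y => (Real.exp_pos _).le)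
    (Measurable.aestronglyMeasurable (by fun_prop)), expMeasure, e2, Real.rpow_neg_one,
    ENNReal.toReal_ofReal (by positivity), one_div]

/-- The law of `-log u`, if it is finite. -/
theorem exists_law (h : IsPowerMean φ) (h0 : Tendsto φ (𝓝[>] 0) (𝓝 1)) :
    ∃ ν : Measure ℝ, IsProbabilityMeasure ν ∧ ν (Set.Iio 0) = 0 ∧
      ∀ θ, 0 < θ → ∫ x, Real.exp (-θ * x) ∂ν = φ θ := by
  obtain ⟨ν, hν⟩ := h
  have hzero : (ν : Measure unitInterval) {0} = 0 := by
    have hlim : Tendsto (fun n : ℕ => φ (1 / ((n : ℝ) + 1))) atTop (𝓝 1) := by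
      refine h0.comp (tendsto_nhdsWithin_iff.2 ⟨tendsto_one_div_add_atTop_nhds_zero_nat, ?_⟩)
      exact Eventually.of_forall fun n => Set.mem_Ioi.2 Nat.one_div_pos_of_nat
    -- Since `0 ^ θ = 0`, an atom at `u = 0` would keep `φ` away from one near `θ = 0`.
    have hle : ∀ θ, 0 < θ → φ θ ≤ (ν : Measure unitInterval).real {0}ᶜ := by
      intro θ hθ
      rw [← hν θ hθ, ← integral_indicator_one (measurableSet_singleton _).compl]
      refine integral_mono (integrable_rpow _ hθ) ?_ fun u => ?_
      · exact (integrable_const (1 : ℝ)).indicator (measurableSet_singleton _).compl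
      · by_cases hu : u = 0
        · simp [hu, Real.zero_rpow hθ.ne']
        · simpa [hu] using (rpow_mem u hθ).2
    have h1 : 1 ≤ (ν : Measure unitInterval).real {0}ᶜ :=
      le_of_tendsto' hlim fun n => hle _ Nat.one_div_pos_of_nat
    rw [probReal_compl_eq_one_sub (measurableSet_singleton _)] at h1
    have h2 : (ν : Measure unitInterval).real {0} = 0 := le_antisymm (by linarith) measureReal_nonneg
    exact (measureReal_eq_zero_iff).1 h2
  have hm : Measurable fun u : unitInterval => -Real.log (u : ℝ) := by fun_prop
  refine ⟨(ν : Measure unitInterval).map fun u : unitInterval => -Real.log (u : ℝ),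
    Measure.isProbabilityMeasure_map hm.aemeasurable, ?_, fun θ hθ => ?_⟩
  · rw [Measure.map_apply hm measurableSet_Iio]
    convert measure_empty (μ := (ν : Measure unitInterval))
    refine Set.eq_empty_of_forall_notMem fun u (hu : -Real.log (u : ℝ) < 0) => ?_
    linarith [Real.log_nonpos u.2.1 u.2.2]
  · rw [← hν θ hθ, integral_map hm.aemeasurable
      (by fun_prop : Measurable fun x : ℝ => Real.exp (-θ * x)).aestronglyMeasurable]
    refine integral_congr_ae ?_
    have hne : ∀ᵐ u ∂(ν : Measure unitInterval), u ≠ 0 := by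
      rw [ae_iff]; simpa using hzero
    filter_upwards [hne] with u hu
    have hpos : (0 : ℝ) < u := lt_of_le_of_ne u.2.1 fun h => hu (Subtype.ext h.symm)
    rw [Real.rpow_def_of_pos hpos]
    ring_nf

end IsPowerMean

/-! ### Existence of the law of the travel time. -/

section travelLaw

variable {α μ u : ℝ}

lemma IsTailLaw.tendsto_integral {ρ : Measure ℝ} (hα : 0 < α) (hρ : IsTailLaw α ρ) (hα1 : α < 1)
    (u : ℝ) :
    Tendsto (fun x : ℝ => x ^ α * ∫ y, (Set.Ioi (u * x)).indicator (fun y => y / (y + x)) y ∂ρ)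
      atTop (𝓝 (tailIntegral α u).toReal) := by
  refine ((ENNReal.tendsto_toReal (tailIntegral_lt_top hα hα1 u).ne).comp
    (hρ.tendsto_lintegral hα hα1 u)).congr' ?_
  filter_upwards [eventually_gt_atTop 0] with x hx
  rw [Function.comp_apply, ENNReal.toReal_mul, ENNReal.toReal_ofReal (by positivity),
    integral_eq_lintegral_of_nonneg_ae]
  · congr 2
    refine lintegral_congr fun y => ?_
    by_cases hy : y ∈ Set.Ioi (u * x) <;> simp [hy]
  · filter_upwards [hρ.pos] with y hy
    exact Set.indicator_apply_nonneg fun _ => by positivity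
  · exact (Measurable.indicator (by fun_prop) measurableSet_Ioi).aestronglyMeasurable

/-- `E[1 / (1 + z u)]`, for a Pareto variable `z`. -/
def paretoMean (α u : ℝ) : ℝ := ∫ z, 1 / (1 + z * u) ∂(paretoMeasure 1 α)

lemma integrable_one_div_pareto (hα : 0 < α) (hu : 0 ≤ u) {f : ℝ → ℝ} (hf : Measurable f)
    (hf0 : ∀ z, 0 < z → 0 ≤ f z) :
    Integrable (fun z => 1 / (1 + f z * u)) (paretoMeasure 1 α) := by
  have := isProbabilityMeasure_paretoMeasure one_pos hα
  refine Integrable.of_bound (C := 1) (Measurable.aestronglyMeasurable (by fun_prop)) ?_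
  filter_upwards [(isTailLaw_pareto hα).pos] with z hz
  have : 0 ≤ f z * u := mul_nonneg (hf0 z hz) hu
  rw [Real.norm_of_nonneg (by positivity), div_le_one (by positivity)]
  linarith

lemma paretoMean_eq (hα : 0 < α) (hα1 : α < 1) (hu : 0 < u) :
    paretoMean α u = 1 - u ^ α * (tailIntegral α u).toReal := by
  have := isProbabilityMeasure_paretoMeasure one_pos hα
  have h := congrArg ENNReal.toReal (lintegral_pareto_eq_tailIntegral hα hu)
  rw [ENNReal.toReal_mul, ENNReal.toReal_ofReal (by positivity),
    ← integral_eq_lintegral_of_nonneg_ae] at h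
  · rw [← h, paretoMean, eq_sub_iff_add_eq, ← integral_add]
    · rw [integral_congr_ae (g := fun _ => (1 : ℝ)) ?_]
      · simp
      filter_upwards [(isTailLaw_pareto hα).pos] with z hz
      have : 0 < 1 + z * u := by positivity
      field_simp
    · exact integrable_one_div_pareto hα hu.le measurable_id fun z hz => hz.le
    · refine Integrable.of_bound (C := 1) (Measurable.aestronglyMeasurable (by fun_prop)) ?_
      filter_upwards [(isTailLaw_pareto hα).pos] with z hz
      rw [Real.norm_of_nonneg (by positivity), div_le_one (by positivity)]
      linarith
  · filter_upwards [(isTailLaw_pareto hα).pos] with z hz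
    positivity
  · exact Measurable.aestronglyMeasurable (by fun_prop)

lemma paretoMean_zero (hα : 0 < α) : paretoMean α 0 = 1 := by
  have := isProbabilityMeasure_paretoMeasure one_pos hα
  simp [paretoMean]

lemma paretoMean_pos (hα : 0 < α) (hu : 0 ≤ u) : 0 < paretoMean α u := by
  have := isProbabilityMeasure_paretoMeasure one_pos hα
  have hae : ∀ᵐ z ∂(paretoMeasure 1 α), 0 < 1 / (1 + z * u) := by
    filter_upwards [(isTailLaw_pareto hα).pos] with z hz
    positivity
  rw [paretoMean, integral_pos_iff_support_of_nonneg_ae (hae.mono fun z hz => hz.le)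
    (integrable_one_div_pareto hα hu measurable_id fun z hz => hz.le)]
  rw [measure_congr (t := Set.univ), measure_univ]
  · exact one_pos
  filter_upwards [hae] with z hz
  exact propext ⟨fun _ => trivial, fun _ => hz.ne'⟩

lemma tailIntegral_zero_toReal (hα : 0 < α) (hα1 : α < 1) :
    (tailIntegral α 0).toReal = α * Real.pi / Real.sin (α * Real.pi) := by
  have hs : 0 < Real.sin (α * Real.pi) := Real.sin_pos_of_pos_of_lt_pi (by positivity)
    (by nlinarith [Real.pi_pos])
  rw [tailIntegral_zero hα hα1, beta_one_sub, ENNReal.toReal_ofReal (by positivity), mul_div_assoc]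

/-- The reciprocal of the Laplace transform of the travel time, as a function of `u = θ / μ`. -/
def travelExponent (α u : ℝ) : ℝ := (tailIntegral α 0).toReal * u ^ α + paretoMean α u

/-- In this form the exponent is the limit of `1 + n^α (1 - φ_n)`, with `φ_n` the transform of one
rescaled contribution of a truncated Pareto depth. -/
lemma travelExponent_eq (hα : 0 < α) (hα1 : α < 1) (hu : 0 < u) : travelExponent α u
    = 1 + u ^ α * ((tailIntegral α 0).toReal - (tailIntegral α u).toReal) := by
  rw [travelExponent, paretoMean_eq hα hα1 hu]
  ring

/-- Traps of depth at most `n`, on the scale `n`. -/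
def truncScale (μ : ℝ) (n : ℕ) (z : ℝ) : ℝ := (Set.Iic (n : ℝ)).indicator (fun z => z / (n * μ)) z

lemma measurable_truncScale (μ : ℝ) (n : ℕ) : Measurable (truncScale μ n) :=
  Measurable.indicator (by fun_prop) measurableSet_Iic

lemma truncScale_nonneg (hμ : 0 < μ) (n : ℕ) {z : ℝ} (hz : 0 < z) : 0 ≤ truncScale μ n z :=
  Set.indicator_apply_nonneg fun _ => by positivity

/-- With `x = n μ / θ` one has `1 - 1 / (1 + zθ / (nμ)) = z / (z + x)`, and `z ≤ n` means `z ≤ (θ /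
μ) x`. The quantity is thus a difference of two truncated means with the known asymptotics. -/
lemma tendsto_truncScale (hα : 0 < α) (hα1 : α < 1) (hμ : 0 < μ) {θ : ℝ} (hθ : 0 < θ) :
    Tendsto (fun n : ℕ => (n : ℝ) ^ α
        * (1 - ∫ z, 1 / (1 + truncScale μ n z * θ) ∂(paretoMeasure 1 α))) atTop
      (𝓝 ((θ / μ) ^ α * ((tailIntegral α 0).toReal - (tailIntegral α (θ / μ)).toReal))) := by
  have := isProbabilityMeasure_paretoMeasure one_pos hα
  have hu : 0 < θ / μ := by positivity
  have hT := isTailLaw_pareto hα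
  have hx : Tendsto (fun n : ℕ => (n : ℝ) / (θ / μ)) atTop atTop :=
    tendsto_natCast_atTop_atTop.atTop_div_const hu
  have h := (((hT.tendsto_integral hα hα1 0).sub (hT.tendsto_integral hα hα1 (θ / μ))).comp
    hx).const_mul ((θ / μ) ^ α)
  refine h.congr' ?_
  filter_upwards [eventually_gt_atTop 0] with n hn
  have hn0 : (0 : ℝ) < n := by exact_mod_cast hn
  set x : ℝ := n / (θ / μ) with hxdef
  have hx0 : 0 < x := by positivity
  have hnx : (n : ℝ) = θ / μ * x := by rw [hxdef]; field_simp
  have hint : ∀ c : ℝ, Integrable ((Set.Ioi (c * x)).indicator fun y => y / (y + x))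
      (paretoMeasure 1 α) := by
    intro c
    refine Integrable.indicator (Integrable.of_bound (C := 1) (Measurable.aestronglyMeasurable (by fun_prop)) ?_) measurableSet_Ioi
    filter_upwards [hT.pos] with z hz
    rw [Real.norm_of_nonneg (by positivity), div_le_one (by positivity)]
    linarith
  have e : 1 - ∫ z, 1 / (1 + truncScale μ n z * θ) ∂(paretoMeasure 1 α)
      = (∫ y, (Set.Ioi (0 * x)).indicator (fun y => y / (y + x)) y ∂(paretoMeasure 1 α))
        - ∫ y, (Set.Ioi (θ / μ * x)).indicator (fun y => y / (y + x)) y ∂(paretoMeasure 1 α) := by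
    have hint' := integrable_one_div_pareto hα hθ.le (measurable_truncScale μ n)
      fun z hz => truncScale_nonneg hμ n hz
    have h1 : (1 : ℝ) = ∫ _, 1 ∂(paretoMeasure 1 α) := by simp
    rw [sub_eq_sub_iff_add_eq_add, ← integral_add (hint 0) hint']
    nth_rewrite 1 [h1]
    rw [← integral_add (integrable_const 1) (hint (θ / μ))]
    refine integral_congr_ae ?_
    filter_upwards [hT.pos] with z hz
    have hz0 : z ∈ Set.Ioi (0 * x) := by simpa using hz
    simp only [truncScale]
    rw [Set.indicator_of_mem hz0]
    by_cases hzn : z ≤ n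
    · rw [Set.indicator_of_mem (show z ∈ Set.Iic (n : ℝ) from hzn),
        Set.indicator_of_notMem (show z ∉ Set.Ioi (θ / μ * x) by rw [← hnx]; simpa using hzn)]
      rw [hnx]
      field_simp
      ring
    · rw [Set.indicator_of_notMem (show z ∉ Set.Iic (n : ℝ) from hzn),
        Set.indicator_of_mem (show z ∈ Set.Ioi (θ / μ * x) by rw [← hnx]; simpa using hzn)]
      simp [add_comm]
  rw [e, Function.comp_apply, ← hxdef]
  rw [hnx, Real.mul_rpow hu.le hx0.le]
  ring

/-- With `a = n^α / (1 + n^α)` the geometric sum of rescaled exponential times in Pareto traps of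
depth at most `n` has transform `(1 + n^α (1 - φ_n))⁻¹`: a travel between successive traps deeper
than `n`, on the scale `n`. -/
lemma isPowerMean_travel (hα : 0 < α) (hα1 : α < 1) (hμ : 0 < μ) :
    IsPowerMean fun θ => (travelExponent α (θ / μ))⁻¹ := by
  have := isProbabilityMeasure_paretoMeasure one_pos hα
  have hT := isTailLaw_pareto hα
  set φ : ℕ → ℝ → ℝ := fun n θ => ∫ z, 1 / (1 + truncScale μ n z * θ) ∂(paretoMeasure 1 α)
    with hφ
  have hφm : ∀ n, IsPowerMean (φ n) := by
    intro n
    have hm := measurable_truncScale μ n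
    have := Measure.isProbabilityMeasure_map (μ := paretoMeasure 1 α) hm.aemeasurable
    refine (IsPowerMean.mixture (κ := (paretoMeasure 1 α).map (truncScale μ n)) ?_).congr
      fun θ _ => ?_
    · rw [ae_map_iff hm.aemeasurable measurableSet_Ici]
      exact hT.pos.mono fun z hz => truncScale_nonneg hμ n hz
    · rw [integral_map hm.aemeasurable
        (by fun_prop : Measurable fun z : ℝ => 1 / (1 + z * θ)).aestronglyMeasurable]
  have hg : ∀ n : ℕ, IsPowerMean fun θ => (1 + (n : ℝ) ^ α * (1 - φ n θ))⁻¹ := by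
    intro n
    have hc : (0 : ℝ) ≤ (n : ℝ) ^ α := by positivity
    have hc1 : (n : ℝ) ^ α / (1 + (n : ℝ) ^ α) < 1 := by rw [div_lt_one (by positivity)]; linarith
    refine ((hφm n).geometric (by positivity) hc1).congr fun θ hθ => ?_
    have h1 := (hφm n).le_one hθ
    have : 0 < 1 + (n : ℝ) ^ α * (1 - φ n θ) := by nlinarith
    have e : 1 - (n : ℝ) ^ α / (1 + (n : ℝ) ^ α) * φ n θ
        = (1 + (n : ℝ) ^ α * (1 - φ n θ)) / (1 + (n : ℝ) ^ α) := by
      field_simp; ring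
    rw [e]
    field_simp
    ring
  refine IsPowerMean.of_tendsto hg fun θ hθ => ?_
  have hu : 0 < θ / μ := by positivity
  have hD := travelExponent_eq hα hα1 hu
  have hpos : 0 < travelExponent α (θ / μ) :=
    add_pos_of_nonneg_of_pos (by positivity) (paretoMean_pos hα hu.le)
  refine Tendsto.inv₀ ?_ hpos.ne'
  rw [hD]
  exact (tendsto_truncScale hα hα1 hμ hθ).const_add 1

/-- This excludes an atom at infinity in the law obtained by compactness. -/
lemma tendsto_travelExponent (hα : 0 < α) (hα1 : α < 1) :
    Tendsto (travelExponent α) (𝓝[>] 0) (𝓝 1) := by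
  have hpow : Tendsto (fun u : ℝ => u ^ α) (𝓝[>] 0) (𝓝 0) := by
    have := (Real.continuousAt_rpow_const 0 α (Or.inr hα.le)).tendsto
    rw [Real.zero_rpow hα.ne'] at this
    exact this.mono_left nhdsWithin_le_nhds
  have h0 : Tendsto (fun u : ℝ => u ^ α * ((tailIntegral α 0).toReal
      - (tailIntegral α u).toReal)) (𝓝[>] 0) (𝓝 0) := by
    refine squeeze_zero' ?_ ?_ (by simpa using hpow.mul_const (tailIntegral α 0).toReal)
    · filter_upwards [self_mem_nhdsWithin] with u (hu : 0 < u)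
      refine mul_nonneg (by positivity) (sub_nonneg.2 ?_)
      exact ENNReal.toReal_mono (tailIntegral_lt_top hα hα1 0).ne (tailIntegral_anti hα hu.le)
    · filter_upwards [self_mem_nhdsWithin] with u (hu : 0 < u)
      have : 0 ≤ (tailIntegral α u).toReal := ENNReal.toReal_nonneg
      gcongr
      linarith
  have := h0.const_add 1
  rw [add_zero] at this
  refine this.congr' ?_
  filter_upwards [self_mem_nhdsWithin] with u hu
  rw [travelExponent_eq hα hα1 hu]

theorem exists_isTravelLaw (hα : 0 < α) (hα1 : α < 1) (hμ : 0 < μ) :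
    ∃ νU : Measure ℝ, IsTravelLaw α μ νU ∧
      ∀ θ, 0 < θ → ∫ x, Real.exp (-θ * x) ∂νU = (travelExponent α (θ / μ))⁻¹ := by
  have hlim : Tendsto (fun θ => (travelExponent α (θ / μ))⁻¹) (𝓝[>] 0) (𝓝 1) := by
    rw [← inv_one]
    refine Tendsto.inv₀ ((tendsto_travelExponent hα hα1).comp ?_) one_ne_zero
    refine tendsto_nhdsWithin_iff.2 ⟨?_, ?_⟩
    · have : Continuous fun θ : ℝ => θ / μ := by fun_prop
      have := this.tendsto 0
      rw [zero_div] at this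
      exact this.mono_left nhdsWithin_le_nhds
    · filter_upwards [self_mem_nhdsWithin] with θ (hθ : 0 < θ)
      exact Set.mem_Ioi.2 (by positivity)
  obtain ⟨ν, hp, hn, h⟩ := (isPowerMean_travel hα hα1 hμ).exists_law hlim
  refine ⟨ν, ⟨hp, hn, fun θ hθ => ?_⟩, h⟩
  rw [← tailIntegral_zero_toReal hα hα1, ← integral_pareto_eq hα (by positivity : 0 ≤ θ / μ)]
  rcases hθ.eq_or_lt with rfl | hθ
  · have := paretoMean_zero hα
    rw [paretoMean] at this
    simp only [zero_div, this, Real.zero_rpow hα.ne']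
    simp
  · exact h θ hθ

end travelLaw

/-! ### The renewal series and its Laplace transform. -/

section renewal

lemma lintegral_exp_Ioi {k : ℝ} (hk : 0 < k) (a : ℝ) :
    ∫⁻ r in Set.Ioi a, ENNReal.ofReal (Real.exp (-k * r)) = ENNReal.ofReal (Real.exp (-k * a) / k) := by
  rw [← ofReal_integral_eq_lintegral_ofReal (integrableOn_exp_mul_Ioi (by linarith) a)
    (ae_of_all _ fun r => (Real.exp_pos _).le), integral_exp_mul_Ioi (by linarith)]
  congr 1
  field_simp

lemma lintegral_exp_Ioc {k : ℝ} (hk : 0 < k) {a b : ℝ} (hab : a ≤ b) :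
    ∫⁻ r in Set.Ioc a b, ENNReal.ofReal (Real.exp (-k * r))
      = ENNReal.ofReal ((Real.exp (-k * a) - Real.exp (-k * b)) / k) := by
  have h := lintegral_union (μ := volume) (f := fun r => ENNReal.ofReal (Real.exp (-k * r)))
    (measurableSet_Ioi (a := b)) (Set.Ioc_disjoint_Ioi_same (a := a))
  rw [Set.Ioc_union_Ioi_eq_Ioi hab, lintegral_exp_Ioi hk, lintegral_exp_Ioi hk] at h
  rw [sub_div, ENNReal.ofReal_sub _ (by positivity), h, ENNReal.add_sub_cancel_right
    ENNReal.ofReal_ne_top]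

/-- The time before the `j`-th renewal. -/
def renewalTime (j : ℕ) (w : ℕ → ℝ × ℝ) : ℝ := ∑ i ∈ Finset.range j, ((w i).1 + (w i).2)

lemma measurable_renewalTime (j : ℕ) : Measurable (renewalTime j) := by
  unfold renewalTime; fun_prop

lemma renewalTime_succ (j : ℕ) (w : ℕ → ℝ × ℝ) :
    renewalTime (j + 1) w = renewalTime j w + (w j).1 + (w j).2 := by
  rw [renewalTime, Finset.sum_range_succ, ← renewalTime, add_assoc]

lemma renewalTime_mono {w : ℕ → ℝ × ℝ} (hw : ∀ i, 0 ≤ (w i).1 ∧ 0 ≤ (w i).2) :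
    Monotone fun j => renewalTime j w :=
  monotone_nat_of_le_succ fun j => by
    rw [renewalTime_succ]; linarith [(hw j).1, (hw j).2]

lemma renewalTime_nonneg {w : ℕ → ℝ × ℝ} (hw : ∀ i, 0 ≤ (w i).1 ∧ 0 ≤ (w i).2) (j : ℕ) :
    0 ≤ renewalTime j w :=
  Finset.sum_nonneg fun i _ => add_nonneg (hw i).1 (hw i).2

/-- The event that the time `r` falls into the `j`-th holding time. -/
def holdingEvent (j : ℕ) (r : ℝ) : Set (ℕ → ℝ × ℝ) :=
  {w | renewalTime j w + (w j).1 < r ∧ r ≤ renewalTime (j + 1) w}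

lemma measurableSet_holdingEvent_uncurry (j : ℕ) :
    MeasurableSet {x : ℝ × (ℕ → ℝ × ℝ) | x.2 ∈ holdingEvent j x.1} := by
  have h := measurable_renewalTime j
  have h' := measurable_renewalTime (j + 1)
  exact (measurableSet_lt (by fun_prop) measurable_fst).inter
    (measurableSet_le measurable_fst (by fun_prop))

lemma measurableSet_holdingEvent (j : ℕ) (r : ℝ) : MeasurableSet (holdingEvent j r) :=
  measurable_prodMk_left (measurableSet_holdingEvent_uncurry j)

/-- The law of the sequence of travel and holding times. -/
abbrev renewalLaw (νU νS : Measure ℝ) : Measure (ℕ → ℝ × ℝ) :=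
  Measure.infinitePi fun _ : ℕ => νU.prod νS

lemma renewalProb_eq (νU νS : Measure ℝ) (r : ℝ) :
    renewalProb νU νS r = ∑' j, renewalLaw νU νS (holdingEvent j r) := rfl

/-- The Laplace transform of a law on `[0, ∞)`. -/
def laplaceLaw (ν : Measure ℝ) (k : ℝ) : ℝ≥0∞ := ∫⁻ x, ENNReal.ofReal (Real.exp (-k * x)) ∂ν

lemma lintegral_exp_prod (νU νS : Measure ℝ) [IsProbabilityMeasure νS] (k : ℝ) :
    ∫⁻ x, ENNReal.ofReal (Real.exp (-k * x.1)) * ENNReal.ofReal (Real.exp (-k * x.2))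
      ∂(νU.prod νS) = laplaceLaw νU k * laplaceLaw νS k := by
  rw [lintegral_prod_mul (f := fun x => ENNReal.ofReal (Real.exp (-k * x)))
    (g := fun x => ENNReal.ofReal (Real.exp (-k * x))) (by fun_prop) (by fun_prop)]
  rfl

variable {νU νS : Measure ℝ} [IsProbabilityMeasure νU] [IsProbabilityMeasure νS]

lemma renewalLaw_ae_nonneg (hU : νU (Set.Iio 0) = 0) (hS : νS (Set.Iio 0) = 0) :
    ∀ᵐ w ∂(renewalLaw νU νS), ∀ i, 0 ≤ (w i).1 ∧ 0 ≤ (w i).2 := by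
  refine ae_all_iff.2 fun i => ?_
  have h := (measurePreserving_eval_infinitePi (fun _ : ℕ => νU.prod νS) i).quasiMeasurePreserving
  have h1 := (Measure.quasiMeasurePreserving_fst (μ := νU) (ν := νS)).comp h
  have h2 := (Measure.quasiMeasurePreserving_snd (μ := νU) (ν := νS)).comp h
  have e1 : ∀ᵐ x ∂νU, 0 ≤ x := by rw [ae_iff]; simp only [not_le]; exact hU
  have e2 : ∀ᵐ x ∂νS, 0 ≤ x := by rw [ae_iff]; simp only [not_le]; exact hS
  exact (h1.ae e1).and (h2.ae e2)

lemma lintegral_prod_mul_renewalLaw {g h : ℝ × ℝ → ℝ≥0∞} (hg : Measurable g) (hh : Measurable h)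
    (j : ℕ) :
    ∫⁻ w, (∏ i ∈ Finset.range j, g (w i)) * h (w j) ∂(renewalLaw νU νS)
      = (∫⁻ x, g x ∂(νU.prod νS)) ^ j * ∫⁻ x, h x ∂(νU.prod νS) := by
  set f : ℕ → ℝ × ℝ → ℝ≥0∞ := fun i => if i = j then h else g with hf
  have hfm : ∀ i, Measurable (f i) := fun i => by
    simp only [hf]; split_ifs <;> assumption
  have hev : ∀ i, ∫⁻ w, f i (w i) ∂(renewalLaw νU νS) = ∫⁻ x, f i x ∂(νU.prod νS) := fun i =>
    (measurePreserving_eval_infinitePi (fun _ : ℕ => νU.prod νS) i).lintegral_comp (hfm i)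
  have key := lintegral_prod_eq_prod_lintegral_of_indepFun (Finset.range (j + 1)) _
    (iIndepFun_infinitePi (P := fun _ : ℕ => νU.prod νS) (X := f) hfm)
    (fun i => (hfm i).comp (measurable_pi_apply i))
  have hlt : ∀ i ∈ Finset.range j, f i = g := fun i hi => by
    simp [hf, (Finset.mem_range.1 hi).ne]
  have hjj : f j = h := by simp [hf]
  calc _ = ∫⁻ w, ∏ i ∈ Finset.range (j + 1), f i (w i) ∂(renewalLaw νU νS) := by
        refine lintegral_congr fun w => ?_
        rw [Finset.prod_range_succ, hjj]
        congr 1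
        exact Finset.prod_congr rfl fun i hi => by rw [hlt i hi]
    _ = _ := by
        rw [key, Finset.prod_range_succ, hev, hjj, Finset.prod_congr rfl fun i hi => ?_,
          Finset.prod_const, Finset.card_range]
        rw [hev, hlt i hi]

lemma exp_renewalTime (k : ℝ) (j : ℕ) (w : ℕ → ℝ × ℝ) :
    ENNReal.ofReal (Real.exp (-k * renewalTime j w)) = ∏ i ∈ Finset.range j,
      (ENNReal.ofReal (Real.exp (-k * (w i).1)) * ENNReal.ofReal (Real.exp (-k * (w i).2))) := by
  rw [renewalTime, Finset.mul_sum, Real.exp_sum, ENNReal.ofReal_prod_of_nonneg fun i _ =>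
    (Real.exp_pos _).le]
  refine Finset.prod_congr rfl fun i _ => ?_
  rw [mul_add, Real.exp_add, ENNReal.ofReal_mul (Real.exp_pos _).le]

lemma lintegral_exp_start (k : ℝ) (j : ℕ) :
    ∫⁻ w, ENNReal.ofReal (Real.exp (-k * (renewalTime j w + (w j).1))) ∂(renewalLaw νU νS)
      = (laplaceLaw νU k * laplaceLaw νS k) ^ j * laplaceLaw νU k := by
  rw [← lintegral_exp_prod]
  have e : laplaceLaw νU k = ∫⁻ x, ENNReal.ofReal (Real.exp (-k * x.1)) ∂(νU.prod νS) := by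
    have := lintegral_prod_mul (μ := νU) (ν := νS)
      (f := fun x => ENNReal.ofReal (Real.exp (-k * x))) (g := fun _ => 1) (by fun_prop) (by fun_prop)
    simpa [laplaceLaw] using this.symm
  rw [e, ← lintegral_prod_mul_renewalLaw (by fun_prop) (by fun_prop)]
  refine lintegral_congr fun w => ?_
  rw [← exp_renewalTime, ← ENNReal.ofReal_mul (Real.exp_pos _).le, ← Real.exp_add, mul_add]

/-- The Laplace transform of the renewal probability. -/
theorem lintegral_exp_renewalProb (hU : νU (Set.Iio 0) = 0) (hS : νS (Set.Iio 0) = 0) {k : ℝ}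
    (hk : 0 < k) :
    ∫⁻ r in Set.Ioi (0 : ℝ), ENNReal.ofReal (Real.exp (-k * r)) * renewalProb νU νS r
      = ENNReal.ofReal (1 / k) * ((1 - laplaceLaw νU k * laplaceLaw νS k)⁻¹
        * (laplaceLaw νU k * ∫⁻ x, ENNReal.ofReal (1 - Real.exp (-k * x)) ∂νS)) := by
  have hterm : ∀ j, ∫⁻ r in Set.Ioi (0 : ℝ), ENNReal.ofReal (Real.exp (-k * r))
        * renewalLaw νU νS (holdingEvent j r)
      = ENNReal.ofReal (1 / k) * ((laplaceLaw νU k * laplaceLaw νS k) ^ j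
        * (laplaceLaw νU k * ∫⁻ x, ENNReal.ofReal (1 - Real.exp (-k * x)) ∂νS)) := by
    intro j
    have hm := measurableSet_holdingEvent_uncurry j
    calc _ = ∫⁻ r in Set.Ioi (0 : ℝ), ∫⁻ w, ENNReal.ofReal (Real.exp (-k * r))
          * (holdingEvent j r).indicator (1 : (ℕ → ℝ × ℝ) → ℝ≥0∞) w ∂(renewalLaw νU νS) := by
          refine lintegral_congr fun r => ?_
          rw [lintegral_const_mul' _ _ ENNReal.ofReal_ne_top,
            lintegral_indicator_one (measurableSet_holdingEvent j r)]
      _ = ∫⁻ w, (∫⁻ r in Set.Ioi (0 : ℝ), ENNReal.ofReal (Real.exp (-k * r))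
          * (holdingEvent j r).indicator (1 : (ℕ → ℝ × ℝ) → ℝ≥0∞) w) ∂(renewalLaw νU νS) := by
          refine lintegral_lintegral_swap (Measurable.aemeasurable ?_)
          have h1 : Measurable fun x : ℝ × (ℕ → ℝ × ℝ) =>
              {x : ℝ × (ℕ → ℝ × ℝ) | x.2 ∈ holdingEvent j x.1}.indicator (1 : ℝ × (ℕ → ℝ × ℝ) → ℝ≥0∞) x :=
            measurable_one.indicator hm
          exact Measurable.mul (by fun_prop) h1
      _ = ∫⁻ w, ENNReal.ofReal (1 / k) * ((∏ i ∈ Finset.range j,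
          (ENNReal.ofReal (Real.exp (-k * (w i).1)) * ENNReal.ofReal (Real.exp (-k * (w i).2))))
          * (ENNReal.ofReal (Real.exp (-k * (w j).1)) * ENNReal.ofReal (1 - Real.exp (-k * (w j).2))))
          ∂(renewalLaw νU νS) := by
          refine lintegral_congr_ae ?_
          filter_upwards [renewalLaw_ae_nonneg hU hS] with w hw
          have ha := renewalTime_nonneg hw j
          set a := renewalTime j w + (w j).1 with hadef
          have ha0 : 0 ≤ a := add_nonneg ha (hw j).1
          have hb : renewalTime (j + 1) w = a + (w j).2 := renewalTime_succ j w
          have hab : a ≤ a + (w j).2 := by linarith [(hw j).2]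
          -- For a fixed sequence the event holds exactly for `r` in a half-open interval, the
          -- `j`-th holding interval, so the integral over `r` is explicit and factorizes over the
          -- independent pairs.
          have e : ∀ r, ENNReal.ofReal (Real.exp (-k * r)) * (holdingEvent j r).indicator (1 : (ℕ → ℝ × ℝ) → ℝ≥0∞) w
              = (Set.Ioc a (a + (w j).2)).indicator (fun r => ENNReal.ofReal (Real.exp (-k * r))) r := by
            intro r
            have : w ∈ holdingEvent j r ↔ r ∈ Set.Ioc a (a + (w j).2) := by
              rw [holdingEvent, Set.mem_ofPred_eq, hb]; rfl
            by_cases hr : r ∈ Set.Ioc a (a + (w j).2)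
            · rw [Set.indicator_of_mem hr, Set.indicator_of_mem (this.2 hr), Pi.one_apply, mul_one]
            · rw [Set.indicator_of_notMem hr, Set.indicator_of_notMem (mt this.1 hr), mul_zero]
          simp only [e]
          rw [setLIntegral_indicator measurableSet_Ioc, Set.inter_eq_left.2
            (fun r hr => Set.mem_Ioi.2 (lt_of_le_of_lt ha0 hr.1)), lintegral_exp_Ioc hk hab, ← exp_renewalTime,
            ← ENNReal.ofReal_mul (Real.exp_pos _).le, ← ENNReal.ofReal_mul (Real.exp_pos _).le,
            ← ENNReal.ofReal_mul (by positivity)]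
          congr 1
          have e1 : Real.exp (-k * a) = Real.exp (-k * renewalTime j w) * Real.exp (-k * (w j).1) := by
            rw [← Real.exp_add, hadef, mul_add]
          have e2 : Real.exp (-k * (a + (w j).2)) = Real.exp (-k * a) * Real.exp (-k * (w j).2) := by
            rw [← Real.exp_add, mul_add (-k) a]
          rw [e2, e1]
          ring
      _ = _ := by
          rw [lintegral_const_mul' _ _ ENNReal.ofReal_ne_top]
          congr 1
          rw [lintegral_prod_mul_renewalLaw
            (g := fun x => ENNReal.ofReal (Real.exp (-k * x.1)) * ENNReal.ofReal (Real.exp (-k * x.2)))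
            (h := fun x => ENNReal.ofReal (Real.exp (-k * x.1))
              * ENNReal.ofReal (1 - Real.exp (-k * x.2))) (by fun_prop) (by fun_prop),
            lintegral_exp_prod, lintegral_prod_mul (f := fun x => ENNReal.ofReal (Real.exp (-k * x)))
              (g := fun x => ENNReal.ofReal (1 - Real.exp (-k * x))) (by fun_prop) (by fun_prop)]
          rfl
  simp only [renewalProb_eq, ← ENNReal.tsum_mul_left]
  rw [lintegral_tsum]
  · simp only [hterm]
    rw [ENNReal.tsum_mul_left, ENNReal.tsum_mul_right, ENNReal.tsum_geometric]
  · intro j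
    have := measurable_measure_prodMk_left (ν := renewalLaw νU νS)
      (measurableSet_holdingEvent_uncurry j)
    exact (Measurable.mul (by fun_prop) this).aemeasurable

lemma measurable_renewalProb : Measurable (renewalProb νU νS) := by
  refine Measurable.tsum fun j => ?_
  exact measurable_measure_prodMk_left (ν := renewalLaw νU νS)
    (measurableSet_holdingEvent_uncurry j)

lemma renewalProb_le_one (hU : νU (Set.Iio 0) = 0) (hS : νS (Set.Iio 0) = 0) (r : ℝ) :
    renewalProb νU νS r ≤ 1 := by
  rw [renewalProb_eq, ← measure_iUnion₀]
  · exact prob_le_one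
  · intro i j hij
    refine measure_mono_null (fun w hw => ?_) (ae_iff.1 (renewalLaw_ae_nonneg hU hS))
    intro hnn
    have hmono := renewalTime_mono hnn
    obtain ⟨⟨h1, h2⟩, h3, h4⟩ := hw
    rcases lt_or_gt_of_ne hij with h | h
    · have : renewalTime (i + 1) w ≤ renewalTime j w := hmono h
      linarith [(hnn j).1]
    · have : renewalTime (j + 1) w ≤ renewalTime i w := hmono h
      linarith [(hnn i).1]
  · exact fun j => (measurableSet_holdingEvent j r).nullMeasurableSet

/-- The renewal probability is continuous from the left. -/
lemma tendsto_renewalProb {k : ℝ} (hk : 0 < k) (hlt : laplaceLaw νU k * laplaceLaw νS k < 1)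
    (hU1 : laplaceLaw νU k ≤ 1) (r : ℝ) :
    Tendsto (fun s => (renewalProb νU νS s).toReal) (𝓝[≤] r) (𝓝 (renewalProb νU νS r).toReal) := by
  have e : ∀ s, (renewalProb νU νS s).toReal
      = ∑' j, (renewalLaw νU νS (holdingEvent j s)).toReal := fun s =>
    ENNReal.tsum_toReal_eq fun j => measure_ne_top _ _
  simp only [e]
  set c := laplaceLaw νU k * laplaceLaw νS k with hc
  refine tendsto_tsum_of_dominated_convergence
    -- A Chernoff bound: the `j`-th holding interval begins before `r` with probability at most
    -- `e^{kr} c^j`.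
    (bound := fun j => Real.exp (k * r) * c.toReal ^ j) ?_ ?_ ?_
  · refine (summable_geometric_of_lt_one ENNReal.toReal_nonneg ?_).mul_left _
    rw [← ENNReal.toReal_one]
    exact (ENNReal.toReal_lt_toReal hlt.ne_top ENNReal.one_ne_top).2 hlt
  · intro j
    -- The holding interval is open on the left and closed on the right, so its indicator is left
    -- continuous in `r`.
    refine (ENNReal.tendsto_toReal (measure_ne_top _ _)).comp
      (tendsto_measure_of_tendsto_indicator_of_isFiniteMeasure _ _
        (fun s => measurableSet_holdingEvent j s) fun w => ?_)
    simp only [holdingEvent, Set.mem_ofPred_eq]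
    by_cases h1 : renewalTime j w + (w j).1 < r
    · by_cases h2 : r ≤ renewalTime (j + 1) w
      · filter_upwards [self_mem_nhdsWithin, mem_nhdsWithin_of_mem_nhds (lt_mem_nhds h1)]
          with s (hs : s ≤ r) hs'
        exact ⟨fun _ => ⟨h1, h2⟩, fun _ => ⟨hs', hs.trans h2⟩⟩
      · filter_upwards [mem_nhdsWithin_of_mem_nhds (lt_mem_nhds (not_le.1 h2))] with s hs
        exact ⟨fun h => absurd h.2 (not_le.2 hs), fun h => absurd h.2 h2⟩
    · filter_upwards [self_mem_nhdsWithin] with s (hs : s ≤ r)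
      exact ⟨fun h => absurd (h.1.trans_le hs) h1, fun h => absurd h.1 h1⟩
  · filter_upwards [self_mem_nhdsWithin] with s (hs : s ≤ r) j
    rw [Real.norm_of_nonneg ENNReal.toReal_nonneg]
    have hb : renewalLaw νU νS (holdingEvent j s) ≤ ENNReal.ofReal (Real.exp (k * r)) * c ^ j := by
      calc _ ≤ ∫⁻ w, ENNReal.ofReal (Real.exp (k * r))
            * ENNReal.ofReal (Real.exp (-k * (renewalTime j w + (w j).1))) ∂(renewalLaw νU νS) := by
            rw [← lintegral_indicator_one (measurableSet_holdingEvent j s)]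
            refine lintegral_mono fun w => ?_
            refine Set.indicator_apply_le' (fun hw => ?_) fun _ => zero_le
            rw [← ENNReal.ofReal_mul (Real.exp_pos _).le, ← Real.exp_add, Pi.one_apply,
              ENNReal.one_le_ofReal]
            refine Real.one_le_exp ?_
            have := hw.1
            nlinarith
        _ ≤ ENNReal.ofReal (Real.exp (k * r)) * (c ^ j * laplaceLaw νU k) := by
            rw [lintegral_const_mul' _ _ ENNReal.ofReal_ne_top, lintegral_exp_start]
        _ ≤ _ := by gcongr; exact mul_le_of_le_one_right' hU1
    have := ENNReal.toReal_mono (by finiteness) hb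
    rwa [ENNReal.toReal_mul, ENNReal.toReal_ofReal (Real.exp_pos _).le, ENNReal.toReal_pow] at this

end renewal

/-! ### Identification of the renewal series with the distribution function of the ratio law. -/

section holdingLaw

variable {α μ : ℝ}

lemma ae_nonneg_of_Iio {ν : Measure ℝ} (hν : ν (Set.Iio 0) = 0) : ∀ᵐ x ∂ν, 0 ≤ x := by
  rw [ae_iff]
  simp only [not_le]
  exact hν

lemma lintegral_exp_expMeasure (hμ : 0 < μ) {c : ℝ} (hc : 0 ≤ c) :
    ∫⁻ y, ENNReal.ofReal (Real.exp (-c * y)) ∂(expMeasure μ) = ENNReal.ofReal (μ / (μ + c)) := by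
  have hm : Measurable (exponentialPDF μ) :=
    ENNReal.measurable_ofReal.comp (measurable_exponentialPDFReal μ)
  have hm' : Measurable (exponentialPDF (μ + c)) :=
    ENNReal.measurable_ofReal.comp (measurable_exponentialPDFReal (μ + c))
  have e : expMeasure μ = volume.withDensity (exponentialPDF μ) := rfl
  rw [e, lintegral_withDensity_eq_lintegral_mul _ hm (by fun_prop)]
  calc _ = ∫⁻ y, ENNReal.ofReal (μ / (μ + c)) * exponentialPDF (μ + c) y := by
        refine lintegral_congr fun y => ?_
        rw [Pi.mul_apply, exponentialPDF_eq, exponentialPDF_eq]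
        split_ifs
        · rw [← ENNReal.ofReal_mul (by positivity), ← ENNReal.ofReal_mul (by positivity)]
          congr 1
          have : -((μ + c) * y) = -(μ * y) + -c * y := by ring
          rw [this, Real.exp_add]
          field_simp
        · simp
    _ = _ := by
        rw [lintegral_const_mul _ hm', lintegral_exponentialPDF_eq_one (by linarith), mul_one]

lemma expMeasure_ae_pos (hμ : 0 < μ) : ∀ᵐ y ∂(expMeasure μ), 0 < y := by
  have := isProbabilityMeasure_expMeasure hμ
  have h1 := cdf_expMeasure_eq hμ 0
  rw [if_pos le_rfl, cdf_eq_real] at h1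
  rw [ae_iff]
  simp only [not_lt]
  exact (measureReal_eq_zero_iff).1 (h1.trans (by simp))

lemma isProbabilityMeasure_holdingLaw (hα : 0 < α) (hμ : 0 < μ) :
    IsProbabilityMeasure (holdingLaw α μ) := by
  have := isProbabilityMeasure_expMeasure hμ
  have := isProbabilityMeasure_paretoMeasure one_pos hα
  exact Measure.isProbabilityMeasure_map (by fun_prop)

lemma holdingLaw_Iio_zero (hα : 0 < α) (hμ : 0 < μ) : holdingLaw α μ (Set.Iio 0) = 0 := by
  have := isProbabilityMeasure_expMeasure hμ
  have := isProbabilityMeasure_paretoMeasure one_pos hα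
  have h1 : ∀ᵐ x ∂((paretoMeasure 1 α).prod (expMeasure μ)), 0 < x.1 :=
    Measure.quasiMeasurePreserving_fst.ae (isTailLaw_pareto hα).pos
  have h2 : ∀ᵐ x ∂((paretoMeasure 1 α).prod (expMeasure μ)), 0 < x.2 :=
    Measure.quasiMeasurePreserving_snd.ae (expMeasure_ae_pos hμ)
  have h : ∀ᵐ x ∂(holdingLaw α μ), 0 ≤ x := by
    rw [holdingLaw, ae_map_iff (by fun_prop) measurableSet_Ici]
    filter_upwards [h1, h2] with x hx1 hx2
    positivity
  rw [ae_iff] at h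
  simp only [not_le] at h
  exact h

lemma laplaceLaw_holdingLaw (hα : 0 < α) (hμ : 0 < μ) {k : ℝ} (hk : 0 ≤ k) :
    laplaceLaw (holdingLaw α μ) k = ENNReal.ofReal (paretoMean α (k / μ)) := by
  have := isProbabilityMeasure_expMeasure hμ
  have hT := isTailLaw_pareto hα
  rw [laplaceLaw, holdingLaw, lintegral_map (by fun_prop) (by fun_prop),
    lintegral_prod _ (by fun_prop), paretoMean, ofReal_integral_eq_lintegral_ofReal
      (integrable_one_div_pareto hα (by positivity) (f := fun z => z) measurable_id fun z hz => hz.le)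
      (hT.pos.mono fun z hz => by positivity)]
  refine lintegral_congr_ae ?_
  filter_upwards [hT.pos] with z hz
  have := lintegral_exp_expMeasure hμ (mul_nonneg hk hz.le)
  calc _ = ∫⁻ y, ENNReal.ofReal (Real.exp (-(k * z) * y)) ∂(expMeasure μ) := by
        refine lintegral_congr fun y => ?_
        ring_nf
    _ = _ := by
        rw [this]
        congr 1
        field_simp

lemma lintegral_one_sub_exp {ν : Measure ℝ} [IsProbabilityMeasure ν] (hν : ν (Set.Iio 0) = 0)
    {k : ℝ} (hk : 0 ≤ k) :
    ∫⁻ x, ENNReal.ofReal (1 - Real.exp (-k * x)) ∂ν = 1 - laplaceLaw ν k := by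
  have hae : ∀ᵐ x ∂ν, 0 ≤ x := ae_nonneg_of_Iio hν
  have hle : ∀ᵐ x ∂ν, ENNReal.ofReal (Real.exp (-k * x)) ≤ 1 := by
    filter_upwards [hae] with x hx
    rw [ENNReal.ofReal_le_one, Real.exp_le_one_iff]
    nlinarith
  have hfin : laplaceLaw ν k ≠ ⊤ := by
    refine ne_top_of_le_ne_top ENNReal.one_ne_top ((lintegral_mono_ae hle).trans ?_)
    simp
  have h := lintegral_sub (μ := ν) (f := fun _ => (1 : ℝ≥0∞))
    (g := fun x => ENNReal.ofReal (Real.exp (-k * x))) (by fun_prop) hfin hle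
  rw [lintegral_one, measure_univ] at h
  rw [laplaceLaw, ← h]
  refine lintegral_congr fun x => ?_
  rw [ENNReal.ofReal_sub _ (Real.exp_pos _).le, ENNReal.ofReal_one]

lemma measurable_measure_Iio (ν : Measure ℝ) : Measurable fun r => ν (Set.Iio r) :=
  Monotone.measurable fun _ _ h => measure_mono (Set.Iio_subset_Iio h)

lemma lintegral_exp_mul_Iio {ν : Measure ℝ} [IsProbabilityMeasure ν] (hν : ∀ᵐ x ∂ν, 0 ≤ x) {k : ℝ}
    (hk : 0 < k) :
    ∫⁻ r in Set.Ioi (0 : ℝ), ENNReal.ofReal (Real.exp (-k * r)) * ν (Set.Iio r)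
      = ENNReal.ofReal (1 / k) * laplaceLaw ν k := by
  calc _ = ∫⁻ r in Set.Ioi (0 : ℝ), ∫⁻ x, ENNReal.ofReal (Real.exp (-k * r))
        * (Set.Iio r).indicator (1 : ℝ → ℝ≥0∞) x ∂ν := by
        refine lintegral_congr fun r => ?_
        rw [lintegral_const_mul' _ _ ENNReal.ofReal_ne_top, lintegral_indicator_one measurableSet_Iio]
    _ = ∫⁻ x, (∫⁻ r in Set.Ioi (0 : ℝ), ENNReal.ofReal (Real.exp (-k * r))
        * (Set.Iio r).indicator (1 : ℝ → ℝ≥0∞) x) ∂ν := by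
        refine lintegral_lintegral_swap (Measurable.aemeasurable ?_)
        have h1 : Measurable fun x : ℝ × ℝ =>
            {x : ℝ × ℝ | x.2 < x.1}.indicator (1 : ℝ × ℝ → ℝ≥0∞) x :=
          measurable_one.indicator (measurableSet_lt measurable_snd measurable_fst)
        exact Measurable.mul (by fun_prop) h1
    _ = ∫⁻ x, ENNReal.ofReal (1 / k) * ENNReal.ofReal (Real.exp (-k * x)) ∂ν := by
        refine lintegral_congr_ae ?_
        filter_upwards [hν] with x hx
        have e : ∀ r, ENNReal.ofReal (Real.exp (-k * r)) * (Set.Iio r).indicator (1 : ℝ → ℝ≥0∞) x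
            = (Set.Ioi x).indicator (fun r => ENNReal.ofReal (Real.exp (-k * r))) r := by
          intro r
          by_cases hr : x < r
          · rw [Set.indicator_of_mem (Set.mem_Ioi.2 hr), Set.indicator_of_mem (Set.mem_Iio.2 hr),
              Pi.one_apply, mul_one]
          · rw [Set.indicator_of_notMem (by simpa using hr),
              Set.indicator_of_notMem (by simpa using hr), mul_zero]
        simp only [e]
        rw [setLIntegral_indicator measurableSet_Ioi, Set.inter_eq_left.2 (Set.Ioi_subset_Ioi hx),
          lintegral_exp_Ioi hk, ← ENNReal.ofReal_mul (by positivity)]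
        congr 1
        ring
    _ = _ := lintegral_const_mul' _ _ ENNReal.ofReal_ne_top

lemma setIntegral_exp_mul_toReal {f : ℝ → ℝ≥0∞} (hf : Measurable f) (hf1 : ∀ r, 0 < r → f r ≤ 1) {k : ℝ} :
    ∫ r in Set.Ioi (0 : ℝ), Real.exp (-k * r) * (f r).toReal
      = (∫⁻ r in Set.Ioi (0 : ℝ), ENNReal.ofReal (Real.exp (-k * r)) * f r).toReal := by
  have hm : Measurable fun r => (f r).toReal := hf.ennreal_toReal
  rw [integral_eq_lintegral_of_nonneg_ae
    (ae_of_all _ fun r => mul_nonneg (Real.exp_pos _).le ENNReal.toReal_nonneg)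
    (Measurable.aestronglyMeasurable (by fun_prop))]
  congr 1
  refine setLIntegral_congr_fun measurableSet_Ioi fun r hr => ?_
  rw [ENNReal.ofReal_mul (Real.exp_pos _).le, ENNReal.ofReal_toReal
    (ne_top_of_le_ne_top ENNReal.one_ne_top (hf1 r hr))]

lemma laplaceLaw_ratioLaw (hα : 0 < α) (hα1 : α < 1) (hμ : 0 < μ) {k : ℝ} (hk : 0 ≤ k) :
    laplaceLaw (ratioLaw α μ) k = tailIntegral α (k / μ) / tailIntegral α 0 :=
  lintegral_exp_ratioLaw hα hα1 hμ hk

lemma continuousAt_ratioLaw_Iio (hα : 0 < α) (hα1 : α < 1) (hμ : 0 < μ) (r : ℝ) :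
    ContinuousAt (fun r => (ratioLaw α μ (Set.Iio r)).toReal) r := by
  have := isProbabilityMeasure_ratioLaw (μ := μ) hα hα1
  refine (ENNReal.continuousAt_toReal (measure_ne_top _ _)).comp
    (f := fun r => ratioLaw α μ (Set.Iio r)) ?_
  refine tendsto_measure_of_ae_tendsto_indicator_of_isFiniteMeasure _ measurableSet_Iio
    (fun r => measurableSet_Iio) ?_
  have hne : ∀ᵐ x ∂(ratioLaw α μ), x ≠ r := by
    rw [ae_iff]; simpa using ratioLaw_singleton hα hα1 hμ r
  filter_upwards [hne] with x hx
  simp only [Set.mem_Iio]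
  rcases lt_or_gt_of_ne hx with h | h
  · filter_upwards [lt_mem_nhds h] with s hs
    exact ⟨fun _ => h, fun _ => hs⟩
  · filter_upwards [gt_mem_nhds h] with s hs
    exact ⟨fun h' => absurd h' (not_lt.2 hs.le), fun h' => absurd h' (not_lt.2 h.le)⟩

/-- The renewal probability is the distribution function of `ratioLaw α μ`. -/
theorem renewalProb_holdingLaw (hα : 0 < α) (hα1 : α < 1) (hμ : 0 < μ) {νU : Measure ℝ}
    [IsProbabilityMeasure νU] (hU : νU (Set.Iio 0) = 0)
    (hL : ∀ θ, 0 < θ → ∫ x, Real.exp (-θ * x) ∂νU = (travelExponent α (θ / μ))⁻¹)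
    {r : ℝ} (hr : 0 < r) :
    renewalProb νU (holdingLaw α μ) r = ratioLaw α μ (Set.Iio r) := by
  have := isProbabilityMeasure_holdingLaw hα hμ
  have := isProbabilityMeasure_ratioLaw (μ := μ) hα hα1
  have hS := holdingLaw_Iio_zero hα hμ
  have hR := ratioLaw_ae_pos hα hα1 hμ
  set I0 := (tailIntegral α 0).toReal with hI0
  have hI0pos : 0 < I0 := ENNReal.toReal_pos (tailIntegral_pos 0).ne' (tailIntegral_lt_top hα hα1 0).ne
  have hLU : ∀ k, 0 < k → laplaceLaw νU k = ENNReal.ofReal (travelExponent α (k / μ))⁻¹ := by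
    intro k hk
    rw [← hL k hk, laplaceLaw, ofReal_integral_eq_lintegral_ofReal _
      (ae_of_all _ fun x => (Real.exp_pos _).le)]
    have hae : ∀ᵐ x ∂νU, 0 ≤ x := ae_nonneg_of_Iio hU
    refine Integrable.of_bound (C := 1) (Measurable.aestronglyMeasurable (by fun_prop)) ?_
    filter_upwards [hae] with x hx
    rw [Real.norm_of_nonneg (Real.exp_pos _).le, Real.exp_le_one_iff]
    nlinarith
  have hψ : ∀ k, 0 < k → 0 < paretoMean α (k / μ) ∧ paretoMean α (k / μ) < 1
      ∧ 0 < travelExponent α (k / μ)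
      ∧ paretoMean α (k / μ) < travelExponent α (k / μ) := by
    intro k hk
    have hu : 0 < k / μ := by positivity
    have h1 := paretoMean_pos hα hu.le
    have h2 : 0 < (k / μ) ^ α * (tailIntegral α (k / μ)).toReal :=
      mul_pos (by positivity) (ENNReal.toReal_pos (tailIntegral_pos _).ne'
        (tailIntegral_lt_top hα hα1 _).ne)
    have h3 := paretoMean_eq hα hα1 hu
    have h4 : 0 < I0 * (k / μ) ^ α := by positivity
    refine ⟨h1, by linarith, ?_, ?_⟩ <;> rw [travelExponent] <;> linarith
  have hlt : ∀ k, 0 < k → laplaceLaw νU k * laplaceLaw (holdingLaw α μ) k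
      = ENNReal.ofReal (paretoMean α (k / μ) / travelExponent α (k / μ)) := by
    intro k hk
    obtain ⟨h1, h2, h3, h4⟩ := hψ k hk
    rw [hLU k hk, laplaceLaw_holdingLaw hα hμ hk.le, ← ENNReal.ofReal_mul (by positivity)]
    congr 1
    field_simp
  have key : ∀ k, 0 < k →
      ∫⁻ r in Set.Ioi (0 : ℝ), ENNReal.ofReal (Real.exp (-k * r))
          * renewalProb νU (holdingLaw α μ) r
        = ∫⁻ r in Set.Ioi (0 : ℝ), ENNReal.ofReal (Real.exp (-k * r))
          * ratioLaw α μ (Set.Iio r) := by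
    intro k hk
    have hu : 0 < k / μ := by positivity
    obtain ⟨h1, h2, h3, h4⟩ := hψ k hk
    rw [lintegral_exp_renewalProb hU hS hk, lintegral_exp_mul_Iio (hR.mono fun x hx => hx.le) hk,
      laplaceLaw_ratioLaw hα hα1 hμ hk.le, lintegral_one_sub_exp hS hk.le, hlt k hk, hLU k hk,
      laplaceLaw_holdingLaw hα hμ hk.le]
    congr 1
    have hd : paretoMean α (k / μ) / travelExponent α (k / μ) < 1 := (div_lt_one h3).2 h4
    rw [← ENNReal.ofReal_toReal (tailIntegral_lt_top hα hα1 (k / μ)).ne,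
      ← ENNReal.ofReal_toReal (tailIntegral_lt_top hα hα1 0).ne,
      ← ENNReal.ofReal_div_of_pos hI0pos, ← ENNReal.ofReal_one, ← ENNReal.ofReal_sub _ (by positivity),
      ← ENNReal.ofReal_sub _ h1.le, ← ENNReal.ofReal_inv_of_pos (by linarith),
      ← ENNReal.ofReal_mul (by positivity), ← ENNReal.ofReal_mul (inv_nonneg.2 (by linarith))]
    congr 1
    have e1 := paretoMean_eq hα hα1 hu
    -- With `u = k / μ`, `ψ = paretoMean α u` and `D = travelExponent α u`, the renewal transform is
    -- `(1 - ψ) / (D - ψ)` up to `1 / k`. Here `1 - ψ = u^α I(u)` and `D - ψ = u^α I(0)`, which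
    -- leaves the transform `I(u) / I(0)` of the ratio law.
    have e2 : travelExponent α (k / μ) - paretoMean α (k / μ) = I0 * (k / μ) ^ α := by
      rw [travelExponent]; ring
    have e3 : 1 - paretoMean α (k / μ) / travelExponent α (k / μ)
        = I0 * (k / μ) ^ α / travelExponent α (k / μ) := by
      rw [← e2]; field_simp
    have hp : (0 : ℝ) < (k / μ) ^ α := by positivity
    rw [e3, e1, inv_div]
    generalize travelExponent α (k / μ) = D at h3
    field_simp
    ring
  have h11 := hψ 1 one_pos
  have hlt1 : laplaceLaw νU 1 * laplaceLaw (holdingLaw α μ) 1 < 1 := by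
    rw [hlt 1 one_pos, ENNReal.ofReal_lt_one, div_lt_one h11.2.2.1]
    exact h11.2.2.2
  have hU1 : laplaceLaw νU 1 ≤ 1 := by
    rw [laplaceLaw]
    have hae : ∀ᵐ x ∂νU, 0 ≤ x := ae_nonneg_of_Iio hU
    refine (lintegral_mono_ae (g := fun _ => 1) ?_).trans (by simp)
    filter_upwards [hae] with x hx
    rw [ENNReal.ofReal_le_one, Real.exp_le_one_iff]
    linarith
  have hm := measurable_renewalProb (νU := νU) (νS := holdingLaw α μ)
  have hle := renewalProb_le_one (νU := νU) (νS := holdingLaw α μ) hU hS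
  have hbound : ∀ {f : ℝ → ℝ≥0∞}, (∀ r, f r ≤ 1) → ∀ r, |(f r).toReal| ≤ 1 := fun hf r => by
    rw [abs_of_nonneg ENNReal.toReal_nonneg]
    exact ENNReal.toReal_le_of_le_ofReal zero_le_one (by simpa using hf r)
  have hcont := continuousAt_ratioLaw_Iio hα hα1 hμ r
  -- Equal Laplace transforms give equality at every point: the series is left continuous and the
  -- ratio law has no atoms.
  have heq := eq_of_laplace (f := fun r => (renewalProb νU (holdingLaw α μ) r).toReal)
    (G := fun r => (ratioLaw α μ (Set.Iio r)).toReal) hm.ennreal_toReal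
    (fun t _ => hbound hle t) (measurable_measure_Iio _).ennreal_toReal
    (fun t _ => hbound (fun _ => prob_le_one) t)
    (fun k => by
      rw [setIntegral_exp_mul_toReal hm fun r _ => hle r,
        setIntegral_exp_mul_toReal (measurable_measure_Iio _) (fun _ _ => prob_le_one),
        key _ (by positivity)]) hr (tendsto_renewalProb one_pos hlt1 hU1 r) hcont
  exact (ENNReal.toReal_eq_toReal_iff' (ne_top_of_le_ne_top ENNReal.one_ne_top (hle r))
    (measure_ne_top _ _)).1 heq

end holdingLaw

/-! ### Means over the depth of a trap. -/

/-- The mean of `1{y > c x} y / (y + x)` for a depth `y` with law `ρ`. -/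
def depthMean (ρ : Measure ℝ) (c x : ℝ) : ℝ :=
  ∫ y, (Set.Ioi (c * x)).indicator (fun y => y / (y + x)) y ∂ρ

section depthMean

variable {ρ : Measure ℝ} {c x : ℝ}

lemma integrable_depth [IsProbabilityMeasure ρ] (hpos : ∀ᵐ y ∂ρ, 0 < y) (hx : 0 < x) {D : Set ℝ} (hD : MeasurableSet D) :
    Integrable (D.indicator fun y => y / (y + x)) ρ := by
  refine Integrable.indicator (Integrable.of_bound (C := 1)
    (Measurable.aestronglyMeasurable (by fun_prop)) ?_) hD
  filter_upwards [hpos] with z hz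
  rw [Real.norm_of_nonneg (by positivity), div_le_one (by positivity)]
  linarith

lemma ofReal_integral_depth [IsProbabilityMeasure ρ] (hpos : ∀ᵐ y ∂ρ, 0 < y) (hx : 0 < x) {D : Set ℝ}
    (hD : MeasurableSet D) :
    ENNReal.ofReal (∫ y, D.indicator (fun y => y / (y + x)) y ∂ρ)
      = ∫⁻ y, D.indicator 1 y * ENNReal.ofReal (y / (y + x)) ∂ρ := by
  rw [ofReal_integral_eq_lintegral_ofReal (integrable_depth hpos hx hD)]
  · refine lintegral_congr fun y => ?_
    by_cases hy : y ∈ D <;> simp [hy]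
  · filter_upwards [hpos] with y hy
    exact Set.indicator_apply_nonneg fun _ => by positivity

lemma depthMean_zero (hpos : ∀ᵐ y ∂ρ, 0 < y) (x : ℝ) :
    depthMean ρ 0 x = ∫ y, y / (y + x) ∂ρ := by
  refine integral_congr_ae ?_
  filter_upwards [hpos] with y hy
  rw [Set.indicator_of_mem (by simpa using hy)]

lemma depthMean_nonneg (hpos : ∀ᵐ y ∂ρ, 0 < y) (hx : 0 < x) : 0 ≤ depthMean ρ c x := by
  refine integral_nonneg_of_ae ?_
  filter_upwards [hpos] with y hy
  exact Set.indicator_apply_nonneg fun _ => by positivity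

lemma depthMean_zero_pos [IsProbabilityMeasure ρ] (hpos : ∀ᵐ y ∂ρ, 0 < y) (hx : 0 < x) : 0 < depthMean ρ 0 x := by
  have hint := integrable_depth hpos hx MeasurableSet.univ
  rw [Set.indicator_univ] at hint
  have hae : ∀ᵐ y ∂ρ, 0 < y / (y + x) := hpos.mono fun y hy => by positivity
  rw [depthMean_zero hpos, integral_pos_iff_support_of_nonneg_ae (hae.mono fun y hy => hy.le) hint,
    measure_congr (t := Set.univ), measure_univ]
  · exact one_pos
  filter_upwards [hae] with z hz
  exact propext ⟨fun _ => trivial, fun _ => hz.ne'⟩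

lemma depthMean_zero_le_one [IsProbabilityMeasure ρ] (hpos : ∀ᵐ y ∂ρ, 0 < y) (hx : 0 < x) : depthMean ρ 0 x ≤ 1 := by
  have hint := integrable_depth hpos hx MeasurableSet.univ
  rw [Set.indicator_univ] at hint
  rw [depthMean_zero hpos]
  calc _ ≤ ∫ _, (1 : ℝ) ∂ρ := by
        refine integral_mono_ae hint (integrable_const 1) ?_
        filter_upwards [hpos] with y hy
        rw [div_le_one (by positivity)]
        linarith
    _ = 1 := by simp

lemma lintegral_depth_Iic [IsProbabilityMeasure ρ] (hpos : ∀ᵐ y ∂ρ, 0 < y) (hx : 0 < x) (c : ℝ) :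
    ∫⁻ y, (Set.Ioi (c * x))ᶜ.indicator 1 y * ENNReal.ofReal (y / (y + x)) ∂ρ
      = ENNReal.ofReal (depthMean ρ 0 x - depthMean ρ c x) := by
  have hint := integrable_depth hpos hx MeasurableSet.univ
  rw [Set.indicator_univ] at hint
  rw [← ofReal_integral_depth hpos hx measurableSet_Ioi.compl, depthMean_zero hpos, depthMean,
    ← integral_sub hint (integrable_depth hpos hx measurableSet_Ioi)]
  congr 1
  refine integral_congr_ae (ae_of_all _ fun y => ?_)
  beta_reduce
  by_cases hy : y ∈ Set.Ioi (c * x)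
  · rw [Set.indicator_of_mem hy, Set.indicator_of_notMem (by simpa using hy), sub_self]
  · rw [Set.indicator_of_notMem hy, Set.indicator_of_mem (by simpa using hy), sub_zero]

/-- The tail in terms of the mean. -/
lemma measure_Ioi_le_depthMean [IsProbabilityMeasure ρ] (hpos : ∀ᵐ y ∂ρ, 0 < y) (hx : 0 < x) (hc : 0 < c) :
    ρ (Set.Ioi (c * x)) ≤ ENNReal.ofReal ((1 + 1 / c) * depthMean ρ 0 x) := by
  have hint := integrable_depth hpos hx MeasurableSet.univ
  rw [Set.indicator_univ] at hint
  rw [depthMean_zero hpos, ← integral_const_mul, ofReal_integral_eq_lintegral_ofReal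
    (hint.const_mul _) (hpos.mono fun y hy => by positivity),
    ← lintegral_indicator_one measurableSet_Ioi]
  refine lintegral_mono_ae ?_
  filter_upwards [hpos] with y hy
  refine Set.indicator_apply_le' (fun hyc => ?_) fun _ => zero_le
  have hyc' : c * x < y := hyc
  rw [Pi.one_apply, ENNReal.one_le_ofReal]
  have e : (1 + 1 / c) * (y / (y + x)) = ((c + 1) * y) / (c * (y + x)) := by field_simp
  rw [e, one_le_div (by positivity)]
  nlinarith

end depthMean

/-! ### Two-sided bounds for the Laplace transform of the depth. -/

section laplaceBounds

variable {Ω : Type*} [MeasurableSpace Ω] {P : Measure Ω} [IsProbabilityMeasure P]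
  {τ : ℤ → Ω → ℝ} {p q l : ℝ} (h : IsDriftPair p q) (hτ : IsPosIIDEnv P τ) (hl : 0 < l)

-- Here the scale `x = d / l` of the relevant depths emerges: a trap is likely to hold the walk at
-- the killing time if its depth is large compared with `d / l`.
omit [MeasurableSpace Ω] in
lemma killProb_weight (τ : ℤ → Ω → ℝ) {d l : ℝ} (hd : 0 < d) (hl : 0 < l) {ω : Ω}
    (hω : 0 < τ 0 ω) :
    killProb d (weight τ l ω 0) = τ 0 ω / (τ 0 ω + d / l) := by
  have h1 : 0 < 1 + l * τ 0 ω := by positivity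
  have h2 : 1 - 1 / (1 + l * τ 0 ω) = l * τ 0 ω / (1 + l * τ 0 ω) := by field_simp; ring
  have h3 : 1 - 1 / (1 + l * τ 0 ω) + 1 / (1 + l * τ 0 ω) * d
      = (l * τ 0 ω + d) / (1 + l * τ 0 ω) := by field_simp; ring
  rw [killProb, weight, h3, h2]
  field_simp

omit [IsProbabilityMeasure P] in
include hτ in
lemma map_trap_ae_pos : ∀ᵐ y ∂(P.map (τ 0)), 0 < y := by
  rw [ae_map_iff (hτ.measurable 0).aemeasurable measurableSet_Ioi]
  exact ae_of_all _ fun ω => hτ.pos 0 ω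

include hτ in
lemma isProbabilityMeasure_map_trap : IsProbabilityMeasure (P.map (τ 0)) :=
  Measure.isProbabilityMeasure_map (hτ.measurable 0).aemeasurable

omit [IsProbabilityMeasure P] in
include hτ hl in
lemma lintegral_indicator_killProb {d : ℝ} (hd : 0 < d) {D : Set ℝ} (hD : MeasurableSet D) :
    ∫⁻ ω, D.indicator 1 (τ 0 ω) * ENNReal.ofReal (killProb d (weight τ l ω 0)) ∂P
      = ∫⁻ y, D.indicator 1 y * ENNReal.ofReal (y / (y + d / l)) ∂(P.map (τ 0)) := by
  rw [lintegral_map (f := fun y => D.indicator 1 y * ENNReal.ofReal (y / (y + d / l)))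
    ((measurable_one.indicator hD).mul (by fun_prop)) (hτ.measurable 0)]
  exact lintegral_congr fun ω => by rw [killProb_weight τ hd hl (hτ.pos 0 ω)]

include hτ hl in
lemma integral_killProb_weight {d : ℝ} (hd : 0 < d) :
    ∫ ω, killProb d (weight τ l ω 0) ∂P = depthMean (P.map (τ 0)) 0 (d / l) := by
  have := isProbabilityMeasure_map_trap hτ
  rw [depthMean_zero (map_trap_ae_pos hτ), integral_map (hτ.measurable 0).aemeasurable
    (Measurable.aestronglyMeasurable (by fun_prop))]
  exact integral_congr_ae (ae_of_all _ fun ω => killProb_weight τ hd hl (hτ.pos 0 ω))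

/-- The correction factor in the bound on the range of the killed walk. -/
def reachFactor (e : ℝ) : ℝ := e ^ 2 + 1 / (1 - 3 * e)

-- With `b = e² d`, the block length `m ≈ 1 / (e d)` balances two losses relative to the killing
-- rate `b m` of a block: the sites near its right end, which the walk may leave behind too early,
-- cost `1 / d ≤ e m`, and double killings cost `m b ≤ 2 e`. Hence `δ ≥ b m (1 - 3 e)`. The sites
-- left of `0` contribute `b / d = e²`.
include h hτ hl in
theorem mul_meanReach_le {b e : ℝ} (hb : b = depthMean (P.map (τ 0)) 0 ((p - q) / l))
    (he : e = √(b / (p - q))) (he3 : e < 1 / 3) :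
    ENNReal.ofReal b * meanReach P p q τ l ≤ ENNReal.ofReal (reachFactor e) := by
  have := isProbabilityMeasure_map_trap hτ
  have hd : 0 < p - q := by linarith [h.lt]
  have hd1 : p - q ≤ 1 := by linarith [h.add_eq, h.q_nonneg]
  set d := p - q with hddef
  have hb0 : 0 < b := hb ▸ depthMean_zero_pos (map_trap_ae_pos hτ) (div_pos hd hl)
  have hb1 : b ≤ 1 := hb ▸ depthMean_zero_le_one (map_trap_ae_pos hτ) (div_pos hd hl)
  have he0 : 0 < e := he ▸ Real.sqrt_pos.2 (div_pos hb0 hd)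
  have hbe : b = e ^ 2 * d := by
    rw [he, Real.sq_sqrt (by positivity)]; field_simp
  set m : ℕ := ⌈1 / (e * d)⌉₊ with hm
  have hm1 : 1 / (e * d) ≤ m := Nat.le_ceil _
  have hm2 : (m : ℝ) < 1 / (e * d) + 1 := Nat.ceil_lt_add_one (by positivity)
  have hm0 : 0 < m := Nat.ceil_pos.2 (by positivity)
  have hmr : (0 : ℝ) < m := by exact_mod_cast hm0
  have h1 : 1 / d ≤ e * m := by
    have := mul_le_mul_of_nonneg_left hm1 he0.le
    have e1 : e * (1 / (e * d)) = 1 / d := by field_simp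
    linarith
  have h2 : m * b ≤ 2 * e := by
    have e1 : (1 / (e * d) + 1) * b = e + e ^ 2 * d := by rw [hbe]; field_simp
    have e2 : m * b ≤ (1 / (e * d) + 1) * b := by gcongr
    have e3 : e ^ 2 * d ≤ e := by nlinarith [mul_pos he0 he0]
    linarith
  set δ := b * (m - 1 / d - m ^ 2 * b) with hδ
  have hδm : b * m * (1 - 3 * e) ≤ δ := by
    have e1 : (m : ℝ) ^ 2 * b ≤ m * (2 * e) := by
      have := mul_le_mul_of_nonneg_left h2 hmr.le
      calc (m : ℝ) ^ 2 * b = m * (m * b) := by ring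
        _ ≤ _ := this
    rw [hδ, mul_assoc]
    refine mul_le_mul_of_nonneg_left ?_ hb0.le
    linarith
  have h13 : 0 < 1 - 3 * e := by linarith
  have hδ0 : 0 < δ := lt_of_lt_of_le (by positivity) hδm
  have hδ1 : δ ≤ 1 := by
    have e1 : δ ≤ b * m := by
      rw [hδ]
      refine mul_le_mul_of_nonneg_left ?_ hb0.le
      have : 0 < 1 / d := by positivity
      have : 0 < (m : ℝ) ^ 2 * b := by positivity
      linarith
    linarith
  have key := tsum_lintegral_reach_le h hτ hl.le
    (hb.trans (integral_killProb_weight hτ hl hd).symm) hm0 hδ hδ0 hδ1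
  calc _ ≤ ENNReal.ofReal b * ENNReal.ofReal (1 / d + m / δ) := by gcongr; exact key
    _ = ENNReal.ofReal (b * (1 / d + m / δ)) := (ENNReal.ofReal_mul hb0.le).symm
    _ ≤ _ := by
        refine ENNReal.ofReal_le_ofReal ?_
        rw [reachFactor, mul_add]
        refine add_le_add (le_of_eq ?_) ?_
        · rw [hbe]; field_simp
        · rw [← mul_div_assoc, div_le_div_iff₀ hδ0 h13]
          linarith

include h hτ hl in
lemma meanReach_ne_top (he3 : √(depthMean (P.map (τ 0)) 0 ((p - q) / l) / (p - q)) < 1 / 3) :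
    meanReach P p q τ l ≠ ⊤ := by
  have := isProbabilityMeasure_map_trap hτ
  have hd : 0 < p - q := by linarith [h.lt]
  have hb0 := depthMean_zero_pos (map_trap_ae_pos hτ) (div_pos hd hl)
  have hle := mul_meanReach_le h hτ hl rfl rfl he3
  intro htop
  rw [htop, ENNReal.mul_top (by simpa using hb0)] at hle
  exact absurd hle (by simp)

include hτ in
lemma measurable_meanOcc {D : Set ℝ} (hD : MeasurableSet D) : Measurable (meanOcc P p q τ D) := by
  refine Measurable.lintegral_prod_right' (f := fun a : ℝ × Ω =>
    ∑' y, D.indicator 1 (τ y a.2) * occAt p q τ y a.1 a.2) ?_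
  refine Measurable.tsum fun y => Measurable.mul ?_ ?_
  · exact (measurable_indicator_comp hτ hD y).comp measurable_snd
  · exact (measurable_occAt_uncurry hτ y).comp measurable_swap

include h hτ hl in
/-- The Laplace transform of the probability to be in a deep trap. -/
theorem laplace_meanOcc_mem {b e K c : ℝ} (hb : b = depthMean (P.map (τ 0)) 0 ((p - q) / l))
    (he : e = √(b / (p - q))) (he3 : e < 1 / 3) (hK : K = reachFactor e) :
    (ENNReal.ofReal l * ∫⁻ u in Set.Ioi (0 : ℝ), ENNReal.ofReal (Real.exp (-l * u))
      * meanOcc P p q τ (Set.Ioi (c * ((p - q) / l))) u).toReal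
      ∈ Set.Icc (1 - K * (1 - depthMean (P.map (τ 0)) c ((p - q) / l) / b))
        (K * (depthMean (P.map (τ 0)) c ((p - q) / l) / b)) := by
  have := isProbabilityMeasure_map_trap hτ
  have hpos := map_trap_ae_pos hτ
  have hd : 0 < p - q := by linarith [h.lt]
  set x := (p - q) / l with hx
  have hx0 : 0 < x := div_pos hd hl
  have hb0 : 0 < b := hb ▸ depthMean_zero_pos hpos hx0
  have hA := meanReach_ne_top h hτ hl (by rw [← hx, ← hb, ← he]; exact he3)
  have hle := mul_meanReach_le h hτ hl hb he he3
  rw [← hK] at hle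
  have hK0 : 0 ≤ K := by
    rw [hK, reachFactor]
    have : 0 < 1 - 3 * e := by linarith
    positivity
  set D := Set.Ioi (c * x) with hD
  have hDm : MeasurableSet D := measurableSet_Ioi
  set L : Set ℝ → ℝ≥0∞ := fun D => ENNReal.ofReal l * ∫⁻ u in Set.Ioi (0 : ℝ),
    ENNReal.ofReal (Real.exp (-l * u)) * meanOcc P p q τ D u with hL
  have hLle : ∀ E : Set ℝ, MeasurableSet E → ∀ a : ℝ,
      ∫⁻ y, E.indicator 1 y * ENNReal.ofReal (y / (y + x)) ∂(P.map (τ 0)) = ENNReal.ofReal a →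
      L E ≤ ENNReal.ofReal (K * (a / b)) := by
    intro E hE a ha
    calc L E ≤ ENNReal.ofReal l * ∫⁻ u, ENNReal.ofReal (Real.exp (-l * u))
          * meanOcc P p q τ E u := by
          exact mul_le_mul_right (setLIntegral_le_lintegral _ _) _
      _ ≤ meanReach P p q τ l * ENNReal.ofReal a := by
          rw [← ha, ← lintegral_indicator_killProb hτ hl hd hE]
          exact lintegral_exp_mul_meanOcc_le h hτ hl hE
      _ = (ENNReal.ofReal b * meanReach P p q τ l) * ENNReal.ofReal (a / b) := by
          rw [mul_comm (ENNReal.ofReal b), mul_assoc, ← ENNReal.ofReal_mul hb0.le]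
          congr 2
          field_simp
      _ ≤ ENNReal.ofReal K * ENNReal.ofReal (a / b) := by gcongr
      _ = _ := (ENNReal.ofReal_mul hK0).symm
  have hD1 := hLle D hDm (depthMean (P.map (τ 0)) c x) (ofReal_integral_depth hpos hx0 hDm).symm
  have hD2 := hLle Dᶜ hDm.compl _ (lintegral_depth_Iic hpos hx0 c)
  -- Only upper bounds are available so far. As the two transforms add up to one, the upper bound
  -- for the complement is a lower bound for `D`.
  have hsum : L D + L Dᶜ = 1 := by
    simp only [hL]
    have hm : Measurable fun u => ENNReal.ofReal (Real.exp (-l * u)) * meanOcc P p q τ D u :=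
      Measurable.mul (by fun_prop) (measurable_meanOcc hτ hDm)
    rw [← mul_add, ← lintegral_add_left hm]
    have e1 : ∫⁻ u in Set.Ioi (0 : ℝ), (ENNReal.ofReal (Real.exp (-l * u)) * meanOcc P p q τ D u
        + ENNReal.ofReal (Real.exp (-l * u)) * meanOcc P p q τ Dᶜ u)
        = ∫⁻ u in Set.Ioi (0 : ℝ), ENNReal.ofReal (Real.exp (-l * u)) := by
      refine setLIntegral_congr_fun measurableSet_Ioi fun u (hu : 0 < u) => ?_
      rw [← mul_add, meanOcc_add_compl hτ hDm u, meanOcc_univ h hτ hl.le hA hu.le, mul_one]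
    rw [e1, lintegral_exp_Ioi hl, ← ENNReal.ofReal_mul hl.le]
    simp [hl.ne']
  have hL1 : L D ≤ 1 := hsum ▸ le_self_add
  have hL2 : L Dᶜ ≤ 1 := hsum ▸ le_add_self
  have hf1 : L D ≠ ⊤ := ne_top_of_le_ne_top ENNReal.one_ne_top hL1
  have hf2 : L Dᶜ ≠ ⊤ := ne_top_of_le_ne_top ENNReal.one_ne_top hL2
  have hsumr : (L D).toReal + (L Dᶜ).toReal = 1 := by
    rw [← ENNReal.toReal_add hf1 hf2, hsum, ENNReal.toReal_one]
  have hmono : depthMean (P.map (τ 0)) c x ≤ b := by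
    rw [hb, depthMean_zero hpos]
    have hint := integrable_depth hpos hx0 MeasurableSet.univ
    rw [Set.indicator_univ] at hint
    refine integral_mono_ae (integrable_depth hpos hx0 hDm) hint ?_
    filter_upwards [hpos] with y hy
    exact Set.indicator_apply_le' (fun _ => le_rfl) fun _ => by positivity
  have hc0 := depthMean_nonneg (c := c) hpos hx0
  have hr1 : (L D).toReal ≤ K * (depthMean (P.map (τ 0)) c x / b) :=
    ENNReal.toReal_le_of_le_ofReal (by positivity) hD1
  have hr2 : (L Dᶜ).toReal ≤ K * ((b - depthMean (P.map (τ 0)) c x) / b) := by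
    refine ENNReal.toReal_le_of_le_ofReal (mul_nonneg hK0 (div_nonneg (by linarith) hb0.le)) ?_
    rwa [← hb] at hD2
  refine ⟨?_, hr1⟩
  have e2 : (b - depthMean (P.map (τ 0)) c x) / b = 1 - depthMean (P.map (τ 0)) c x / b := by
    field_simp
  rw [e2] at hr2
  change _ ≤ (L D).toReal
  linarith

end laplaceBounds

/-! ### Scaling limits of the Laplace transforms. -/

/-- The drift `d n`, the scale `σ n` of the depths and the scale `T n` of the times. -/
structure IsScaling (α μ : ℝ) (d σ T : ℕ → ℝ) : Prop where
  drift_pos : ∀ n, 0 < d n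
  drift_le : ∀ n, d n ≤ 1
  scale_pos : ∀ n, 0 < σ n
  time : ∀ n, T n * d n = μ * σ n
  scale_top : Tendsto σ atTop atTop
  rare : Tendsto (fun n => σ n ^ (-α) / d n) atTop (𝓝 0)

section sideWeight

variable {Ω : Type*} [MeasurableSpace Ω] {P : Measure Ω} [IsProbabilityMeasure P]
  {τ : ℤ → Ω → ℝ} {p q α C : ℝ}

-- From `min 1 s ≤ 2 s / (s + 1)` with `s = a τ`, which reduces the truncated mean to the bound at
-- `x = 1 / a`.
omit [IsProbabilityMeasure P] in
lemma meanTrunc_le (hτ : IsPosIIDEnv P τ)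
    (hC : ∀ x, 0 < x → ∫⁻ y, ENNReal.ofReal (y / (y + x)) ∂(P.map (τ 0))
      ≤ ENNReal.ofReal (C * x ^ (-α))) {a : ℝ} (ha : 0 ≤ a) :
    meanTrunc P τ a ≤ ENNReal.ofReal (2 * C * a ^ α) := by
  rcases ha.eq_or_lt with rfl | ha
  · simp [meanTrunc]
  have h1 := hC a⁻¹ (by positivity)
  rw [lintegral_map (by fun_prop) (hτ.measurable 0), Real.inv_rpow ha.le, Real.rpow_neg ha.le,
    inv_inv] at h1
  calc meanTrunc P τ a ≤ ∫⁻ ω, ENNReal.ofReal 2 * ENNReal.ofReal (τ 0 ω / (τ 0 ω + a⁻¹)) ∂P := by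
        refine lintegral_mono fun ω => ?_
        have hω := hτ.pos 0 ω
        have e : τ 0 ω / (τ 0 ω + a⁻¹) = a * τ 0 ω / (a * τ 0 ω + 1) := by field_simp
        rw [← ENNReal.ofReal_one, ← ENNReal.ofReal_min, ← ENNReal.ofReal_mul zero_le_two, e]
        refine ENNReal.ofReal_le_ofReal ?_
        have hy : 0 < a * τ 0 ω := by positivity
        rw [← mul_div_assoc, le_div_iff₀ (by positivity)]
        rcases le_total 1 (a * τ 0 ω) with h | h
        · rw [min_eq_left h]; linarith
        · rw [min_eq_right h]; nlinarith
    _ ≤ ENNReal.ofReal 2 * ENNReal.ofReal (C * a ^ α) := by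
        rw [lintegral_const_mul' _ _ ENNReal.ofReal_ne_top]
        gcongr
    _ = _ := by rw [← ENNReal.ofReal_mul zero_le_two, mul_assoc]

lemma ratio_rpow_le (h : IsDriftPair p q) (hα : 0 < α) (hα1 : α < 1) :
    (q / p) ^ α ≤ 1 - α * (p - q) := by
  have hp : 0 < p := by linarith [h.q_nonneg, h.lt]
  have hq := h.q_nonneg
  have hadd := h.add_eq
  have hlt := h.lt
  calc (q / p) ^ α ≤ (1 + -(p - q)) ^ α := by
        refine Real.rpow_le_rpow (by positivity) ?_ hα.le
        rw [div_le_iff₀ hp]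
        nlinarith
    _ ≤ 1 + α * -(p - q) := rpow_one_add_le_one_add_mul_self (by linarith) hα.le hα1.le
    _ = _ := by ring

-- To the left of the trap the weights decay geometrically with ratio `(q / p)^α ≤ 1 - α (p - q)`,
-- which yields `1 / (α (p - q))`; to the right there are `M` sites without decay.
omit [IsProbabilityMeasure P] in
lemma sideWeight_le (h : IsDriftPair p q) (hτ : IsPosIIDEnv P τ) (hα : 0 < α) (hα1 : α < 1)
    (hC0 : 0 ≤ C)
    (hC : ∀ x, 0 < x → ∫⁻ y, ENNReal.ofReal (y / (y + x)) ∂(P.map (τ 0))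
      ≤ ENNReal.ofReal (C * x ^ (-α))) {ρ : ℝ} (hρ : 0 < ρ) (M : ℕ) :
    sideWeight P p q τ ρ M
      ≤ ENNReal.ofReal (2 * C * ρ ^ (-α) * (1 / (α * (p - q)) + M)) := by
  have hp : 0 < p := by linarith [h.q_nonneg, h.lt]
  have hr0 : 0 ≤ q / p := h.ratio_nonneg
  have hd : 0 < p - q := by linarith [h.lt]
  have hr := ratio_rpow_le h hα hα1
  set A := 2 * C * ρ ^ (-α) with hA
  have hA0 : 0 ≤ A := by positivity
  set R := (q / p) ^ α with hR
  have hR0 : 0 ≤ R := by positivity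
  have hR1 : R < 1 := by
    have : 0 < α * (p - q) := by positivity
    linarith
  have hterm : ∀ k : ℕ, meanTrunc P τ ((q / p) ^ k / ρ) ≤ ENNReal.ofReal (A * R ^ k) := by
    intro k
    refine (meanTrunc_le hτ hC (by positivity)).trans_eq ?_
    congr 1
    rw [Real.div_rpow (by positivity) hρ.le, hA, Real.rpow_neg hρ.le, hR, ← Real.rpow_natCast,
      ← Real.rpow_natCast, ← Real.rpow_mul hr0, ← Real.rpow_mul hr0, mul_comm (k : ℝ)]
    ring
  unfold sideWeight
  rw [tsum_of_nat_of_neg_add_one ENNReal.summable ENNReal.summable, mul_add,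
    ENNReal.ofReal_add (by positivity) (by positivity)]
  refine add_le_add ?_ ?_
  · calc _ ≤ ∑' k : ℕ, ENNReal.ofReal (A * R ^ k) := by
          refine ENNReal.tsum_le_tsum fun k => ?_
          split_ifs
          · exact zero_le
          · simpa using hterm k
      _ = ENNReal.ofReal (A * (1 - R)⁻¹) := by
          rw [← ENNReal.ofReal_tsum_of_nonneg (fun k => by positivity)
            ((summable_geometric_of_lt_one hR0 hR1).mul_left _), tsum_mul_left,
            tsum_geometric_of_lt_one hR0 hR1]
      _ ≤ _ := by
          refine ENNReal.ofReal_le_ofReal (mul_le_mul_of_nonneg_left ?_ hA0)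
          rw [one_div]
          gcongr
          linarith
  · calc _ ≤ ∑' k : ℕ, if k ∈ Finset.range M then ENNReal.ofReal A else 0 := by
          refine ENNReal.tsum_le_tsum fun k => ?_
          by_cases hk : k < M
          · rw [if_neg (by omega), if_pos (Finset.mem_range.2 hk)]
            have e : (-((k : ℤ) + 1)).toNat = 0 := by omega
            rw [e]
            simpa using hterm 0
          · rw [if_pos (by omega)]
            exact zero_le
      _ = _ := by
          rw [tsum_eq_sum (s := Finset.range M) fun k hk => if_neg hk, Finset.sum_ite_mem,
            Finset.inter_self, Finset.sum_const, Finset.card_range, nsmul_eq_mul,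
            ENNReal.ofReal_mul hA0, ENNReal.ofReal_natCast, mul_comm]

end sideWeight

section scaling

variable {Ω : Type*} [MeasurableSpace Ω] {P : Measure Ω} [IsProbabilityMeasure P]
  {τ : ℤ → Ω → ℝ} {α μ : ℝ} {d σ T : ℕ → ℝ}

lemma IsScaling.time_pos (hS : IsScaling α μ d σ T) (hμ : 0 < μ) (n : ℕ) : 0 < T n := by
  have h1 := hS.drift_pos n
  have h2 : 0 < T n * d n := by rw [hS.time n]; exact mul_pos hμ (hS.scale_pos n)
  exact (pos_iff_pos_of_mul_pos h2).2 h1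

lemma IsScaling.isDriftPair (hS : IsScaling α μ d σ T) (n : ℕ) :
    IsDriftPair ((1 + d n) / 2) ((1 - d n) / 2) where
  q_nonneg := by linarith [hS.drift_le n]
  add_eq := by ring
  lt := by linarith [hS.drift_pos n]

lemma IsScaling.drift_eq (d : ℕ → ℝ) (n : ℕ) : (1 + d n) / 2 - (1 - d n) / 2 = d n := by ring

lemma IsScaling.div_eq (hS : IsScaling α μ d σ T) (hμ : 0 < μ) {k : ℝ} (hk : 0 < k) (n : ℕ) :
    d n / (k / T n) = μ * σ n / k := by
  have := hS.time_pos hμ n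
  rw [← hS.time n]
  field_simp

/-- With `x = μ σ / k`, the factor `x^α · depthMean` has a finite limit and `x^(-α) / d → 0` by the
hypothesis `rare`. This drives all error terms of the range estimate to zero. -/
lemma IsScaling.tendsto_sqrt (hS : IsScaling α μ d σ T) (hα : 0 < α) (hα1 : α < 1) (hμ : 0 < μ)
    {ρ : Measure ℝ} (hρ : IsTailLaw α ρ) {k : ℝ} (hk : 0 < k) :
    Tendsto (fun n => √(depthMean ρ 0 (μ * σ n / k) / d n)) atTop (𝓝 0) := by
  have hx : Tendsto (fun n => μ * σ n / k) atTop atTop :=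
    (hS.scale_top.const_mul_atTop hμ).atTop_div_const hk
  have h1 := ((hρ.tendsto_integral hα hα1 0).comp hx).mul (hS.rare.const_mul ((μ / k) ^ (-α)))
  rw [mul_zero, mul_zero] at h1
  have h2 : Tendsto (fun n => depthMean ρ 0 (μ * σ n / k) / d n) atTop (𝓝 0) := by
    refine h1.congr fun n => ?_
    have hσ := hS.scale_pos n
    have e : μ * σ n / k = μ / k * σ n := by ring
    have hx0 : 0 < μ * σ n / k := by positivity
    have e2 : (μ * σ n / k) ^ α * ((μ / k) ^ (-α) * σ n ^ (-α)) = 1 := by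
      rw [← Real.mul_rpow (by positivity) hσ.le, ← e, ← Real.rpow_add hx0, add_neg_cancel,
        Real.rpow_zero]
    rw [Function.comp_apply]
    change (μ * σ n / k) ^ α * depthMean ρ 0 (μ * σ n / k) * ((μ / k) ^ (-α) * (σ n ^ (-α) / d n)) = _
    calc _ = ((μ * σ n / k) ^ α * ((μ / k) ^ (-α) * σ n ^ (-α)))
          * (depthMean ρ 0 (μ * σ n / k) / d n) := by ring
      _ = _ := by rw [e2, one_mul]
  simpa using h2.sqrt

lemma tendsto_reachFactor : Tendsto reachFactor (𝓝 0) (𝓝 1) := by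
  have : ContinuousAt reachFactor 0 := by
    unfold reachFactor
    refine ContinuousAt.add (by fun_prop) (ContinuousAt.div (by fun_prop) (by fun_prop) (by norm_num))
  have h := this.tendsto
  have e : reachFactor 0 = 1 := by norm_num [reachFactor]
  rwa [e] at h

lemma IsScaling.eventually_meanReach_ne_top (hS : IsScaling α μ d σ T) (hα : 0 < α) (hα1 : α < 1)
    (hμ : 0 < μ) (hτ : IsPosIIDEnv P τ) (hρ : IsTailLaw α (P.map (τ 0))) {k : ℝ} (hk : 0 < k) :
    ∀ᶠ n in atTop, meanReach P ((1 + d n) / 2) ((1 - d n) / 2) τ (k / T n) ≠ ⊤ := by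
  filter_upwards [(hS.tendsto_sqrt hα hα1 hμ hρ hk).eventually_lt_const (by norm_num : (0 : ℝ) < 1 / 3)]
    with n hn
  refine meanReach_ne_top (hS.isDriftPair n) hτ (div_pos hk (hS.time_pos hμ n)) ?_
  rwa [drift_eq, hS.div_eq hμ hk]

/-- Convergence of the Laplace transforms. -/
theorem IsScaling.tendsto_laplace (hS : IsScaling α μ d σ T) (hα : 0 < α) (hα1 : α < 1)
    (hμ : 0 < μ) (hτ : IsPosIIDEnv P τ) (hρ : IsTailLaw α (P.map (τ 0))) {k v : ℝ} (hk : 0 < k) :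
    Tendsto (fun n => (ENNReal.ofReal (k / T n) * ∫⁻ u in Set.Ioi (0 : ℝ),
        ENNReal.ofReal (Real.exp (-(k / T n) * u))
          * meanOcc P ((1 + d n) / 2) ((1 - d n) / 2) τ (Set.Ioi (v * σ n)) u).toReal) atTop
      (𝓝 ((tailIntegral α (k * v / μ)).toReal / (tailIntegral α 0).toReal)) := by
  set c := k * v / μ with hc
  set ρ := P.map (τ 0) with hρdef
  have hx : Tendsto (fun n => μ * σ n / k) atTop atTop :=
    (hS.scale_top.const_mul_atTop hμ).atTop_div_const hk
  have hI0 : (tailIntegral α 0).toReal ≠ 0 :=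
    (ENNReal.toReal_pos (tailIntegral_pos 0).ne' (tailIntegral_lt_top hα hα1 0).ne).ne'
  have hr : Tendsto (fun n => depthMean ρ c (μ * σ n / k) / depthMean ρ 0 (μ * σ n / k)) atTop
      (𝓝 ((tailIntegral α c).toReal / (tailIntegral α 0).toReal)) := by
    refine (((hρ.tendsto_integral hα hα1 c).comp hx).div
      ((hρ.tendsto_integral hα hα1 0).comp hx) hI0).congr fun n => ?_
    have hσ := hS.scale_pos n
    have : (0 : ℝ) < (μ * σ n / k) ^ α := by positivity
    exact mul_div_mul_left _ _ this.ne'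
  have he := hS.tendsto_sqrt hα hα1 hμ hρ hk
  have hK := tendsto_reachFactor.comp he
  have hlo := ((hr.const_sub 1).mul hK).const_sub 1
  have hhi := hK.mul hr
  rw [one_mul] at hhi
  rw [mul_one, sub_sub_cancel] at hlo
  -- Since the correction factor tends to one, the lower bound `1 - K (1 - ratio)` and the upper
  -- bound `K · ratio` have the same limit.
  refine tendsto_of_tendsto_of_tendsto_of_le_of_le' hlo hhi ?_ ?_
  all_goals
    filter_upwards [he.eventually_lt_const (by norm_num : (0 : ℝ) < 1 / 3)] with n hn
    have hT := hS.time_pos hμ n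
    have hmem := laplace_meanOcc_mem (c := c) (hS.isDriftPair n) hτ (div_pos hk hT) rfl rfl
      (by rw [drift_eq, hS.div_eq hμ hk]; exact hn) rfl
    rw [drift_eq, hS.div_eq hμ hk] at hmem
    have e : c * (μ * σ n / k) = v * σ n := by rw [hc]; field_simp
    rw [e] at hmem
  · have := hmem.1
    simp only [Function.comp_apply]
    rw [mul_comm] at this ⊢
    linarith
  · exact hmem.2

end scaling

/-! ### Pointwise convergence of the occupation of deep traps. -/

section limit

variable {Ω : Type*} [MeasurableSpace Ω] {P : Measure Ω} [IsProbabilityMeasure P]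
  {τ : ℤ → Ω → ℝ} {α μ : ℝ} {d σ T : ℕ → ℝ}

/-- Since `q / p ≤ exp (-(p - q))`, a window of length `1 / (p - q)` suffices for `(q / p)^(M + 1) ≤
1 / e ≤ 1 / 2`. -/
lemma one_sub_ratio_pow_ge {p q : ℝ} (h : IsDriftPair p q) {M : ℕ} (hM : 1 / (p - q) ≤ M) :
    1 / 2 ≤ 1 - (q / p) ^ (M + 1) := by
  have hp : 0 < p := by linarith [h.q_nonneg, h.lt]
  have hd : 0 < p - q := by linarith [h.lt]
  have hle : q / p ≤ Real.exp (-(p - q)) := by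
    refine le_trans ?_ (Real.add_one_le_exp _)
    rw [div_le_iff₀ hp]
    nlinarith [h.add_eq, h.q_nonneg]
  have h1 : (q / p) ^ (M + 1) ≤ Real.exp (-1) := by
    calc (q / p) ^ (M + 1) ≤ Real.exp (-(p - q)) ^ (M + 1) :=
          pow_le_pow_left₀ h.ratio_nonneg hle _
      _ = Real.exp (-((M + 1 : ℕ) * (p - q))) := by rw [← Real.exp_nat_mul]; ring_nf
      _ ≤ _ := by
          rw [Real.exp_le_exp, neg_le_neg_iff]
          have : 1 ≤ (M : ℝ) * (p - q) := (div_le_iff₀ hd).1 hM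
          push_cast
          nlinarith
  have h2 : Real.exp (-1) ≤ 1 / 2 := by
    rw [Real.exp_neg, one_div]
    exact inv_anti₀ two_pos (by linarith [Real.add_one_le_exp (1 : ℝ)])
  linarith

/-- The modulus of the downward drops of the probability to be in a deep trap. -/
lemma IsScaling.meanOcc_le_add (hS : IsScaling α μ d σ T) (hα : 0 < α) (hα1 : α < 1) (hμ : 0 < μ)
    (hτ : IsPosIIDEnv P τ) {C : ℝ} (hC0 : 0 ≤ C)
    (hC : ∀ x, 0 < x → ∫⁻ y, ENNReal.ofReal (y / (y + x)) ∂(P.map (τ 0))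
      ≤ ENNReal.ofReal (C * x ^ (-α))) {v : ℝ} (hv : 0 < v) (n : ℕ)
    (hn : √(depthMean (P.map (τ 0)) 0 (μ * σ n) / d n) < 1 / 3)
    (hK : reachFactor √(depthMean (P.map (τ 0)) 0 (μ * σ n) / d n) ≤ 2)
    {s s' t r : ℝ} (hs : 0 ≤ s) (hst : s ≤ t) (hss : s ≤ s') (hsr : s' ≤ s + r) :
    (meanOcc P ((1 + d n) / 2) ((1 - d n) / 2) τ (Set.Ioi (v * σ n)) (T n * s)).toReal
      ≤ (meanOcc P ((1 + d n) / 2) ((1 - d n) / 2) τ (Set.Ioi (v * σ n)) (T n * s')).toReal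
        + Real.exp t * (2 * (1 + μ / v)) * (4 * C * v ^ (-α) * (1 / α + 2) * (σ n ^ (-α) / d n)
          + 2 * μ / v * r) := by
  have := isProbabilityMeasure_map_trap hτ
  have hpos := map_trap_ae_pos hτ
  have h := hS.isDriftPair n
  have hT := hS.time_pos hμ n
  have hσ := hS.scale_pos n
  have hd := hS.drift_pos n
  have hd1 := hS.drift_le n
  set p := (1 + d n) / 2 with hp
  set q := (1 - d n) / 2 with hq
  have hpq : p - q = d n := by rw [hp, hq]; ring
  have hr : 0 ≤ r := by linarith
  set ρ := v * σ n with hρ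
  have hρ0 : 0 < ρ := by positivity
  have hl : (0 : ℝ) < 1 / T n := by positivity
  -- A window of length of order `1 / d`: long enough that the exit term is bounded with a factor 2,
  -- short enough that the side weights are of order `σ^(-α) / d`, which tends to zero.
  set M : ℕ := ⌈1 / d n⌉₊ with hM
  have hM1 : 1 / d n ≤ M := Nat.le_ceil _
  have hM2 : (M : ℝ) ≤ 2 / d n := by
    have := Nat.ceil_lt_add_one (show 0 ≤ 1 / d n by positivity)
    have h1 : 1 ≤ 1 / d n := by rw [le_div_iff₀ hd]; linarith
    have h2 : 2 / d n = 1 / d n + 1 / d n := by ring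
    linarith
  set D := Set.Ioi ρ with hD
  set A := meanReach P p q τ (1 / T n) with hA
  have hdiv : (p - q) / (1 / T n) = μ * σ n := by
    have := hS.time n
    rw [hpq, ← this]; field_simp
  set b := depthMean (P.map (τ 0)) 0 (μ * σ n) with hb
  have hx0 : 0 < μ * σ n := by positivity
  have hb0 : 0 < b := depthMean_zero_pos hpos hx0
  have hbA : ENNReal.ofReal b * A ≤ ENNReal.ofReal 2 :=
    (mul_meanReach_le h hτ hl (b := b) (by rw [hdiv]) (by rw [hpq]) hn).trans
      (ENNReal.ofReal_le_ofReal hK)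
  -- The mean number of deep traps among the sites reached stays bounded: their density is at most
  -- `(1 + μ / v) b` and `b A ≤ 2`.
  have hPA : P {ω | τ 0 ω ∈ D} * A ≤ ENNReal.ofReal (2 * (1 + μ / v)) := by
    have h1 := measure_Ioi_le_depthMean hpos hx0 (c := v / μ) (by positivity)
    have e : v / μ * (μ * σ n) = ρ := by rw [hρ]; field_simp
    rw [e, Measure.map_apply (hτ.measurable 0) measurableSet_Ioi, one_div_div] at h1
    calc _ ≤ ENNReal.ofReal ((1 + μ / v) * b) * A := by gcongr; exact h1
      _ = ENNReal.ofReal (1 + μ / v) * (ENNReal.ofReal b * A) := by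
          rw [ENNReal.ofReal_mul (by positivity), mul_assoc]
      _ ≤ ENNReal.ofReal (1 + μ / v) * ENNReal.ofReal 2 := by gcongr
      _ = _ := by rw [← ENNReal.ofReal_mul (by positivity), mul_comm]
  have hmain := TrapModel.meanOcc_le_add h hτ hl.le (D := D) measurableSet_Ioi hρ0
    (fun x hx => le_of_lt hx) M (T n * s) (r := T n * (s' - s))
    (mul_nonneg hT.le (by linarith))
  have e1 : T n * s + T n * (s' - s) = T n * s' := by ring
  have e2 : 1 / T n * (T n * s) = s := by field_simp
  rw [e1, e2, hpq] at hmain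
  have hSW := sideWeight_le h hτ hα hα1 hC0 hC hρ0 M
  rw [hpq] at hSW
  set W := 2 * C * v ^ (-α) * (1 / α + 2) * (σ n ^ (-α) / d n) with hW
  have hSW' : sideWeight P p q τ ρ M ≤ ENNReal.ofReal W := by
    refine hSW.trans (ENNReal.ofReal_le_ofReal ?_)
    rw [hρ, Real.mul_rpow hv.le hσ.le]
    calc 2 * C * (v ^ (-α) * σ n ^ (-α)) * (1 / (α * d n) + M)
        ≤ 2 * C * (v ^ (-α) * σ n ^ (-α)) * (1 / (α * d n) + 2 / d n) := by gcongr
      _ = W := by rw [hW]; field_simp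
  have hpow := one_sub_ratio_pow_ge h (M := M) (by rwa [hpq])
  have hκ : T n * (s' - s) * d n / (ρ * (1 - (q / p) ^ (M + 1))) ≤ 2 * μ / v * r := by
    rw [div_le_iff₀ (mul_pos hρ0 (by linarith))]
    calc T n * (s' - s) * d n = μ * σ n * (s' - s) := by rw [← hS.time n]; ring
      _ ≤ μ * σ n * r := by gcongr; linarith
      _ = 2 * μ / v * r * (ρ * (1 / 2)) := by rw [hρ]; field_simp
      _ ≤ _ := by gcongr
  have hW0 : 0 ≤ W := by positivity
  have hB0 : 0 ≤ 2 * μ / v * r := by positivity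
  have hbound : ENNReal.ofReal (Real.exp s) * P {ω | τ 0 ω ∈ D} * (2 * A * sideWeight P p q τ ρ M
        + A * ENNReal.ofReal (T n * (s' - s) * d n / (ρ * (1 - (q / p) ^ (M + 1)))))
      ≤ ENNReal.ofReal (Real.exp t * (2 * (1 + μ / v)) * (2 * W + 2 * μ / v * r)) := by
    calc _ = ENNReal.ofReal (Real.exp s) * (P {ω | τ 0 ω ∈ D} * A)
          * (2 * sideWeight P p q τ ρ M
            + ENNReal.ofReal (T n * (s' - s) * d n / (ρ * (1 - (q / p) ^ (M + 1))))) := by ring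
      _ ≤ ENNReal.ofReal (Real.exp t) * ENNReal.ofReal (2 * (1 + μ / v))
          * (2 * ENNReal.ofReal W + ENNReal.ofReal (2 * μ / v * r)) := by gcongr
      _ = _ := by
          have e3 : (2 : ℝ≥0∞) = ENNReal.ofReal 2 := by simp
          rw [e3, ← ENNReal.ofReal_mul zero_le_two, ← ENNReal.ofReal_add (by positivity) hB0,
            ← ENNReal.ofReal_mul (Real.exp_pos _).le, ← ENNReal.ofReal_mul (by positivity)]
  have hs' : 0 ≤ T n * s' := mul_nonneg hT.le (hs.trans hss)
  have hfin : meanOcc P p q τ D (T n * s') ≠ ⊤ :=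
    ne_top_of_le_ne_top ENNReal.one_ne_top (meanOcc_le_one h hτ D hs')
  have hfinal := ENNReal.toReal_mono (by finiteness) (hmain.trans (add_le_add le_rfl hbound))
  rw [ENNReal.toReal_add hfin ENNReal.ofReal_ne_top, ENNReal.toReal_ofReal (by positivity)] at hfinal
  refine hfinal.trans_eq ?_
  rw [hW]
  ring

/-- The depth of the trap in which the process is, on the scale `σ n`, converges in law. -/
theorem IsScaling.tendsto_meanOcc (hS : IsScaling α μ d σ T) (hα : 0 < α) (hα1 : α < 1)
    (hμ : 0 < μ) (hτ : IsPosIIDEnv P τ) (hρ : IsTailLaw α (P.map (τ 0))) {v t : ℝ} (hv : 0 < v)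
    (ht : 0 < t) :
    Tendsto (fun n => (meanOcc P ((1 + d n) / 2) ((1 - d n) / 2) τ (Set.Ioi (v * σ n))
      (T n * t)).toReal) atTop (𝓝 (ratioLaw α μ (Set.Iio (t / v))).toReal) := by
  have := isProbabilityMeasure_ratioLaw (μ := μ) hα hα1
  have hle1 : ∀ {x : ℝ≥0∞}, x ≤ 1 → |x.toReal| ≤ 1 := fun hx => by
    rw [abs_of_nonneg ENNReal.toReal_nonneg]
    exact ENNReal.toReal_le_of_le_ofReal zero_le_one (by simpa using hx)
  have hmm : ∀ n, Measurable (meanOcc P ((1 + d n) / 2) ((1 - d n) / 2) τ (Set.Ioi (v * σ n))) :=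
    fun n => measurable_meanOcc hτ measurableSet_Ioi
  have hGm : Measurable fun r => ratioLaw α μ (Set.Iio r) := measurable_measure_Iio _
  refine tendsto_of_laplace
    (F := fun n t => (meanOcc P ((1 + d n) / 2) ((1 - d n) / 2) τ (Set.Ioi (v * σ n))
      (T n * t)).toReal)
    (G := fun t => (ratioLaw α μ (Set.Iio (t / v))).toReal) (fun n => ?_) (fun n s hs => ?_) ?_
    (fun s _ => hle1 prob_le_one) (fun j => ?_) ht ?_ ?_
  · exact ((hmm n).comp (measurable_const_mul (T n))).ennreal_toReal
  · exact hle1 (meanOcc_le_one (hS.isDriftPair n) hτ _ (mul_nonneg (hS.time_pos hμ n).le hs.le))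
  · exact (hGm.comp (measurable_div_const v)).ennreal_toReal
  · set k : ℝ := j + 1 with hk
    have hk0 : 0 < k := by positivity
    have hlim := (hS.tendsto_laplace hα hα1 hμ hτ hρ (v := v) hk0).const_mul (1 / k)
    have hG : ∫ t in Set.Ioi (0 : ℝ), Real.exp (-k * t) * (ratioLaw α μ (Set.Iio (t / v))).toReal
        = 1 / k * ((tailIntegral α (k * v / μ)).toReal / (tailIntegral α 0).toReal) := by
      have e1 := integral_comp_mul_left_Ioi'
        (fun t => Real.exp (-k * t) * (ratioLaw α μ (Set.Iio (t / v))).toReal) 0 hv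
      rw [mul_zero] at e1
      rw [← e1]
      have e2 : ∀ r, Real.exp (-k * (v * r)) * (ratioLaw α μ (Set.Iio (v * r / v))).toReal
          = Real.exp (-(k * v) * r) * (ratioLaw α μ (Set.Iio r)).toReal := fun r => by
        rw [mul_div_cancel_left₀ _ hv.ne']; ring_nf
      simp only [e2]
      rw [setIntegral_exp_mul_toReal hGm fun r _ => prob_le_one,
        lintegral_exp_mul_Iio ((ratioLaw_ae_pos hα hα1 hμ).mono fun x hx => hx.le) (by positivity),
        laplaceLaw_ratioLaw hα hα1 hμ (by positivity), ENNReal.toReal_mul, ENNReal.toReal_div,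
        ENNReal.toReal_ofReal (by positivity), smul_eq_mul]
      field_simp
    rw [hG]
    refine hlim.congr fun n => ?_
    have hT := hS.time_pos hμ n
    have e1 := integral_comp_mul_left_Ioi
      (fun u => Real.exp (-(k / T n) * u) * (meanOcc P ((1 + d n) / 2) ((1 - d n) / 2) τ
        (Set.Ioi (v * σ n)) u).toReal) 0 hT
    rw [mul_zero, setIntegral_exp_mul_toReal (hmm n) fun u hu =>
      meanOcc_le_one (hS.isDriftPair n) hτ _ hu.le] at e1
    have e2 : ∀ t, -(k / T n) * (T n * t) = -k * t := fun t => by field_simp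
    simp only [e2] at e1
    rw [e1, ENNReal.toReal_mul, ENNReal.toReal_ofReal (by positivity), smul_eq_mul]
    field_simp
  · exact (continuousAt_ratioLaw_Iio hα hα1 hμ (t / v)).comp (f := fun t => t / v) (by fun_prop)
  · intro ε hε
    obtain ⟨C, hC0, hC⟩ := hρ.exists_lintegral_le hα hα1
    set E := Real.exp t * (2 * (1 + μ / v)) with hE
    have hE0 : 0 < E := by positivity
    set B := 2 * μ / v with hB
    have hB0 : 0 < B := by positivity
    -- The escape term of the modulus is `E B r`, so this `r` makes it `ε / 2`; the side-weight term
    -- does not depend on `r` and is below `ε / 2` for large `n`.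
    refine ⟨ε / (2 * E * B), by positivity, ?_⟩
    have h1 := hS.tendsto_sqrt hα hα1 hμ hρ one_pos
    simp only [div_one] at h1
    have h2 := tendsto_reachFactor.comp h1
    have h3 := hS.rare.const_mul (E * (4 * C * v ^ (-α) * (1 / α + 2)))
    rw [mul_zero] at h3
    filter_upwards [h1.eventually_lt_const (by norm_num : (0 : ℝ) < 1 / 3),
      h2.eventually_lt_const (by norm_num : (1 : ℝ) < 2),
      h3.eventually_lt_const (by positivity : 0 < ε / 2)] with n hn1 hn2 hn3 s s' hs hst hss hsr
    refine (hS.meanOcc_le_add hα hα1 hμ hτ hC0.le hC hv n hn1 hn2.le hs hst hss hsr).trans ?_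
    have e : E * (B * (ε / (2 * E * B))) = ε / 2 := by field_simp
    rw [mul_add, e]
    linarith

end limit

/-- Tails determine the half-open intervals `(a, b]`, a π-system that contains small neighbourhoods
of every point, and these determine weak convergence. -/
lemma tendsto_probabilityMeasure_of_Ioi {κ : ℕ → ProbabilityMeasure ℝ} {κ₀ : ProbabilityMeasure ℝ}
    (h : ∀ v, Tendsto (fun n => (κ n : Measure ℝ).real (Set.Ioi v)) atTop
      (𝓝 ((κ₀ : Measure ℝ).real (Set.Ioi v)))) : Tendsto κ atTop (𝓝 κ₀) := by
  have hsub : ∀ (ν : ProbabilityMeasure ℝ) {a b : ℝ}, a < b → ((ν (Set.Ioc a b) : NNReal) : ℝ)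
      = (ν : Measure ℝ).real (Set.Ioi a) - (ν : Measure ℝ).real (Set.Ioi b) := by
    intro ν a b hab
    rw [← Set.Ioc_union_Ioi_eq_Ioi hab.le, measureReal_union Set.Ioc_disjoint_Ioi_same
      measurableSet_Ioi, add_sub_cancel_right]
    rfl
  refine IsPiSystem.tendsto_probabilityMeasure_of_tendsto_of_mem
    (S := {S | ∃ a b : ℝ, a < b ∧ Set.Ioc a b = S}) (isPiSystem_Ioc id id) ?_ ?_ ?_
  · rintro s ⟨a, b, -, rfl⟩
    exact measurableSet_Ioc
  · intro u hu x hx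
    obtain ⟨ε, hε, hball⟩ := Metric.isOpen_iff.1 hu x hx
    refine ⟨Set.Ioc (x - ε / 2) (x + ε / 2), ⟨_, _, by linarith, rfl⟩,
      Ioc_mem_nhds (by linarith) (by linarith), fun y hy => hball ?_⟩
    rw [Metric.mem_ball, Real.dist_eq, abs_lt]
    constructor <;> linarith [hy.1, hy.2]
  · rintro s ⟨a, b, hab, rfl⟩
    rw [← NNReal.tendsto_coe]
    simp only [hsub _ hab]
    exact (h a).sub (h b)

/-! ### The law of `ξ_t` and the constant `c(t)`. -/

section limitLaw

variable {α μ t : ℝ}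

/-- The law of the limit of the depth of the trap at time `t`. -/
def limitLaw (α μ t : ℝ) : Measure ℝ := (ratioLaw α μ).map fun r => t / r

lemma isProbabilityMeasure_limitLaw (hα : 0 < α) (hα1 : α < 1) (t : ℝ) :
    IsProbabilityMeasure (limitLaw α μ t) := by
  have := isProbabilityMeasure_ratioLaw (μ := μ) hα hα1
  exact Measure.isProbabilityMeasure_map (by fun_prop)

lemma limitLaw_ae_pos (hα : 0 < α) (hα1 : α < 1) (hμ : 0 < μ) (ht : 0 < t) :
    ∀ᵐ x ∂(limitLaw α μ t), 0 < x := by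
  rw [limitLaw, ae_map_iff (by fun_prop) measurableSet_Ioi]
  filter_upwards [ratioLaw_ae_pos hα hα1 hμ] with r hr
  positivity

lemma limitLaw_Iio_zero (hα : 0 < α) (hα1 : α < 1) (hμ : 0 < μ) (ht : 0 < t) :
    limitLaw α μ t (Set.Iio 0) = 0 :=
  measure_mono_null (fun x (hx : x < 0) => not_lt.2 hx.le) (ae_iff.1 (limitLaw_ae_pos hα hα1 hμ ht))

lemma limitLaw_Ioi (hα : 0 < α) (hα1 : α < 1) (hμ : 0 < μ) (t : ℝ) {v : ℝ} (hv : 0 < v) :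
    limitLaw α μ t (Set.Ioi v) = ratioLaw α μ (Set.Iio (t / v)) := by
  rw [limitLaw, Measure.map_apply (by fun_prop) measurableSet_Ioi]
  refine measure_congr ?_
  filter_upwards [ratioLaw_ae_pos hα hα1 hμ] with r hr
  refine propext ?_
  change v < t / r ↔ r < t / v
  rw [lt_div_iff₀ hr, lt_div_iff₀ hv, mul_comm]

lemma limitLaw_real_Ioi_of_nonpos (hα : 0 < α) (hα1 : α < 1) (hμ : 0 < μ) (ht : 0 < t) {v : ℝ}
    (hv : v ≤ 0) : (limitLaw α μ t).real (Set.Ioi v) = 1 := by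
  have := isProbabilityMeasure_limitLaw (μ := μ) hα hα1 t
  have h : limitLaw α μ t (Set.Ioi v) = limitLaw α μ t Set.univ := by
    refine measure_congr ?_
    filter_upwards [limitLaw_ae_pos hα hα1 hμ ht] with x hx
    exact propext ⟨fun _ => trivial, fun _ => lt_of_le_of_lt hv hx⟩
  rw [measureReal_def, h, measure_univ, ENNReal.toReal_one]

lemma limitLaw_ne_dirac (hα : 0 < α) (hα1 : α < 1) (hμ : 0 < μ) (ht : 0 < t) (a : ℝ) :
    limitLaw α μ t ≠ Measure.dirac a := by
  intro h
  have h1 : limitLaw α μ t {a} = 0 := by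
    rw [limitLaw, Measure.map_apply (by fun_prop) (measurableSet_singleton a)]
    have h2 := (measure_eq_zero_iff_ae_notMem).1 (ratioLaw_singleton hα hα1 hμ (t / a))
    rw [measure_eq_zero_iff_ae_notMem]
    filter_upwards [h2, ratioLaw_ae_pos hα hα1 hμ] with r hr hr0 hra
    refine hr ?_
    have e : t / r = a := hra
    rw [Set.mem_singleton_iff, ← e, div_div_cancel₀ ht.ne']
  rw [h] at h1
  simp at h1

lemma expNegInvGlue_eq {x : ℝ} (hx : 0 < x) : expNegInvGlue x = Real.exp (-x⁻¹) := by
  rw [expNegInvGlue, if_neg (not_le.2 hx)]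

lemma expNegInvGlue_lt_one (x : ℝ) : expNegInvGlue x < 1 := by
  rw [expNegInvGlue]
  split_ifs with h
  · exact one_pos
  · rw [Real.exp_lt_one_iff, neg_lt_zero]
    exact inv_pos.2 (not_le.1 h)

lemma continuous_expNegInvGlue : Continuous expNegInvGlue :=
  expNegInvGlue.contDiff (n := 0) |>.continuous

/-- The function `expNegInvGlue`, as a bounded continuous function. -/
def glue : BoundedContinuousFunction ℝ ℝ :=
  BoundedContinuousFunction.ofNormedAddCommGroup expNegInvGlue continuous_expNegInvGlue 1 fun x => by
    rw [Real.norm_of_nonneg (expNegInvGlue.nonneg x)]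
    exact (expNegInvGlue_lt_one x).le

lemma integral_expNegInvGlue_mem {ν : Measure ℝ} [IsProbabilityMeasure ν] (hν : ∀ᵐ x ∂ν, 0 < x) :
    0 < ∫ x, expNegInvGlue x ∂ν ∧ ∫ x, expNegInvGlue x ∂ν < 1 := by
  have hint : Integrable expNegInvGlue ν := glue.integrable ν
  have huniv : ∀ {f : ℝ → ℝ}, (∀ᵐ x ∂ν, 0 < f x) → Integrable f ν → 0 < ∫ x, f x ∂ν := by
    intro f hf hfi
    rw [integral_pos_iff_support_of_nonneg_ae (hf.mono fun x hx => hx.le) hfi,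
      measure_congr (t := Set.univ), measure_univ]
    · exact one_pos
    filter_upwards [hf] with z hz
    exact propext ⟨fun _ => trivial, fun _ => hz.ne'⟩
  refine ⟨huniv (hν.mono fun x hx => expNegInvGlue.pos_of_pos hx) hint, ?_⟩
  have h := huniv (f := fun x => 1 - expNegInvGlue x)
    (ae_of_all _ fun x => sub_pos.2 (expNegInvGlue_lt_one x)) ((integrable_const 1).sub hint)
  rw [integral_sub (integrable_const 1) hint] at h
  simp only [integral_const, probReal_univ, smul_eq_mul, mul_one] at h
  linarith

end limitLaw

/-! ### Passage to an everywhere positive environment, and convergence in law. -/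

section modification

variable {Ω : Type*} [MeasurableSpace Ω] {P : Measure Ω} {α : ℝ} {τ : ℤ → Ω → ℝ}

/-- A positive modification of a depth. -/
def toPos (x : ℝ) : ℝ := if 0 < x then x else 1

lemma measurable_toPos : Measurable toPos :=
  Measurable.ite (measurableSet_lt measurable_const measurable_id) measurable_id measurable_const

lemma toPos_pos (x : ℝ) : 0 < toPos x := by
  unfold toPos
  split_ifs with h
  exacts [h, one_pos]

lemma IsTrapEnvironment.ae_toPos (hτ : IsTrapEnvironment P α τ) :
    ∀ᵐ ω ∂P, ∀ z, toPos (τ z ω) = τ z ω :=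
  ae_all_iff.2 fun z => (hτ.pos z).mono fun _ hω => if_pos hω

lemma IsTrapEnvironment.isPosIIDEnv (hτ : IsTrapEnvironment P α τ) :
    IsPosIIDEnv P fun z ω => toPos (τ z ω) where
  measurable z := measurable_toPos.comp (hτ.measurable z)
  indep := hτ.indep.comp (fun _ => toPos) fun _ => measurable_toPos
  identDistrib z := (hτ.identDistrib z).comp measurable_toPos
  pos _ _ := toPos_pos _

lemma IsTrapEnvironment.isTailLaw [IsProbabilityMeasure P] (hτ : IsTrapEnvironment P α τ) :
    IsTailLaw α (P.map fun ω => toPos (τ 0 ω)) where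
  isProbabilityMeasure := isProbabilityMeasure_map_trap hτ.isPosIIDEnv
  pos := map_trap_ae_pos hτ.isPosIIDEnv
  tail := by
    have hm : Measurable fun ω => toPos (τ 0 ω) := measurable_toPos.comp (hτ.measurable 0)
    refine hτ.tail.congr fun x => ?_
    rw [measureReal_def, measureReal_def, Measure.map_apply hm measurableSet_Ioi]
    congr 2
    refine measure_congr ?_
    filter_upwards [hτ.ae_toPos] with ω hω
    refine propext ?_
    change x < τ 0 ω ↔ x < toPos (τ 0 ω)
    rw [hω 0]

end modification

section convergence

variable {Ω : Type*} [MeasurableSpace Ω] {P : Measure Ω} [IsProbabilityMeasure P]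
  {τ : ℤ → Ω → ℝ} {α μ : ℝ} {d σ T : ℕ → ℝ} {Y : ℕ → ℝ → Ω → ℤ}

lemma measurable_trap (hτ : ∀ z, Measurable (τ z)) {Z : Ω → ℤ} (hZ : Measurable Z) :
    Measurable fun ω => τ (Z ω) ω :=
  measurable_eval_int.comp (f := fun ω => ((fun z => τ z ω), Z ω))
    ((measurable_pi_lambda _ hτ).prodMk hZ)

variable (hS : IsScaling α μ d σ T) (hα : 0 < α) (hα1 : α < 1) (hμ : 0 < μ)
  (hτ : IsPosIIDEnv P τ) (hρ : IsTailLaw α (P.map (τ 0)))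
  (hY : ∀ n, ∃ ε η, IsJumpModel P ((1 + d n) / 2) ((1 - d n) / 2) τ ε η (Y n))
  (hYm : ∀ n s, Measurable (Y n s))
include hS hα hα1 hμ hτ hρ hY hYm

/-- The tails of the rescaled depths converge. -/
theorem tendsto_tail {t : ℝ} (ht : 0 < t) (v : ℝ) :
    Tendsto (fun n => P.real {ω | v < τ (Y n (T n * t) ω) ω / σ n}) atTop
      (𝓝 ((limitLaw α μ t).real (Set.Ioi v))) := by
  rcases le_or_gt v 0 with hv | hv
  · rw [limitLaw_real_Ioi_of_nonpos hα hα1 hμ ht hv]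
    refine tendsto_const_nhds.congr fun n => ?_
    have e : {ω | v < τ (Y n (T n * t) ω) ω / σ n} = Set.univ :=
      Set.eq_univ_of_forall fun ω => lt_of_le_of_lt hv (div_pos (hτ.pos _ ω) (hS.scale_pos n))
    rw [e, probReal_univ]
  · rw [measureReal_def, limitLaw_Ioi hα hα1 hμ t hv]
    refine (hS.tendsto_meanOcc hα hα1 hμ hτ hρ hv ht).congr' ?_
    filter_upwards [hS.eventually_meanReach_ne_top hα hα1 hμ hτ hρ one_pos] with n hA
    obtain ⟨ε, η, hX⟩ := hY n
    have hT := hS.time_pos hμ n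
    have e : {ω | v < τ (Y n (T n * t) ω) ω / σ n}
        = {ω | τ (Y n (T n * t) ω) ω ∈ Set.Ioi (v * σ n)} :=
      Set.ext fun ω => lt_div_iff₀ (hS.scale_pos n)
    rw [measureReal_def, e, hX.measure_trap_mem (hS.isDriftPair n) hτ (by positivity) hA
      (by positivity) measurableSet_Ioi (hYm n _)]

/-- The probability not to jump during a time `σ n` converges. -/
theorem tendsto_measure_forall_eq {t : ℝ} (ht : 0 < t) {κ : ℕ → ProbabilityMeasure ℝ}
    {κ₀ : ProbabilityMeasure ℝ}
    (hκ : ∀ n, (κ n : Measure ℝ) = P.map fun ω => τ (Y n (T n * t) ω) ω / σ n)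
    (hlim : Tendsto κ atTop (𝓝 κ₀)) :
    Tendsto (fun n => P.real {ω | ∀ r, 0 ≤ r → r ≤ σ n → Y n (T n * t) ω = Y n (T n * t + r) ω})
      atTop (𝓝 (∫ x, expNegInvGlue x ∂(κ₀ : Measure ℝ))) := by
  refine ((ProbabilityMeasure.tendsto_iff_forall_integral_tendsto.1 hlim) glue).congr' ?_
  filter_upwards [hS.eventually_meanReach_ne_top hα hα1 hμ hτ hρ one_pos] with n hA
  obtain ⟨ε, η, hX⟩ := hY n
  have hT := hS.time_pos hμ n
  have hσ := hS.scale_pos n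
  have hm := measurable_trap hτ.measurable (hYm n (T n * t))
  rw [measureReal_def, hX.measure_forall_eq (hS.isDriftPair n) hτ (by positivity) hA
      (by positivity) hσ.le, hκ n, integral_map (hm.div_const _).aemeasurable
      glue.continuous.aestronglyMeasurable,
    integral_eq_lintegral_of_nonneg_ae
      (f := fun ω => glue (τ (Y n (T n * t) ω) ω / σ n))
      (ae_of_all _ fun ω => expNegInvGlue.nonneg _)
      (glue.continuous.measurable.comp (hm.div_const _)).aestronglyMeasurable]
  congr 1
  refine lintegral_congr fun ω => ?_
  congr 1
  change expNegInvGlue _ = _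
  rw [expNegInvGlue_eq (div_pos (hτ.pos _ ω) hσ), inv_div, neg_div]

end convergence

/-! ### The scaling exponents and the theorem. -/

section rates

variable {α β μ : ℝ}

lemma eventually_le_rpow (hβ0 : 0 ≤ β) (hμβ : β = 0 → μ ≤ 1) :
    ∀ᶠ N : ℕ in atTop, μ ≤ (N : ℝ) ^ β := by
  rcases hβ0.eq_or_lt with rfl | hβ
  · exact Eventually.of_forall fun N => by simpa using hμβ rfl
  · exact ((tendsto_rpow_atTop hβ).comp tendsto_natCast_atTop_atTop).eventually_ge_atTop μ

/-- With `N = n + N₀`, `σ^(-α) / d = N^(-(α - β (α + 1))) / μ`; the exponent is negative precisely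
when `β < α / (α + 1)`. The shift by `N₀` keeps the drift at most one for every index. -/
lemma isScaling_natCast (hα0 : 0 < α) (hβ : β < α / (α + 1)) (hμ : 0 < μ) {N₀ : ℕ}
    (hN1 : 1 ≤ N₀) (hN : ∀ N : ℕ, N₀ ≤ N → μ ≤ (N : ℝ) ^ β) :
    IsScaling α μ (fun n => μ / ((n + N₀ : ℕ) : ℝ) ^ β) (fun n => ((n + N₀ : ℕ) : ℝ) ^ (1 - β))
      (fun n => ((n + N₀ : ℕ) : ℝ)) := by
  have hpos : ∀ n : ℕ, (0 : ℝ) < ((n + N₀ : ℕ) : ℝ) := fun n => by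
    exact_mod_cast (by omega : 0 < n + N₀)
  have hβ' : β * (α + 1) < α := (lt_div_iff₀ (by linarith)).1 hβ
  have hβ1 : β < 1 := hβ.trans ((div_lt_one (by linarith)).2 (by linarith))
  have htop : Tendsto (fun n : ℕ => ((n + N₀ : ℕ) : ℝ)) atTop atTop :=
    tendsto_natCast_atTop_atTop.comp (tendsto_add_atTop_nat N₀)
  refine ⟨fun n => ?_, fun n => ?_, fun n => ?_, fun n => ?_, ?_, ?_⟩
  · have := hpos n; positivity
  · have := hpos n
    exact (div_le_one (by positivity)).2 (hN _ (by omega))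
  · have := hpos n; positivity
  · have := hpos n
    rw [Real.rpow_sub this, Real.rpow_one]
    ring
  · exact (tendsto_rpow_atTop (by linarith)).comp htop
  · have h1 : 0 < α - β * (α + 1) := by linarith
    have h2 := ((tendsto_rpow_neg_atTop h1).comp htop).const_mul (1 / μ)
    rw [mul_zero] at h2
    refine h2.congr fun n => ?_
    have := hpos n
    rw [Function.comp_apply, ← Real.rpow_mul this.le]
    have e : -(α - β * (α + 1)) = (1 - β) * -α + β := by ring
    rw [e, Real.rpow_add this]
    field_simp

end rates

/-- The environment may be replaced by a positive one. -/
lemma IsTrapModel.exists_isJumpModel {Ω : Type*} [MeasurableSpace Ω] {P : Measure Ω} {α p q : ℝ}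
    {τ : ℤ → Ω → ℝ} {X : ℝ → Ω → ℤ} (hτ : IsTrapEnvironment P α τ) (hX : IsTrapModel P τ p X)
    (hpq : q = 1 - p) : ∃ ε η, IsJumpModel P p q (fun z ω => toPos (τ z ω)) ε η X := by
  obtain ⟨ε, η, h1, h2, h3, h4, h5, h6, h7, h8, h9⟩ := hX
  refine ⟨ε, η, ⟨h1, h2, h3, fun n => (h4 n).1, fun n => ?_, h5, h6, h7⟩, ?_, ?_⟩
  · rw [hpq]; exact (h4 n).2
  · have hm : Measurable fun (f : ℤ → ℝ) z => toPos (f z) :=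
      measurable_pi_lambda _ fun z => measurable_toPos.comp (measurable_pi_apply z)
    exact h8.comp hm measurable_id
  · filter_upwards [hτ.ae_toPos, h9] with ω hω hpath
    simpa only [hω] using hpath

end TrapModel

end

open TrapModel in
/-- `ξ t` is the law of the limit variable `ξ_t`, and `c t = E[exp (-1 / ξ_t)]` with the usual
convention `exp (-1 / 0) = 0` (this is Mathlib's function `expNegInvGlue`). The process `X N` is the
trap model with right-jump probability `(1 + μ / N ^ β) / 2`, which exists as soon as `μ ≤ N ^ β`,
and `X N (N * t)` is the value of the rescaled process at time `t`. -/
theorem theorem2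
    (α β μ : ℝ) (hα0 : 0 < α) (hα1 : α < 1) (hβ0 : 0 ≤ β) (hβ : β < α / (α + 1))
    (hμ : 0 < μ) (hμβ : β = 0 → μ ≤ 1)
    {Ω : Type*} [MeasurableSpace Ω] (P : Measure Ω) [IsProbabilityMeasure P]
    (τ : ℤ → Ω → ℝ) (hτ : TrapModel.IsTrapEnvironment P α τ)
    (X : ℕ → ℝ → Ω → ℤ) (hXm : ∀ N t, Measurable (X N t))
    (hX : ∀ N : ℕ, 1 ≤ N → μ ≤ (N : ℝ) ^ β →
      TrapModel.IsTrapModel P τ ((1 + μ / (N : ℝ) ^ β) / 2) (X N)) :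
    ∃ (νU : Measure ℝ) (ξ : ℝ → ProbabilityMeasure ℝ) (c : ℝ → ℝ),
      TrapModel.IsTravelLaw α μ νU ∧
      ∀ t : ℝ, 0 < t →
        (ξ t : Measure ℝ) (Set.Iio 0) = 0 ∧
        (∀ a : ℝ, (ξ t : Measure ℝ) ≠ Measure.dirac a) ∧
        (∀ v : ℝ, 0 < v → (ξ t : Measure ℝ) (Set.Ioi v)
          = TrapModel.renewalProb νU (TrapModel.holdingLaw α μ) (t / v)) ∧
        TendstoInDistribution
          (fun (N : ℕ) ω => τ (X N (N * t) ω) ω / (N : ℝ) ^ (1 - β)) atTop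
          (id : ℝ → ℝ) (fun _ => P) (ξ t : Measure ℝ) ∧
        c t = ∫ x, expNegInvGlue x ∂(ξ t : Measure ℝ) ∧
        0 < c t ∧ c t < 1 ∧
        Tendsto
          (fun N : ℕ => P.real {ω | ∀ s : ℝ, 0 ≤ s → s ≤ (N : ℝ) ^ (-β) →
            X N (N * t) ω = X N (N * (t + s)) ω}) atTop (𝓝 (c t)) := by
  obtain ⟨νU, hνU, hlap⟩ := exists_isTravelLaw hα0 hα1 hμ
  have := hνU.isProbabilityMeasure
  set ξ : ℝ → ProbabilityMeasure ℝ := fun t =>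
    ⟨limitLaw α μ t, isProbabilityMeasure_limitLaw hα0 hα1 t⟩ with hξ
  refine ⟨νU, ξ, fun t => ∫ x, expNegInvGlue x ∂(ξ t : Measure ℝ), hνU, fun t ht => ?_⟩
  have hξt : (ξ t : Measure ℝ) = limitLaw α μ t := rfl
  -- The jump probabilities make sense only once `μ ≤ N ^ β`. All limits are taken along the shifted
  -- sequence `n + N₀`, which does not change them.
  obtain ⟨N₁, hN₁⟩ := eventually_atTop.1 (eventually_le_rpow hβ0 hμβ)
  set N₀ := max N₁ 1 with hN₀
  have hN1 : 1 ≤ N₀ := le_max_right _ _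
  have hgood : ∀ N : ℕ, N₀ ≤ N → μ ≤ (N : ℝ) ^ β := fun N hN =>
    hN₁ N ((le_max_left _ _).trans hN)
  have hS := isScaling_natCast hα0 hβ hμ hN1 hgood
  have hτ' := hτ.isPosIIDEnv
  have hρ := hτ.isTailLaw
  have hY : ∀ n : ℕ, ∃ ε η, IsJumpModel P ((1 + μ / ((n + N₀ : ℕ) : ℝ) ^ β) / 2)
      ((1 - μ / ((n + N₀ : ℕ) : ℝ) ^ β) / 2) (fun z ω => toPos (τ z ω)) ε η (X (n + N₀)) :=
    fun n => (hX _ (by omega) (hgood _ (by omega))).exists_isJumpModel hτ (by ring)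
  have hm : ∀ N : ℕ, Measurable fun ω => τ (X N (N * t) ω) ω / (N : ℝ) ^ (1 - β) := fun N =>
    (measurable_trap hτ.measurable (hXm N _)).div_const _
  have hae : ∀ N : ℕ, (fun ω => τ (X N (N * t) ω) ω / (N : ℝ) ^ (1 - β))
      =ᵐ[P] fun ω => toPos (τ (X N (N * t) ω) ω) / (N : ℝ) ^ (1 - β) := fun N => by
    filter_upwards [hτ.ae_toPos] with ω hω
    rw [hω]
  set κ : ℕ → ProbabilityMeasure ℝ := fun N =>
    ⟨P.map fun ω => τ (X N (N * t) ω) ω / (N : ℝ) ^ (1 - β),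
      Measure.isProbabilityMeasure_map (hm N).aemeasurable⟩ with hκ
  have htail := fun v => tendsto_tail hS hα0 hα1 hμ hτ' hρ hY (fun n s => hXm (n + N₀) s) ht v
  have hlim : Tendsto (fun n => κ (n + N₀)) atTop (𝓝 (ξ t)) := by
    refine tendsto_probabilityMeasure_of_Ioi fun v => (htail v).congr fun n => ?_
    change _ = (P.map _).real _
    rw [measureReal_def, measureReal_def, Measure.map_apply (hm _) measurableSet_Ioi]
    congr 1
    refine measure_congr ?_
    filter_upwards [hae (n + N₀)] with ω hω
    refine propext ?_
    change _ ↔ v < τ (X (n + N₀) ((n + N₀ : ℕ) * t) ω) ω / ((n + N₀ : ℕ) : ℝ) ^ (1 - β)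
    rw [hω]
    rfl
  have := isProbabilityMeasure_limitLaw (μ := μ) hα0 hα1 t
  obtain ⟨hc0, hc1⟩ := integral_expNegInvGlue_mem (limitLaw_ae_pos hα0 hα1 hμ ht)
  refine ⟨limitLaw_Iio_zero hα0 hα1 hμ ht, limitLaw_ne_dirac hα0 hα1 hμ ht, fun v hv => ?_, ?_, rfl,
    hc0, hc1, ?_⟩
  · rw [hξt, limitLaw_Ioi hα0 hα1 hμ t hv,
      renewalProb_holdingLaw hα0 hα1 hμ hνU.nonneg hlap (div_pos ht hv)]
  · refine ⟨fun N => (hm N).aemeasurable, aemeasurable_id, ?_⟩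
    have h := (tendsto_add_atTop_iff_nat N₀).1 hlim
    have e : (⟨(ξ t : Measure ℝ).map id, Measure.isProbabilityMeasure_map aemeasurable_id⟩ :
        ProbabilityMeasure ℝ) = ξ t := Subtype.ext (Measure.map_id (μ := (ξ t : Measure ℝ)))
    rw [e]
    exact h
  · rw [← tendsto_add_atTop_iff_nat N₀]
    refine (tendsto_measure_forall_eq hS hα0 hα1 hμ hτ' hρ hY (fun n s => hXm (n + N₀) s) ht
      (κ := fun n => κ (n + N₀)) (fun n => Measure.map_congr (hae (n + N₀))) hlim).congr fun n => ?_
    have hN : (0 : ℝ) < ((n + N₀ : ℕ) : ℝ) := by exact_mod_cast (by omega : 0 < n + N₀)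
    -- A rescaled time `s ≤ N^(-β)` is an original time `r = N s ≤ N^(1 - β)`: the waiting time is
    -- exactly the scale of the depths.
    have hpow : ((n + N₀ : ℕ) : ℝ) ^ (1 - β) = ((n + N₀ : ℕ) : ℝ) * ((n + N₀ : ℕ) : ℝ) ^ (-β) := by
      rw [sub_eq_add_neg, Real.rpow_add hN, Real.rpow_one]
    congr 1
    ext ω
    constructor
    · intro h s hs hs'
      have := h (((n + N₀ : ℕ) : ℝ) * s) (by positivity)
        (by rw [hpow]; exact mul_le_mul_of_nonneg_left hs' hN.le)
      rw [this, mul_add]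
    · intro h r hr hr'
      have := h (r / ((n + N₀ : ℕ) : ℝ)) (by positivity)
        (by rw [div_le_iff₀ hN, mul_comm, ← hpow]; exact hr')
      rw [this, mul_add, mul_div_cancel₀ _ hN.ne']
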